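/- There are an absolute constant $p>0$ and a polynomial $q$ such that for every integer $1\le\tau<\infty$ there are a randomized algorithm (a fixed program for the real RAM with unit-cost arithmetic operations, square roots and comparisons on real numbers, with index arithmetic, and with the ability to draw a uniformly random element of $\{0,\dots,m\}$) and a constant $C$ with the following property. Let $k\ge 1$, $1\le j\le d$ and $n\ge 1$ be integers, let $0<\epsilon,\gamma\le 1$, and let $P$ be a set of $n$ points in $\mathbb{R}^d$ (repetitions allowed). Write $\|x,\mathcal{F}\|$ for the Euclidean distance from a point $x$ to a flat $\mathcal{F}$, and let $$Opt=\inf_{\mathcal{G}_1,\dots,\mathcal{G}_k}\ \frac{1}{|P|}\sum_{x\in P}\min_{1\le l\le k}\|x,\mathcal{G}_l\|^\tau ,$$ where the infimum is over all choices of $k$ $j$-dimensional flats in $\mathbb{R}^d$. Given $n,d,k,j,\epsilon,\gamma$ and the coordinates of the points of $P$, the algorithm always halts after at most $C\cdot 2^{q(kj/(\epsilon\gamma))}\,nd$ steps, and with probability at least $p$ it outputs $k$ $j$-dimensional flats $\mathcal{F}_1,\dots,\mathcal{F}_k$, each given by $j+1$ points spanning it, for which there is a nonempty subset $P'$ of $P$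 with $|P'|\ge(1-\gamma)|P|$ and $$\frac{1}{|P'|}\sum_{x\in P'}\min_{1\le l\le k}\|x,\mathcal{F}_l\|^\tau\le(1+\epsilon)\,Opt .$$ -/

import Mathlib

/-! ## A randomized real RAM with unit-cost steps -/

namespace RealRAM

/-- Instructions of a randomized real RAM.  The machine has index registers `I[·]` and an index
memory `M[·]` holding natural numbers, and real registers `X[·]` and a real memory `A[·]` holding
exact real numbers.  The arguments of the instructions are fixed numbers (register names, integer
constants, labels); the memories are accessed indirectly through index registers.  There is no
rounding instruction and no multiplication or division of indices. -/
inductive Instr where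
  /-- `I[a] := c` -/
  | iconst (a c : ℕ)
  /-- `I[a] := I[b] + I[c]` -/
  | iadd (a b c : ℕ)
  /-- `I[a] := max (I[b] - I[c]) 0` -/
  | isub (a b c : ℕ)
  /-- `I[a] := M[I[b]]` -/
  | iload (a b : ℕ)
  /-- `M[I[a]] := I[b]` -/
  | istore (a b : ℕ)
  /-- `I[a] :=` a fresh uniformly random element of `{0, …, I[b]}` -/
  | irand (a b : ℕ)
  /-- `X[a] := z` -/
  | rconst (a : ℕ) (z : ℤ)
  /-- `X[a] := I[b]` -/
  | rcast (a b : ℕ)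
  /-- `X[a] := X[b] + X[c]` -/
  | radd (a b c : ℕ)
  /-- `X[a] := X[b] - X[c]` -/
  | rsub (a b c : ℕ)
  /-- `X[a] := X[b] * X[c]` -/
  | rmul (a b c : ℕ)
  /-- `X[a] := X[b] / X[c]` (the value is `0` if `X[c] = 0`) -/
  | rdiv (a b c : ℕ)
  /-- `X[a] := √X[b]` (the value is `0` if `X[b] < 0`) -/
  | rsqrt (a b : ℕ)
  /-- `X[a] := A[I[b]]` -/
  | rload (a b : ℕ)
  /-- `A[I[a]] := X[b]` -/
  | rstore (a b : ℕ)
  /-- if `I[b] ≤ I[c]`, go to instruction number `t` -/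
  | ijump (b c t : ℕ)
  /-- if `X[b] ≤ X[c]`, go to instruction number `t` -/
  | rjump (b c t : ℕ)

/-- A program is a finite list of instructions. -/
abbrev Program := List Instr

/-- A configuration: program counter, registers and memories. -/
structure Config where
  pc : ℕ
  I : ℕ → ℕ
  M : ℕ → ℕ
  X : ℕ → ℝ
  A : ℕ → ℝ

/-- The machine has halted when the program counter has left the program. -/
def Halted (prog : Program) (c : Config) : Prop := prog.length ≤ c.pc

/-- The effect of a single instruction: a probability distribution on configurations (a point mass
except for `irand`). -/
noncomputable def exec (c : Config) : Instr → PMF Config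
  | .iconst a v => PMF.pure { c with pc := c.pc + 1, I := Function.update c.I a v }
  | .iadd a b b' => PMF.pure
      { c with pc := c.pc + 1, I := Function.update c.I a (c.I b + c.I b') }
  | .isub a b b' => PMF.pure
      { c with pc := c.pc + 1, I := Function.update c.I a (c.I b - c.I b') }
  | .iload a b => PMF.pure
      { c with pc := c.pc + 1, I := Function.update c.I a (c.M (c.I b)) }
  | .istore a b => PMF.pure
      { c with pc := c.pc + 1, M := Function.update c.M (c.I a) (c.I b) }
  | .irand a b => (PMF.uniformOfFintype (Fin (c.I b + 1))).map fun v =>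
      { c with pc := c.pc + 1, I := Function.update c.I a (v : ℕ) }
  | .rconst a z => PMF.pure
      { c with pc := c.pc + 1, X := Function.update c.X a (z : ℝ) }
  | .rcast a b => PMF.pure
      { c with pc := c.pc + 1, X := Function.update c.X a (c.I b : ℝ) }
  | .radd a b b' => PMF.pure
      { c with pc := c.pc + 1, X := Function.update c.X a (c.X b + c.X b') }
  | .rsub a b b' => PMF.pure
      { c with pc := c.pc + 1, X := Function.update c.X a (c.X b - c.X b') }
  | .rmul a b b' => PMF.pure
      { c with pc := c.pc + 1, X := Function.update c.X a (c.X b * c.X b') }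
  | .rdiv a b b' => PMF.pure
      { c with pc := c.pc + 1, X := Function.update c.X a (c.X b / c.X b') }
  | .rsqrt a b => PMF.pure
      { c with pc := c.pc + 1, X := Function.update c.X a (Real.sqrt (c.X b)) }
  | .rload a b => PMF.pure
      { c with pc := c.pc + 1, X := Function.update c.X a (c.A (c.I b)) }
  | .rstore a b => PMF.pure
      { c with pc := c.pc + 1, A := Function.update c.A (c.I a) (c.X b) }
  | .ijump b b' t => PMF.pure
      { c with pc := if c.I b ≤ c.I b' then t else c.pc + 1 }
  | .rjump b b' t => PMF.pure
      { c with pc := if c.X b ≤ c.X b' then t else c.pc + 1 }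

/-- One step of the machine; a halted machine does not move. -/
noncomputable def step (prog : Program) (c : Config) : PMF Config :=
  match prog[c.pc]? with
  | some ins => exec c ins
  | none => PMF.pure c

/-- The distribution of the configuration after `t` steps from `c`; the random choices of different
steps are independent. -/
noncomputable def run (prog : Program) : ℕ → Config → PMF Config
  | 0, c => PMF.pure c
  | t + 1, c => (step prog c).bind (run prog t)

end RealRAM

/-! ## Projective clustering -/

namespace ProjectiveClustering

/-- A `j`-flat of `ℝᵈ`: a nonempty affine subspace of dimension `j`. -/
def IsFlat {d : ℕ} (j : ℕ) (F : AffineSubspace ℝ (EuclideanSpace ℝ (Fin d))) : Prop :=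
  (F : Set (EuclideanSpace ℝ (Fin d))).Nonempty ∧ Module.finrank ℝ F.direction = j

/-- The `L_τ` sense objective of the sets `F 1, …, F k` on the points `P i`, `i ∈ S`:
`1/|S| * ∑_{i ∈ S} min_l ‖P i, F l‖ ^ τ`. -/
noncomputable def cost {n d k : ℕ} (τ : ℕ) (P : Fin n → EuclideanSpace ℝ (Fin d))
    (S : Finset (Fin n)) (F : Fin k → AffineSubspace ℝ (EuclideanSpace ℝ (Fin d))) : ℝ :=
  1 / (S.card : ℝ) *
    ∑ i ∈ S, ⨅ l : Fin k, Metric.infDist (P i) (F l : Set (EuclideanSpace ℝ (Fin d))) ^ τ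

/-- The optimal objective value on all points, over all choices of `k` `j`-flats. -/
noncomputable def opt {n d : ℕ} (τ k j : ℕ) (P : Fin n → EuclideanSpace ℝ (Fin d)) : ℝ :=
  ⨅ F : Fin k → {F : AffineSubspace ℝ (EuclideanSpace ℝ (Fin d)) // IsFlat j F},
    cost τ P Finset.univ fun l => (F l : AffineSubspace ℝ (EuclideanSpace ℝ (Fin d)))

/-- `F 1, …, F k` are `j`-flats whose objective on a subset of at least `(1 - γ) n` of the `n`
points is at most `(1 + ε)` times the optimum for all points. -/
def IsApproxSolution {n d k : ℕ} (τ j : ℕ) (ε γ : ℝ) (P : Fin n → EuclideanSpace ℝ (Fin d))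
    (F : Fin k → AffineSubspace ℝ (EuclideanSpace ℝ (Fin d))) : Prop :=
  (∀ l, IsFlat j (F l)) ∧
    ∃ S : Finset (Fin n), S.Nonempty ∧ (1 - γ) * (n : ℝ) ≤ (S.card : ℝ) ∧
      cost τ P S F ≤ (1 + ε) * opt τ k j P

/-- The initial configuration on an instance: `n, d, k, j` in the first index registers, `ε, γ` in
the first real registers, the `n * d` coordinates of the points (point by point) at the beginning
of the real memory, and `0` everywhere else. -/
noncomputable def input {n d : ℕ} (k j : ℕ) (ε γ : ℝ) (P : Fin n → EuclideanSpace ℝ (Fin d)) :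
    RealRAM.Config where
  pc := 0
  I := fun a => if a = 0 then n else if a = 1 then d else if a = 2 then k else
    if a = 3 then j else 0
  M := fun _ => 0
  X := fun a => if a = 0 then ε else if a = 1 then γ else 0
  A := fun a =>
    if h : a < n * d then
      P (finProdFinEquiv.symm ⟨a, h⟩).1 (finProdFinEquiv.symm ⟨a, h⟩).2
    else 0

/-- The flats written in a configuration: the beginning of the real memory lists the coordinates of
`j + 1` points for each of the flats, one flat after the other, and the `l`-th flat is the affine
span of its points. -/
noncomputable def output (d k j : ℕ) (c : RealRAM.Config) (l : Fin k) :
    AffineSubspace ℝ (EuclideanSpace ℝ (Fin d)) :=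
  affineSpan ℝ (Set.range fun s : Fin (j + 1) =>
    (WithLp.toLp 2 fun i : Fin d => c.A (((l : ℕ) * (j + 1) + s) * d + i) :
      EuclideanSpace ℝ (Fin d)))

end ProjectiveClustering

/-! ## Structured programs for the real RAM -/

namespace RealRAM

open scoped ENNReal

/-! Geometric reason. Fix nearly optimal flats, assign every point to a nearest one, and let R^τ be
their cost. By Markov's inequality all but a fraction θ/2 of the points, θ = εγ/32, lie within ρ =
2R/θ of their flats. It therefore suffices to find, for each flat F, a flat G whose distance to
almost every remaining point x of the cluster of F is at most (1+a)·dist(x,F) + 2aρ. With a of order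
ε²γ/τ the additive term is εR/(16τ), and convexity of the τ-th power turns this into a factor close
to 1 on the cost (`sum_pow_combination_le`, `card_good_threshold`).

Such a G is spanned by affine combinations of m random points with weights on a grid, m being
polynomial in τkj/(εγ). Write x = p + u with p the projection to F, and lift p to homogeneous
coordinates. If among M+1 sampled lifts a subfamily of maximal volume is chosen, every lift is a
combination of it with coefficients in [-1,1], and at most j+1 samples belong to it. By symmetry a
random M-tuple fails to span, in this bounded sense, only about a fraction (j+1)/(M+1) of the
cluster (`MaxVol.exists_coeff`, `half_le_card_spanning`). The sampled points themselves have errors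
u that may add up badly. This is repaired by gradient descent: a point that is approximated badly
can be mixed into the weights of the spanning points without moving the points of F that they
represent, and this lowers the total squared error by a fixed amount (`errSq_descend_le`). While
many points are bad, a random sample is bad with a fair chance, so boundedly many further samples
suffice (`descent_count`). Rounding the weights moves the spanning points inside F only slightly,
which is undone by solving a perturbed identity system (`IsWeight.round`). A span of too small
dimension is enlarged by unit vectors (`exists_completion`).

The algorithm knows neither clusters nor weights and guesses everything: m samples for each flat,
all weights, and a random input point whose distance serves as the threshold that cuts out P'. A
trial is accepted if the flats have dimension j and the threshold keeps (1-γ)n points. A trial of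
the right quality has probability at least 2^(-m^5) (`trial_prob`). Among 2^(m^5) trials the
accepted one of least average is kept, and one of them is good enough with probability at least 1/2
(`Spec.retry`, `half_le_retry`).

Machine reason. Programs are compiled from structured commands. `Spec` is a triple for expectations
in continuation-passing form: a guarantee for the remaining program is transported backwards through
the command, so no distribution of intermediate states has to be described. Registers 8 and 9 hold 0
and 1, hence adding `I[8]` copies a register. Subroutines of higher numbers are called by those of
lower numbers, and `Fr L` records that registers below `L` survive. The real memory is a list of
vectors: the n points, j unit vectors, one scratch vector, the candidate points, their Gram-Schmidt
vectors, and the best candidates so far. -/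

/-- The contents of the registers and memories, without the program counter. -/
structure St where
  I : ℕ → ℕ
  M : ℕ → ℕ
  X : ℕ → ℝ
  A : ℕ → ℝ

/-- The configuration with contents `s` and program counter `pc`. -/
def St.at (s : St) (pc : ℕ) : Config := ⟨pc, s.I, s.M, s.X, s.A⟩

/-- Conditions of conditional jumps. -/
inductive Cond where
  | idx (b c : ℕ)
  | real (b c : ℕ)

/-- Truth of a condition in a state. -/
def Cond.Holds : Cond → St → Prop
  | .idx b c, s => s.I b ≤ s.I c
  | .real b c, s => s.X b ≤ s.X c

/-- The jump to `t` under a condition. -/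
def Cond.instr : Cond → ℕ → Instr
  | .idx b c, t => .ijump b c t
  | .real b c, t => .rjump b c t

/-- Structured commands: `loop c x` repeats `x` until `c` holds. -/
inductive Cmd where
  | skip
  | ins (i : Instr)
  | seq (x y : Cmd)
  | ite (c : Cond) (x y : Cmd)
  | loop (c : Cond) (x : Cmd)

infixr:60 " ;; " => Cmd.seq

/-- Length of the compiled code. -/
def Cmd.len : Cmd → ℕ
  | .skip => 0
  | .ins _ => 1
  | .seq x y => x.len + y.len
  | .ite _ x y => 2 + y.len + x.len
  | .loop _ x => 2 + x.len

/-- Compiled code of a command, to be placed at position `a`. -/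
def Cmd.comp : Cmd → ℕ → List Instr
  | .skip, _ => []
  | .ins i, _ => [i]
  | .seq x y, a => x.comp a ++ y.comp (a + x.len)
  | .ite c x y, a => c.instr (a + (2 + y.len)) ::
      (y.comp (a + 1) ++ (.ijump 0 0 (a + (2 + y.len + x.len)) :: x.comp (a + (2 + y.len))))
  | .loop c x, a => c.instr (a + (2 + x.len)) :: (x.comp (a + 1) ++ [.ijump 0 0 a])

theorem Cmd.length_comp (x : Cmd) (a : ℕ) : (x.comp a).length = x.len := by
  induction x generalizing a with
  | skip => rfl
  | ins i => rfl
  | seq x y hx hy => simp [Cmd.comp, Cmd.len, hx, hy]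
  | ite c x y hx hy => simp [Cmd.comp, Cmd.len, hx, hy]; omega
  | loop c x hx => simp [Cmd.comp, Cmd.len, hx]; omega

/-- The list `L` of instructions stands at position `a` of the program. -/
def CodeAt (prog : Program) (a : ℕ) (L : List Instr) : Prop :=
  ∀ i, i < L.length → prog[a + i]? = L[i]?

theorem CodeAt.append {prog : Program} {a : ℕ} {L L' : List Instr}
    (h : CodeAt prog a (L ++ L')) : CodeAt prog a L ∧ CodeAt prog (a + L.length) L' := by
  constructor
  · intro i hi
    rw [h i (by simp; omega), List.getElem?_append_left hi]
  · intro i hi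
    rw [add_assoc, h _ (by simp; omega), List.getElem?_append_right (by omega)]
    congr 1; omega

theorem CodeAt.cons {prog : Program} {a : ℕ} {i : Instr} {L : List Instr}
    (h : CodeAt prog a (i :: L)) : prog[a]? = some i ∧ CodeAt prog (a + 1) L := by
  constructor
  · simpa using h 0 (by simp)
  · intro j hj
    have := h (j + 1) (by simp; omega)
    rw [show a + (j + 1) = a + 1 + j by omega] at this
    simpa using this

/-- Within `t` steps the program has halted on every random path, and the final configuration is
in `E` with probability at least `p`. -/
def Ens (prog : Program) (E : Set Config) (c : Config) (t : ℕ) (p : ℝ≥0∞) : Prop :=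
  ∀ s, t ≤ s → (∀ c' ∈ (run prog s c).support, Halted prog c') ∧
    p ≤ (run prog s c).toOuterMeasure E

theorem Ens.mono {prog : Program} {E : Set Config} {c : Config} {t t' : ℕ} {p p' : ℝ≥0∞}
    (h : Ens prog E c t p) (ht : t ≤ t') (hp : p' ≤ p) : Ens prog E c t' p' :=
  fun s hs => ⟨(h s (ht.trans hs)).1, hp.trans (h s (ht.trans hs)).2⟩

theorem run_halted {prog : Program} {c : Config} (h : Halted prog c) (t : ℕ) :
    run prog t c = PMF.pure c := by
  induction t with
  | zero => rfl
  | succ t ih =>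
    have : step prog c = PMF.pure c := by
      unfold step
      rw [List.getElem?_eq_none h]
    rw [run, this, PMF.pure_bind, ih]

theorem Ens.halted {prog : Program} {E : Set Config} {c : Config} {p : ℝ≥0∞}
    (h : Halted prog c) (hc : p ≤ (PMF.pure c).toOuterMeasure E) : Ens prog E c 0 p := by
  intro s _
  rw [run_halted h]
  refine ⟨?_, hc⟩
  intro c' hc'
  rw [PMF.support_pure, Set.mem_singleton_iff] at hc'
  rwa [hc']

theorem Ens.of_step {prog : Program} {E : Set Config} {c c' : Config} {t : ℕ} {p : ℝ≥0∞}
    (hs : step prog c = PMF.pure c') (h : Ens prog E c' t p) : Ens prog E c (t + 1) p := by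
  intro s hs'
  obtain ⟨r, rfl⟩ : ∃ r, s = r + 1 := ⟨s - 1, by omega⟩
  rw [run, hs, PMF.pure_bind]
  exact h r (by omega)

/-- Conditioning on the drawn value: the guarantees `p v` of the successors may differ and enter
through their mean. -/
theorem Ens.of_rand {prog : Program} {E : Set Config} {c : Config} {b : ℕ}
    {f : Fin (b + 1) → Config} {t : ℕ} {p : Fin (b + 1) → ℝ≥0∞}
    (hs : step prog c = (PMF.uniformOfFintype (Fin (b + 1))).map f)
    (h : ∀ v, Ens prog E (f v) t (p v)) :
    Ens prog E c (t + 1) (((b : ℝ≥0∞) + 1)⁻¹ * ∑ v, p v) := by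
  intro s hs'
  obtain ⟨r, rfl⟩ : ∃ r, s = r + 1 := ⟨s - 1, by omega⟩
  rw [run, hs, PMF.bind_map]
  refine ⟨?_, ?_⟩
  · intro c' hc'
    rw [PMF.mem_support_bind_iff] at hc'
    obtain ⟨v, -, hv⟩ := hc'
    exact (h v r (by omega)).1 c' hv
  · rw [PMF.toOuterMeasure_bind_apply, tsum_fintype, Finset.mul_sum]
    refine Finset.sum_le_sum fun v _ => ?_
    simp only [PMF.uniformOfFintype_apply, Fintype.card_fin, Nat.cast_add, Nat.cast_one]
    gcongr
    exact (h v r (by omega)).2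

/-- Instructions without jumps and random choices. -/
def Instr.plain : Instr → Bool
  | .irand _ _ => false
  | .ijump _ _ _ => false
  | .rjump _ _ _ => false
  | _ => true

/-- The effect of a plain instruction. -/
noncomputable def Instr.act : Instr → St → St
  | .iconst a v, c => { c with I := Function.update c.I a v }
  | .iadd a b b', c => { c with I := Function.update c.I a (c.I b + c.I b') }
  | .isub a b b', c => { c with I := Function.update c.I a (c.I b - c.I b') }
  | .iload a b, c => { c with I := Function.update c.I a (c.M (c.I b)) }
  | .istore a b, c => { c with M := Function.update c.M (c.I a) (c.I b) }
  | .rconst a z, c => { c with X := Function.update c.X a (z : ℝ) }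
  | .rcast a b, c => { c with X := Function.update c.X a (c.I b : ℝ) }
  | .radd a b b', c => { c with X := Function.update c.X a (c.X b + c.X b') }
  | .rsub a b b', c => { c with X := Function.update c.X a (c.X b - c.X b') }
  | .rmul a b b', c => { c with X := Function.update c.X a (c.X b * c.X b') }
  | .rdiv a b b', c => { c with X := Function.update c.X a (c.X b / c.X b') }
  | .rsqrt a b, c => { c with X := Function.update c.X a (Real.sqrt (c.X b)) }
  | .rload a b, c => { c with X := Function.update c.X a (c.A (c.I b)) }
  | .rstore a b, c => { c with A := Function.update c.A (c.I a) (c.X b) }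
  | .irand _ _, c => c
  | .ijump _ _ _, c => c
  | .rjump _ _ _, c => c

theorem exec_plain {i : Instr} (hi : i.plain = true) (s : St) (a : ℕ) :
    exec (s.at a) i = PMF.pure ((i.act s).at (a + 1)) := by
  cases i <;> first | rfl | simp [Instr.plain] at hi

theorem step_of_code {prog : Program} {a : ℕ} {i : Instr} (h : prog[a]? = some i) (s : St) :
    step prog (s.at a) = exec (s.at a) i := by
  simp [step, St.at, h]

theorem step_cond {prog : Program} {a t : ℕ} {c : Cond} (h : prog[a]? = some (c.instr t)) (s : St) :
    (c.Holds s → step prog (s.at a) = PMF.pure (s.at t)) ∧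
    (¬ c.Holds s → step prog (s.at a) = PMF.pure (s.at (a + 1))) := by
  rw [step_of_code h]
  cases c <;>
  · constructor <;> intro hc <;> simp only [Cond.Holds] at hc <;> simp [Cond.instr, exec, St.at, hc]

theorem step_goto {prog : Program} {a t : ℕ} (h : prog[a]? = some (.ijump 0 0 t)) (s : St) :
    step prog (s.at a) = PMF.pure (s.at t) := by
  rw [step_of_code h]
  simp [exec, St.at]

/-- The command `x`, started in `s`, ends within `n` steps on every random path, in a state with
`Q`, and the expectation of `q` in the final state is at least `p`. -/
def Spec (x : Cmd) (s : St) (n : ℕ) (Q : St → Prop) (q : St → ℝ≥0∞) (p : ℝ≥0∞) : Prop :=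
  ∀ (prog : Program) (a : ℕ) (E : Set Config) (t : ℕ), CodeAt prog a (x.comp a) →
    (∀ s', Q s' → Ens prog E (s'.at (a + x.len)) t (q s')) → Ens prog E (s.at a) (t + n) p

theorem Spec.mono {x : Cmd} {s : St} {n n' : ℕ} {Q Q' : St → Prop} {q q' : St → ℝ≥0∞}
    {p p' : ℝ≥0∞} (h : Spec x s n Q q p) (hn : n ≤ n') (hQ : ∀ s', Q s' → Q' s')
    (hq : ∀ s', Q s' → q s' ≤ q' s') (hp : p' ≤ p) : Spec x s n' Q' q' p' := by
  intro prog a E t hc hE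
  exact (h prog a E t hc fun s' hs' => (hE s' (hQ s' hs')).mono le_rfl (hq s' hs')).mono
    (by omega) hp

/-- For `x` the continuation consists of `y` and the rest of the program. Hence `q₁` is at once the
guarantee obtained from `y` and the quantity whose expectation `x` bounds, and nothing has to be
integrated. -/
theorem Spec.seq {x y : Cmd} {s : St} {n₁ n₂ : ℕ} {Q₁ Q : St → Prop} {q₁ q : St → ℝ≥0∞}
    {p : ℝ≥0∞} (hx : Spec x s n₁ Q₁ q₁ p) (hy : ∀ s', Q₁ s' → Spec y s' n₂ Q q (q₁ s')) :
    Spec (x ;; y) s (n₁ + n₂) Q q p := by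
  intro prog a E t hc hE
  obtain ⟨h1, h2⟩ := CodeAt.append hc
  rw [Cmd.length_comp] at h2
  have := hx prog a E (t + n₂) h1 fun s' hs' => hy s' hs' prog (a + x.len) E t h2 (by
    intro s'' h''
    have := hE s'' h''
    rwa [Cmd.len, ← add_assoc] at this)
  exact this.mono (by omega) le_rfl

theorem Spec.rand {a b : ℕ} {s : St} {Q : St → Prop} {q : St → ℝ≥0∞}
    (hQ : ∀ v, v ≤ s.I b → Q { s with I := Function.update s.I a v }) :
    Spec (.ins (.irand a b)) s 1 Q q (((s.I b : ℝ≥0∞) + 1)⁻¹ *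
      ∑ v : Fin (s.I b + 1), q { s with I := Function.update s.I a v }) := by
  intro prog pc E t hc hE
  refine Ens.of_rand (f := fun v => ({ s with I := Function.update s.I a v } : St).at (pc + 1)) ?_
    fun v => hE _ (hQ v (by omega))
  rw [step_of_code (CodeAt.cons hc).1]
  simp only [exec, St.at]
  -- In `exec` the passage from `Fin` to `ℕ` is a bind with a point mass; it is merged here into the
  -- map.
  change PMF.map _ (PMF.bind _ fun v : Fin (s.I b + 1) => PMF.pure (v : ℕ)) = _
  rw [PMF.map_bind]
  simp only [PMF.pure_map]
  rfl

/-- The two extra steps are the failed test and the jump back. -/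
theorem Spec.loop_succ {c : Cond} {x : Cmd} {s : St} {n₁ n₂ : ℕ} {Q₁ Q : St → Prop}
    {q₁ q : St → ℝ≥0∞} {p : ℝ≥0∞} (hn : ¬ c.Holds s) (hx : Spec x s n₁ Q₁ q₁ p)
    (hy : ∀ s', Q₁ s' → Spec (.loop c x) s' n₂ Q q (q₁ s')) :
    Spec (.loop c x) s (n₂ + (n₁ + 2)) Q q p := by
  intro prog a E t hc hE
  have hc' := hc
  obtain ⟨h1, h2⟩ := CodeAt.cons hc'
  obtain ⟨h2, h3⟩ := CodeAt.append h2
  obtain ⟨h3, -⟩ := CodeAt.cons h3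
  rw [Cmd.length_comp] at h3
  have := hx prog (a + 1) E (t + n₂ + 1) h2 fun s' hs' =>
    Ens.of_step (step_goto h3 s') (hy s' hs' prog a E t hc hE)
  exact (Ens.of_step ((step_cond h1 s).2 hn) this).mono (by omega) le_rfl

/-- The command `x` takes the state `s` to `s'` in at most `n` steps. -/
def Det (x : Cmd) (s : St) (n : ℕ) (s' : St) : Prop :=
  ∀ (Q : St → Prop) (q : St → ℝ≥0∞), Q s' → Spec x s n Q q (q s')

theorem Det.skip (s : St) : Det .skip s 0 s := by
  intro Q q hs prog a E t _ hE
  simpa [Cmd.len] using hE s hs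

theorem Det.ins {i : Instr} (hi : i.plain = true) (s : St) : Det (.ins i) s 1 (i.act s) := by
  intro Q q hs prog a E t hc hE
  refine Ens.of_step ?_ (hE _ hs)
  rw [step_of_code (CodeAt.cons hc).1, exec_plain hi]
  rfl

theorem Det.mono {x : Cmd} {s s' : St} {n n' : ℕ} (h : Det x s n s') (hn : n ≤ n') :
    Det x s n' s' :=
  fun Q q hs => (h Q q hs).mono hn (fun _ => id) (fun _ _ => le_rfl) le_rfl

theorem Det.seq {x y : Cmd} {s s₁ s' : St} {n₁ n₂ : ℕ} (hx : Det x s n₁ s₁)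
    (hy : Det y s₁ n₂ s') : Det (x ;; y) s (n₁ + n₂) s' := by
  intro Q q hs
  refine Spec.seq (hx (fun s₂ => s₂ = s₁) (fun _ => q s') rfl) ?_
  rintro _ rfl
  exact hy Q q hs

theorem Det.ite_true {c : Cond} {x y : Cmd} {s s' : St} {n : ℕ} (hc : c.Holds s)
    (hx : Det x s n s') : Det (.ite c x y) s (n + 2) s' := by
  intro Q q hs prog a E t hcode hE
  obtain ⟨h1, h2⟩ := CodeAt.cons hcode
  obtain ⟨-, h3⟩ := CodeAt.append h2
  obtain ⟨-, h4⟩ := CodeAt.cons h3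
  rw [Cmd.length_comp] at h4
  rw [show a + 1 + y.len + 1 = a + (2 + y.len) by omega] at h4
  have := hx Q q hs prog (a + (2 + y.len)) E t h4 (by
    intro s'' h''
    have := hE s'' h''
    rwa [Cmd.len, ← add_assoc] at this)
  exact (Ens.of_step ((step_cond h1 s).1 hc) this).mono (by omega) le_rfl

theorem Det.ite_false {c : Cond} {x y : Cmd} {s s' : St} {n : ℕ} (hc : ¬ c.Holds s)
    (hy : Det y s n s') : Det (.ite c x y) s (n + 2) s' := by
  intro Q q hs prog a E t hcode hE
  obtain ⟨h1, h2⟩ := CodeAt.cons hcode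
  obtain ⟨h2, h3⟩ := CodeAt.append h2
  obtain ⟨h3, -⟩ := CodeAt.cons h3
  rw [Cmd.length_comp] at h3
  have := hy Q q hs prog (a + 1) E (t + 1) h2 (by
    intro s'' h''
    exact Ens.of_step (step_goto h3 _) (hE s'' h''))
  exact (Ens.of_step ((step_cond h1 s).2 hc) this).mono (by omega) le_rfl

theorem Det.loop_exit {c : Cond} {x : Cmd} {s : St} (hc : c.Holds s) : Det (.loop c x) s 1 s := by
  intro Q q hs prog a E t hcode hE
  exact Ens.of_step ((step_cond (CodeAt.cons hcode).1 s).1 hc) (hE s hs)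

theorem Det.loop_succ {c : Cond} {x : Cmd} {s s₁ s' : St} {n₁ n₂ : ℕ} (hn : ¬ c.Holds s)
    (hx : Det x s n₁ s₁) (hy : Det (.loop c x) s₁ n₂ s') :
    Det (.loop c x) s (n₂ + (n₁ + 2)) s' := by
  intro Q q hs
  refine Spec.loop_succ hn (hx (fun s₂ => s₂ = s₁) (fun _ => q s') rfl) ?_
  rintro _ rfl
  exact hy Q q hs

/-- The command `x` has no random effect from `s` on, ends within `n` steps, and the final state
has `Q`. -/
def Tot (x : Cmd) (s : St) (n : ℕ) (Q : St → Prop) : Prop := ∃ s', Det x s n s' ∧ Q s'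

theorem Tot.mono {x : Cmd} {s : St} {n n' : ℕ} {Q Q' : St → Prop} (h : Tot x s n Q) (hn : n ≤ n')
    (hQ : ∀ s', Q s' → Q' s') : Tot x s n' Q' := by
  obtain ⟨s', h1, h2⟩ := h
  exact ⟨s', h1.mono hn, hQ s' h2⟩

theorem Tot.seq {x y : Cmd} {s : St} {n₁ n₂ : ℕ} {Q₁ Q : St → Prop} (hx : Tot x s n₁ Q₁)
    (hy : ∀ s', Q₁ s' → Tot y s' n₂ Q) : Tot (x ;; y) s (n₁ + n₂) Q := by
  obtain ⟨s₁, h1, h2⟩ := hx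
  obtain ⟨s', h3, h4⟩ := hy s₁ h2
  exact ⟨s', h1.seq h3, h4⟩

theorem Tot.spec {x : Cmd} {s : St} {n : ℕ} {Q : St → Prop} {q : St → ℝ≥0∞} {p : ℝ≥0∞}
    (h : Tot x s n Q) (hp : ∀ s', Q s' → p ≤ q s') : Spec x s n Q q p := by
  obtain ⟨s', h1, h2⟩ := h
  exact (h1 Q q h2).mono le_rfl (fun _ => id) (fun _ _ => le_rfl) (hp s' h2)

/-- A list of instructions in a row. -/
def blk (L : List Instr) : Cmd := L.foldr (fun i x => .ins i ;; x) .skip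

theorem Det.blk {L : List Instr} (hL : L.all Instr.plain = true) (s : St) :
    Det (blk L) s L.length (L.foldl (fun s i => i.act s) s) := by
  induction L generalizing s with
  | nil => exact Det.skip s
  | cons i L ih =>
    simp only [List.all_cons, Bool.and_eq_true] at hL
    have := (Det.ins hL.1 s).seq (ih hL.2 (i.act s))
    exact this.mono (by simp [add_comm])

theorem Tot.blk {L : List Instr} {s : St} {Q : St → Prop} {n : ℕ}
    (hL : L.all Instr.plain = true) (hn : L.length ≤ n)
    (h : Q (L.foldl (fun s i => i.act s) s)) : Tot (blk L) s n Q :=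
  ⟨_, (Det.blk hL s).mono hn, h⟩

theorem Tot.ite {c : Cond} {x y : Cmd} {s : St} {n : ℕ} {Q : St → Prop}
    (hx : c.Holds s → Tot x s n Q) (hy : ¬ c.Holds s → Tot y s n Q) :
    Tot (.ite c x y) s (n + 2) Q := by
  by_cases hc : c.Holds s
  · obtain ⟨s', h1, h2⟩ := hx hc
    exact ⟨s', Det.ite_true hc h1, h2⟩
  · obtain ⟨s', h1, h2⟩ := hy hc
    exact ⟨s', Det.ite_false hc h1, h2⟩

/-- `for I[i] := 0, …, I[c] - 1 do x`; the register `I[69]` serves as a constant. -/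
def forTo (i c : ℕ) (x : Cmd) : Cmd :=
  .ins (.iconst i 0) ;; .loop (.idx c i) (x ;; blk [.iconst 69 1, .iadd i i 69])

/-- The state at the end of a loop pass. -/
def St.tick (s : St) (i : ℕ) : St :=
  { s with I := Function.update (Function.update s.I 69 1) i (s.I i + 1) }

/-- The invariant refers to the loop head, so a pass must establish it for the ticked state. A pass
costs the body, two instructions for the counter, the test and the jump; the final 2 is the
initialization and the last test. -/
theorem Tot.forTo {i c : ℕ} {x : Cmd} {s : St} {n N : ℕ} (Inv : ℕ → St → Prop) (hi : i ≠ 69)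
    (h0 : Inv 0 { s with I := Function.update s.I i 0 })
    (hI : ∀ v s', v ≤ N → Inv v s' → s'.I i = v ∧ s'.I c = N)
    (hx : ∀ v s', v < N → Inv v s' → Tot x s' n fun s'' => Inv (v + 1) (s''.tick i)) :
    Tot (forTo i c x) s (N * (n + 4) + 2) (Inv N) := by
  have key : ∀ r v s', v + r = N → Inv v s' →
      Tot (.loop (.idx c i) (x ;; RealRAM.blk [.iconst 69 1, .iadd i i 69])) s' (r * (n + 4) + 1)
        (Inv N) := by
    intro r
    induction r with
    | zero =>
      intro v s' hv hs'
      obtain ⟨h1, h2⟩ := hI v s' (by omega) hs'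
      refine ⟨s', (Det.loop_exit ?_).mono (by omega), by simpa [← hv] using hs'⟩
      simp only [Cond.Holds]; omega
    | succ r ih =>
      intro v s' hv hs'
      obtain ⟨h1, h2⟩ := hI v s' (by omega) hs'
      obtain ⟨s₁, h3, h4⟩ := hx v s' (by omega) hs'
      obtain ⟨s₂, h5, h6⟩ := ih (v + 1) _ (by omega) h4
      have hb : Det (RealRAM.blk [Instr.iconst 69 1, Instr.iadd i i 69]) s₁ 2 (s₁.tick i) := by
        have := Det.blk (L := [Instr.iconst 69 1, Instr.iadd i i 69]) rfl s₁
        simpa [Instr.act, St.tick, hi] using this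
      refine ⟨s₂, (Det.loop_succ ?_ (h3.seq hb) h5).mono ?_, h6⟩
      · simp only [Cond.Holds]; omega
      · ring_nf; omega
  have := Tot.seq (x := .ins (.iconst i 0)) (s := s) (n₁ := 1)
    (Q₁ := fun s' => s' = { s with I := Function.update s.I i 0 })
    ⟨_, Det.ins rfl s, rfl⟩ (fun s' hs' => key N 0 s' (by omega) (hs' ▸ h0))
  exact this.mono (by omega) fun _ => id

end RealRAM

/-! ## Vector operations -/

namespace RealRAM

open Function

/-- `s'` has the same index memory as `s`, and the same registers below `L`. -/
structure Fr (L : ℕ) (s s' : St) : Prop where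
  I : ∀ r, r < L → s'.I r = s.I r
  X : ∀ r, r < L → s'.X r = s.X r
  M : s'.M = s.M

theorem Fr.refl (L : ℕ) (s : St) : Fr L s s := ⟨fun _ _ => rfl, fun _ _ => rfl, rfl⟩

theorem Fr.trans {L L' : ℕ} {s s' s'' : St} (h : Fr L s s') (h' : Fr L' s' s'') (hL : L ≤ L') :
    Fr L s s'' :=
  ⟨fun r hr => (h'.I r (by omega)).trans (h.I r hr), fun r hr => (h'.X r (by omega)).trans (h.X r hr),
    h'.M.trans h.M⟩

theorem Fr.mono {L L' : ℕ} {s s' : St} (h : Fr L' s s') (hL : L ≤ L') : Fr L s s' :=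
  (Fr.refl L s).trans h hL

/-- `I[a] := I[b] * I[c]` by repeated addition. -/
def mulI (a b c : ℕ) : Cmd := .ins (.iconst a 0) ;; forTo 60 c (blk [.iadd a a b])

theorem mulI_tot {a b c : ℕ} (s : St) {N : ℕ} (hN : s.I c = N) (hab : a ≠ b) (hac : a ≠ c)
    (ha : a ≠ 60) (ha' : a ≠ 69) (hb : b ≠ 60) (hb' : b ≠ 69) (hc : c ≠ 60) (hc' : c ≠ 69) :
    Tot (mulI a b c) s (N * 5 + 3) fun s' => s'.I a = s.I b * N ∧
      (∀ r, r ≠ a → r ≠ 60 → r ≠ 69 → s'.I r = s.I r) ∧ s'.X = s.X ∧ s'.M = s.M ∧ s'.A = s.A := by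
  have := Tot.seq (x := .ins (.iconst a 0)) (s := s) (n₁ := 1)
    (Q₁ := fun s' => s' = { s with I := update s.I a 0 }) ⟨_, Det.ins rfl s, rfl⟩
    (fun s' hs' => Tot.forTo (i := 60) (c := c) (x := blk [.iadd a a b]) (n := 1) (N := N) (s := s')
      (fun v s' => s'.I 60 = v ∧ s'.I a = s.I b * v ∧
      (∀ r, r ≠ a → r ≠ 60 → r ≠ 69 → s'.I r = s.I r) ∧ s'.X = s.X ∧ s'.M = s.M ∧ s'.A = s.A)
      (by norm_num) ?_ ?_ ?_)
  · refine this.mono (by omega) ?_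
    rintro s' ⟨-, h⟩
    exact h
  · subst hs'
    refine ⟨by simp, by simp [ha], ?_, rfl, rfl, rfl⟩
    intro r h1 h2 h3
    simp [h1, h2]
  · rintro v s' - ⟨h1, h2, h3, -⟩
    exact ⟨h1, by rw [h3 c hac.symm hc hc', hN]⟩
  · rintro v s' hv ⟨h1, h2, h3, h4, h5, h6⟩
    refine Tot.blk rfl le_rfl ?_
    simp only [List.foldl, Instr.act, St.tick]
    refine ⟨by simp [ha.symm, h1], ?_, ?_, h4, h5, h6⟩
    · simp only [update_of_ne ha, update_of_ne ha', update_self, h2, h3 b hab.symm hb hb']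
      ring
    · intro r hr1 hr2 hr3
      simp [hr1, hr2, hr3, h3 r hr1 hr2 hr3]

/-- The vector number `v` of the real memory, vectors of dimension `d` being stored one after the
other. -/
noncomputable def vecs (d : ℕ) (A : ℕ → ℝ) (v : ℕ) : EuclideanSpace ℝ (Fin d) :=
  WithLp.toLp 2 fun i => A (v * d + i)

@[simp] theorem vecs_apply (d : ℕ) (A : ℕ → ℝ) (v : ℕ) (i : Fin d) :
    vecs d A v i = A (v * d + i) := rfl

/-- Vector `I[50]` := vector `I[51]` + `X[50]` * vector `I[52]`. -/
def axpy : Cmd :=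
  mulI 53 50 1 ;; mulI 54 51 1 ;; mulI 55 52 1 ;; blk [.iconst 61 1] ;;
    forTo 60 1 (blk [.rload 51 54, .rload 52 55, .rmul 52 52 50, .radd 51 51 52, .rstore 53 51,
      .iadd 53 53 61, .iadd 54 54 61, .iadd 55 55 61])

theorem axpy_tot (s : St) {d : ℕ} (hd : 1 ≤ d) (h1 : s.I 1 = d) :
    Tot axpy s (50 * d) fun s' => Fr 50 s s' ∧ vecs d s'.A =
      update (vecs d s.A) (s.I 50) (vecs d s.A (s.I 51) + s.X 50 • vecs d s.A (s.I 52)) := by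
  set a := s.I 50 with ha
  set b := s.I 51 with hb
  set c := s.I 52 with hc
  have key : Tot axpy s ((d * 5 + 3) + ((d * 5 + 3) + ((d * 5 + 3) + (1 + (d * (8 + 4) + 2)))))
      (fun s' => s'.I 60 = d ∧ s'.I 61 = 1 ∧ s'.I 53 = a * d + d ∧ s'.I 54 = b * d + d ∧
        s'.I 55 = c * d + d ∧ s'.X 50 = s.X 50 ∧ Fr 50 s s' ∧
        s'.A = fun p => if a * d ≤ p ∧ p < a * d + d then
          s.A (b * d + (p - a * d)) + s.X 50 * s.A (c * d + (p - a * d)) else s.A p) := by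
    refine Tot.seq (mulI_tot s h1 (by norm_num) (by norm_num) (by norm_num) (by norm_num)
      (by norm_num) (by norm_num) (by norm_num) (by norm_num)) ?_
    rintro s1 ⟨e1, f1, g1, k1, l1⟩
    refine Tot.seq (mulI_tot s1 ((f1 1 (by norm_num) (by norm_num) (by norm_num)).trans h1)
      (by norm_num) (by norm_num) (by norm_num) (by norm_num)
      (by norm_num) (by norm_num) (by norm_num) (by norm_num)) ?_
    rintro s2 ⟨e2, f2, g2, k2, l2⟩
    refine Tot.seq (mulI_tot s2 (((f2 1 (by norm_num) (by norm_num) (by norm_num)).trans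
      (f1 1 (by norm_num) (by norm_num) (by norm_num))).trans h1)
      (by norm_num) (by norm_num) (by norm_num) (by norm_num)
      (by norm_num) (by norm_num) (by norm_num) (by norm_num)) ?_
    rintro s3 ⟨e3, f3, g3, k3, l3⟩
    refine Tot.seq (Tot.blk (Q := fun s' => s' = { s3 with I := update s3.I 61 1 }) rfl le_rfl rfl) ?_
    rintro s4 rfl
    refine Tot.forTo (n := 8) (fun v s' => s'.I 60 = v ∧ s'.I 61 = 1 ∧ s'.I 53 = a * d + v ∧
        s'.I 54 = b * d + v ∧ s'.I 55 = c * d + v ∧ s'.X 50 = s.X 50 ∧ Fr 50 s s' ∧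
        s'.A = fun p => if a * d ≤ p ∧ p < a * d + v then
          s.A (b * d + (p - a * d)) + s.X 50 * s.A (c * d + (p - a * d)) else s.A p)
      (by norm_num) ?_ ?_ ?_
    · refine ⟨by simp, by simp, ?_, ?_, ?_, ?_, ⟨?_, ?_, ?_⟩, ?_⟩
      · simp [f3, f2, e1, ha]
      · simp [f3, e2, f1, hb]
      · simp [e3, f2, f1, hc]
      · simp [g3, g2, g1]
      · intro r hr
        have : r ≠ 53 ∧ r ≠ 54 ∧ r ≠ 55 ∧ r ≠ 60 ∧ r ≠ 61 ∧ r ≠ 69 := by omega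
        simp [this, f3, f2, f1]
      · intro r hr
        simp [g3, g2, g1]
      · simp [k3, k2, k1]
      · funext p
        rw [if_neg (by omega)]
        simp [l3, l2, l1]
    · rintro v s' - ⟨i1, -, -, -, -, -, i2, -⟩
      exact ⟨i1, (i2.I 1 (by norm_num)).trans h1⟩
    · rintro v s' hv ⟨i1, i2, i3, i4, i5, i6, i7, i8⟩
      refine Tot.blk rfl le_rfl ?_
      simp only [List.foldl, Instr.act, St.tick]
      refine ⟨by simp [i1], by simp [i2], by simp [i2, i3]; ring, by simp [i2, i4]; ring,
        by simp [i2, i5]; ring, by simp [i6], ⟨?_, ?_, ?_⟩, ?_⟩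
      · intro r hr
        have : r ≠ 53 ∧ r ≠ 54 ∧ r ≠ 55 ∧ r ≠ 60 ∧ r ≠ 61 ∧ r ≠ 69 := by omega
        simp [this, i7.I r hr]
      · intro r hr
        have : r ≠ 51 ∧ r ≠ 52 := by omega
        simp [this, i7.X r hr]
      · simp [i7.M]
      -- Coordinate v has not been overwritten yet in any vector, so the target may coincide with
      -- either of the arguments. Later in-place calls depend on this.
      · have hread : ∀ q, s'.A (q * d + v) = s.A (q * d + v) := by
          intro q
          rw [i8]
          simp only
          split_ifs with h
          · exfalso
            rcases lt_trichotomy q a with h' | h' | h'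
            · have : (q + 1) * d ≤ a * d := Nat.mul_le_mul_right d h'
              rw [add_mul] at this; omega
            · subst h'; omega
            · have : (a + 1) * d ≤ q * d := Nat.mul_le_mul_right d h'
              rw [add_mul] at this; omega
          · rfl
        funext p
        by_cases hp : p = a * d + v
        · subst hp
          simp [i3, i4, i5, i6, hread]
          ring
        · simp only [update_self, i3, ne_eq, hp, not_false_eq_true, update_of_ne,
            i8]
          by_cases hp' : a * d ≤ p ∧ p < a * d + v
          · rw [if_pos hp', if_pos (by omega)]
          · rw [if_neg hp', if_neg (by omega)]
  refine key.mono (by omega) ?_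
  rintro s' ⟨-, -, -, -, -, -, h, hA⟩
  refine ⟨h, ?_⟩
  funext v
  ext i
  rw [vecs_apply, hA]
  have hi := i.2
  by_cases hv : v = a
  · subst hv
    simp only [update_self]
    rw [if_pos (by omega)]
    simp
  · rw [update_of_ne hv, vecs_apply]
    simp only
    rw [if_neg]
    rintro ⟨h2, h3⟩
    rcases lt_or_gt_of_ne hv with h' | h'
    · have : (v + 1) * d ≤ a * d := Nat.mul_le_mul_right d h'
      rw [add_mul] at this; omega
    · have : (a + 1) * d ≤ v * d := Nat.mul_le_mul_right d h'
      rw [add_mul] at this; omega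

/-- `X[50]` := inner product of the vectors `I[50]` and `I[51]`. -/
def dot : Cmd :=
  mulI 53 50 1 ;; mulI 54 51 1 ;; blk [.iconst 61 1, .rconst 50 0] ;;
    forTo 60 1 (blk [.rload 51 53, .rload 52 54, .rmul 51 51 52, .radd 50 50 51,
      .iadd 53 53 61, .iadd 54 54 61])

theorem dot_tot (s : St) {d : ℕ} (hd : 1 ≤ d) (h1 : s.I 1 = d) :
    Tot dot s (50 * d) fun s' => Fr 50 s s' ∧ s'.A = s.A ∧
      s'.X 50 = inner ℝ (vecs d s.A (s.I 50)) (vecs d s.A (s.I 51)) := by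
  set a := s.I 50 with ha
  set b := s.I 51 with hb
  have key : Tot dot s ((d * 5 + 3) + ((d * 5 + 3) + (2 + (d * (6 + 4) + 2))))
      (fun s' => s'.I 60 = d ∧ s'.I 61 = 1 ∧ s'.I 53 = a * d + d ∧ s'.I 54 = b * d + d ∧
        Fr 50 s s' ∧ s'.A = s.A ∧
        s'.X 50 = ∑ i ∈ Finset.range d, s.A (a * d + i) * s.A (b * d + i)) := by
    refine Tot.seq (mulI_tot s h1 (by norm_num) (by norm_num) (by norm_num) (by norm_num)
      (by norm_num) (by norm_num) (by norm_num) (by norm_num)) ?_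
    rintro s1 ⟨e1, f1, g1, k1, l1⟩
    refine Tot.seq (mulI_tot s1 ((f1 1 (by norm_num) (by norm_num) (by norm_num)).trans h1)
      (by norm_num) (by norm_num) (by norm_num) (by norm_num)
      (by norm_num) (by norm_num) (by norm_num) (by norm_num)) ?_
    rintro s2 ⟨e2, f2, g2, k2, l2⟩
    refine Tot.seq (Tot.blk (Q := fun s' => s' = { s2 with
      I := update s2.I 61 1, X := update s2.X 50 0 }) rfl le_rfl ?_) ?_
    · simp [Instr.act]
    rintro s4 rfl
    refine Tot.forTo (n := 6) (fun v s' => s'.I 60 = v ∧ s'.I 61 = 1 ∧ s'.I 53 = a * d + v ∧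
        s'.I 54 = b * d + v ∧ Fr 50 s s' ∧ s'.A = s.A ∧
        s'.X 50 = ∑ i ∈ Finset.range v, s.A (a * d + i) * s.A (b * d + i))
      (by norm_num) ?_ ?_ ?_
    · refine ⟨by simp, by simp, ?_, ?_, ⟨?_, ?_, ?_⟩, ?_, ?_⟩
      · simp [f2, e1, ha]
      · simp [e2, f1, hb]
      · intro r hr
        have : r ≠ 53 ∧ r ≠ 54 ∧ r ≠ 55 ∧ r ≠ 60 ∧ r ≠ 61 ∧ r ≠ 69 := by omega
        simp [this, f2, f1]
      · intro r hr
        have : r ≠ 50 := by omega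
        simp [g2, g1, this]
      · simp [k2, k1]
      · simp [l2, l1]
      · simp
    · rintro v s' - ⟨i1, -, -, -, i2, -⟩
      exact ⟨i1, (i2.I 1 (by norm_num)).trans h1⟩
    · rintro v s' hv ⟨i1, i2, i3, i4, i7, i8, i9⟩
      refine Tot.blk rfl le_rfl ?_
      simp only [List.foldl, Instr.act, St.tick]
      refine ⟨by simp [i1], by simp [i2], by simp [i2, i3]; ring, by simp [i2, i4]; ring,
        ⟨?_, ?_, ?_⟩, ?_, ?_⟩
      · intro r hr
        have : r ≠ 53 ∧ r ≠ 54 ∧ r ≠ 55 ∧ r ≠ 60 ∧ r ≠ 61 ∧ r ≠ 69 := by omega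
        simp [this, i7.I r hr]
      · intro r hr
        have : r ≠ 50 ∧ r ≠ 51 ∧ r ≠ 52 := by omega
        simp [this, i7.X r hr]
      · simp [i7.M]
      · simp [i8]
      · rw [Finset.sum_range_succ, ← i9]
        simp [i3, i4, i8]
  refine key.mono (by omega) ?_
  rintro s' ⟨-, -, -, -, h, hA, hX⟩
  refine ⟨h, hA, ?_⟩
  rw [hX, Finset.sum_range, PiLp.inner_apply]
  refine Finset.sum_congr rfl fun i _ => ?_
  simp [mul_comm]

end RealRAM

/-! ## Projections, rows of candidates, and distances to flats -/

namespace RealRAM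

open Function

/-- Plain instructions which write only to registers with numbers at least `L`. -/
def Instr.high (L : ℕ) : Instr → Bool
  | .iconst a _ => decide (L ≤ a)
  | .iadd a _ _ => decide (L ≤ a)
  | .isub a _ _ => decide (L ≤ a)
  | .iload a _ => decide (L ≤ a)
  | .rconst a _ => decide (L ≤ a)
  | .rcast a _ => decide (L ≤ a)
  | .radd a _ _ => decide (L ≤ a)
  | .rsub a _ _ => decide (L ≤ a)
  | .rmul a _ _ => decide (L ≤ a)
  | .rdiv a _ _ => decide (L ≤ a)
  | .rsqrt a _ => decide (L ≤ a)
  | .rload a _ => decide (L ≤ a)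
  | _ => false

theorem fr_act {L : ℕ} {i : Instr} (hi : i.high L = true) (s : St) :
    i.plain = true ∧ Fr L s (i.act s) ∧ (i.act s).A = s.A := by
  have key : ∀ a r, L ≤ a → r < L → r ≠ a := fun a r h h' => by omega
  cases i <;> simp only [Instr.high, decide_eq_true_eq, Bool.false_eq_true] at hi <;>
    refine ⟨rfl, ⟨fun r hr => ?_, fun r hr => ?_, rfl⟩, rfl⟩ <;>
    simp only [Instr.act] <;> rw [update_of_ne (key _ _ hi hr)]

/-- A row of instructions which write only to registers with numbers at least `L`. -/
theorem Tot.blkFr (L : ℕ) {l : List Instr} {s : St} {Q : St → Prop}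
    (hl : l.all (Instr.high L) = true) (h : Q (l.foldl (fun s i => i.act s) s)) :
    Tot (RealRAM.blk l) s l.length fun s' => Fr L s s' ∧ s'.A = s.A ∧ Q s' := by
  have key : ∀ (l : List Instr) (s : St), l.all (Instr.high L) = true → l.all Instr.plain = true ∧
      Fr L s (l.foldl (fun s i => i.act s) s) ∧ (l.foldl (fun s i => i.act s) s).A = s.A := by
    intro l
    induction l with
    | nil => intro s _; exact ⟨rfl, Fr.refl L s, rfl⟩
    | cons i l ih =>
      intro s hl
      simp only [List.all_cons, Bool.and_eq_true] at hl ⊢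
      obtain ⟨h1, h2, h3⟩ := fr_act hl.1 s
      obtain ⟨h4, h5, h6⟩ := ih (i.act s) hl.2
      exact ⟨⟨h1, h4⟩, h2.trans h5 le_rfl, h6.trans h3⟩
  obtain ⟨h1, h2, h3⟩ := key l s hl
  exact Tot.blk h1 le_rfl ⟨h2, h3, h⟩

/-- Loop control touches only the counter and register 69; both lie at or above `L`, so a frame
condition can be part of a loop invariant. -/
theorem Fr.resp {L i : ℕ} {s s' s'' : St} (h : Fr L s s') (hi : L ≤ i) (hL : L ≤ 69)
    (hI : ∀ r, r ≠ i → r ≠ 69 → s''.I r = s'.I r) (hM : s''.M = s'.M) (hX : s''.X = s'.X) :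
    Fr L s s'' :=
  ⟨fun r hr => by rw [hI r (by omega) (by omega), h.I r hr], fun r hr => by rw [hX, h.X r hr],
    by rw [hM, h.M]⟩

/-- A `for` loop whose invariant is insensitive to the counter and to the constant register. -/
theorem Tot.forTo' {i c : ℕ} {x : Cmd} {s : St} {n N : ℕ} (Inv : ℕ → St → Prop) (hi : i < 69)
    (hresp : ∀ v s' s'', Inv v s' → (∀ r, r ≠ i → r ≠ 69 → s''.I r = s'.I r) → s''.M = s'.M →
      s''.X = s'.X → s''.A = s'.A → Inv v s'')
    (h0 : Inv 0 s) (hI : ∀ v s', Inv v s' → s'.I c = N)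
    (hx : ∀ v s', v < N → Inv v s' → s'.I i = v →
      Tot x s' n fun s'' => Inv (v + 1) s'' ∧ s''.I i = v) :
    Tot (RealRAM.forTo i c x) s (N * (n + 4) + 2) (Inv N) := by
  have := Tot.forTo (i := i) (c := c) (x := x) (s := s) (n := n) (N := N)
    (fun v s' => s'.I i = v ∧ Inv v s') hi.ne ?_ ?_ ?_
  · exact this.mono le_rfl fun s' h => h.2
  · refine ⟨by simp, hresp _ _ _ h0 ?_ rfl rfl rfl⟩
    intro r hr _
    simp [hr]
  · rintro v s' - ⟨h1, h2⟩
    exact ⟨h1, hI v s' h2⟩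
  · rintro v s' hv ⟨h1, h2⟩
    refine (hx v s' hv h2 h1).mono le_rfl ?_
    rintro s'' ⟨h3, h4⟩
    refine ⟨by simp [St.tick, h4], hresp _ _ _ h3 ?_ rfl rfl rfl⟩
    intro r hr hr'
    simp [St.tick, hr, hr']

section Proj

variable {E : Type*} [NormedAddCommGroup E] [InnerProductSpace ℝ E]

/-- `v` minus its projection to the line of `b`. -/
noncomputable def projStep (b v : E) : E := v - (inner ℝ v b / inner ℝ b b) • b

/-- `v` minus its projections to `b 0, …, b (t - 1)`, one after the other. -/
noncomputable def projSeq (b : ℕ → E) : ℕ → E → E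
  | 0, v => v
  | t + 1, v => projStep (b t) (projSeq b t v)

theorem projSeq_congr {b b' : ℕ → E} {t : ℕ} (h : ∀ s, s < t → b s = b' s) (v : E) :
    projSeq b t v = projSeq b' t v := by
  induction t with
  | zero => rfl
  | succ t ih => rw [projSeq, projSeq, ih fun s hs => h s (by omega), h t (by omega)]

end Proj

/-- Vector `I[40]` minus its projection to vector `I[41]`. -/
def proj : Cmd :=
  blk [.iadd 50 40 8, .iadd 51 41 8] ;; dot ;;
  blk [.rconst 49 0, .radd 48 50 49, .iadd 50 41 8, .iadd 51 41 8] ;; dot ;;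
  blk [.rdiv 48 48 50, .rsub 50 49 48, .iadd 50 40 8, .iadd 51 40 8, .iadd 52 41 8] ;; axpy

theorem proj_tot (s : St) {d : ℕ} (hd : 1 ≤ d) (h1 : s.I 1 = d) (h8 : s.I 8 = 0) :
    Tot proj s (200 * d) fun s' => Fr 48 s s' ∧ vecs d s'.A =
      update (vecs d s.A) (s.I 40) (projStep (vecs d s.A (s.I 41)) (vecs d s.A (s.I 40))) := by
  have : Tot proj s (2 + (50 * d + (4 + (50 * d + (5 + 50 * d))))) fun s' => Fr 48 s s' ∧
      vecs d s'.A = update (vecs d s.A) (s.I 40)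
        (projStep (vecs d s.A (s.I 41)) (vecs d s.A (s.I 40))) := by
    refine Tot.seq (Tot.blkFr 50 (Q := fun s' => s'.I 50 = s.I 40 ∧ s'.I 51 = s.I 41) rfl
      (by simp [Instr.act, h8])) ?_
    rintro s1 ⟨F1, A1, a1, b1⟩
    refine Tot.seq (dot_tot s1 hd ((F1.I 1 (by norm_num)).trans h1)) ?_
    rintro s2 ⟨F2, A2, a2⟩
    have G2 : Fr 48 s s2 := (F1.mono (by norm_num)).trans F2 (by norm_num)
    refine Tot.seq (Tot.blkFr 48 (Q := fun s' => s'.I 50 = s.I 41 ∧ s'.I 51 = s.I 41 ∧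
      s'.X 48 = s2.X 50 ∧ s'.X 49 = 0) rfl
      (by simp [Instr.act, G2.I 41, G2.I 8, h8])) ?_
    rintro s3 ⟨F3, A3, a3, b3, c3, d3⟩
    have G3 : Fr 48 s s3 := G2.trans F3 (by norm_num)
    refine Tot.seq (dot_tot s3 hd ((G3.I 1 (by norm_num)).trans h1)) ?_
    rintro s4 ⟨F4, A4, a4⟩
    have G4 : Fr 48 s s4 := G3.trans F4 (by norm_num)
    refine Tot.seq (Tot.blkFr 48 (Q := fun s' => s'.I 50 = s.I 40 ∧ s'.I 51 = s.I 40 ∧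
      s'.I 52 = s.I 41 ∧ s'.X 50 = - (s2.X 50 / s4.X 50)) rfl ?_) ?_
    · simp [Instr.act, G4.I 41, G4.I 40, G4.I 8, h8, F4.X 48, F4.X 49, c3, d3]
    rintro s5 ⟨F5, A5, a5, b5, c5, d5⟩
    have G5 : Fr 48 s s5 := G4.trans F5 (by norm_num)
    refine (axpy_tot s5 hd ((G5.I 1 (by norm_num)).trans h1)).mono le_rfl ?_
    rintro s6 ⟨F6, V6⟩
    refine ⟨G5.trans F6 (by norm_num), ?_⟩
    have hA5 : s5.A = s.A := by rw [A5, A4, A3, A2, A1]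
    have hA3 : s3.A = s.A := by rw [A3, A2, A1]
    rw [V6, a5, b5, c5, d5, a2, a4, a1, b1, A1, a3, b3, hA5, hA3, projStep, neg_smul, sub_eq_add_neg]
  exact this.mono (by omega) fun _ => id

/-- Vector `I[40]` minus its projections to the `I[43]` vectors from number `I[42]` on. -/
def projAll : Cmd :=
  blk [.iadd 41 42 8] ;; forTo 44 43 (proj ;; blk [.iadd 41 41 9])

/-- The target is updated in place while the directions are read. By `ha` it is none of them, so
every pass sees the original direction. -/
theorem projAll_tot (s : St) {d : ℕ} (hd : 1 ≤ d) (h1 : s.I 1 = d) (h8 : s.I 8 = 0)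
    (h9 : s.I 9 = 1) (ha : ∀ t, t < s.I 43 → s.I 42 + t ≠ s.I 40) :
    Tot projAll s (s.I 43 * (205 * d) + 3) fun s' => Fr 40 s s' ∧ vecs d s'.A =
      update (vecs d s.A) (s.I 40)
        (projSeq (fun t => vecs d s.A (s.I 42 + t)) (s.I 43) (vecs d s.A (s.I 40))) := by
  have : Tot projAll s (1 + (s.I 43 * ((200 * d + 1) + 4) + 2)) fun s' =>
      s'.I 41 = s.I 42 + s.I 43 ∧ s'.I 42 = s.I 42 ∧ s'.I 43 = s.I 43 ∧ s'.I 40 = s.I 40 ∧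
      Fr 40 s s' ∧ vecs d s'.A = update (vecs d s.A) (s.I 40)
        (projSeq (fun t => vecs d s.A (s.I 42 + t)) (s.I 43) (vecs d s.A (s.I 40))) := by
    refine Tot.seq (Tot.blkFr 41 (Q := fun s' => s'.I 41 = s.I 42 ∧ s'.I 42 = s.I 42 ∧
      s'.I 43 = s.I 43) rfl (by simp [Instr.act, h8])) ?_
    rintro s1 ⟨F1, A1, a1, b1, c1⟩
    refine Tot.forTo' (fun v s' => s'.I 41 = s.I 42 + v ∧ s'.I 42 = s.I 42 ∧ s'.I 43 = s.I 43 ∧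
      s'.I 40 = s.I 40 ∧ Fr 40 s s' ∧ vecs d s'.A = update (vecs d s.A) (s.I 40)
        (projSeq (fun t => vecs d s.A (s.I 42 + t)) v (vecs d s.A (s.I 40))))
      (by norm_num) ?_ ?_ ?_ ?_
    · rintro v s' s'' ⟨e1, e2, e3, e4, e5, e6⟩ hI hM hX hA
      refine ⟨by rw [hI _ (by norm_num) (by norm_num), e1],
        by rw [hI _ (by norm_num) (by norm_num), e2], by rw [hI _ (by norm_num) (by norm_num), e3],
        by rw [hI _ (by norm_num) (by norm_num), e4],
        e5.resp (by norm_num) (by norm_num) hI hM hX, by rw [hA, e6]⟩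
    · refine ⟨by simpa using a1, b1, c1, F1.I 40 (by norm_num), F1.mono (by norm_num), ?_⟩
      simp [A1, projSeq]
    · rintro v s' ⟨-, -, e, -⟩
      exact e
    · rintro v s' hv ⟨e1, e2, e3, e4, e5, e6⟩ hi
      refine Tot.seq (proj_tot s' hd ((e5.I 1 (by norm_num)).trans h1)
        ((e5.I 8 (by norm_num)).trans h8)) ?_
      rintro s2 ⟨F2, V2⟩
      refine (Tot.blkFr 41 (Q := fun s' => s'.I 41 = s.I 42 + (v + 1) ∧ s'.I 42 = s.I 42 ∧
        s'.I 43 = s.I 43 ∧ s'.I 44 = v) rfl ?_).mono le_rfl ?_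
      · simp [Instr.act, F2.I, e1, e2, e3, hi, e5.I, h9, add_assoc]
      · rintro s3 ⟨F3, A3, a3, b3, c3, d3⟩
        refine ⟨⟨a3, b3, c3, ?_, ?_, ?_⟩, d3⟩
        · rw [F3.I 40 (by norm_num), F2.I 40 (by norm_num), e4]
        · exact (e5.trans F2 (by norm_num)).trans F3 (by norm_num)
        · rw [A3, V2, e6, e4, e1]
          simp [projSeq, update_of_ne (ha v hv)]
  refine this.mono ?_ fun s' h => ⟨h.2.2.2.2.1, h.2.2.2.2.2⟩
  have : s.I 43 * (200 * d + 1 + 4) ≤ s.I 43 * (205 * d) := Nat.mul_le_mul_left _ (by omega)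
  omega

end RealRAM

/-! ### Distance powers of a point to the nearest candidate flat. -/

namespace RealRAM

open Function

/-- `X[32]` := the `τ`-th power of the distance of the point `I[30]` to the nearest flat. -/
def evalPt (τ : ℕ) : Cmd :=
  blk [.iadd 32 11 8, .iadd 33 12 8] ;;
  forTo 31 2 (
    blk [.iadd 50 14 8, .iadd 51 30 8, .iadd 52 32 8, .rconst 50 (-1)] ;; axpy ;;
    blk [.iadd 40 14 8, .iadd 42 33 8, .iadd 43 10 8] ;; projAll ;;
    blk [.iadd 50 14 8, .iadd 51 14 8] ;; dot ;;
    blk [.rsqrt 30 50, .rconst 31 1, .iconst 34 τ] ;; forTo 35 34 (blk [.rmul 31 31 30]) ;;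
    .ite (.idx 31 8) (blk [.rconst 33 0, .radd 32 31 33])
      (.ite (.real 31 32) (blk [.rconst 33 0, .radd 32 31 33]) .skip) ;;
    blk [.iadd 32 32 10, .iadd 33 33 10])

/-- The `τ`-th power of the distance of `x` to the flat with base point `V c` and orthogonal
directions `V g, …, V (g + J - 1)`. -/
noncomputable def flatPow {d : ℕ} (τ J : ℕ) (V : ℕ → EuclideanSpace ℝ (Fin d)) (c g : ℕ)
    (x : EuclideanSpace ℝ (Fin d)) : ℝ :=
  ‖projSeq (fun t => V (g + t)) J (x - V c)‖ ^ τ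

/-- A running minimum. All vector work happens in the scratch vector `I[14]`, which lies above the
point and below the stored flats, so they stay intact. -/
theorem evalPt_tot (τ : ℕ) (s : St) {d : ℕ} (hd : 1 ≤ d) (h1 : s.I 1 = d) (h8 : s.I 8 = 0)
    (h9 : s.I 9 = 1) (hi : s.I 30 < s.I 14) (hc : s.I 14 < s.I 11) (hg : s.I 14 < s.I 12) :
    Tot (evalPt τ) s (s.I 2 * (s.I 10 * (205 * d) + 100 * d + 5 * τ + 40) + 4) fun s' =>
      Fr 30 s s' ∧ (∃ w, vecs d s'.A = update (vecs d s.A) (s.I 14) w) ∧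
      (∀ l, l < s.I 2 → s'.X 32 ≤ flatPow τ (s.I 10) (vecs d s.A) (s.I 11 + l * s.I 10)
        (s.I 12 + l * s.I 10) (vecs d s.A (s.I 30))) ∧
      (0 < s.I 2 → ∃ l, l < s.I 2 ∧ s'.X 32 = flatPow τ (s.I 10) (vecs d s.A)
        (s.I 11 + l * s.I 10) (s.I 12 + l * s.I 10) (vecs d s.A (s.I 30))) := by
  set k := s.I 2 with hk
  set J := s.I 10 with hJ
  set V := vecs d s.A with hV
  set pw : ℕ → ℝ := fun l => flatPow τ J V (s.I 11 + l * J) (s.I 12 + l * J) (V (s.I 30)) with hpw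
  let Inv : ℕ → St → Prop := fun v s' => s'.I 30 = s.I 30 ∧ s'.I 32 = s.I 11 + v * J ∧
    s'.I 33 = s.I 12 + v * J ∧ Fr 30 s s' ∧ (∃ w, vecs d s'.A = update V (s.I 14) w) ∧
      (∀ l, l < v → s'.X 32 ≤ pw l) ∧ (0 < v → ∃ l, l < v ∧ s'.X 32 = pw l)
  have key : Tot (evalPt τ) s (2 + (k * ((4 + (50 * d + (3 + (J * (205 * d) + 3 + (2 + (50 * d +
      (3 + (τ * (1 + 4) + 2 + (2 + 2 + 2 + 2)))))))))+ 4) + 2)) (Inv k) := by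
    refine Tot.seq (Tot.blkFr 32 (Q := fun s' => s'.I 32 = s.I 11 ∧ s'.I 33 = s.I 12) rfl
      (by simp [Instr.act, h8])) ?_
    rintro s1 ⟨F1, A1, a1, b1⟩
    refine Tot.forTo' Inv (by norm_num) ?_ ?_ ?_ ?_
    · rintro v s' s'' ⟨e1, e2, e3, e4, e5, e6, e7⟩ hI hM hX hA
      refine ⟨by rw [hI _ (by norm_num) (by norm_num), e1],
        by rw [hI _ (by norm_num) (by norm_num), e2], by rw [hI _ (by norm_num) (by norm_num), e3],
        e4.resp (by norm_num) (by norm_num) hI hM hX, by rw [hA]; exact e5, by rw [hX]; exact e6,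
        by rw [hX]; exact e7⟩
    · exact ⟨F1.I 30 (by norm_num), by simpa using a1, by simpa using b1, F1.mono (by norm_num),
        ⟨V (s.I 14), by rw [A1, update_eq_self]⟩, by simp, by simp⟩
    · rintro v s' ⟨-, -, -, e, -⟩
      exact e.I 2 (by norm_num)
    · rintro v s' hv ⟨e1, e2, e3, e4, ⟨w, e5⟩, e6, e7⟩ hi31
      have i8 : s'.I 8 = 0 := (e4.I 8 (by norm_num)).trans h8
      have i9 : s'.I 9 = 1 := (e4.I 9 (by norm_num)).trans h9
      have i1 : s'.I 1 = d := (e4.I 1 (by norm_num)).trans h1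
      have i14 : s'.I 14 = s.I 14 := e4.I 14 (by norm_num)
      have i10 : s'.I 10 = J := e4.I 10 (by norm_num)
      refine Tot.mono (n := 4 + (50 * d + (3 + (J * (205 * d) + 3 + (2 + (50 * d +
        (3 + (τ * (1 + 4) + 2 + (2 + 2 + 2 + 2))))))))) ?_ le_rfl fun _ => id
      refine Tot.seq (Tot.blkFr 40 (Q := fun t => t.I 50 = s.I 14 ∧ t.I 51 = s.I 30 ∧
        t.I 52 = s.I 11 + v * J ∧ t.X 50 = -1) rfl
        (by simp [Instr.act, i8, i14, e1, e2])) ?_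
      rintro t1 ⟨F1, A1, a1, b1, c1, d1⟩
      refine Tot.seq (axpy_tot t1 hd ((F1.I 1 (by norm_num)).trans i1)) ?_
      rintro t2 ⟨F2, V2⟩
      have G2 : Fr 40 s' t2 := F1.trans F2 (by norm_num)
      have V2' : vecs d t2.A = update V (s.I 14) (V (s.I 30) - V (s.I 11 + v * J)) := by
        rw [V2, A1, a1, b1, c1, d1, e5, update_idem, update_of_ne (by omega),
          update_of_ne (by omega), neg_one_smul, sub_eq_add_neg]
      refine Tot.seq (Tot.blkFr 40 (Q := fun t => t.I 40 = s.I 14 ∧ t.I 42 = s.I 12 + v * J ∧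
        t.I 43 = J) rfl (by simp [Instr.act, G2.I, i8, i14, e3, i10])) ?_
      rintro t3 ⟨F3, A3, a3, b3, c3⟩
      have G3 : Fr 40 s' t3 := G2.trans F3 (by norm_num)
      refine Tot.seq ((projAll_tot t3 hd ((G3.I 1 (by norm_num)).trans i1)
        ((G3.I 8 (by norm_num)).trans i8) ((G3.I 9 (by norm_num)).trans i9)
        (by intro t _; omega)).mono (by rw [c3]) fun _ => id) ?_
      rintro t4 ⟨F4, V4⟩
      have G4 : Fr 40 s' t4 := G3.trans F4 (by norm_num)
      set y := projSeq (fun t => V (s.I 12 + v * J + t)) J (V (s.I 30) - V (s.I 11 + v * J)) with hy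
      have V4' : vecs d t4.A = update V (s.I 14) y := by
        rw [V4, a3, b3, c3, A3, V2', update_idem, update_self, hy]
        congr 1
        refine projSeq_congr (fun r _ => ?_) _
        rw [update_of_ne (by omega)]
      refine Tot.seq (Tot.blkFr 40 (Q := fun t => t.I 50 = s.I 14 ∧ t.I 51 = s.I 14) rfl
        (by simp [Instr.act, G4.I, i8, i14])) ?_
      rintro t5 ⟨F5, A5, a5, b5⟩
      have G5 : Fr 40 s' t5 := G4.trans F5 (by norm_num)
      refine Tot.seq (dot_tot t5 hd ((G5.I 1 (by norm_num)).trans i1)) ?_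
      rintro t6 ⟨F6, A6, d6⟩
      have G6 : Fr 40 s' t6 := G5.trans F6 (by norm_num)
      rw [a5, b5, A5, V4', update_self] at d6
      refine Tot.seq (Tot.blkFr 30 (Q := fun t => t.X 30 = ‖y‖ ∧ t.X 31 = 1 ∧ t.I 34 = τ ∧
        t.I 30 = s.I 30 ∧ t.I 31 = v ∧ t.I 32 = s.I 11 + v * J ∧ t.I 33 = s.I 12 + v * J ∧
        t.X 32 = s'.X 32) rfl ?_) ?_
      · simp [Instr.act, d6, G6.I, G6.X, e1, e2, e3, hi31]
      rintro t7 ⟨F7, A7, a7, b7, c7, d7, f7, g7, k7, l7⟩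
      have G7 : Fr 30 s t7 := (e4.trans G6 (by norm_num)).trans F7 (by norm_num)
      have VA7 : vecs d t7.A = update V (s.I 14) y := by rw [A7, A6, A5, V4']
      refine Tot.seq (Tot.forTo' (n := 1) (N := τ) (s := t7) (fun v' t => t.X 30 = ‖y‖ ∧
        t.X 31 = ‖y‖ ^ v' ∧ t.I 34 = τ ∧
        t.I 30 = s.I 30 ∧ t.I 31 = v ∧ t.I 32 = s.I 11 + v * J ∧ t.I 33 = s.I 12 + v * J ∧
        t.X 32 = s'.X 32 ∧ Fr 30 s t ∧ t.A = t7.A) (by norm_num) ?_ ?_ ?_ ?_) ?_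
      · rintro v' u u' ⟨p1, p2, p3, p4, p5, p6, p7, p8, p9, p10⟩ hI hM hX hA
        refine ⟨by rw [hX, p1], by rw [hX, p2], by rw [hI _ (by norm_num) (by norm_num), p3],
          by rw [hI _ (by norm_num) (by norm_num), p4], by rw [hI _ (by norm_num) (by norm_num), p5],
          by rw [hI _ (by norm_num) (by norm_num), p6], by rw [hI _ (by norm_num) (by norm_num), p7],
          by rw [hX, p8], p9.resp (by norm_num) (by norm_num) hI hM hX, by rw [hA, p10]⟩
      · exact ⟨a7, by simpa using b7, c7, d7, f7, g7, k7, l7, G7, rfl⟩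
      · rintro v' u ⟨-, -, p3, -⟩
        exact p3
      · rintro v' u hv' ⟨p1, p2, p3, p4, p5, p6, p7, p8, p9, p10⟩ hi35
        refine (Tot.blkFr 30 (Q := fun t => t.X 30 = ‖y‖ ∧
          t.X 31 = ‖y‖ ^ (v' + 1) ∧ t.I 34 = τ ∧
          t.I 30 = s.I 30 ∧ t.I 31 = v ∧ t.I 32 = s.I 11 + v * J ∧ t.I 33 = s.I 12 + v * J ∧
          t.X 32 = s'.X 32 ∧ t.I 35 = v') rfl ?_).mono le_rfl ?_
        · simp [Instr.act, p1, p2, p3, p4, p5, p6, p7, p8, hi35, pow_succ]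
        · rintro t ⟨H1, H2, q1, q2, q3, q4, q5, q6, q7, q8, q9⟩
          exact ⟨⟨q1, q2, q3, q4, q5, q6, q7, q8, p9.trans H1 le_rfl, H2.trans p10⟩, q9⟩
      rintro t8 ⟨-, b8, -, d8, f8, g8, k8, l8, G8, A8⟩
      have hpv : t8.X 31 = pw v := by rw [b8]; rfl
      have VA8 : vecs d t8.A = update V (s.I 14) y := by rw [A8, VA7]
      have hset : ∀ L : ℝ → Prop, L (pw v) → Tot (RealRAM.blk [.rconst 33 0, .radd 32 31 33]) t8 2
          fun t => t.I 30 = s.I 30 ∧ t.I 31 = v ∧ t.I 32 = s.I 11 + v * J ∧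
            t.I 33 = s.I 12 + v * J ∧ L (t.X 32) ∧ Fr 30 s t ∧ t.A = t8.A := by
        intro L hL
        refine (Tot.blkFr 30 (Q := fun t => t.I 30 = s.I 30 ∧ t.I 31 = v ∧ t.I 32 = s.I 11 + v * J ∧
            t.I 33 = s.I 12 + v * J ∧ L (t.X 32)) rfl ?_).mono le_rfl ?_
        · simp [Instr.act, d8, f8, g8, k8, hpv, hL]
        · rintro t ⟨H1, H2, q1, q2, q3, q4, q5⟩
          exact ⟨q1, q2, q3, q4, q5, G8.trans H1 le_rfl, H2⟩
      -- Before the first flat `X[32]` has no meaning: flat 0 is stored unconditionally, later ones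
      -- only if they are not larger than the minimum so far.
      refine Tot.seq (Tot.ite (n := 2 + 2) (Q := fun t => t.I 30 = s.I 30 ∧ t.I 31 = v ∧
            t.I 32 = s.I 11 + v * J ∧
            t.I 33 = s.I 12 + v * J ∧ ((∀ l, l < v + 1 → t.X 32 ≤ pw l) ∧
            (∃ l, l < v + 1 ∧ t.X 32 = pw l)) ∧ Fr 30 s t ∧ t.A = t8.A) ?_ ?_) ?_
      · intro hle
        simp only [Cond.Holds, f8, G8.I 8 (by norm_num), h8] at hle
        obtain rfl : v = 0 := by omega
        refine (hset (fun x => (∀ l, l < 0 + 1 → x ≤ pw l) ∧ (∃ l, l < 0 + 1 ∧ x = pw l)) ?_).mono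
          (by norm_num) fun _ => id
        refine ⟨fun l hl => ?_, 0, by norm_num, rfl⟩
        obtain rfl : l = 0 := by omega
        exact le_rfl
      · intro hle
        simp only [Cond.Holds, f8, G8.I 8 (by norm_num), h8] at hle
        refine Tot.ite ?_ ?_
        · intro hle2
          simp only [Cond.Holds, hpv, l8] at hle2
          refine hset (fun x => (∀ l, l < v + 1 → x ≤ pw l) ∧ (∃ l, l < v + 1 ∧ x = pw l)) ?_
          refine ⟨fun l hl => ?_, v, by omega, rfl⟩
          rcases Nat.lt_succ_iff_lt_or_eq.1 hl with h | h
          · exact hle2.trans (e6 l h)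
          · rw [h]
        · intro hle2
          simp only [Cond.Holds, hpv, l8, not_le] at hle2
          refine ⟨t8, (Det.skip t8).mono (by norm_num), d8, f8, g8, k8, ⟨?_, ?_⟩, G8, rfl⟩
          · intro l hl
            rw [l8]
            rcases Nat.lt_succ_iff_lt_or_eq.1 hl with h | h
            · exact e6 l h
            · rw [h]; exact hle2.le
          · obtain ⟨l, hl, hl'⟩ := e7 (by omega)
            exact ⟨l, by omega, by rw [l8, hl']⟩
      rintro t9 ⟨a9, b9, c9, d9, ⟨f9, g9⟩, G9, A9⟩
      refine (Tot.blkFr 32 (Q := fun t => t.I 30 = s.I 30 ∧ t.I 31 = v ∧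
        t.I 32 = s.I 11 + (v + 1) * J ∧ t.I 33 = s.I 12 + (v + 1) * J ∧ t.X 32 = t9.X 32) rfl ?_).mono
        le_rfl ?_
      · simp [Instr.act, a9, b9, c9, d9, G9.I 10, ← hJ, add_mul, add_assoc]
      · rintro t ⟨H1, H2, q1, q2, q3, q4, q5⟩
        refine ⟨⟨q1, q3, q4, G9.trans H1 (by norm_num), ⟨y, by rw [H2, A9, VA8]⟩, ?_, ?_⟩, q2⟩
        · rw [q5]; exact f9
        · rw [q5]; exact fun _ => g9
  refine key.mono ?_ ?_
  · have : k * ((4 + (50 * d + (3 + (J * (205 * d) + 3 + (2 + (50 * d +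
      (3 + (τ * (1 + 4) + 2 + (2 + 2 + 2 + 2))))))))) + 4) ≤
      k * (J * (205 * d) + 100 * d + 5 * τ + 40) := Nat.mul_le_mul_left _ (by omega)
    omega
  · rintro s' ⟨-, -, -, h4, h5, h6, h7⟩
    exact ⟨h4, h5, h6, h7⟩

end RealRAM

/-! ### Candidate points as combinations of samples and unit vectors. -/

namespace RealRAM

open Function

/-- The combination of sample vectors and unit vectors whose weights are stored in `M` from `wp` on
and whose samples are listed in `M` from `sb` on. -/
noncomputable def rowVal {d : ℕ} (D H : ℝ) (m j n : ℕ) (M : ℕ → ℕ)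
    (V : ℕ → EuclideanSpace ℝ (Fin d)) (sb wp : ℕ) : EuclideanSpace ℝ (Fin d) :=
  ∑ i ∈ Finset.range m, (((M (wp + i) : ℝ) - H) / D) • V (M (sb + i)) +
    ∑ i ∈ Finset.range j, (((M (wp + m + i) : ℝ) - H) / D) • V (n + i)

/-- Vector `I[20]` := combination with samples from `M[I[22]]` on and weights from `M[I[21]]` on. -/
def buildRow : Cmd :=
  blk [.iadd 50 20 8, .iadd 51 20 8, .iadd 52 20 8, .rconst 50 (-1)] ;; axpy ;;
  blk [.iadd 25 22 8] ;;
  forTo 26 4 (blk [.iload 52 25, .iload 27 21, .rcast 50 27, .rsub 50 50 3, .rdiv 50 50 2,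
    .iadd 50 20 8, .iadd 51 20 8, .iadd 21 21 9, .iadd 25 25 9] ;; axpy) ;;
  forTo 26 3 (blk [.iadd 52 0 26, .iload 27 21, .rcast 50 27, .rsub 50 50 3, .rdiv 50 50 2,
    .iadd 50 20 8, .iadd 51 20 8, .iadd 21 21 9] ;; axpy)

theorem buildRow_tot (s : St) {d : ℕ} (hd : 1 ≤ d) (h1 : s.I 1 = d) (h8 : s.I 8 = 0)
    (h9 : s.I 9 = 1) (hs : ∀ i, i < s.I 4 → s.M (s.I 22 + i) ≠ s.I 20)
    (he : ∀ i, i < s.I 3 → s.I 0 + i ≠ s.I 20) :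
    Tot buildRow s ((s.I 4 + s.I 3) * (70 * d) + 60 * d + 10) fun s' =>
      Fr 20 s s' ∧ (∀ r, r < 25 → r ≠ 21 → s'.I r = s.I r) ∧
      s'.I 21 = s.I 21 + (s.I 4 + s.I 3) ∧
      vecs d s'.A = update (vecs d s.A) (s.I 20) (rowVal (s.X 2) (s.X 3) (s.I 4) (s.I 3) (s.I 0)
        s.M (vecs d s.A) (s.I 22) (s.I 21)) := by
  set V := vecs d s.A with hV
  have key : Tot buildRow s (4 + (50 * d + (1 + (s.I 4 * ((9 + 50 * d) + 4) + 2 +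
      (s.I 3 * ((8 + 50 * d) + 4) + 2))))) fun s' =>
      Fr 20 s s' ∧ (∀ r, r < 25 → r ≠ 21 → s'.I r = s.I r) ∧
      s'.I 21 = s.I 21 + (s.I 4 + s.I 3) ∧
      vecs d s'.A = update V (s.I 20) (∑ i ∈ Finset.range (s.I 4),
        (((s.M (s.I 21 + i) : ℝ) - s.X 3) / s.X 2) • V (s.M (s.I 22 + i)) +
        ∑ i ∈ Finset.range (s.I 3), (((s.M (s.I 21 + s.I 4 + i) : ℝ) - s.X 3) / s.X 2) •
        V (s.I 0 + i)) := by
    refine Tot.seq (Tot.blkFr 28 (Q := fun s' => s'.I 50 = s.I 20 ∧ s'.I 51 = s.I 20 ∧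
      s'.I 52 = s.I 20 ∧ s'.X 50 = -1) rfl (by simp [Instr.act, h8])) ?_
    rintro s1 ⟨F1, A1, a1, b1, c1, d1⟩
    -- The target row is cleared as v + (-1)·v before the combination is accumulated.
    refine Tot.seq (axpy_tot s1 hd ((F1.I 1 (by norm_num)).trans h1)) ?_
    rintro s2 ⟨F2, V2⟩
    have G2 : Fr 28 s s2 := F1.trans F2 (by norm_num)
    have V2' : vecs d s2.A = update V (s.I 20) 0 := by
      rw [V2, A1, a1, b1, c1, d1, neg_one_smul, add_neg_cancel]
    refine Tot.seq (Tot.blkFr 25 (Q := fun s' => s'.I 25 = s.I 22) rfl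
      (by simp [Instr.act, G2.I, h8])) ?_
    rintro s3 ⟨F3, A3, a3⟩
    have G3 : Fr 25 s s3 := (G2.mono (by norm_num)).trans F3 le_rfl
    refine Tot.seq (Tot.forTo' (N := s.I 4) (n := 9 + 50 * d) (fun v s' => Fr 20 s s' ∧
      (∀ r, r < 25 → r ≠ 21 → s'.I r = s.I r) ∧ s'.I 21 = s.I 21 + v ∧ s'.I 25 = s.I 22 + v ∧
      vecs d s'.A = update V (s.I 20) (∑ i ∈ Finset.range v,
        (((s.M (s.I 21 + i) : ℝ) - s.X 3) / s.X 2) • V (s.M (s.I 22 + i)))) (by norm_num)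
        ?_ ?_ ?_ ?_) ?_
    · rintro v s' s'' ⟨e1, e2, e3, e4, e5⟩ hI hM hX hA
      refine ⟨e1.resp (by norm_num) (by norm_num) hI hM hX, ?_,
        by rw [hI _ (by norm_num) (by norm_num), e3],
        by rw [hI _ (by norm_num) (by norm_num), e4], by rw [hA, e5]⟩
      intro r hr hr'
      rw [hI r (by omega) (by omega), e2 r hr hr']
    · refine ⟨G3.mono (by norm_num), fun r hr _ => G3.I r hr, G3.I 21 (by norm_num), a3, ?_⟩
      rw [A3, V2', Finset.sum_range_zero]
    · rintro v s' ⟨e1, -⟩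
      exact e1.I 4 (by norm_num)
    · rintro v s' hv ⟨e1, e2, e3, e4, e5⟩ hi
      refine Tot.seq (Tot.blkFr 20 (Q := fun t => t.I 50 = s.I 20 ∧ t.I 51 = s.I 20 ∧
        t.I 52 = s.M (s.I 22 + v) ∧ t.X 50 = ((s.M (s.I 21 + v) : ℝ) - s.X 3) / s.X 2 ∧
        t.I 26 = v ∧ t.I 21 = s.I 21 + (v + 1) ∧ t.I 25 = s.I 22 + (v + 1) ∧
        (∀ r, r < 25 → r ≠ 21 → t.I r = s.I r)) rfl ?_) ?_
      · have e9 := e2 9 (by norm_num) (by norm_num)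
        have e8 := e2 8 (by norm_num) (by norm_num)
        have e20 := e2 20 (by norm_num) (by norm_num)
        refine ⟨?_, ?_, ?_, ?_, ?_, ?_, ?_, ?_⟩
        · simp [Instr.act, e20, e8, h8]
        · simp [Instr.act, e20, e8, h8]
        · simp [Instr.act, e4, e1.M]
        · simp [Instr.act, e3, e1.M, e1.X]
        · simp [Instr.act, hi]
        · simp [Instr.act, e9, h9, e3, add_assoc]
        · simp [Instr.act, e9, h9, e4, add_assoc]
        · intro r hr hr'
          have : r ≠ 52 ∧ r ≠ 27 ∧ r ≠ 50 ∧ r ≠ 51 ∧ r ≠ 25 := by omega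
          simp [Instr.act, this, hr', e2 r hr hr']
      rintro t ⟨F, A, q1, q2, q3, q4, q5, q6, q7, q8⟩
      refine (axpy_tot t hd ((q8 1 (by norm_num) (by norm_num)).trans h1)).mono le_rfl ?_
      rintro t' ⟨F', V'⟩
      refine ⟨⟨(e1.trans F le_rfl).trans F' (by norm_num), ?_, ?_, ?_, ?_⟩, ?_⟩
      · intro r hr hr'
        rw [F'.I r (by omega), q8 r hr hr']
      · rw [F'.I 21 (by norm_num), q6]
      · rw [F'.I 25 (by norm_num), q7]
      · rw [V', q1, q2, q3, q4, A, e5, update_idem, update_self, update_of_ne (hs v hv),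
          Finset.sum_range_succ]
      · rw [F'.I 26 (by norm_num), q5]
    rintro s4 ⟨F4, I4, a4, -, V4⟩
    refine (Tot.forTo' (N := s.I 3) (n := 8 + 50 * d) (fun v s' => Fr 20 s s' ∧
      (∀ r, r < 25 → r ≠ 21 → s'.I r = s.I r) ∧ s'.I 21 = s.I 21 + s.I 4 + v ∧
      vecs d s'.A = update V (s.I 20) (∑ i ∈ Finset.range (s.I 4),
        (((s.M (s.I 21 + i) : ℝ) - s.X 3) / s.X 2) • V (s.M (s.I 22 + i)) +
        ∑ i ∈ Finset.range v, (((s.M (s.I 21 + s.I 4 + i) : ℝ) - s.X 3) / s.X 2) •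
        V (s.I 0 + i))) (by norm_num) ?_ ?_ ?_ ?_).mono le_rfl ?_
    · rintro v s' s'' ⟨e1, e2, e3, e5⟩ hI hM hX hA
      refine ⟨e1.resp (by norm_num) (by norm_num) hI hM hX, ?_,
        by rw [hI _ (by norm_num) (by norm_num), e3], by rw [hA, e5]⟩
      intro r hr hr'
      rw [hI r (by omega) (by omega), e2 r hr hr']
    · refine ⟨F4, I4, a4, ?_⟩
      rw [V4, Finset.sum_range_zero, add_zero]
    · rintro v s' ⟨e1, -⟩
      exact e1.I 3 (by norm_num)
    · rintro v s' hv ⟨e1, e2, e3, e5⟩ hi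
      refine Tot.seq (Tot.blkFr 20 (Q := fun t => t.I 50 = s.I 20 ∧ t.I 51 = s.I 20 ∧
        t.I 52 = s.I 0 + v ∧ t.X 50 = ((s.M (s.I 21 + s.I 4 + v) : ℝ) - s.X 3) / s.X 2 ∧
        t.I 26 = v ∧ t.I 21 = s.I 21 + s.I 4 + (v + 1) ∧
        (∀ r, r < 25 → r ≠ 21 → t.I r = s.I r)) rfl ?_) ?_
      · have e9 := e2 9 (by norm_num) (by norm_num)
        have e8 := e2 8 (by norm_num) (by norm_num)
        have e20 := e2 20 (by norm_num) (by norm_num)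
        have e0 := e2 0 (by norm_num) (by norm_num)
        refine ⟨?_, ?_, ?_, ?_, ?_, ?_, ?_⟩
        · simp [Instr.act, e20, e8, h8]
        · simp [Instr.act, e20, e8, h8]
        · simp [Instr.act, e0, hi]
        · simp [Instr.act, e3, e1.M, e1.X]
        · simp [Instr.act, hi]
        · simp [Instr.act, e9, h9, e3, add_assoc]
        · intro r hr hr'
          have : r ≠ 52 ∧ r ≠ 27 ∧ r ≠ 50 ∧ r ≠ 51 ∧ r ≠ 25 := by omega
          simp [Instr.act, this, hr', e2 r hr hr']
      rintro t ⟨F, A, q1, q2, q3, q4, q5, q6, q8⟩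
      refine (axpy_tot t hd ((q8 1 (by norm_num) (by norm_num)).trans h1)).mono le_rfl ?_
      rintro t' ⟨F', V'⟩
      refine ⟨⟨(e1.trans F le_rfl).trans F' (by norm_num), ?_, ?_, ?_⟩, ?_⟩
      · intro r hr hr'
        rw [F'.I r (by omega), q8 r hr hr']
      · rw [F'.I 21 (by norm_num), q6]
      · rw [V', q1, q2, q3, q4, A, e5, update_idem, update_self, update_of_ne (he v hv),
          Finset.sum_range_succ, add_assoc]
      · rw [F'.I 26 (by norm_num), q5]
    · rintro s' ⟨e1, e2, e3, e5⟩
      exact ⟨e1, e2, by rw [e3, add_assoc], e5⟩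
  refine key.mono ?_ fun _ => id
  have h1 : s.I 4 * (9 + 50 * d + 4) ≤ s.I 4 * (70 * d) := Nat.mul_le_mul_left _ (by omega)
  have h2 : s.I 3 * (8 + 50 * d + 4) ≤ s.I 3 * (70 * d) := Nat.mul_le_mul_left _ (by omega)
  rw [add_mul]
  omega

theorem rowVal_congr {d : ℕ} {D H : ℝ} {m j n : ℕ} {M : ℕ → ℕ}
    {V V' : ℕ → EuclideanSpace ℝ (Fin d)} {sb wp : ℕ}
    (h : ∀ i, i < m → V (M (sb + i)) = V' (M (sb + i))) (h' : ∀ i, i < j → V (n + i) = V' (n + i)) :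
    rowVal D H m j n M V sb wp = rowVal D H m j n M V' sb wp := by
  rw [rowVal, rowVal]
  congr 1 <;> refine Finset.sum_congr rfl fun i hi => ?_ <;> rw [Finset.mem_range] at hi
  · rw [h i hi]
  · rw [h' i hi]

/-- The spanning points of all candidate flats. -/
def build : Cmd :=
  blk [.iadd 20 11 8, .iadd 21 17 8, .iconst 22 1] ;;
  forTo 23 2 (forTo 24 10 (buildRow ;; blk [.iadd 20 20 9]) ;; blk [.iadd 22 22 4])

theorem mul_add_inj {J l l' t t' : ℕ} (ht : t < J) (ht' : t' < J) (h : l * J + t = l' * J + t') :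
    l = l' ∧ t = t' := by
  have hl : l = l' := by
    rcases lt_trichotomy l l' with h' | h' | h'
    · have : (l + 1) * J ≤ l' * J := Nat.mul_le_mul_right J h'
      rw [add_mul] at this; omega
    · exact h'
    · have : (l' + 1) * J ≤ l * J := Nat.mul_le_mul_right J h'
      rw [add_mul] at this; omega
  subst hl
  exact ⟨rfl, by omega⟩

theorem mul_add_lt {J k l t : ℕ} (hl : l < k) (ht : t < J) : l * J + t < k * J := by
  have : (l + 1) * J ≤ k * J := Nat.mul_le_mul_right J hl
  rw [add_mul] at this; omega

/-- All summands lie below address `I[11]` and all rows are written from there on, so earlier rows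
do not influence later ones. Cell 0 of `M` is reserved for the threshold; hence the samples start at
cell 1. -/
theorem build_tot (s : St) {d : ℕ} (hd : 1 ≤ d) (h1 : s.I 1 = d) (h8 : s.I 8 = 0)
    (h9 : s.I 9 = 1) (hs : ∀ l i, l < s.I 2 → i < s.I 4 → s.M (1 + l * s.I 4 + i) < s.I 11)
    (he : s.I 0 + s.I 3 ≤ s.I 11) :
    Tot build s (s.I 2 * (s.I 10 * ((s.I 4 + s.I 3) * (70 * d) + 75 * d) + 10) + 5) fun s' =>
      Fr 20 s s' ∧
      (∀ v, (v < s.I 11 ∨ s.I 11 + s.I 2 * s.I 10 ≤ v) → vecs d s'.A v = vecs d s.A v) ∧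
      ∀ l t, l < s.I 2 → t < s.I 10 → vecs d s'.A (s.I 11 + (l * s.I 10 + t)) =
        rowVal (s.X 2) (s.X 3) (s.I 4) (s.I 3) (s.I 0)
        s.M (vecs d s.A) (1 + l * s.I 4) (s.I 17 + (l * s.I 10 + t) * (s.I 4 + s.I 3)) := by
  set V := vecs d s.A with hV
  set J := s.I 10 with hJ
  set m := s.I 4 with hm
  set j := s.I 3 with hj
  set k := s.I 2 with hk
  let W : ℕ → ℕ → EuclideanSpace ℝ (Fin d) := fun l t => rowVal (s.X 2) (s.X 3) m j (s.I 0) s.M V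
    (1 + l * m) (s.I 17 + (l * J + t) * (m + j))
  let Inv : ℕ → St → Prop := fun q s' => Fr 20 s s' ∧ s'.I 20 = s.I 11 + q ∧
    s'.I 21 = s.I 17 + q * (m + j) ∧
    (∀ v, (v < s.I 11 ∨ s.I 11 + q ≤ v) → vecs d s'.A v = V v) ∧
    ∀ l t, t < J → l * J + t < q → vecs d s'.A (s.I 11 + (l * J + t)) = W l t
  have hInv : ∀ i q s' s'', 22 ≤ i → Inv q s' → (∀ r, r ≠ i → r ≠ 69 → s''.I r = s'.I r) →
      s''.M = s'.M → s''.X = s'.X → s''.A = s'.A → Inv q s'' := by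
    rintro i q s' s'' hi ⟨e1, e2, e3, e4, e5⟩ hI hM hX hA
    refine ⟨e1.resp (by omega) (by norm_num) hI hM hX,
      by rw [hI _ (by omega) (by norm_num), e2], by rw [hI _ (by omega) (by norm_num), e3],
      by rw [hA]; exact e4, by rw [hA]; exact e5⟩
  have key : Tot build s (3 + (k * ((J * ((((m + j) * (70 * d) + 60 * d + 10) + 1) + 4) + 2 + 1) + 4)
      + 2)) fun s' => s'.I 22 = 1 + k * m ∧ Inv (k * J) s' := by
    refine Tot.seq (Tot.blkFr 20 (Q := fun s' => s'.I 20 = s.I 11 ∧ s'.I 21 = s.I 17 ∧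
      s'.I 22 = 1) rfl (by simp [Instr.act, h8])) ?_
    rintro s1 ⟨F1, A1, a1, b1, c1⟩
    refine Tot.forTo' (fun l s' => s'.I 22 = 1 + l * m ∧ Inv (l * J) s') (by norm_num) ?_ ?_ ?_ ?_
    · rintro v s' s'' ⟨e1, e2⟩ hI hM hX hA
      exact ⟨by rw [hI _ (by norm_num) (by norm_num), e1],
        hInv 23 _ s' s'' (by norm_num) e2 hI hM hX hA⟩
    · refine ⟨by simpa using c1, F1, by simpa using a1, by simpa using b1, fun v _ => by rw [A1], ?_⟩
      intro l t ht hlt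
      omega
    · rintro v s' ⟨-, e, -⟩
      exact e.I 2 (by norm_num)
    · rintro l s' hl ⟨e22, e⟩ hi23
      refine Tot.seq (n₂ := 1) (Tot.forTo' (i := 24) (c := 10) (N := J) (n := ((m + j) * (70 * d) + 60 * d + 10) + 1)
        (fun t s' => s'.I 22 = 1 + l * m ∧ s'.I 23 = l ∧ Inv (l * J + t) s') (by norm_num)
        ?_ ?_ ?_ ?_) ?_
      · rintro v s' s'' ⟨e1, e1', e2⟩ hI hM hX hA
        exact ⟨by rw [hI _ (by norm_num) (by norm_num), e1],
          by rw [hI _ (by norm_num) (by norm_num), e1'],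
          hInv 24 _ s' s'' (by norm_num) e2 hI hM hX hA⟩
      · exact ⟨e22, hi23, e⟩
      · rintro v s' ⟨-, -, e, -⟩
        exact e.I 10 (by norm_num)
      · rintro t u ht ⟨u22, u23, uF, u20, u21, uV, uW⟩ u24
        have i3 : u.I 3 = j := uF.I 3 (by norm_num)
        have i4 : u.I 4 = m := uF.I 4 (by norm_num)
        have i0 : u.I 0 = s.I 0 := uF.I 0 (by norm_num)
        refine Tot.seq ((buildRow_tot u hd ((uF.I 1 (by norm_num)).trans h1)
          ((uF.I 8 (by norm_num)).trans h8) ((uF.I 9 (by norm_num)).trans h9) ?_ ?_).mono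
          (by rw [i3, i4]) fun _ => id) ?_
        · intro i hi
          rw [i4] at hi
          have := hs l i hl hi
          rw [uF.M, u22, u20]
          omega
        · intro i hi
          rw [i3] at hi
          omega
        rintro u1 ⟨F1, I1, a1, V1⟩
        refine (Tot.blkFr 20 (Q := fun t' => t'.I 20 = s.I 11 + (l * J + (t + 1)) ∧
          t'.I 21 = s.I 17 + (l * J + (t + 1)) * (m + j) ∧ t'.I 22 = 1 + l * m ∧ t'.I 23 = l ∧
          t'.I 24 = t) rfl ?_).mono le_rfl ?_
        · refine ⟨?_, ?_, ?_, ?_, ?_⟩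
          · simp [Instr.act, I1, u20, uF.I, h9, add_assoc]
          · simp only [List.foldl, Instr.act]
            rw [update_of_ne (by norm_num), a1, u21, i3, i4]
            ring
          · simp [Instr.act, I1, u22]
          · simp [Instr.act, I1, u23]
          · simp [Instr.act, I1, u24]
        · rintro u2 ⟨F2, A2, a2, b2, c2, d2, f2⟩
          refine ⟨⟨c2, d2, (uF.trans F1 le_rfl).trans F2 le_rfl, a2, b2, ?_, ?_⟩, f2⟩
          · intro v hv
            rw [A2, V1, update_of_ne (by omega), uV v (by omega)]
          · intro l' t' ht' hlt
            rw [A2, V1, u20]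
            by_cases hq : l' * J + t' = l * J + t
            · obtain ⟨rfl, rfl⟩ := mul_add_inj ht' ht hq
              rw [update_self, uF.X 2 (by norm_num), uF.X 3 (by norm_num), i3, i4, i0, uF.M, u22,
                u21]
              refine rowVal_congr (fun i hi => uV _ (Or.inl (hs l' i hl hi))) fun i hi =>
                uV _ (Or.inl ?_)
              omega
            · rw [update_of_ne (by omega)]
              exact uW l' t' ht' (by omega)
      rintro u ⟨u22, u23, uF, u20, u21, uV, uW⟩
      refine (Tot.blkFr 22 (Q := fun t' => t'.I 22 = 1 + (l + 1) * m ∧ t'.I 23 = l) rfl ?_).mono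
        le_rfl ?_
      · simp [Instr.act, u22, u23, uF.I, ← hm, add_mul, add_assoc]
      · rintro u2 ⟨F2, A2, a2, b2⟩
        have hq : (l + 1) * J = l * J + J := by ring
        rw [hq]
        refine ⟨⟨a2, uF.trans F2 (by norm_num), ?_, ?_, ?_, ?_⟩, b2⟩
        · rw [F2.I 20 (by norm_num), u20]
        · rw [F2.I 21 (by norm_num), u21]
        · rw [A2]; exact uV
        · rw [A2]; exact uW
  refine key.mono ?_ ?_
  · have : k * ((J * ((((m + j) * (70 * d) + 60 * d + 10) + 1) + 4) + 2 + 1) + 4) ≤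
      k * (J * ((m + j) * (70 * d) + 75 * d) + 10) := by
      refine Nat.mul_le_mul_left _ ?_
      have : J * ((((m + j) * (70 * d) + 60 * d + 10) + 1) + 4) ≤
        J * ((m + j) * (70 * d) + 75 * d) := Nat.mul_le_mul_left _ (by omega)
      omega
    omega
  · rintro s' ⟨-, h3, -, -, h5, h6⟩
    exact ⟨h3, h5, fun l t hl ht => h6 l t ht (mul_add_lt hl ht)⟩

end RealRAM

/-! ### Gram-Schmidt orthogonalization and the dimension test. -/

namespace RealRAM

open Function

section GramSchmidt

variable {E : Type*} [NormedAddCommGroup E] [InnerProductSpace ℝ E]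

/-- The parts subtracted earlier are orthogonal to `b t` and do not change the inner product with
it. A zero vector `b t` causes no harm, since its term vanishes. -/
theorem projSeq_of_orthogonal {b : ℕ → E} (hb : ∀ s t, s ≠ t → inner ℝ (b s) (b t) = 0) (v : E)
    (t : ℕ) : projSeq b t v =
      v - ∑ s ∈ Finset.range t, (inner ℝ v (b s) / inner ℝ (b s) (b s)) • b s := by
  induction t with
  | zero => simp [projSeq]
  | succ t ih =>
    have h : inner ℝ (projSeq b t v) (b t) = inner ℝ v (b t) := by
      rw [ih, inner_sub_left, sum_inner, Finset.sum_eq_zero, sub_zero]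
      intro s hs
      rw [inner_smul_left, hb s t (by simp at hs; omega), mul_zero]
    rw [projSeq, projStep, h, ih, Finset.sum_range_succ, sub_sub]

/-- Connects the computed sequence of projections with the Gram-Schmidt process, whose span and
orthogonality properties are known. -/
theorem projSeq_gramSchmidt (f : ℕ → E) (t : ℕ) :
    projSeq (InnerProductSpace.gramSchmidt ℝ f) t (f t) =
      InnerProductSpace.gramSchmidt ℝ f t := by
  rw [projSeq_of_orthogonal fun s t hst => InnerProductSpace.gramSchmidt_orthogonal ℝ f hst,
    InnerProductSpace.gramSchmidt_def]
  congr 1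
  refine Finset.sum_congr (by ext; simp) fun s _ => ?_
  rw [Submodule.starProjection_singleton, real_inner_comm, real_inner_self_eq_norm_sq]
  rfl

end GramSchmidt

/-- Orthogonalization of the directions of all candidate flats; `I[22]` counts the zero vectors. -/
def gsPhase : Cmd :=
  blk [.iadd 20 11 8, .iadd 21 12 8, .iadd 25 12 8, .iadd 26 11 8, .iconst 22 0] ;;
  forTo 23 2 (forTo 24 10 (
      blk [.iadd 50 21 8, .iadd 51 26 8, .iadd 52 20 8, .rconst 50 (-1)] ;; axpy ;;
      blk [.iadd 40 21 8, .iadd 42 25 8, .iadd 43 24 8] ;; projAll ;;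
      blk [.iadd 50 21 8, .iadd 51 21 8, .rconst 20 0] ;; dot ;;
      .ite (.real 50 20) (blk [.iadd 22 22 9]) .skip ;;
      blk [.iadd 21 21 9, .iadd 26 26 9]) ;;
    blk [.iadd 20 20 10, .iadd 25 25 10])

theorem outside_succ {v a q : ℕ} (h : v < a ∨ a + (q + 1) ≤ v) :
    v ≠ a + q ∧ (v < a ∨ a + q ≤ v) := by omega

-- Each difference of a candidate point and the base point of its flat is projected off the earlier
-- results, which by induction are the Gram-Schmidt vectors of the same flat. The number of zeros
-- will decide whether all flats have dimension j.
set_option maxHeartbeats 400000 in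
open scoped Classical in
theorem gsPhase_tot (s : St) {d : ℕ} (hd : 1 ≤ d) (h1 : s.I 1 = d) (h8 : s.I 8 = 0)
    (h9 : s.I 9 = 1) (hg : s.I 11 + s.I 2 * s.I 10 ≤ s.I 12)
    (G : ℕ → ℕ → EuclideanSpace ℝ (Fin d))
    (hG : ∀ l t, G l t = InnerProductSpace.gramSchmidt ℝ (fun t =>
      vecs d s.A (s.I 11 + (l * s.I 10 + t)) - vecs d s.A (s.I 11 + l * s.I 10)) t) :
    Tot gsPhase s (s.I 2 * (s.I 10 * (s.I 10 * (205 * d) + 130 * d) + 10) + 7) fun s' =>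
      Fr 20 s s' ∧
      (∀ v, (v < s.I 12 ∨ s.I 12 + s.I 2 * s.I 10 ≤ v) → vecs d s'.A v = vecs d s.A v) ∧
      (∀ l t, l < s.I 2 → t < s.I 10 → vecs d s'.A (s.I 12 + (l * s.I 10 + t)) = G l t) ∧
      s'.I 22 = ∑ l ∈ Finset.range (s.I 2), ∑ t ∈ Finset.range (s.I 10),
        if G l t = 0 then 1 else 0 := by
  set V := vecs d s.A with hV
  set J := s.I 10 with hJ
  set k := s.I 2 with hk
  let cn : ℕ → ℕ → ℕ := fun l t => ∑ t ∈ Finset.range t, if G l t = 0 then 1 else 0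
  let Inv : ℕ → St → Prop := fun q s' => Fr 20 s s' ∧ s'.I 21 = s.I 12 + q ∧
    s'.I 26 = s.I 11 + q ∧
    (∀ v, (v < s.I 12 ∨ s.I 12 + q ≤ v) → vecs d s'.A v = V v) ∧
    ∀ l t, t < J → l * J + t < q → vecs d s'.A (s.I 12 + (l * J + t)) = G l t
  have hInv : ∀ i q s' s'', 23 ≤ i → i ≠ 26 → Inv q s' →
      (∀ r, r ≠ i → r ≠ 69 → s''.I r = s'.I r) →
      s''.M = s'.M → s''.X = s'.X → s''.A = s'.A → Inv q s'' := by
    rintro i q s' s'' hi hi' ⟨e1, e2, e3, e4, e5⟩ hI hM hX hA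
    refine ⟨e1.resp (by omega) (by norm_num) hI hM hX,
      by rw [hI _ (by omega) (by norm_num), e2], by rw [hI _ (by omega) (by norm_num), e3],
      by rw [hA]; exact e4, by rw [hA]; exact e5⟩
  have key : Tot gsPhase s (5 + (k * ((J * ((4 + (50 * d + (3 + (J * (205 * d) + 3 + (3 + (50 * d +
      ((1 + 2) + 2))))))) + 4) + 2 + 2) + 4) + 2)) fun s' =>
        s'.I 20 = s.I 11 + k * J ∧ s'.I 25 = s.I 12 + k * J ∧
        s'.I 22 = ∑ l ∈ Finset.range k, cn l J ∧ Inv (k * J) s' := by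
    refine Tot.seq (Tot.blkFr 20 (Q := fun s' => s'.I 20 = s.I 11 ∧ s'.I 21 = s.I 12 ∧
      s'.I 25 = s.I 12 ∧ s'.I 26 = s.I 11 ∧ s'.I 22 = 0) rfl (by simp [Instr.act, h8])) ?_
    rintro s1 ⟨F1, A1, a1, b1, c1, d1, f1⟩
    refine Tot.forTo' (fun l s' => s'.I 20 = s.I 11 + l * J ∧ s'.I 25 = s.I 12 + l * J ∧
        s'.I 22 = ∑ l ∈ Finset.range l, cn l J ∧ Inv (l * J) s') (by norm_num) ?_ ?_ ?_ ?_
    · rintro v s' s'' ⟨e1, e2, e3, e4⟩ hI hM hX hA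
      exact ⟨by rw [hI _ (by norm_num) (by norm_num), e1],
        by rw [hI _ (by norm_num) (by norm_num), e2],
        by rw [hI _ (by norm_num) (by norm_num), e3],
        hInv 23 _ s' s'' (by norm_num) (by norm_num) e4 hI hM hX hA⟩
    · refine ⟨by simpa using a1, by simpa using c1, by simpa using f1, F1, by simpa using b1,
        by simpa using d1, fun v _ => by rw [A1], ?_⟩
      intro l t ht hlt
      omega
    · rintro v s' ⟨-, -, -, e, -⟩
      exact e.I 2 (by norm_num)
    · rintro l s' hl ⟨e20, e25, e22, e⟩ hi23
      refine Tot.seq (n₂ := 2) (Tot.forTo' (i := 24) (c := 10) (N := J)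
        (n := 4 + (50 * d + (3 + (J * (205 * d) + 3 + (3 + (50 * d + ((1 + 2) + 2)))))))
        (fun t s' => s'.I 20 = s.I 11 + l * J ∧ s'.I 25 = s.I 12 + l * J ∧ s'.I 23 = l ∧
        s'.I 22 = ∑ l ∈ Finset.range l, cn l J + cn l t ∧ Inv (l * J + t) s') (by norm_num)
        ?_ ?_ ?_ ?_) ?_
      · rintro v s' s'' ⟨e1, e2, e3, e3', e4⟩ hI hM hX hA
        exact ⟨by rw [hI _ (by norm_num) (by norm_num), e1],
          by rw [hI _ (by norm_num) (by norm_num), e2],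
          by rw [hI _ (by norm_num) (by norm_num), e3],
          by rw [hI _ (by norm_num) (by norm_num), e3'],
          hInv 24 _ s' s'' (by norm_num) (by norm_num) e4 hI hM hX hA⟩
      · exact ⟨e20, e25, hi23, by simpa [cn] using e22, e⟩
      · rintro v s' ⟨-, -, -, -, e, -⟩
        exact e.I 10 (by norm_num)
      · rintro t u ht ⟨u20, u25, u23, u22, uF, u21, u26, uV, uW⟩ u24
        have i8 : u.I 8 = 0 := (uF.I 8 (by norm_num)).trans h8
        have i9 : u.I 9 = 1 := (uF.I 9 (by norm_num)).trans h9
        have i1 : u.I 1 = d := (uF.I 1 (by norm_num)).trans h1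
        have hlt : l * J + t < k * J := mul_add_lt hl ht
        -- Only t predecessors are projected off; for a uniform bound of a pass t is then replaced
        -- by J.
        refine Tot.mono (n := 4 + (50 * d + (3 + (t * (205 * d) + 3 + (3 + (50 * d +
          ((1 + 2) + 2))))))) ?_ ?_ fun _ => id
        rotate_left
        · have : t * (205 * d) ≤ J * (205 * d) := Nat.mul_le_mul_right _ ht.le
          omega
        refine Tot.seq (Tot.blkFr 28 (Q := fun t' => t'.I 50 = s.I 12 + (l * J + t) ∧
          t'.I 51 = s.I 11 + (l * J + t) ∧ t'.I 52 = s.I 11 + l * J ∧ t'.X 50 = -1) rfl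
          (by simp [Instr.act, i8, u20, u21, u26])) ?_
        rintro t1 ⟨F1, A1, a1, b1, c1, d1⟩
        refine Tot.seq (axpy_tot t1 hd ((F1.I 1 (by norm_num)).trans i1)) ?_
        rintro t2 ⟨F2, V2⟩
        have G2 : Fr 28 u t2 := F1.trans F2 (by norm_num)
        rw [a1, b1, c1, d1, A1, uV _ (Or.inl (by omega)), uV _ (Or.inl (by omega)), neg_one_smul,
          ← sub_eq_add_neg] at V2
        refine Tot.seq (Tot.blkFr 28 (Q := fun t' => t'.I 40 = s.I 12 + (l * J + t) ∧
          t'.I 42 = s.I 12 + l * J ∧ t'.I 43 = t) rfl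
          (by simp [Instr.act, G2.I, i8, u21, u25, u24])) ?_
        rintro t3 ⟨F3, A3, a3, b3, c3⟩
        have G3 : Fr 28 u t3 := G2.trans F3 (by norm_num)
        refine Tot.seq ((projAll_tot t3 hd ((G3.I 1 (by norm_num)).trans i1)
          ((G3.I 8 (by norm_num)).trans i8) ((G3.I 9 (by norm_num)).trans i9)
          (by intro t' _; omega)).mono (by rw [c3]) fun _ => id) ?_
        rintro t4 ⟨F4, V4⟩
        have G4 : Fr 28 u t4 := G3.trans F4 (by norm_num)
        have V4' : vecs d t4.A = update (vecs d u.A) (s.I 12 + (l * J + t)) (G l t) := by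
          rw [V4, a3, b3, c3, A3, V2, update_idem, update_self]
          congr 1
          rw [hG l t, ← projSeq_gramSchmidt]
          refine projSeq_congr (fun r hr => ?_) _
          rw [update_of_ne (by omega), add_assoc, uW l r (hr.trans ht) (by omega), hG]
        refine Tot.seq (Tot.blkFr 20 (Q := fun t' => t'.I 50 = s.I 12 + (l * J + t) ∧
          t'.I 51 = s.I 12 + (l * J + t) ∧ t'.X 20 = 0 ∧ ∀ r, r < 28 → t'.I r = u.I r) rfl ?_) ?_
        · refine ⟨by simp [Instr.act, G4.I, i8, u21], by simp [Instr.act, G4.I, i8, u21],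
            by simp [Instr.act], ?_⟩
          intro r hr
          have : r ≠ 50 ∧ r ≠ 51 := by omega
          simp [Instr.act, this, G4.I r hr]
        rintro t5 ⟨F5, A5, a5, b5, c5, I5⟩
        refine Tot.seq (dot_tot t5 hd ((I5 1 (by norm_num)).trans i1)) ?_
        rintro t6 ⟨F6, A6, a6⟩
        have G6 : Fr 20 s t6 := ((uF.trans G4 (by norm_num)).trans F5 le_rfl).trans F6 (by norm_num)
        rw [a5, b5, A5, V4', update_self] at a6
        have I6 : ∀ r, r < 28 → t6.I r = u.I r := fun r hr => by
          rw [F6.I r (by omega), I5 r hr]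
        have c6 : t6.X 20 = 0 := by rw [F6.X 20 (by norm_num), c5]
        -- Arithmetic is exact, so the comparison of the squared norm with 0 decides whether the
        -- vector vanishes.
        refine Tot.seq (Tot.ite (n := 1) (Q := fun t' => Fr 20 t6 t' ∧ t'.A = t6.A ∧
          (∀ r, r < 28 → r ≠ 22 → t'.I r = u.I r) ∧
          t'.I 22 = u.I 22 + if G l t = 0 then 1 else 0) ?_ ?_) ?_
        · intro hz
          simp only [Cond.Holds, a6, c6] at hz
          have hz' : G l t = 0 := by
            rwa [real_inner_self_nonpos] at hz
          refine (Tot.blkFr 20 (Q := fun t' => (∀ r, r < 28 → r ≠ 22 → t'.I r = u.I r) ∧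
            t'.I 22 = u.I 22 + if G l t = 0 then 1 else 0) rfl ?_).mono le_rfl fun _ => id
          refine ⟨?_, by simp [Instr.act, I6, i9, hz']⟩
          intro r hr hr'
          simp [Instr.act, hr', I6 r hr]
        · intro hz
          simp only [Cond.Holds, a6, c6] at hz
          have hz' : G l t ≠ 0 := by
            rwa [real_inner_self_nonpos] at hz
          refine ⟨t6, (Det.skip t6).mono (by norm_num), Fr.refl _ _, rfl, fun r hr _ => I6 r hr, ?_⟩
          simp [hz', I6]
        rintro t7 ⟨F7, A7, I7, a7⟩
        refine (Tot.blkFr 20 (Q := fun t' => t'.I 20 = s.I 11 + l * J ∧ t'.I 25 = s.I 12 + l * J ∧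
          t'.I 23 = l ∧ t'.I 22 = ∑ l ∈ Finset.range l, cn l J + cn l (t + 1) ∧ t'.I 24 = t ∧
          t'.I 21 = s.I 12 + (l * J + (t + 1)) ∧ t'.I 26 = s.I 11 + (l * J + (t + 1)))
          rfl ?_).mono le_rfl ?_
        · refine ⟨?_, ?_, ?_, ?_, ?_, ?_, ?_⟩
          · simp [Instr.act, I7, u20]
          · simp [Instr.act, I7, u25]
          · simp [Instr.act, I7, u23]
          · simp only [List.foldl, Instr.act, cn, Finset.sum_range_succ]
            rw [update_of_ne (by norm_num), update_of_ne (by norm_num), a7, u22, add_assoc]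
          · simp [Instr.act, I7, u24]
          · simp [Instr.act, I7, u21, i9, add_assoc]
          · simp [Instr.act, I7, u26, i9, add_assoc]
        rintro t8 ⟨F8, A8, a8, b8, c8, d8, f8, g8, k8⟩
        have VA : vecs d t8.A = update (vecs d u.A) (s.I 12 + (l * J + t)) (G l t) := by
          rw [A8, A7, A6, A5, V4']
        refine ⟨⟨a8, b8, c8, d8, (G6.trans F7 le_rfl).trans F8 le_rfl, g8, k8, ?_, ?_⟩, f8⟩
        · intro v hv
          obtain ⟨h1, h2⟩ := outside_succ (q := l * J + t) hv
          rw [VA, update_of_ne h1, uV v h2]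
        · intro l' t' ht' hlt'
          rw [VA]
          by_cases hq : l' * J + t' = l * J + t
          · obtain ⟨rfl, rfl⟩ := mul_add_inj ht' ht hq
            rw [update_self]
          · rw [update_of_ne fun h => hq (Nat.add_left_cancel h)]
            exact uW l' t' ht' (Nat.lt_of_le_of_ne (Nat.le_of_lt_succ hlt') hq)
      rintro u ⟨u20, u25, u23, u22, uF, u21, u26, uV, uW⟩
      refine (Tot.blkFr 20 (Q := fun t' => t'.I 20 = s.I 11 + (l + 1) * J ∧
        t'.I 25 = s.I 12 + (l + 1) * J ∧ t'.I 22 = u.I 22 ∧ t'.I 23 = l ∧ t'.I 21 = u.I 21 ∧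
        t'.I 26 = u.I 26) rfl ?_).mono le_rfl ?_
      · simp [Instr.act, u20, u25, u23, uF.I, ← hJ, add_mul, add_assoc]
      · rintro u2 ⟨F2, A2, a2, b2, c2, d2, f2, g2⟩
        have hq : (l + 1) * J = l * J + J := by ring
        refine ⟨⟨a2, b2, ?_, ?_⟩, d2⟩
        · rw [c2, u22, Finset.sum_range_succ]
        · rw [hq]
          refine ⟨uF.trans F2 le_rfl, by rw [f2, u21], by rw [g2, u26], ?_, ?_⟩
          · rw [A2]; exact uV
          · rw [A2]; exact uW
  refine key.mono ?_ ?_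
  · have : k * ((J * ((4 + (50 * d + (3 + (J * (205 * d) + 3 + (3 + (50 * d +
      ((1 + 2) + 2))))))) + 4) + 2 + 2) + 4) ≤
      k * (J * (J * (205 * d) + 130 * d) + 10) := by
      refine Nat.mul_le_mul_left _ ?_
      have : J * ((4 + (50 * d + (3 + (J * (205 * d) + 3 + (3 + (50 * d +
        ((1 + 2) + 2))))))) + 4) ≤ J * (J * (205 * d) + 130 * d) := Nat.mul_le_mul_left _ (by omega)
      omega
    omega
  · rintro s' ⟨-, -, h2, h3, -, -, h5, h6⟩
    exact ⟨h3, h5, fun l t hl ht => h6 l t ht (mul_add_lt hl ht), h2⟩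

end RealRAM

/-! ### Thresholding, averaging, and keeping the best candidates. -/

namespace RealRAM

open Function

/-- Copy `I[15]` vectors from number `I[25]` on to number `I[26]` on. -/
def copyAll : Cmd :=
  forTo 24 15 (blk [.iadd 50 26 8, .iadd 51 25 8, .iadd 52 25 8, .rconst 50 0] ;; axpy ;;
    blk [.iadd 25 25 9, .iadd 26 26 9])

/-- Copying is `axpy` with factor 0. The two address ranges are disjoint, so the source is intact
when it is read. -/
theorem copyAll_tot (s : St) {d : ℕ} (hd : 1 ≤ d) (h1 : s.I 1 = d) (h8 : s.I 8 = 0)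
    (h9 : s.I 9 = 1) (h : s.I 26 + s.I 15 ≤ s.I 25 ∨ s.I 25 + s.I 15 ≤ s.I 26) :
    Tot copyAll s (s.I 15 * (60 * d) + 2) fun s' => Fr 24 s s' ∧
      (∀ v, (v < s.I 26 ∨ s.I 26 + s.I 15 ≤ v) → vecs d s'.A v = vecs d s.A v) ∧
      ∀ q, q < s.I 15 → vecs d s'.A (s.I 26 + q) = vecs d s.A (s.I 25 + q) := by
  have key : Tot copyAll s (s.I 15 * ((4 + (50 * d + 2)) + 4) + 2) fun s' => Fr 24 s s' ∧
      s'.I 25 = s.I 25 + s.I 15 ∧ s'.I 26 = s.I 26 + s.I 15 ∧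
      (∀ v, (v < s.I 26 ∨ s.I 26 + s.I 15 ≤ v) → vecs d s'.A v = vecs d s.A v) ∧
      ∀ q, q < s.I 15 → vecs d s'.A (s.I 26 + q) = vecs d s.A (s.I 25 + q) := by
    refine Tot.forTo' (fun p s' => Fr 24 s s' ∧
      s'.I 25 = s.I 25 + p ∧ s'.I 26 = s.I 26 + p ∧
      (∀ v, (v < s.I 26 ∨ s.I 26 + p ≤ v) → vecs d s'.A v = vecs d s.A v) ∧
      ∀ q, q < p → vecs d s'.A (s.I 26 + q) = vecs d s.A (s.I 25 + q)) (by norm_num) ?_ ?_ ?_ ?_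
    · rintro v s' s'' ⟨e1, e2, e3, e4, e5⟩ hI hM hX hA
      exact ⟨e1.resp (by norm_num) (by norm_num) hI hM hX,
        by rw [hI _ (by norm_num) (by norm_num), e2],
        by rw [hI _ (by norm_num) (by norm_num), e3], by rw [hA]; exact e4, by rw [hA]; exact e5⟩
    · exact ⟨Fr.refl _ _, rfl, rfl, fun _ _ => rfl, fun q hq => by omega⟩
    · rintro v s' ⟨e, -⟩
      exact e.I 15 (by norm_num)
    · rintro p s' hp ⟨e1, e2, e3, e4, e5⟩ hi
      have i8 : s'.I 8 = 0 := (e1.I 8 (by norm_num)).trans h8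
      have i9 : s'.I 9 = 1 := (e1.I 9 (by norm_num)).trans h9
      refine Tot.seq (Tot.blkFr 28 (Q := fun t => t.I 50 = s.I 26 + p ∧ t.I 51 = s.I 25 + p ∧
        t.I 52 = s.I 25 + p ∧ t.X 50 = 0) rfl (by simp [Instr.act, i8, e2, e3])) ?_
      rintro t ⟨F, A, a1, a2, a3, a4⟩
      refine Tot.seq (axpy_tot t hd ((F.I 1 (by norm_num)).trans
        ((e1.I 1 (by norm_num)).trans h1))) ?_
      rintro t' ⟨F', V'⟩
      rw [a1, a2, a3, a4, zero_smul, add_zero, A, e4 (s.I 25 + p) (by omega)] at V'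
      refine (Tot.blkFr 24 (Q := fun t => t.I 25 = s.I 25 + (p + 1) ∧ t.I 26 = s.I 26 + (p + 1) ∧
        t.I 24 = p) rfl ?_).mono le_rfl ?_
      · simp [Instr.act, F'.I, F.I, e2, e3, i9, hi, add_assoc]
      · rintro u ⟨F2, A2, b1, b2, b3⟩
        refine ⟨⟨((e1.trans F (by norm_num)).trans F' (by norm_num)).trans F2 le_rfl, b1, b2, ?_, ?_⟩,
          b3⟩
        · intro v hv
          rw [A2, V', update_of_ne (by omega), e4 v (by omega)]
        · intro q hq
          rw [A2, V']
          by_cases hqp : q = p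
          · subst hqp
            rw [update_self]
          · rw [update_of_ne (by omega), e5 q (by omega)]
  refine key.mono ?_ fun s' h => ⟨h.1, h.2.2.2⟩
  have : s.I 15 * ((4 + (50 * d + 2)) + 4) ≤ s.I 15 * (60 * d) := Nat.mul_le_mul_left _ (by omega)
  omega

theorem flatPow_update {d τ J : ℕ} {V : ℕ → EuclideanSpace ℝ (Fin d)} {a c g : ℕ}
    (w x : EuclideanSpace ℝ (Fin d)) (hc : a < c) (hg : a < g) :
    flatPow τ J (update V a w) c g x = flatPow τ J V c g x := by
  rw [flatPow, flatPow, update_of_ne hc.ne']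
  congr 2
  refine projSeq_congr (fun s _ => ?_) _
  rw [update_of_ne (by omega)]

/-- The `τ`-th power of the distance of `x` to the nearest of `k` flats stored from `c` and `g` on. -/
noncomputable def nearPow {d : ℕ} (τ k J : ℕ) (V : ℕ → EuclideanSpace ℝ (Fin d)) (c g : ℕ)
    (x : EuclideanSpace ℝ (Fin d)) : ℝ :=
  ⨅ l : Fin k, flatPow τ J V (c + l * J) (g + l * J) x

theorem nearPow_update {d τ k J : ℕ} {V : ℕ → EuclideanSpace ℝ (Fin d)} {a c g : ℕ}
    (w x : EuclideanSpace ℝ (Fin d)) (hc : a < c) (hg : a < g) :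
    nearPow τ k J (update V a w) c g x = nearPow τ k J V c g x := by
  rw [nearPow, nearPow]
  congr 1
  funext l
  exact flatPow_update _ _ (by omega) (by omega)

theorem evalPt_tot' (τ : ℕ) (s : St) {d : ℕ} (hd : 1 ≤ d) (h1 : s.I 1 = d) (h8 : s.I 8 = 0)
    (h9 : s.I 9 = 1) (hi : s.I 30 < s.I 14) (hc : s.I 14 < s.I 11) (hg : s.I 14 < s.I 12)
    (hk : 0 < s.I 2) :
    Tot (evalPt τ) s (s.I 2 * (s.I 10 * (205 * d) + 100 * d + 5 * τ + 40) + 4) fun s' =>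
      Fr 30 s s' ∧ (∃ w, vecs d s'.A = update (vecs d s.A) (s.I 14) w) ∧
      s'.X 32 = nearPow τ (s.I 2) (s.I 10) (vecs d s.A) (s.I 11) (s.I 12) (vecs d s.A (s.I 30)) := by
  refine (evalPt_tot τ s hd h1 h8 h9 hi hc hg).mono le_rfl ?_
  rintro s' ⟨e1, e2, e3, e4⟩
  refine ⟨e1, e2, ?_⟩
  obtain ⟨l, hl, e⟩ := e4 hk
  have : Nonempty (Fin (s.I 2)) := ⟨⟨0, hk⟩⟩
  refine le_antisymm (le_ciInf fun l => e3 l l.2) ?_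
  rw [e]
  exact ciInf_le (Set.finite_range _).bddBelow (⟨l, hl⟩ : Fin (s.I 2))

/-- Store the candidate flats as the best ones. -/
def updBest : Cmd :=
  blk [.iadd 25 11 8, .iadd 26 13 8] ;; copyAll ;; blk [.rconst 23 0, .radd 4 21 23]

/-- Evaluate the candidate flats on the points not farther than the point `M[0]`, and keep them if
they are better than the best ones so far. -/
def select (τ : ℕ) : Cmd :=
  blk [.iload 30 8] ;; evalPt τ ;; blk [.rconst 21 0, .radd 20 32 21, .iconst 21 0] ;;
  forTo 20 0 (blk [.iadd 30 20 8] ;; evalPt τ ;;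
    .ite (.real 32 20) (blk [.iadd 21 21 9, .radd 21 21 32]) .skip) ;;
  blk [.rcast 22 21, .rdiv 21 21 22, .rconst 23 0] ;;
  .ite (.real 5 22) (.ite (.idx 22 2) (.ite (.real 23 4) (.ite (.real 21 4) updBest .skip) updBest)
    .skip) .skip

theorem updBest_tot (s : St) {d : ℕ} (hd : 1 ≤ d) (h1 : s.I 1 = d) (h8 : s.I 8 = 0)
    (h9 : s.I 9 = 1) (h : s.I 11 + s.I 15 ≤ s.I 13) :
    Tot updBest s (s.I 15 * (60 * d) + 6) fun s' => (∀ r, r < 20 → s'.I r = s.I r) ∧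
      (∀ r, r < 20 → r ≠ 4 → s'.X r = s.X r) ∧ s'.M = s.M ∧ s'.X 4 = s.X 21 ∧
      (∀ v, v < s.I 13 → vecs d s'.A v = vecs d s.A v) ∧
      ∀ q, q < s.I 15 → vecs d s'.A (s.I 13 + q) = vecs d s.A (s.I 11 + q) := by
  have : Tot updBest s (2 + ((s.I 15 * (60 * d) + 2) + 2)) fun s' => (∀ r, r < 20 → s'.I r = s.I r) ∧
      (∀ r, r < 20 → r ≠ 4 → s'.X r = s.X r) ∧ s'.M = s.M ∧ s'.X 4 = s.X 21 ∧
      (∀ v, v < s.I 13 → vecs d s'.A v = vecs d s.A v) ∧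
      ∀ q, q < s.I 15 → vecs d s'.A (s.I 13 + q) = vecs d s.A (s.I 11 + q) := by
    refine Tot.seq (Tot.blkFr 24 (Q := fun t => t.I 25 = s.I 11 ∧ t.I 26 = s.I 13) rfl
      (by simp [Instr.act, h8])) ?_
    rintro t ⟨F, A, a1, a2⟩
    have i15 := F.I 15 (by norm_num)
    refine Tot.seq (n₂ := 2) ((copyAll_tot t hd ((F.I 1 (by norm_num)).trans h1)
      ((F.I 8 (by norm_num)).trans h8) ((F.I 9 (by norm_num)).trans h9) (by omega)).mono
      (by rw [i15]) fun _ => id) ?_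
    rintro t' ⟨F', h2, h3⟩
    refine Tot.blk rfl le_rfl ?_
    rw [a1, a2, i15, A] at h3
    rw [a2, i15, A] at h2
    refine ⟨?_, ?_, ?_, ?_, ?_, ?_⟩
    · intro r hr
      simp [Instr.act, F'.I r (by omega), F.I r (by omega)]
    · intro r hr hr4
      have : r ≠ 23 := by omega
      simp [Instr.act, this, hr4, F'.X r (by omega), F.X r (by omega)]
    · simp [Instr.act, F'.M, F.M]
    · simp [Instr.act, F'.X, F.X]
    · intro v hv
      exact h2 v (Or.inl hv)
    · exact h3
  exact this.mono (by omega) fun _ => id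

-- The averages are nonnegative, so a negative `X[4]` can encode that nothing has been stored yet.
-- This is why the comparison with `X[4]` in `upd` is conditional.
open scoped Classical in
set_option maxHeartbeats 400000 in
theorem select_tot (τ : ℕ) (s : St) {d : ℕ} (hd : 1 ≤ d) (h1 : s.I 1 = d) (h8 : s.I 8 = 0)
    (h9 : s.I 9 = 1) (hn : s.I 0 ≤ s.I 14) (h0 : s.M 0 < s.I 0) (hc : s.I 14 < s.I 11)
    (hg : s.I 14 < s.I 12) (hk : 0 < s.I 2) (hb : s.I 11 + s.I 15 ≤ s.I 13)
    (h13 : s.I 14 < s.I 13)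
    (F : ℕ → ℝ) (hF : ∀ i, F i = nearPow τ (s.I 2) (s.I 10) (vecs d s.A) (s.I 11) (s.I 12)
      (vecs d s.A i))
    (avg : ℝ) (havg : avg = (∑ i ∈ Finset.range (s.I 0) with F i ≤ F (s.M 0), F i) /
      ((Finset.range (s.I 0)).filter fun i => F i ≤ F (s.M 0)).card)
    (upd : Prop) (hupd : upd ↔ s.X 5 ≤ ((Finset.range (s.I 0)).filter fun i =>
      F i ≤ F (s.M 0)).card ∧ s.I 22 ≤ s.I 2 ∧ (0 ≤ s.X 4 → avg ≤ s.X 4)) :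
    Tot (select τ) s ((s.I 0 + 1) * (s.I 2 * (s.I 10 * (205 * d) + 100 * d + 5 * τ + 40) + 20) +
      s.I 15 * (60 * d) + 20) fun s' =>
      (∀ r, r < 20 → s'.I r = s.I r) ∧ (∀ r, r < 20 → r ≠ 4 → s'.X r = s.X r) ∧ s'.M = s.M ∧
      (∀ v, v < s.I 14 → vecs d s'.A v = vecs d s.A v) ∧
      (upd → s'.X 4 = avg ∧
        ∀ q, q < s.I 15 → vecs d s'.A (s.I 13 + q) = vecs d s.A (s.I 11 + q)) ∧
      (¬ upd → s'.X 4 = s.X 4 ∧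
        ∀ q, q < s.I 15 → vecs d s'.A (s.I 13 + q) = vecs d s.A (s.I 13 + q)) := by
  set V := vecs d s.A with hV
  set Te := s.I 2 * (s.I 10 * (205 * d) + 100 * d + 5 * τ + 40) + 4 with hTe
  let S : ℕ → Finset ℕ := fun v => (Finset.range v).filter fun i => F i ≤ F (s.M 0)
  -- An evaluation changes only the scratch vector, which no later evaluation depends on; all of
  -- them thus return values of the same function `F`.
  have ev : ∀ (t : St) (w : EuclideanSpace ℝ (Fin d)), Fr 20 s t → t.I 30 < s.I 0 →
      vecs d t.A = update V (s.I 14) w → Tot (evalPt τ) t Te fun t' => Fr 30 t t' ∧ Fr 20 s t' ∧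
        (∃ w, vecs d t'.A = update V (s.I 14) w) ∧ t'.X 32 = F (t.I 30) := by
    intro t w Ft ht hw
    refine (evalPt_tot' τ t hd ((Ft.I 1 (by norm_num)).trans h1)
      ((Ft.I 8 (by norm_num)).trans h8) ((Ft.I 9 (by norm_num)).trans h9)
      (by rw [Ft.I 14 (by norm_num)]; omega)
      (by rw [Ft.I 14 (by norm_num), Ft.I 11 (by norm_num)]; omega)
      (by rw [Ft.I 14 (by norm_num), Ft.I 12 (by norm_num)]; omega)
      (by rw [Ft.I 2 (by norm_num)]; omega)).mono
      (by rw [Ft.I 2 (by norm_num), Ft.I 10 (by norm_num)]) ?_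
    rintro t' ⟨e1, ⟨w', e2⟩, e3⟩
    refine ⟨e1, Ft.trans e1 (by norm_num), ⟨w', ?_⟩, ?_⟩
    · rw [e2, Ft.I 14 (by norm_num), hw, update_idem]
    · rw [e3, Ft.I 2 (by norm_num), Ft.I 10 (by norm_num), Ft.I 11 (by norm_num),
        Ft.I 12 (by norm_num), hw, nearPow_update _ _ hc hg, update_of_ne (by omega), hF]
  have key : Tot (select τ) s (1 + (Te + (3 + ((s.I 0 * ((1 + (Te + (2 + 2))) + 4) + 2) + (3 +
      ((((s.I 15 * (60 * d) + 6) + 2) + 2) + 2 + 2)))))) fun s' =>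
      (∀ r, r < 20 → s'.I r = s.I r) ∧ (∀ r, r < 20 → r ≠ 4 → s'.X r = s.X r) ∧ s'.M = s.M ∧
      (∀ v, v < s.I 14 → vecs d s'.A v = V v) ∧
      (upd → s'.X 4 = avg ∧
        ∀ q, q < s.I 15 → vecs d s'.A (s.I 13 + q) = V (s.I 11 + q)) ∧
      (¬ upd → s'.X 4 = s.X 4 ∧
        ∀ q, q < s.I 15 → vecs d s'.A (s.I 13 + q) = V (s.I 13 + q)) := by
    refine Tot.seq (Tot.blkFr 23 (Q := fun t => t.I 30 = s.M 0) rfl (by simp [Instr.act, h8])) ?_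
    rintro t1 ⟨F1, A1, a1⟩
    refine Tot.seq (ev t1 (V (s.I 14)) (F1.mono (by norm_num)) (by rw [a1]; exact h0)
      (by rw [A1, update_eq_self])) ?_
    rintro t2 ⟨F2, G2, ⟨w2, V2⟩, b2⟩
    rw [a1] at b2
    refine Tot.seq (Tot.blkFr 20 (Q := fun t => t.X 20 = F (s.M 0) ∧ t.X 21 = 0 ∧ t.I 21 = 0 ∧
      t.I 22 = s.I 22) rfl (by simp [Instr.act, b2, F2.I, F1.I])) ?_
    rintro t3 ⟨F3, A3, a3, b3, c3, d3⟩
    refine Tot.seq (Tot.forTo' (i := 20) (c := 0) (N := s.I 0) (n := 1 + (Te + (2 + 2)))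
      (fun v t => Fr 20 s t ∧ t.X 20 = F (s.M 0) ∧ t.X 21 = ∑ i ∈ S v, F i ∧ t.I 21 = (S v).card ∧
      t.I 22 = s.I 22 ∧ ∃ w, vecs d t.A = update V (s.I 14) w) (by norm_num) ?_ ?_ ?_ ?_) ?_
    · rintro v s' s'' ⟨e1, e2, e3, e4, e5, e6⟩ hI hM hX hA
      exact ⟨e1.resp (by norm_num) (by norm_num) hI hM hX, by rw [hX, e2], by rw [hX, e3],
        by rw [hI _ (by norm_num) (by norm_num), e4],
        by rw [hI _ (by norm_num) (by norm_num), e5], by rw [hA]; exact e6⟩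
    · exact ⟨G2.trans F3 le_rfl, a3, by simpa [S] using b3, by simpa [S] using c3, d3, w2,
        by rw [A3, V2]⟩
    · rintro v s' ⟨e, -⟩
      exact e.I 0 (by norm_num)
    · rintro v u hv ⟨e1, e2, e3, e4, e5, ⟨w, e6⟩⟩ hi
      refine Tot.seq (Tot.blkFr 23 (Q := fun t => t.I 30 = v) rfl
        (by simp [Instr.act, hi, e1.I, h8])) ?_
      rintro u1 ⟨F1, A1, a1⟩
      refine Tot.seq (ev u1 w (e1.trans F1 (by norm_num)) (by rw [a1]; exact hv)
        (by rw [A1, e6])) ?_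
      rintro u2 ⟨F2, G2, ⟨w2, V2⟩, b2⟩
      rw [a1] at b2
      have H2 : Fr 23 u u2 := F1.trans F2 (by norm_num)
      refine Tot.ite ?_ ?_
      · intro hle
        have hle' : F v ≤ F (s.M 0) := by
          simpa only [Cond.Holds, b2, H2.X 20 (by norm_num), e2] using hle
        have hS : S (v + 1) = insert v (S v) := by
          simp only [S, Finset.range_add_one, Finset.filter_insert, hle', if_true]
        have hvS : v ∉ S v := by simp [S]
        refine (Tot.blkFr 20 (Q := fun t => t.X 20 = F (s.M 0) ∧ t.X 21 = ∑ i ∈ S (v + 1), F i ∧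
          t.I 21 = (S (v + 1)).card ∧ t.I 22 = s.I 22 ∧ t.I 20 = v) rfl ?_).mono le_rfl ?_
        · rw [hS, Finset.sum_insert hvS, Finset.card_insert_of_notMem hvS]
          simp [Instr.act, H2.X, H2.I, e2, e3, e4, e5, e1.I, h9, b2, hi, add_comm]
        · rintro u3 ⟨F3, A3, a3, b3, c3, d3, f3⟩
          exact ⟨⟨G2.trans F3 le_rfl, a3, b3, c3, d3, w2, by rw [A3, V2]⟩, f3⟩
      · intro hle
        have hle' : ¬ F v ≤ F (s.M 0) := by
          simpa only [Cond.Holds, b2, H2.X 20 (by norm_num), e2] using hle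
        have hS : S (v + 1) = S v := by
          simp only [S, Finset.range_add_one, Finset.filter_insert, hle', if_false]
        refine ⟨u2, (Det.skip u2).mono (by norm_num), ⟨G2, ?_, ?_, ?_, ?_, w2, V2⟩, ?_⟩
        · rw [H2.X 20 (by norm_num), e2]
        · rw [H2.X 21 (by norm_num), e3, hS]
        · rw [H2.I 21 (by norm_num), e4, hS]
        · rw [H2.I 22 (by norm_num), e5]
        · rw [H2.I 20 (by norm_num), hi]
    rintro t4 ⟨F4, a4, b4, c4, d4, w4, V4⟩
    refine Tot.seq (Tot.blkFr 20 (Q := fun t => t.X 21 = avg ∧ t.X 22 = (S (s.I 0)).card ∧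
      t.X 23 = 0 ∧ t.I 22 = s.I 22) rfl ?_) ?_
    · simp [Instr.act, b4, c4, d4, havg, S]
    rintro t5 ⟨F5, A5, a5, b5, c5, d5⟩
    have G5 : Fr 20 s t5 := F4.trans F5 le_rfl
    have V5 : vecs d t5.A = update V (s.I 14) w4 := by rw [A5, V4]
    have x5 : t5.X 5 = s.X 5 := G5.X 5 (by norm_num)
    have x4 : t5.X 4 = s.X 4 := G5.X 4 (by norm_num)
    have hyes : upd → Tot updBest t5 (s.I 15 * (60 * d) + 6) fun s' =>
      (∀ r, r < 20 → s'.I r = s.I r) ∧ (∀ r, r < 20 → r ≠ 4 → s'.X r = s.X r) ∧ s'.M = s.M ∧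
      (∀ v, v < s.I 14 → vecs d s'.A v = V v) ∧
      (upd → s'.X 4 = avg ∧
        ∀ q, q < s.I 15 → vecs d s'.A (s.I 13 + q) = V (s.I 11 + q)) ∧
      (¬ upd → s'.X 4 = s.X 4 ∧
        ∀ q, q < s.I 15 → vecs d s'.A (s.I 13 + q) = V (s.I 13 + q)) := by
      intro hu
      have i11 := G5.I 11 (by norm_num)
      have i13 := G5.I 13 (by norm_num)
      have i15 := G5.I 15 (by norm_num)
      refine (updBest_tot t5 hd ((G5.I 1 (by norm_num)).trans h1)
        ((G5.I 8 (by norm_num)).trans h8) ((G5.I 9 (by norm_num)).trans h9)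
        (by omega)).mono (by rw [i15]) ?_
      rintro s' ⟨e1, e2, e3, e4, e5, e6⟩
      refine ⟨fun r hr => by rw [e1 r hr, G5.I r hr], fun r hr hr' => by rw [e2 r hr hr', G5.X r hr],
        by rw [e3, G5.M], ?_, fun _ => ⟨by rw [e4, a5], ?_⟩, fun h => absurd hu h⟩
      · intro v hv
        rw [e5 v (by omega), V5, update_of_ne (by omega)]
      · intro q hq
        have := e6 q (by omega)
        rw [i11, i13, V5, update_of_ne (by omega)] at this
        exact this
    have hno : ∀ n, ¬ upd → Tot .skip t5 n fun s' =>
      (∀ r, r < 20 → s'.I r = s.I r) ∧ (∀ r, r < 20 → r ≠ 4 → s'.X r = s.X r) ∧ s'.M = s.M ∧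
      (∀ v, v < s.I 14 → vecs d s'.A v = V v) ∧
      (upd → s'.X 4 = avg ∧
        ∀ q, q < s.I 15 → vecs d s'.A (s.I 13 + q) = V (s.I 11 + q)) ∧
      (¬ upd → s'.X 4 = s.X 4 ∧
        ∀ q, q < s.I 15 → vecs d s'.A (s.I 13 + q) = V (s.I 13 + q)) := by
      intro n hu
      refine ⟨t5, (Det.skip t5).mono (by omega), fun r hr => G5.I r hr, fun r hr _ => G5.X r hr, G5.M,
        ?_, fun h => absurd h hu, fun _ => ⟨x4, ?_⟩⟩
      · intro v hv
        rw [V5, update_of_ne (by omega)]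
      · intro q hq
        rw [V5, update_of_ne (by omega)]
    have i2 : t5.I 2 = s.I 2 := G5.I 2 (by norm_num)
    refine Tot.ite ?_ ?_
    · intro c1
      simp only [Cond.Holds, x5, b5] at c1
      refine Tot.ite ?_ ?_
      · intro c2
        simp only [Cond.Holds, d5, i2] at c2
        refine Tot.ite ?_ ?_
        · intro c3
          simp only [Cond.Holds, c5, x4] at c3
          refine Tot.ite ?_ ?_
          · intro c4
            simp only [Cond.Holds, a5, x4] at c4
            exact hyes (hupd.2 ⟨c1, c2, fun _ => c4⟩)
          · intro c4
            simp only [Cond.Holds, a5, x4] at c4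
            exact hno _ fun h => c4 ((hupd.1 h).2.2 c3)
        · intro c3
          simp only [Cond.Holds, c5, x4] at c3
          exact (hyes (hupd.2 ⟨c1, c2, fun h => absurd h c3⟩)).mono (by omega) fun _ => id
      · intro c2
        simp only [Cond.Holds, d5, i2] at c2
        exact hno _ fun h => c2 (hupd.1 h).2.1
    · intro c1
      simp only [Cond.Holds, x5, b5] at c1
      exact hno _ fun h => c1 (hupd.1 h).1
  refine key.mono ?_ fun _ => id
  have : s.I 0 * ((1 + (Te + (2 + 2))) + 4) ≤ s.I 0 * (Te + 16) := Nat.mul_le_mul_left _ (by omega)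
  have h2 : (s.I 0 + 1) * (s.I 2 * (s.I 10 * (205 * d) + 100 * d + 5 * τ + 40) + 20) =
    s.I 0 * (Te + 16) + (Te + 16) := by rw [hTe]; ring
  rw [h2]
  omega

end RealRAM

/-! ### One trial: random numbers and the deterministic part. -/

namespace RealRAM

open Function
open scoped ENNReal

/-- The constants of an instance. -/
structure Glob (n d k j m U : ℕ) (D H g : ℝ) (s : St) : Prop where
  i0 : s.I 0 = n
  i1 : s.I 1 = d
  i2 : s.I 2 = k
  i3 : s.I 3 = j
  i4 : s.I 4 = m
  i5 : s.I 5 = U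
  i7 : s.I 7 = n - 1
  i8 : s.I 8 = 0
  i9 : s.I 9 = 1
  i10 : s.I 10 = j + 1
  i11 : s.I 11 = n + j + 1
  i12 : s.I 12 = n + j + 1 + k * (j + 1)
  i13 : s.I 13 = n + j + 1 + k * (j + 1) + k * (j + 1)
  i14 : s.I 14 = n + j
  i15 : s.I 15 = k * (j + 1)
  i17 : s.I 17 = 1 + k * m
  i18 : s.I 18 = k * (j + 1) * (m + j)
  x2 : s.X 2 = D
  x3 : s.X 3 = H
  x5 : s.X 5 = g

/-- The excepted registers are those that vary: the trial counter `I[6]` and the best value `X[4]`.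
-/
theorem Glob.congr {n d k j m U : ℕ} {D H g : ℝ} {s s' : St} (h : Glob n d k j m U D H g s)
    (hI : ∀ r, r < 20 → r ≠ 6 → s'.I r = s.I r) (hX : ∀ r, r < 20 → r ≠ 4 → s'.X r = s.X r) :
    Glob n d k j m U D H g s' := by
  constructor
  all_goals first
    | rw [hI _ (by norm_num) (by norm_num)]
    | rw [hX _ (by norm_num) (by norm_num)]
  exacts [h.i0, h.i1, h.i2, h.i3, h.i4, h.i5, h.i7, h.i8, h.i9, h.i10, h.i11, h.i12, h.i13, h.i14,
    h.i15, h.i17, h.i18, h.x2, h.x3, h.x5]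

/-- The points of the candidate flats of a trial with random numbers `M`. -/
noncomputable def cand {d : ℕ} (n k j m : ℕ) (D H : ℝ) (V : ℕ → EuclideanSpace ℝ (Fin d))
    (M : ℕ → ℕ) (l t : ℕ) : EuclideanSpace ℝ (Fin d) :=
  rowVal D H m j n M V (1 + l * m) (1 + k * m + (l * (j + 1) + t) * (m + j))

/-- The Gram-Schmidt vectors of a candidate flat. -/
noncomputable def gsVec {E : Type*} [NormedAddCommGroup E] [InnerProductSpace ℝ E]
    (z : ℕ → ℕ → E) (l t : ℕ) : E :=
  InnerProductSpace.gramSchmidt ℝ (fun t => z l t - z l 0) t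

/-- The computed `τ`-th power of the distance of `x` to the nearest of `k` candidate flats. -/
noncomputable def distPow {E : Type*} [NormedAddCommGroup E] [InnerProductSpace ℝ E]
    (τ k J : ℕ) (z : ℕ → ℕ → E) (x : E) : ℝ :=
  ⨅ l : Fin k, ‖projSeq (gsVec z l) J (x - z l 0)‖ ^ τ

open scoped Classical in
/-- The number of zero Gram-Schmidt vectors. -/
noncomputable def zeroCount {E : Type*} [NormedAddCommGroup E] [InnerProductSpace ℝ E]
    (k J : ℕ) (z : ℕ → ℕ → E) : ℕ :=
  ∑ l ∈ Finset.range k, ∑ t ∈ Finset.range J, if gsVec z l t = 0 then 1 else 0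

open scoped Classical in
/-- The points that are at most as far from the candidate flats as the point number `i`. -/
noncomputable def near {E : Type*} [NormedAddCommGroup E] [InnerProductSpace ℝ E]
    (τ n k J : ℕ) (z : ℕ → ℕ → E) (V : ℕ → E) (i : ℕ) : Finset ℕ :=
  (Finset.range n).filter fun i' => distPow τ k J z (V i') ≤ distPow τ k J z (V i)

/-- The average over `near`. -/
noncomputable def nearAvg {E : Type*} [NormedAddCommGroup E] [InnerProductSpace ℝ E]
    (τ n k J : ℕ) (z : ℕ → ℕ → E) (V : ℕ → E) (i : ℕ) : ℝ :=
  (∑ i' ∈ near τ n k J z V i, distPow τ k J z (V i')) / (near τ n k J z V i).card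

/-- The part of a trial after the random choices. -/
def trialDet (τ : ℕ) : Cmd := build ;; gsPhase ;; select τ

/-- A bound for the running time of `trialDet`. -/
def trialTime (τ n d k j m : ℕ) : ℕ :=
  (k * ((j + 1) * ((m + j) * (70 * d) + 75 * d) + 10) + 5) +
  ((k * ((j + 1) * ((j + 1) * (205 * d) + 130 * d) + 10) + 7) +
  ((n + 1) * (k * ((j + 1) * (205 * d) + 100 * d + 5 * τ + 40) + 20) +
      k * (j + 1) * (60 * d) + 20))

theorem trialDet_tot (τ : ℕ) (s : St) {n d k j m U : ℕ} {D H g : ℝ} (hd : 1 ≤ d) (hk : 1 ≤ k)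
    (hs : Glob n d k j m U D H g s) (hM : ∀ i, i < 1 + k * m → s.M i < n)
    (z : ℕ → ℕ → EuclideanSpace ℝ (Fin d)) (hz : z = cand n k j m D H (vecs d s.A) s.M)
    (upd : Prop) (hupd : upd ↔ g ≤ (near τ n k (j + 1) z (vecs d s.A) (s.M 0)).card ∧
      zeroCount k (j + 1) z ≤ k ∧
      (0 ≤ s.X 4 → nearAvg τ n k (j + 1) z (vecs d s.A) (s.M 0) ≤ s.X 4)) :
    Tot (trialDet τ) s (trialTime τ n d k j m) fun s' =>
      (∀ r, r < 20 → s'.I r = s.I r) ∧ (∀ r, r < 20 → r ≠ 4 → s'.X r = s.X r) ∧ s'.M = s.M ∧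
      (∀ v, v < n + j → vecs d s'.A v = vecs d s.A v) ∧
      (upd → s'.X 4 = nearAvg τ n k (j + 1) z (vecs d s.A) (s.M 0) ∧
        ∀ l t, l < k → t < j + 1 → vecs d s'.A (s.I 13 + (l * (j + 1) + t)) = z l t) ∧
      (¬ upd → s'.X 4 = s.X 4 ∧
        ∀ q, q < k * (j + 1) → vecs d s'.A (s.I 13 + q) = vecs d s.A (s.I 13 + q)) := by
  classical
  set V := vecs d s.A with hV
  have hlM : ∀ l i, l < k → i < m → s.M (1 + l * m + i) < n := fun l i hl hi =>
    hM _ (by have := mul_add_lt hl hi; omega)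
  refine Tot.seq ((build_tot s hd hs.i1 hs.i8 hs.i9 ?_ ?_).mono
    (by rw [hs.i2, hs.i3, hs.i4, hs.i10]) fun _ => id) ?_
  · intro l i hl hi
    rw [hs.i2] at hl
    rw [hs.i4] at hi ⊢
    have := hlM l i hl hi
    rw [hs.i11]; omega
  · rw [hs.i0, hs.i3, hs.i11]; omega
  rintro s1 ⟨F1, V1, W1⟩
  rw [hs.i2, hs.i10, hs.i11] at V1
  have W1' : ∀ l t, l < k → t < j + 1 → vecs d s1.A (n + j + 1 + (l * (j + 1) + t)) = z l t := by
    intro l t hl ht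
    have := W1 l t (by rw [hs.i2]; exact hl) (by rw [hs.i10]; exact ht)
    rw [hs.i11, hs.i10] at this
    rw [this, hz, cand, hs.x2, hs.x3, hs.i4, hs.i3, hs.i0, hs.i17]
  have g1 : Glob n d k j m U D H g s1 :=
    hs.congr (fun r hr _ => F1.I r hr) fun r hr _ => F1.X r hr
  let z1 : ℕ → ℕ → EuclideanSpace ℝ (Fin d) := fun l t =>
    vecs d s1.A (n + j + 1 + (l * (j + 1) + t))
  have hz1 : ∀ l t, l < k → t < j + 1 → z1 l t = z l t := W1'
  -- Outside the range of candidates `z1` reads unrelated memory. The Gram-Schmidt vector number t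
  -- depends only on the members up to t, so it does not matter.
  have hgs : ∀ l t, l < k → t < j + 1 → gsVec z1 l t = gsVec z l t := by
    intro l t hl
    have key : ∀ t, t < j + 1 → InnerProductSpace.gramSchmidt ℝ (fun t => z1 l t - z1 l 0) t =
        InnerProductSpace.gramSchmidt ℝ (fun t => z l t - z l 0) t := by
      intro t
      induction t using Nat.strong_induction_on with
      | _ t ih =>
        intro ht
        rw [InnerProductSpace.gramSchmidt_def, InnerProductSpace.gramSchmidt_def]
        congr 1
        · rw [hz1 l t hl ht, hz1 l 0 hl (by omega)]
        · refine Finset.sum_congr rfl fun i hi => ?_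
          rw [Finset.mem_Iio] at hi
          rw [ih i hi (by omega), hz1 l t hl ht, hz1 l 0 hl (by omega)]
    exact key t
  refine Tot.seq ((gsPhase_tot s1 hd g1.i1 g1.i8 g1.i9 (by rw [g1.i11, g1.i2, g1.i10, g1.i12])
    (gsVec z1) ?_).mono (by rw [g1.i2, g1.i10]) fun _ => id) ?_
  · intro l t
    rw [gsVec, g1.i11, g1.i10]
    rfl
  rintro s2 ⟨F2, V2, W2, c2⟩
  rw [g1.i2, g1.i10, g1.i12] at V2
  rw [g1.i2, g1.i10] at c2
  have W2' : ∀ l t, l < k → t < j + 1 →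
      vecs d s2.A (n + j + 1 + k * (j + 1) + (l * (j + 1) + t)) = gsVec z l t := by
    intro l t hl ht
    have := W2 l t (by rw [g1.i2]; exact hl) (by rw [g1.i10]; exact ht)
    rw [g1.i12, g1.i10] at this
    rw [this, hgs l t hl ht]
  have c2' : s2.I 22 = zeroCount k (j + 1) z := by
    rw [c2, zeroCount]
    refine Finset.sum_congr rfl fun l hl => Finset.sum_congr rfl fun t ht => ?_
    rw [Finset.mem_range] at hl ht
    rw [hgs l t hl ht]
    by_cases h : gsVec z l t = 0 <;> simp [h]
  have W3 : ∀ l t, l < k → t < j + 1 → vecs d s2.A (n + j + 1 + (l * (j + 1) + t)) = z l t := by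
    intro l t hl ht
    rw [V2 _ (Or.inl (by have := mul_add_lt hl ht; omega)), W1' l t hl ht]
  have F12 : Fr 20 s s2 := F1.trans F2 le_rfl
  have g2 : Glob n d k j m U D H g s2 :=
    hs.congr (fun r hr _ => F12.I r hr) fun r hr _ => F12.X r hr
  have M2 : s2.M = s.M := F12.M
  have V20 : ∀ v, v < n + j + 1 → vecs d s2.A v = V v := fun v hv => by
    rw [V2 v (Or.inl (by omega)), V1 v (Or.inl hv)]
  have hnp : ∀ i, i < n → nearPow τ k (j + 1) (vecs d s2.A) (n + j + 1) (n + j + 1 + k * (j + 1))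
      (vecs d s2.A i) = distPow τ k (j + 1) z (V i) := by
    intro i hi
    rw [nearPow, distPow]
    congr 1
    funext l
    have h0 := W3 l 0 l.2 (by omega)
    rw [add_zero] at h0
    rw [flatPow, h0, V20 i (by omega)]
    congr 2
    refine projSeq_congr (fun t ht => ?_) _
    rw [← W2' l t l.2 ht, add_assoc]
  have h0 : s.M 0 < n := hM 0 (by omega)
  set F : ℕ → ℝ := fun i => nearPow τ k (j + 1) (vecs d s2.A) (n + j + 1)
    (n + j + 1 + k * (j + 1)) (vecs d s2.A i) with hF
  have hnear : (Finset.range n).filter (fun i => F i ≤ F (s.M 0)) =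
      near τ n k (j + 1) z V (s.M 0) := by
    rw [near]
    refine Finset.filter_congr fun i hi => ?_
    rw [Finset.mem_range] at hi
    rw [hF]
    simp only
    rw [hnp i hi, hnp _ h0]
  have havg : nearAvg τ n k (j + 1) z V (s.M 0) =
      (∑ i ∈ Finset.range n with F i ≤ F (s.M 0), F i) /
        ((Finset.range n).filter fun i => F i ≤ F (s.M 0)).card := by
    rw [nearAvg, hnear]
    congr 1
    refine Finset.sum_congr rfl fun i hi => ?_
    rw [hF]
    simp only
    rw [hnp]
    simp only [near, Finset.mem_filter, Finset.mem_range] at hi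
    exact hi.1
  refine (select_tot τ s2 hd g2.i1 g2.i8 g2.i9 (by rw [g2.i0, g2.i14]; omega)
    (by rw [M2, g2.i0]; exact h0) (by rw [g2.i14, g2.i11]; omega) (by rw [g2.i14, g2.i12]; omega)
    (by rw [g2.i2]; omega) (by rw [g2.i11, g2.i13, g2.i15]; omega)
    (by rw [g2.i14, g2.i13]; omega) F (fun i => by rw [g2.i2, g2.i10, g2.i11, g2.i12])
    (nearAvg τ n k (j + 1) z V (s.M 0)) (by rw [g2.i0, M2]; exact havg) upd ?_).mono
    (by rw [g2.i0, g2.i2, g2.i10, g2.i15]) ?_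
  · rw [g2.i0, M2, hnear, g2.x5, c2', g2.i2, F12.X 4 (by norm_num)]
    exact hupd
  rintro s' ⟨e1, e2, e3, e4, e5, e6⟩
  rw [g2.i14] at e4
  rw [g2.i15, g2.i13, g2.i11] at e5
  rw [g2.i15, g2.i13] at e6
  refine ⟨fun r hr => by rw [e1 r hr, F12.I r hr], fun r hr hr' => by rw [e2 r hr hr', F12.X r hr],
    by rw [e3, M2], fun v hv => by rw [e4 v hv, V20 v (by omega)], ?_, ?_⟩
  · intro hu
    refine ⟨(e5 hu).1, fun l t hl ht => ?_⟩
    rw [hs.i13, (e5 hu).2 _ (mul_add_lt hl ht), W3 l t hl ht]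
  · intro hu
    refine ⟨by rw [(e6 hu).1, F12.X 4 (by norm_num)], fun q hq => ?_⟩
    rw [hs.i13, (e6 hu).2 q hq, V2 _ (Or.inr (by omega)), V1 _ (Or.inr (by omega))]

/-- The mean of `f` over the memories that arise from `M` by writing `R` independent uniformly
random elements of `{0, …, b}` from position `q` on. -/
noncomputable def avgM (b : ℕ) : ℕ → ℕ → ((ℕ → ℕ) → ℝ≥0∞) → (ℕ → ℕ) → ℝ≥0∞
  | 0, _, f, M => f M
  | R + 1, q, f, M => ((b : ℝ≥0∞) + 1)⁻¹ * ∑ v : Fin (b + 1), avgM b R (q + 1) f (update M q v)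

/-- Write `I[c]` random numbers, of size at most `I[b]`, into the memory from `M[I[21]]` on. -/
def draw (c b : ℕ) : Cmd :=
  forTo 20 c (.ins (.irand 22 b) ;; blk [.istore 21 22, .iadd 21 21 9])

theorem Spec.of_det_seq {x y : Cmd} {s s₁ : St} {n₁ n₂ : ℕ} {Q : St → Prop} {q : St → ℝ≥0∞}
    {p : ℝ≥0∞} (hx : Det x s n₁ s₁) (hy : Spec y s₁ n₂ Q q p) :
    Spec (x ;; y) s (n₁ + n₂) Q q p := by
  refine Spec.seq (hx (fun s' => s' = s₁) (fun _ => p) rfl) ?_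
  rintro _ rfl
  exact hy

/-- Peeling off the first drawn cell reproduces the recursion of `avgM`, so the mean over the
remaining cells is the intermediate value of the loop. -/
theorem draw_spec {c b : ℕ} (hc : c < 20) (hb : b < 20) (f : (ℕ → ℕ) → ℝ≥0∞) (s : St) (R q : ℕ)
    (hR : s.I c = R) (hq : s.I 21 = q) (h9 : s.I 9 = 1) :
    Spec (draw c b) s (R * 9 + 2) (fun s' => (∀ r, r < 20 → s'.I r = s.I r) ∧ s'.X = s.X ∧
      s'.A = s.A ∧ s'.I 21 = q + R ∧ ∀ i, (i < q ∨ q + R ≤ i → s'.M i = s.M i) ∧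
      (q ≤ i → i < q + R → s'.M i ≤ s.I b)) (fun s' => f s'.M) (avgM (s.I b) R q f s.M) := by
  set B := s.I b with hB
  let Inv : ℕ → ℕ → St → Prop := fun v u s' => v + u = R ∧ (∀ r, r < 20 → s'.I r = s.I r) ∧
    s'.X = s.X ∧ s'.A = s.A ∧ s'.I 21 = q + v ∧ s'.I 20 = v ∧
    ∀ i, (i < q ∨ q + v ≤ i → s'.M i = s.M i) ∧ (q ≤ i → i < q + v → s'.M i ≤ B)
  have key : ∀ u v s', Inv v u s' → Spec (.loop (.idx c 20) ((.ins (.irand 22 b) ;;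
      blk [.istore 21 22, .iadd 21 21 9]) ;; blk [.iconst 69 1, .iadd 20 20 69])) s' (u * 9 + 1)
      (Inv R 0) (fun s' => f s'.M) (avgM B u (q + v) f s'.M) := by
    intro u
    induction u with
    | zero =>
      intro v s' h
      have h' := h
      obtain ⟨e1, e2, e3, e4, e5, e6, e7⟩ := h
      refine ((Det.loop_exit ?_) (Inv R 0) (fun s' => f s'.M) ?_).mono le_rfl (fun _ => id)
        (fun _ _ => le_rfl) le_rfl
      · simp only [Cond.Holds, e2 c hc, hR, e6]; omega
      · obtain rfl : v = R := by omega
        exact h'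
    | succ u ih =>
      intro v s' ⟨e1, e2, e3, e4, e5, e6, e7⟩
      have hIb : s'.I b = B := e2 b hb
      let nxt : ℕ → St := fun w => { s' with
        I := update (update (update (update s'.I 22 w) 21 (q + v + 1)) 69 1) 20 (v + 1)
        M := update s'.M (q + v) w }
      have hbody : Spec ((.ins (.irand 22 b) ;; blk [.istore 21 22, .iadd 21 21 9]) ;;
          blk [.iconst 69 1, .iadd 20 20 69]) s' ((1 + 2) + 2) (Inv (v + 1) u)
          (fun s' => avgM B u (q + (v + 1)) f s'.M) (avgM B (u + 1) (q + v) f s'.M) := by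
        have hr := Spec.rand (a := 22) (b := b) (s := s')
          (Q := fun t => ∃ w, w ≤ B ∧ t = { s' with I := update s'.I 22 w })
          (q := fun t => avgM B u (q + (v + 1)) f (update s'.M (q + v) (t.I 22)))
          (fun w hw => ⟨w, by omega, rfl⟩)
        refine Spec.seq (n₁ := 1 + 2) (n₂ := 2) (Q₁ := fun t => ∃ w, w ≤ B ∧ t = { s' with
          I := update (update s'.I 22 w) 21 (q + v + 1), M := update s'.M (q + v) w })
          (q₁ := fun t => avgM B u (q + (v + 1)) f t.M) (Spec.mono (Spec.seq (n₂ := 2)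
            (q := fun t => avgM B u (q + (v + 1)) f t.M) hr ?_)
          le_rfl (fun _ => id) (fun _ _ => le_rfl) ?_) ?_
        · rintro _ ⟨w, hw, rfl⟩
          refine Tot.spec (Tot.blk rfl le_rfl (Q := fun t => t = { s' with
            I := update (update s'.I 22 w) 21 (q + v + 1), M := update s'.M (q + v) w }) ?_) ?_ |>.mono
            le_rfl ?_ (fun _ _ => le_rfl) le_rfl
          · simp [Instr.act, e5, e2 9, h9]
          · rintro _ rfl
            simp
          · rintro _ rfl
            exact ⟨w, hw, rfl⟩
        · rw [avgM, hIb]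
          simp [add_assoc]
        · rintro _ ⟨w, hw, rfl⟩
          refine Tot.spec (Tot.blk rfl le_rfl (Q := fun t => t = nxt w) ?_) ?_ |>.mono
            le_rfl ?_ (fun _ _ => le_rfl) le_rfl
          · simp [Instr.act, e6, nxt]
          · rintro _ rfl
            simp [nxt]
          · rintro _ rfl
            refine ⟨by omega, ?_, e3, e4, ?_, ?_, ?_⟩
            · intro r hr
              have : r ≠ 20 ∧ r ≠ 69 ∧ r ≠ 21 ∧ r ≠ 22 := by omega
              simp [nxt, this, e2 r hr]
            · simp [nxt, add_assoc]
            · simp [nxt]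
            · intro i
              by_cases hi : i = q + v
              · subst hi
                simp only [nxt, update_self]
                exact ⟨fun h => by omega, fun _ _ => hw⟩
              · simp only [nxt, update_of_ne hi]
                exact ⟨fun h => (e7 i).1 (by omega), fun h h' => (e7 i).2 h (by omega)⟩
      exact (Spec.loop_succ (by simp only [Cond.Holds, e2 c hc, hR, e6]; omega) hbody
        fun t ht => ih (v + 1) t ht).mono (by omega) (fun _ => id) (fun _ _ => le_rfl) le_rfl
  have h0 : Inv 0 R ((Instr.iconst 20 0).act s) := by
    refine ⟨by omega, ?_, rfl, rfl, ?_, ?_, ?_⟩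
    · intro r hr
      have : r ≠ 20 := by omega
      simp [Instr.act, this]
    · simp [Instr.act, hq]
    · simp [Instr.act]
    · exact fun i => ⟨fun _ => rfl, fun _ _ => by omega⟩
  refine (Spec.of_det_seq (Det.ins rfl s) (key R 0 _ h0)).mono (by omega) ?_ (fun _ _ => le_rfl)
    le_rfl
  rintro s' ⟨-, e2, e3, e4, e5, -, e7⟩
  exact ⟨e2, e3, e4, e5, e7⟩

/-- One trial. -/
def trial (τ : ℕ) : Cmd :=
  blk [.iconst 21 0] ;; draw 17 7 ;; draw 18 5 ;; trialDet τ

/-- The distribution of the random numbers of a trial. -/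
noncomputable def drawAvg (n k j m U : ℕ) (f : (ℕ → ℕ) → ℝ≥0∞) (M : ℕ → ℕ) : ℝ≥0∞ :=
  avgM (n - 1) (1 + k * m) 0 (avgM U (k * (j + 1) * (m + j)) (1 + k * m) f) M

/-- After the draws a trial is deterministic. It is enough to bound the final value from below by a
function `f` of the drawn memory alone; its mean is then a lower bound for the expectation. -/
theorem trial_spec (τ : ℕ) (s : St) {n d k j m U : ℕ} {D H g : ℝ} (hn : 1 ≤ n) (hd : 1 ≤ d)
    (hk : 1 ≤ k) (hs : Glob n d k j m U D H g s) (Q : St → Prop) (q : St → ℝ≥0∞)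
    (f : (ℕ → ℕ) → ℝ≥0∞)
    (hQ : ∀ s' M z, (∀ i, i < 1 + k * m → M i < n) →
      z = cand n k j m D H (vecs d s.A) M →
      (∀ r, r < 20 → s'.I r = s.I r) → (∀ r, r < 20 → r ≠ 4 → s'.X r = s.X r) →
      (∀ v, v < n + j → vecs d s'.A v = vecs d s.A v) →
      ∀ upd : Prop, (upd ↔ g ≤ (near τ n k (j + 1) z (vecs d s.A) (M 0)).card ∧
        zeroCount k (j + 1) z ≤ k ∧
        (0 ≤ s.X 4 → nearAvg τ n k (j + 1) z (vecs d s.A) (M 0) ≤ s.X 4)) →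
      (upd → s'.X 4 = nearAvg τ n k (j + 1) z (vecs d s.A) (M 0) ∧
        ∀ l t, l < k → t < j + 1 → vecs d s'.A (s.I 13 + (l * (j + 1) + t)) = z l t) →
      (¬ upd → s'.X 4 = s.X 4 ∧
        ∀ q, q < k * (j + 1) → vecs d s'.A (s.I 13 + q) = vecs d s.A (s.I 13 + q)) →
      Q s' ∧ f M ≤ q s') :
    Spec (trial τ) s (1 + ((1 + k * m) * 9 + 2 + (k * (j + 1) * (m + j) * 9 + 2 +
      trialTime τ n d k j m))) Q q (drawAvg n k j m U f s.M) := by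
  have hb : Det (blk [.iconst 21 0]) s 1 ((Instr.iconst 21 0).act s) := Det.blk rfl s
  refine Spec.of_det_seq hb ?_
  set s1 := (Instr.iconst 21 0).act s with hs1
  have I1 : ∀ r, r < 20 → s1.I r = s.I r := fun r hr => by
    have : r ≠ 21 := by omega
    simp [hs1, Instr.act, this]
  refine Spec.seq ((draw_spec (c := 17) (b := 7) (by norm_num) (by norm_num)
    (avgM U (k * (j + 1) * (m + j)) (1 + k * m) f) s1 (1 + k * m) 0 (by rw [I1 17 (by norm_num), hs.i17])
    (by simp [hs1, Instr.act]) (by rw [I1 9 (by norm_num), hs.i9])).mono le_rfl (fun _ => id)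
    (fun _ _ => le_rfl) (by rw [I1 7 (by norm_num), hs.i7]; rfl)) ?_
  rintro s2 ⟨I2, X2, A2, p2, M2⟩
  rw [zero_add] at p2
  refine Spec.seq ((draw_spec (c := 18) (b := 5) (by norm_num) (by norm_num) f s2
    (k * (j + 1) * (m + j)) (1 + k * m)
    (by rw [I2 18 (by norm_num), I1 18 (by norm_num), hs.i18]) p2
    (by rw [I2 9 (by norm_num), I1 9 (by norm_num), hs.i9])).mono le_rfl (fun _ => id)
    (fun _ _ => le_rfl) (by rw [I2 5 (by norm_num), I1 5 (by norm_num), hs.i5])) ?_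
  rintro s3 ⟨I3, X3, A3, p3, M3⟩
  have I4 : ∀ r, r < 20 → s3.I r = s.I r := fun r hr => by rw [I3 r hr, I2 r hr, I1 r hr]
  have X4 : s3.X = s.X := by rw [X3, X2]; rfl
  have A4 : s3.A = s.A := by rw [A3, A2]; rfl
  have g3 : Glob n d k j m U D H g s3 := hs.congr (fun r hr _ => I4 r hr) fun r _ _ => by rw [X4]
  have hM : ∀ i, i < 1 + k * m → s3.M i < n := by
    intro i hi
    rw [(M3 i).1 (Or.inl hi)]
    have := (M2 i).2 (Nat.zero_le i) (by omega)
    rw [I1 7 (by norm_num), hs.i7] at this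
    omega
  have T := trialDet_tot τ s3 hd hk g3 hM _ rfl _ Iff.rfl
  rw [A4, X4, I4 13 (by norm_num)] at T
  obtain ⟨s', h1, e1, e2, -, e4, e5, e6⟩ := T
  have hq := hQ s' s3.M _ hM rfl (fun r hr => by rw [e1 r hr, I4 r hr]) e2 e4 _ Iff.rfl e5 e6
  exact (h1 Q q hq.1).mono le_rfl (fun _ => id) (fun _ _ => le_rfl) hq.2

end RealRAM

/-! ### Preparation of the constants and of the memory layout. -/

namespace RealRAM

open Function
open scoped ENNReal

/-- `I[a] := 2 ^ I[c]`. -/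
def pow2 (a c : ℕ) : Cmd := .ins (.iconst a 1) ;; forTo 26 c (blk [.iadd a a a])

theorem pow2_tot {a c : ℕ} (s : St) {N : ℕ} (hN : s.I c = N) (hac : a ≠ c)
    (ha : a ≠ 26) (ha' : a ≠ 69) (hc : c ≠ 26) (hc' : c ≠ 69) :
    Tot (pow2 a c) s (N * 5 + 3) fun s' => s'.I a = 2 ^ N ∧
      (∀ r, r ≠ a → r ≠ 26 → r ≠ 69 → s'.I r = s.I r) ∧ s'.X = s.X ∧ s'.M = s.M ∧ s'.A = s.A := by
  have := Tot.seq (x := .ins (.iconst a 1)) (s := s) (n₁ := 1)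
    (Q₁ := fun s' => s' = { s with I := update s.I a 1 }) ⟨_, Det.ins rfl s, rfl⟩
    (fun s' hs' => Tot.forTo (i := 26) (c := c) (x := blk [.iadd a a a]) (n := 1) (N := N) (s := s')
      (fun v s' => s'.I 26 = v ∧ s'.I a = 2 ^ v ∧
      (∀ r, r ≠ a → r ≠ 26 → r ≠ 69 → s'.I r = s.I r) ∧ s'.X = s.X ∧ s'.M = s.M ∧ s'.A = s.A)
      (by norm_num) ?_ ?_ ?_)
  · refine this.mono (by omega) ?_
    rintro s' ⟨-, h⟩
    exact h
  · subst hs'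
    refine ⟨by simp, by simp [ha], ?_, rfl, rfl, rfl⟩
    intro r h1 h2 h3
    simp [h1, h2]
  · rintro v s' - ⟨h1, h2, h3, -⟩
    exact ⟨h1, by rw [h3 c hac.symm hc hc', hN]⟩
  · rintro v s' hv ⟨h1, h2, h3, h4, h5, h6⟩
    refine Tot.blk rfl le_rfl ?_
    simp only [List.foldl, Instr.act, St.tick]
    refine ⟨by simp [ha.symm, h1], ?_, ?_, h4, h5, h6⟩
    · simp only [update_of_ne ha, update_of_ne ha', update_self, h2]
      ring
    · intro r hr1 hr2 hr3
      simp [hr1, hr2, hr3, h3 r hr1 hr2 hr3]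

/-- Count up `I[4]` until it is at least `X[20]`. -/
def ceilLoop : Cmd := .loop (.real 20 21) (blk [.iadd 4 4 9, .rcast 21 4])

/-- Without a rounding instruction the ceiling is found by counting up. This is affordable, as m is
far smaller than the number of trials. -/
theorem ceilLoop_tot (s : St) (h4 : s.I 4 = 0) (h21 : s.X 21 = 0) (h9 : s.I 9 = 1) :
    Tot ceilLoop s (⌈s.X 20⌉₊ * 4 + 1) fun s' => s'.I 4 = ⌈s.X 20⌉₊ ∧
      (∀ r, r ≠ 4 → s'.I r = s.I r) ∧ (∀ r, r ≠ 21 → s'.X r = s.X r) ∧ s'.M = s.M ∧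
      s'.A = s.A := by
  have key : ∀ (u v : ℕ) (s' : St), v + u = ⌈s.X 20⌉₊ → s'.I 4 = v → s'.X 21 = (v : ℝ) →
      (∀ r, r ≠ 4 → s'.I r = s.I r) → (∀ r, r ≠ 21 → s'.X r = s.X r) → s'.M = s.M → s'.A = s.A →
      Tot ceilLoop s' (u * 4 + 1) fun s' => s'.I 4 = ⌈s.X 20⌉₊ ∧
      (∀ r, r ≠ 4 → s'.I r = s.I r) ∧ (∀ r, r ≠ 21 → s'.X r = s.X r) ∧ s'.M = s.M ∧
      s'.A = s.A := by
    intro u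
    induction u with
    | zero =>
      intro v s' hv h1 h2 h3 h4 h5 h6
      refine ⟨s', (Det.loop_exit ?_).mono (by omega), by omega, h3, h4, h5, h6⟩
      simp only [Cond.Holds, h2, h4 20 (by norm_num)]
      exact Nat.ceil_le.1 (by omega)
    | succ u ih =>
      intro v s' hv h1 h2 h3 h4 h5 h6
      obtain ⟨t, d1, d2⟩ := ih (v + 1) { s' with I := update s'.I 4 (v + 1), X := update s'.X 21 ((v + 1 : ℕ) : ℝ) }
        (by omega) (by simp) (by simp)
        (fun r hr => by simp [hr, h3 r hr]) (fun r hr => by simp [hr, h4 r hr]) h5 h6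
      have hb := Det.blk (L := [.iadd 4 4 9, .rcast 21 4]) rfl s'
      have e : List.foldl (fun s i => Instr.act i s) s' [.iadd 4 4 9, .rcast 21 4] =
          { s' with I := update s'.I 4 (v + 1), X := update s'.X 21 ((v + 1 : ℕ) : ℝ) } := by
        simp [Instr.act, h1, h3 9, h9]
      rw [e] at hb
      refine ⟨t, (Det.loop_succ ?_ hb d1).mono (by simp only [List.length_cons, List.length_nil]; omega), d2⟩
      simp only [Cond.Holds, h2, h4 20 (by norm_num), not_le]
      exact Nat.lt_ceil.1 (by omega)
  exact key _ 0 s (by omega) h4 (by simpa using h21) (fun _ _ => rfl) (fun _ _ => rfl) rfl rfl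

/-- Preparation: sample sizes, number of trials, addresses, and unit vectors. -/
def setup (τ : ℕ) : Cmd :=
  blk [.iconst 8 0, .iconst 9 1, .rconst 20 (128 * τ : ℕ), .rcast 21 2, .rmul 20 20 21, .rcast 21 3,
    .rmul 20 20 21, .rdiv 20 20 0, .rdiv 20 20 1, .rmul 20 20 20, .rmul 20 20 20, .rmul 20 20 20,
    .iconst 4 0, .rcast 21 4] ;;
  ceilLoop ;;
  blk [.iadd 24 4 4] ;; pow2 25 24 ;;
  blk [.rcast 3 25, .rsqrt 2 3, .iadd 5 25 25, .isub 7 0 9, .iadd 10 3 9, .iadd 14 0 3,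
    .iadd 11 14 9, .rconst 21 1, .rsub 21 21 1, .rcast 22 0, .rmul 5 21 22, .rconst 4 (-1)] ;;
  mulI 15 10 2 ;; blk [.iadd 12 11 15, .iadd 13 12 15] ;;
  mulI 30 2 4 ;; blk [.iadd 17 9 30, .iadd 31 4 3] ;; mulI 18 15 31 ;;
  mulI 27 4 4 ;; mulI 28 27 27 ;; mulI 29 28 4 ;; pow2 16 29 ;;
  mulI 20 0 1 ;; blk [.iadd 21 1 9, .rconst 21 1] ;;
  forTo 22 3 (blk [.rstore 20 21, .iadd 20 20 21])

/-- The sample size. -/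
noncomputable def sampleSize (τ k j : ℕ) (ε γ : ℝ) : ℕ := ⌈(128 * τ * k * j / ε / γ) ^ 8⌉₊

-- Unit vector i is vector number n + i and has its one at address (n+i)d + i = nd + i(d+1). Only
-- the ones are written; on an input memory the cells between them are already 0.
set_option maxHeartbeats 1000000 in
theorem setup_tot (τ : ℕ) (s : St) {n d k j m : ℕ} {ε γ : ℝ}
    (h0 : s.I 0 = n) (h1 : s.I 1 = d) (h2 : s.I 2 = k) (h3 : s.I 3 = j) (x0 : s.X 0 = ε)
    (x1 : s.X 1 = γ) (hm : m = sampleSize τ k j ε γ) :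
    Tot (setup τ) s (100 * (m ^ 5 + m ^ 2 + m + k + j + d + 1)) fun s' =>
      Glob n d k j m (2 * 4 ^ m) (2 ^ m) (4 ^ m) ((1 - γ) * n) s' ∧ s'.I 16 = 2 ^ m ^ 5 ∧
      s'.X 4 = -1 ∧ s'.A = fun p => if ∃ i, i < j ∧ p = n * d + i * (d + 1) then 1 else s.A p := by
  have key : Tot (setup τ) s (14 + ((m * 4 + 1) + (1 + ((m + m) * 5 + 3 + (12 + (k * 5 + 3 + (2 +
      (m * 5 + 3 + (2 + ((m + j) * 5 + 3 + (m * 5 + 3 + ((m * m) * 5 + 3 + (m * 5 + 3 +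
      (m ^ 5 * 5 + 3 + (d * 5 + 3 + (2 + (j * (2 + 4) + 2))))))))))))))))) fun s' =>
      Glob n d k j m (2 * 4 ^ m) (2 ^ m) (4 ^ m) ((1 - γ) * n) s' ∧ s'.I 16 = 2 ^ m ^ 5 ∧
      s'.X 4 = -1 ∧ s'.A = fun p => if ∃ i, i < j ∧ p = n * d + i * (d + 1) then 1 else s.A p := by
    refine Tot.seq (Tot.blkFr 4 (Q := fun t => t.I 4 = 0 ∧ t.X 21 = 0 ∧ t.I 9 = 1 ∧ t.I 8 = 0 ∧
      t.X 20 = (128 * τ * k * j / ε / γ) ^ 8) rfl ?_) ?_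
    · simp [Instr.act, h2, h3, x0, x1]
      ring
    rintro s1 ⟨F1, A1, a1, b1, c1, d1, e1⟩
    refine Tot.seq (n₁ := m * 4 + 1) ((ceilLoop_tot s1 a1 b1 c1).mono
      (by rw [e1, hm, sampleSize]) fun _ => id) ?_
    rintro s2 ⟨a2, I2, X2, -, A2⟩
    rw [e1, ← sampleSize, ← hm] at a2
    refine Tot.seq (Tot.blkFr 20 (Q := fun t => t.I 24 = m + m) rfl (by simp [Instr.act, a2])) ?_
    rintro s3 ⟨F3, A3, a3⟩
    refine Tot.seq (pow2_tot s3 a3 (by norm_num) (by norm_num) (by norm_num) (by norm_num)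
      (by norm_num)) ?_
    rintro s4 ⟨a4, I4, X4, -, A4⟩
    have J4 : ∀ r, r < 4 → s4.I r = s.I r := fun r hr => by
      rw [I4 r (by omega) (by omega) (by omega), F3.I r (by omega), I2 r (by omega), F1.I r hr]
    have K4 : ∀ r, r < 4 → s4.X r = s.X r := fun r hr => by
      rw [X4, F3.X r (by omega), X2 r (by omega), F1.X r hr]
    have j9 : s4.I 9 = 1 := by
      rw [I4 9 (by norm_num) (by norm_num) (by norm_num), F3.I 9 (by norm_num), I2 9 (by norm_num), c1]
    have j8 : s4.I 8 = 0 := by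
      rw [I4 8 (by norm_num) (by norm_num) (by norm_num), F3.I 8 (by norm_num), I2 8 (by norm_num), d1]
    have j4 : s4.I 4 = m := by
      rw [I4 4 (by norm_num) (by norm_num) (by norm_num), F3.I 4 (by norm_num), a2]
    -- Doubling 2m times gives the weight bound 4^m; its square root is the grid denominator 2^m.
    have hpow : (2 : ℕ) ^ (m + m) = 4 ^ m := by rw [← two_mul, pow_mul]; norm_num
    rw [hpow] at a4
    have hsq : Real.sqrt (4 ^ m) = 2 ^ m := by
      rw [show (4 : ℝ) ^ m = (2 ^ m) ^ 2 by rw [← pow_mul, mul_comm, pow_mul]; norm_num]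
      exact Real.sqrt_sq (by positivity)
    refine Tot.seq (Tot.blkFr 2 (Q := fun t => t.I 0 = n ∧ t.I 1 = d ∧ t.I 2 = k ∧ t.I 3 = j ∧
      t.I 4 = m ∧ t.I 5 = 2 * 4 ^ m ∧ t.I 7 = n - 1 ∧ t.I 8 = 0 ∧ t.I 9 = 1 ∧ t.I 10 = j + 1 ∧
      t.I 11 = n + j + 1 ∧ t.I 14 = n + j ∧ t.X 2 = 2 ^ m ∧ t.X 3 = 4 ^ m ∧ t.X 4 = -1 ∧
      t.X 5 = (1 - γ) * n) rfl ?_) ?_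
    · simp [Instr.act, J4, K4, j9, j8, j4, a4, h0, h1, h2, h3, x1, hsq, two_mul]
    rintro s5 ⟨F5, A5, i0, i1, i2, i3, i4, i5, i7, i8, i9, i10, i11, i14, y2, y3, y4, y5⟩
    refine Tot.seq (mulI_tot s5 i2 (by norm_num) (by norm_num) (by norm_num) (by norm_num)
      (by norm_num) (by norm_num) (by norm_num) (by norm_num)) ?_
    rintro s6 ⟨a6, I6, X6, -, A6⟩
    rw [i10] at a6
    refine Tot.seq (Tot.blk (Q := fun t => t = { s6 with
      I := update (update s6.I 12 (n + j + 1 + k * (j + 1))) 13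
        (n + j + 1 + k * (j + 1) + k * (j + 1)) }) rfl le_rfl ?_) ?_
    · simp [Instr.act, I6, i11, a6, mul_comm]
    rintro s7 hs7
    have I7 : ∀ r, r ≠ 12 → r ≠ 13 → s7.I r = s6.I r := fun r hr hr' => by
      rw [hs7]; simp [hr, hr']
    refine Tot.seq (mulI_tot s7 (N := m) (by simp [I7, I6, i4]) (by norm_num) (by norm_num)
      (by norm_num) (by norm_num) (by norm_num) (by norm_num) (by norm_num) (by norm_num)) ?_
    rintro s8 ⟨a8, I8, X8, -, A8⟩
    refine Tot.seq (Tot.blk (Q := fun t => t = { s8 with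
      I := update (update s8.I 17 (1 + k * m)) 31 (m + j) }) rfl le_rfl ?_) ?_
    · simp [Instr.act, I8, I7, I6, i9, a8, i2, i4, i3]
    rintro s9 hs9
    have I9 : ∀ r, r ≠ 17 → r ≠ 31 → s9.I r = s8.I r := fun r hr hr' => by
      rw [hs9]; simp [hr, hr']
    refine Tot.seq (mulI_tot s9 (N := m + j) (by simp [hs9]) (by norm_num) (by norm_num)
      (by norm_num) (by norm_num) (by norm_num) (by norm_num) (by norm_num) (by norm_num)) ?_
    rintro s10 ⟨a10, I10, X10, -, A10⟩
    refine Tot.seq (mulI_tot s10 (N := m) (by simp [I10, I9, I8, I7, I6, i4]) (by norm_num)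
      (by norm_num)
      (by norm_num) (by norm_num) (by norm_num) (by norm_num) (by norm_num) (by norm_num)) ?_
    rintro s11 ⟨a11, I11, X11, -, A11⟩
    have a11' : s11.I 27 = m * m := by rw [a11]; simp [I10, I9, I8, I7, I6, i4]
    refine Tot.seq (mulI_tot s11 a11' (by norm_num) (by norm_num)
      (by norm_num) (by norm_num) (by norm_num) (by norm_num) (by norm_num) (by norm_num)) ?_
    rintro s12 ⟨a12, I12, X12, -, A12⟩
    refine Tot.seq (mulI_tot s12 (N := m) (by simp [I12, I11, I10, I9, I8, I7, I6, i4]) (by norm_num)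
      (by norm_num)
      (by norm_num) (by norm_num) (by norm_num) (by norm_num) (by norm_num) (by norm_num)) ?_
    rintro s13 ⟨a13, I13, X13, -, A13⟩
    have a13' : s13.I 29 = m ^ 5 := by rw [a13, a12, a11']; ring
    refine Tot.seq (pow2_tot s13 a13' (by norm_num) (by norm_num) (by norm_num) (by norm_num)
      (by norm_num)) ?_
    rintro s14 ⟨a14, I14, X14, -, A14⟩
    refine Tot.seq (mulI_tot s14 (N := d) (by simp [I14, I13, I12, I11, I10, I9, I8, I7, I6, i1])
      (by norm_num) (by norm_num)
      (by norm_num) (by norm_num) (by norm_num) (by norm_num) (by norm_num) (by norm_num)) ?_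
    rintro s15 ⟨a15, I15, X15, -, A15⟩
    have a15' : s15.I 20 = n * d := by
      rw [a15]; simp [I14, I13, I12, I11, I10, I9, I8, I7, I6, i0]
    have X15' : s15.X = s5.X := by
      rw [X15, X14, X13, X12, X11, X10, hs9]
      simp only
      rw [X8, hs7]
      simp only
      rw [X6]
    have A15' : s15.A = s.A := by
      rw [A15, A14, A13, A12, A11, A10, hs9]
      simp only
      rw [A8, hs7]
      simp only
      rw [A6, A5, A4, A3, A2, A1]
    have G15 : Glob n d k j m (2 * 4 ^ m) (2 ^ m) (4 ^ m) ((1 - γ) * n) s15 := by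
      constructor
      · simp [I15, I14, I13, I12, I11, I10, I9, I8, I7, I6, i0]
      · simp [I15, I14, I13, I12, I11, I10, I9, I8, I7, I6, i1]
      · simp [I15, I14, I13, I12, I11, I10, I9, I8, I7, I6, i2]
      · simp [I15, I14, I13, I12, I11, I10, I9, I8, I7, I6, i3]
      · simp [I15, I14, I13, I12, I11, I10, I9, I8, I7, I6, i4]
      · simp [I15, I14, I13, I12, I11, I10, I9, I8, I7, I6, i5]
      · simp [I15, I14, I13, I12, I11, I10, I9, I8, I7, I6, i7]
      · simp [I15, I14, I13, I12, I11, I10, I9, I8, I7, I6, i8]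
      · simp [I15, I14, I13, I12, I11, I10, I9, I8, I7, I6, i9]
      · simp [I15, I14, I13, I12, I11, I10, I9, I8, I7, I6, i10]
      · simp [I15, I14, I13, I12, I11, I10, I9, I8, I7, I6, i11]
      · simp [I15, I14, I13, I12, I11, I10, I9, I8, hs7]
      · simp [I15, I14, I13, I12, I11, I10, I9, I8, hs7]
      · simp [I15, I14, I13, I12, I11, I10, I9, I8, I7, I6, i14]
      · simp [I15, I14, I13, I12, I11, I10, I9, I8, I7, a6, mul_comm]
      · simp [I15, I14, I13, I12, I11, I10, hs9]
      · simp [I15, I14, I13, I12, I11, a10, I9, I8, I7, a6, mul_comm]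
      · rw [X15', y2]
      · rw [X15', y3]
      · rw [X15', y5]
    refine Tot.seq (Tot.blkFr 20 (Q := fun t => t.I 20 = n * d ∧ t.I 21 = d + 1 ∧ t.X 21 = 1)
      rfl (by simp [Instr.act, a15', G15.i1, G15.i9])) ?_
    rintro s16 ⟨F16, A16, a16, b16, c16⟩
    refine (Tot.forTo' (N := j) (n := 2) (fun v t => Fr 20 s15 t ∧ t.I 20 = n * d + v * (d + 1) ∧
      t.I 21 = d + 1 ∧ t.X 21 = 1 ∧
      t.A = fun p => if ∃ i, i < v ∧ p = n * d + i * (d + 1) then 1 else s.A p)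
      (by norm_num) ?_ ?_ ?_ ?_).mono le_rfl ?_
    · rintro v s' s'' ⟨e1, e2, e3, e4, e5⟩ hI hM hX hA
      exact ⟨e1.resp (by norm_num) (by norm_num) hI hM hX,
        by rw [hI _ (by norm_num) (by norm_num), e2],
        by rw [hI _ (by norm_num) (by norm_num), e3], by rw [hX, e4], by rw [hA, e5]⟩
    · refine ⟨F16, by simpa using a16, b16, c16, ?_⟩
      funext p
      rw [if_neg (by rintro ⟨i, hi, -⟩; omega), A16, A15']
    · rintro v t ⟨e, -⟩
      rw [e.I 3 (by norm_num), G15.i3]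
    · rintro v t hv ⟨e1, e2, e3, e4, e5⟩ hi
      refine Tot.blk rfl le_rfl ?_
      refine ⟨⟨⟨?_, ?_, ?_⟩, ?_, ?_, ?_, ?_⟩, ?_⟩
      · intro r hr
        have : r ≠ 20 := by omega
        simp [Instr.act, this, e1.I r hr]
      · intro r hr
        simp [Instr.act, e1.X r hr]
      · simp [Instr.act, e1.M]
      · simp [Instr.act, e2, e3]; ring
      · simp [Instr.act, e3]
      · simp [Instr.act, e4]
      · simp only [List.foldl, Instr.act, e2, e4, e5]
        funext p
        by_cases hp : p = n * d + v * (d + 1)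
        · subst hp
          rw [update_self, if_pos ⟨v, by omega, rfl⟩]
        · rw [update_of_ne hp]
          refine if_congr ⟨?_, ?_⟩ rfl rfl
          · rintro ⟨i, hi, h⟩
            exact ⟨i, by omega, h⟩
          · rintro ⟨i, hi, h⟩
            refine ⟨i, ?_, h⟩
            rcases Nat.lt_succ_iff_lt_or_eq.1 hi with h' | h'
            · exact h'
            · exact absurd (h' ▸ h) hp
      · simp [Instr.act, hi]
    · rintro t ⟨e1, -, -, -, e5⟩
      refine ⟨G15.congr (fun r hr _ => e1.I r hr) fun r hr _ => e1.X r hr, ?_, ?_, e5⟩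
      · rw [e1.I 16 (by norm_num), I15 16 (by norm_num) (by norm_num) (by norm_num), a14]
      · rw [e1.X 4 (by norm_num), X15', y4]
  refine key.mono ?_ fun _ => id
  have e : m * m = m ^ 2 := (pow_two m).symm
  rw [e]
  omega

end RealRAM

/-! ### Repetition of trials and the complete program. -/

namespace RealRAM

open Function
open scoped ENNReal

/-- Repeated independent trials: if a trial succeeds with probability at least `ρ`, and later trials
do not destroy a success, then `N` trials succeed with probability at least `1 - (1 - ρ) ^ N`. -/
theorem Spec.retry {i c : ℕ} {x : Cmd} {s : St} {n N : ℕ} {ρ : ℝ} (Inv Good : St → Prop)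
    [DecidablePred Good] (hi : i ≠ 69) (hρ : 0 ≤ ρ) (hρ' : ρ ≤ 1) (h0 : Inv s)
    (hresp : ∀ s' s'', Inv s' → (∀ r, r ≠ i → r ≠ 69 → s''.I r = s'.I r) → s''.X = s'.X →
      s''.M = s'.M → s''.A = s'.A → Inv s'' ∧ (Good s'' ↔ Good s'))
    (hc : ∀ s', Inv s' → s'.I c = N)
    (hx : ∀ s', Inv s' → ∀ a : ℝ, 0 ≤ a → a ≤ 1 → Spec x s' n
      (fun s'' => Inv s'' ∧ s''.I i = s'.I i)
      (fun s'' => if Good s'' then 1 else ENNReal.ofReal a)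
      (if Good s' then 1 else ENNReal.ofReal (a + (1 - a) * ρ))) :
    Spec (forTo i c x) s (N * (n + 4) + 2) Inv (fun s' => if Good s' then 1 else 0)
      (ENNReal.ofReal (1 - (1 - ρ) ^ N)) := by
  have hpw : ∀ r : ℕ, 0 ≤ (1 - ρ) ^ r ∧ (1 - ρ) ^ r ≤ 1 := fun r =>
    ⟨pow_nonneg (by linarith) r, pow_le_one₀ (by linarith) (by linarith)⟩
  -- r is the number of trials left. The value of a state is 1 after a success and 1 - (1-ρ)^r
  -- otherwise.
  have key : ∀ r v s', v + r = N → Inv s' → s'.I i = v →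
      Spec (.loop (.idx c i) (x ;; blk [.iconst 69 1, .iadd i i 69])) s' (r * (n + 4) + 1)
        Inv (fun s' => if Good s' then 1 else 0)
        (if Good s' then 1 else ENNReal.ofReal (1 - (1 - ρ) ^ r)) := by
    intro r
    induction r with
    | zero =>
      intro v s' hv hs' hv'
      refine (Det.loop_exit ?_ Inv (fun s' => if Good s' then 1 else 0) hs').mono (by omega)
        (fun _ => id) (fun _ _ => le_rfl) (by simp)
      simp only [Cond.Holds]
      rw [hc s' hs']
      omega
    | succ r ih =>
      intro v s' hv hs' hv'
      -- The value with r trials left plays the role of `a`: then a + (1-a)ρ is the value with r+1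
      -- trials left.
      have h1 := hx s' hs' (1 - (1 - ρ) ^ r) (by linarith [(hpw r).2]) (by linarith [(hpw r).1])
      have h2 : Spec (x ;; blk [.iconst 69 1, .iadd i i 69]) s' (n + 2)
          (fun s'' => Inv s'' ∧ s''.I i = v + 1)
          (fun s'' => if Good s'' then 1 else ENNReal.ofReal (1 - (1 - ρ) ^ r))
          (if Good s' then 1 else ENNReal.ofReal (1 - (1 - ρ) ^ r + (1 - (1 - (1 - ρ) ^ r)) * ρ)) := by
        refine Spec.seq h1 ?_
        rintro s₁ ⟨h3, h4⟩
        have hb : Det (blk [Instr.iconst 69 1, Instr.iadd i i 69]) s₁ 2 (s₁.tick i) := by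
          have := Det.blk (L := [Instr.iconst 69 1, Instr.iadd i i 69]) rfl s₁
          simpa [Instr.act, St.tick, hi] using this
        obtain ⟨h5, h6⟩ := hresp s₁ (s₁.tick i) h3
          (fun r hr hr' => by simp [St.tick, hr, hr']) rfl rfl rfl
        refine (hb _ (fun s'' => if Good s'' then 1 else ENNReal.ofReal (1 - (1 - ρ) ^ r))
          ⟨h5, by simp [St.tick, h4, hv']⟩).mono le_rfl (fun _ => id) (fun _ _ => le_rfl) ?_
        simp only [h6, le_refl]
      have h7 := Spec.loop_succ (c := .idx c i) (Q := Inv)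
        (q := fun s' => if Good s' then 1 else 0) (n₂ := r * (n + 4) + 1)
        (by simp only [Cond.Holds]; rw [hc s' hs']; omega) h2 (by
          rintro s'' ⟨h3, h4⟩
          exact ih (v + 1) s'' (by omega) h3 h4)
      refine h7.mono (by ring_nf; omega) (fun _ => id) (fun _ _ => le_rfl) ?_
      refine le_of_eq ?_
      congr 2
      ring
  set s1 : St := { s with I := update s.I i 0 } with hs1
  obtain ⟨h1, -⟩ := hresp s s1 h0 (fun r hr _ => by simp [hs1, hr]) rfl rfl rfl
  refine (Spec.of_det_seq (Det.ins rfl s) (key N 0 s1 (by omega) h1 (by simp [hs1]))).mono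
    (by omega) (fun _ => id) (fun _ _ => le_rfl) ?_
  by_cases hg : Good s1
  · rw [if_pos hg]
    exact ENNReal.ofReal_le_one.2 (by linarith [(hpw N).1])
  · rw [if_neg hg]

/-- The mean has total mass 1, so constants pass through it. This separates the success indicator of
a trial from the value of the later trials. -/
theorem avgM_affine (b : ℕ) (c c' : ℝ≥0∞) (g : (ℕ → ℕ) → ℝ≥0∞) (R q : ℕ) (M : ℕ → ℕ) :
    avgM b R q (fun M => c + c' * g M) M = c + c' * avgM b R q g M := by
  induction R generalizing q M with
  | zero => rfl
  | succ R ih =>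
    simp only [avgM, ih]
    rw [Finset.sum_add_distrib, ← Finset.mul_sum, mul_add, Finset.sum_const, Finset.card_univ,
      Fintype.card_fin, nsmul_eq_mul, ← mul_assoc, Nat.cast_add, Nat.cast_one,
      ENNReal.inv_mul_cancel (by simp) (by simp), one_mul, mul_left_comm]

theorem drawAvg_affine (n k j m U : ℕ) (c c' : ℝ≥0∞) (g : (ℕ → ℕ) → ℝ≥0∞) (M : ℕ → ℕ) :
    drawAvg n k j m U (fun M => c + c' * g M) M = c + c' * drawAvg n k j m U g M := by
  unfold drawAvg
  rw [← avgM_affine]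
  congr 1
  funext M
  exact avgM_affine ..

/-- Copy the best flats to the beginning of the memory. -/
def finish : Cmd := blk [.iadd 25 13 8, .iconst 26 0] ;; copyAll

/-- The whole algorithm. -/
def mainCmd (τ : ℕ) : Cmd := setup τ ;; forTo 6 16 (trial τ) ;; finish

/-- A unit vector. -/
noncomputable def unitVec (d i : ℕ) : EuclideanSpace ℝ (Fin d) :=
  WithLp.toLp 2 fun q : Fin d => if (q : ℕ) = i then 1 else 0

/-- The vectors at the beginning of the memory: the points and unit vectors. -/
def IsData {n d : ℕ} (j : ℕ) (P : Fin n → EuclideanSpace ℝ (Fin d))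
    (V : ℕ → EuclideanSpace ℝ (Fin d)) : Prop :=
  (∀ i : Fin n, V i = P i) ∧ ∀ i, i < j → V (n + i) = unitVec d i

/-- Candidate flats of dimension `j` with average distance power `v` on the points near them. -/
def Valid {E : Type*} [NormedAddCommGroup E] [InnerProductSpace ℝ E] (τ n k j : ℕ) (g : ℝ)
    (z : ℕ → ℕ → E) (V : ℕ → E) (i : ℕ) : Prop :=
  i < n ∧ g ≤ (near τ n k (j + 1) z V i).card ∧ zeroCount k (j + 1) z ≤ k

theorem distPow_nonneg {E : Type*} [NormedAddCommGroup E] [InnerProductSpace ℝ E]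
    (τ k J : ℕ) (z : ℕ → ℕ → E) (x : E) : 0 ≤ distPow τ k J z x :=
  Real.iInf_nonneg fun _ => by positivity

theorem nearAvg_nonneg {E : Type*} [NormedAddCommGroup E] [InnerProductSpace ℝ E]
    (τ n k J : ℕ) (z : ℕ → ℕ → E) (V : ℕ → E) (i : ℕ) : 0 ≤ nearAvg τ n k J z V i :=
  div_nonneg (Finset.sum_nonneg fun _ _ => distPow_nonneg ..) (by positivity)

theorem input_data {n d k j : ℕ} {ε γ : ℝ} {P : Fin n → EuclideanSpace ℝ (Fin d)} {A : ℕ → ℝ}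
    (hjd : j ≤ d) (hA : A = fun p => if ∃ i, i < j ∧ p = n * d + i * (d + 1) then 1 else
      (ProjectiveClustering.input k j ε γ P).A p) : IsData j P (vecs d A) := by
  subst hA
  constructor
  · intro i
    ext q
    have h : (i : ℕ) * d + q < n * d := mul_add_lt i.2 q.2
    simp only [vecs, ProjectiveClustering.input]
    rw [if_neg, dif_pos h]
    · have : (⟨(i : ℕ) * d + q, h⟩ : Fin (n * d)) = finProdFinEquiv (i, q) := by
        ext
        simp [finProdFinEquiv]
        ring
      rw [this, Equiv.symm_apply_apply]
    · rintro ⟨i', -, h'⟩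
      omega
  · intro i hi
    ext q
    simp only [vecs, ProjectiveClustering.input, unitVec]
    by_cases hq : (q : ℕ) = i
    · rw [if_pos hq, if_pos ⟨i, hi, by rw [hq]; ring⟩]
    · rw [if_neg hq, if_neg, dif_neg (by rw [add_mul]; omega)]
      rintro ⟨i', hi', h'⟩
      have : i * d + q = i' * d + i' := by
        rw [add_mul] at h'
        linarith
      obtain ⟨h1, h2⟩ := mul_add_inj q.2 (by omega) this
      exact hq (by omega)

/-- The time for all trials. -/
def mainTime (τ n d k j m : ℕ) : ℕ :=
  100 * (m ^ 5 + m ^ 2 + m + k + j + d + 1) + ((2 ^ m ^ 5 *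
    (1 + ((1 + k * m) * 9 + 2 + (k * (j + 1) * (m + j) * 9 + 2 + trialTime τ n d k j m)) + 4) + 2) +
    (2 + (k * (j + 1) * (60 * d) + 2)))

-- `hprob` is required for all `V` and `M` that are compatible with the data, because a trial starts
-- with the scratch vectors and random numbers that its predecessors left behind.
open scoped Classical in
theorem mainCmd_spec (τ : ℕ) {n d k j m : ℕ} {ε γ ρ o : ℝ} {P : Fin n → EuclideanSpace ℝ (Fin d)}
    (hn : 1 ≤ n) (hk : 1 ≤ k) (hd : 1 ≤ d) (hjd : j ≤ d) (hm : m = sampleSize τ k j ε γ)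
    (hρ : 0 ≤ ρ) (hρ' : ρ ≤ 1)
    (hprob : ∀ V M, IsData j P V → ENNReal.ofReal ρ ≤ drawAvg n k j m (2 * 4 ^ m) (fun M =>
      if Valid τ n k j ((1 - γ) * n) (cand n k j m (2 ^ m) (4 ^ m) V M) V (M 0) ∧
        nearAvg τ n k (j + 1) (cand n k j m (2 ^ m) (4 ^ m) V M) V (M 0) ≤ o then 1 else 0) M)
    (s : St) (hs : s.at 0 = ProjectiveClustering.input k j ε γ P) :
    Spec (mainCmd τ) s (mainTime τ n d k j m) (fun _ => True)
      (fun s' => if ∃ z V i, IsData j P V ∧ Valid τ n k j ((1 - γ) * n) z V i ∧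
        nearAvg τ n k (j + 1) z V i ≤ o ∧
        ∀ l t, l < k → t < j + 1 → vecs d s'.A (l * (j + 1) + t) = z l t then 1 else 0)
      (ENNReal.ofReal (1 - (1 - ρ) ^ 2 ^ m ^ 5)) := by
  obtain ⟨sI, sM, sX, sA⟩ := s
  simp only [St.at, ProjectiveClustering.input, Config.mk.injEq, true_and] at hs
  obtain ⟨hI, hM, hX, hA⟩ := hs
  obtain ⟨s1, d1, g1, n1, x1, a1⟩ := setup_tot τ (n := n) (d := d) (k := k) (j := j) (m := m) (ε := ε)
    (γ := γ) ⟨sI, sM, sX, sA⟩ (by simp [hI]) (by simp [hI]) (by simp [hI]) (by simp [hI])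
    (by simp [hX]) (by simp [hX]) hm
  refine Spec.of_det_seq d1 ?_
  have hV1 : IsData j P (vecs d s1.A) := by
    refine input_data (k := k) (ε := ε) (γ := γ) hjd ?_
    rw [a1]
    simp only [ProjectiveClustering.input, hA]
  -- A nonnegative `X[4]` is the average of the stored candidates with respect to some vector memory
  -- `V`, namely that of the trial that stored them; the current memory may differ outside the data.
  let Inv : St → Prop := fun s => Glob n d k j m (2 * 4 ^ m) (2 ^ m) (4 ^ m) ((1 - γ) * n) s ∧
    s.I 16 = 2 ^ m ^ 5 ∧ IsData j P (vecs d s.A) ∧ (0 ≤ s.X 4 → ∃ z V i, IsData j P V ∧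
      Valid τ n k j ((1 - γ) * n) z V i ∧ nearAvg τ n k (j + 1) z V i = s.X 4 ∧
      ∀ l t, l < k → t < j + 1 →
        vecs d s.A (n + j + 1 + k * (j + 1) + k * (j + 1) + (l * (j + 1) + t)) = z l t)
  let Good : St → Prop := fun s => 0 ≤ s.X 4 ∧ s.X 4 ≤ o
  have h1 : Inv s1 := ⟨g1, n1, hV1, fun h => by rw [x1] at h; norm_num at h⟩
  refine Spec.seq (n₁ := 2 ^ m ^ 5 * (1 + ((1 + k * m) * 9 + 2 + (k * (j + 1) * (m + j) * 9 + 2 +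
      trialTime τ n d k j m)) + 4) + 2)
    (Q₁ := Inv) (q₁ := fun s' => if Good s' then 1 else 0) ?_ ?_
  · refine Spec.retry Inv Good (by norm_num) hρ hρ' h1 ?_ (fun s' h => h.2.1) ?_
    · rintro s' s'' ⟨e1, e2, e3, e4⟩ hI hX hM hA
      refine ⟨⟨e1.congr (fun r hr hr' => hI r hr' (by omega)) fun r _ _ => by rw [hX],
        by rw [hI 16 (by norm_num) (by norm_num), e2], by rw [hA]; exact e3, ?_⟩, ?_⟩
      · rw [hX, hA]
        exact e4
      · simp only [Good, hX]
    · rintro s' ⟨e1, e2, e3, e4⟩ a ha ha'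
      -- A former success counts 1. Otherwise the value is a + (1-a)·[this trial succeeds].
      let f : (ℕ → ℕ) → ℝ≥0∞ := fun M => if Good s' then 1 else ENNReal.ofReal a +
        ENNReal.ofReal (1 - a) * (if Valid τ n k j ((1 - γ) * n)
          (cand n k j m (2 ^ m) (4 ^ m) (vecs d s'.A) M) (vecs d s'.A) (M 0) ∧
        nearAvg τ n k (j + 1) (cand n k j m (2 ^ m) (4 ^ m) (vecs d s'.A) M) (vecs d s'.A) (M 0) ≤ o
        then 1 else 0)
      refine (trial_spec τ s' hn hd hk e1 (fun s'' => Inv s'' ∧ s''.I 6 = s'.I 6)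
        (fun s'' => if Good s'' then 1 else ENNReal.ofReal a) f ?_).mono le_rfl (fun _ => id)
        (fun _ _ => le_rfl) ?_
      · intro s'' M z hMn hz hI hX hV upd hupd hu hnu
        have hM0 : M 0 < n := hMn 0 (by omega)
        have hVn : ∀ v, v < n → vecs d s''.A v = vecs d s'.A v := fun v hv => hV v (by omega)
        have hV3 : IsData j P (vecs d s''.A) := by
          refine ⟨fun i => ?_, fun i hi => ?_⟩
          · rw [hV i (by omega), e3.1 i]
          · rw [hV _ (by omega), e3.2 i hi]
        rw [e1.i13] at hu hnu
        refine ⟨⟨⟨e1.congr (fun r hr _ => hI r hr) hX, by rw [hI 16 (by norm_num), e2], hV3, ?_⟩,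
          hI 6 (by norm_num)⟩, ?_⟩
        · intro h4
          by_cases h : upd
          · obtain ⟨c1, c2⟩ := hu h
            exact ⟨z, _, M 0, e3, ⟨hM0, (hupd.1 h).1, (hupd.1 h).2.1⟩, c1.symm, c2⟩
          · obtain ⟨c1, c2⟩ := hnu h
            rw [c1] at h4 ⊢
            obtain ⟨z', V', i', k1, k2, k3, k4⟩ := e4 h4
            exact ⟨z', V', i', k1, k2, k3, fun l t hl ht => by rw [c2 _ (mul_add_lt hl ht), k4 l t hl ht]⟩
        · by_cases hg : Good s'
          · have : Good s'' := by
              by_cases h : upd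
              · obtain ⟨c1, c2⟩ := hu h
                refine ⟨by rw [c1]; exact nearAvg_nonneg .., ?_⟩
                rw [c1]
                exact ((hupd.1 h).2.2 hg.1).trans hg.2
              · obtain ⟨c1, -⟩ := hnu h
                simp only [Good, c1]
                exact hg
            simp only [f, if_pos hg, if_pos this, le_refl]
          · simp only [f, if_neg hg]
            by_cases hS : Valid τ n k j ((1 - γ) * n)
                (cand n k j m (2 ^ m) (4 ^ m) (vecs d s'.A) M) (vecs d s'.A) (M 0) ∧
                nearAvg τ n k (j + 1) (cand n k j m (2 ^ m) (4 ^ m) (vecs d s'.A) M) (vecs d s'.A)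
                  (M 0) ≤ o
            · have hh : upd := by
                rw [← hz] at hS
                refine hupd.2 ⟨hS.1.2.1, hS.1.2.2, fun h4 => ?_⟩
                -- Without a former success a stored value exceeds `o`, so a successful trial
                -- replaces it.
                have : o < s'.X 4 := not_le.1 fun h => hg ⟨h4, h⟩
                exact hS.2.trans this.le
              have hg' : Good s'' := by
                obtain ⟨c1, -⟩ := hu hh
                refine ⟨by rw [c1]; exact nearAvg_nonneg .., ?_⟩
                rw [c1, hz]
                exact hS.2
              rw [if_pos hS, if_pos hg', mul_one, ← ENNReal.ofReal_add ha (by linarith)]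
              simp
            · rw [if_neg hS, mul_zero, add_zero]
              split_ifs
              · exact ENNReal.ofReal_le_one.2 ha'
              · exact le_rfl
      · by_cases hg : Good s'
        · simp only [f, if_pos hg]
          -- With c' = 0 this says that the mean of the constant 1 is 1.
          have := drawAvg_affine n k j m (2 * 4 ^ m) 1 0 (fun _ => 0) s'.M
          simp only [zero_mul, add_zero] at this
          rw [this]
        · simp only [f, if_neg hg]
          rw [drawAvg_affine, ENNReal.ofReal_add ha (mul_nonneg (by linarith) hρ),
            ENNReal.ofReal_mul (by linarith)]
          gcongr
          exact hprob _ _ e3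
  · rintro s2 ⟨e1, e2, e3, e4⟩
    refine Tot.spec (Q := fun s' => True ∧ (Good s2 → ∃ z V i, IsData j P V ∧
        Valid τ n k j ((1 - γ) * n) z V i ∧ nearAvg τ n k (j + 1) z V i ≤ o ∧
        ∀ l t, l < k → t < j + 1 → vecs d s'.A (l * (j + 1) + t) = z l t)) (p :=
        if Good s2 then 1 else 0) ?_ ?_ |>.mono le_rfl (fun _ _ => trivial) (fun _ _ => le_rfl) le_rfl
    · refine Tot.seq (Tot.blkFr 20 (Q := fun t => t.I 25 = n + j + 1 + k * (j + 1) + k * (j + 1) ∧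
        t.I 26 = 0) rfl (by simp [Instr.act, e1.i13, e1.i8])) ?_
      rintro s3 ⟨F3, A3, i25, i26⟩
      refine (copyAll_tot s3 hd (by rw [F3.I 1 (by norm_num), e1.i1])
        (by rw [F3.I 8 (by norm_num), e1.i8]) (by rw [F3.I 9 (by norm_num), e1.i9]) (by
        rw [i25, i26, F3.I 15 (by norm_num), e1.i15]; omega)).mono
        (by rw [F3.I 15 (by norm_num), e1.i15]) ?_
      rintro s4 ⟨-, -, W⟩
      refine ⟨trivial, ?_⟩
      rintro ⟨h4, h5⟩
      obtain ⟨z, V, i, k1, k2, k3, k4⟩ := e4 h4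
      refine ⟨z, V, i, k1, k2, k3.le.trans h5, fun l t hl ht => ?_⟩
      rw [F3.I 15 (by norm_num), e1.i15, i25, i26] at W
      have := W _ (mul_add_lt hl ht)
      rw [zero_add] at this
      rw [this, A3, k4 l t hl ht]
    · rintro s' ⟨-, h⟩
      by_cases hg : Good s2
      · rw [if_pos hg, if_pos (h hg)]
      · rw [if_neg hg]
        exact zero_le

end RealRAM

/-! ### Geometric meaning of the computed quantities, and running time. -/

namespace RealRAM

open Function
open scoped ENNReal

section Geometry

variable {E : Type*} [NormedAddCommGroup E] [InnerProductSpace ℝ E]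

/-- Pythagoras for x - p and p - q, q being any point of the flat. -/
theorem infDist_affineSubspace {F : AffineSubspace ℝ E} {x p : E} (hp : p ∈ F)
    (h : ∀ v ∈ F.direction, inner ℝ (x - p) v = 0) :
    Metric.infDist x (F : Set E) = ‖x - p‖ := by
  refine le_antisymm ?_ ?_
  · rw [← dist_eq_norm]
    exact Metric.infDist_le_dist_of_mem hp
  · refine (Metric.le_infDist ⟨p, hp⟩).2 fun q hq => ?_
    have h1 := h (p - q) (AffineSubspace.vsub_mem_direction hp hq)
    rw [dist_eq_norm]
    have h2 : x - q = (x - p) + (p - q) := by abel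
    have h3 := norm_add_sq_real (x - p) (p - q)
    rw [h1, ← h2] at h3
    exact le_of_sq_le_sq (by nlinarith [sq_nonneg ‖p - q‖]) (norm_nonneg _)

/-- The affine span of the first `J` points of a sequence. -/
def spanOf (J : ℕ) (z : ℕ → E) : AffineSubspace ℝ E :=
  affineSpan ℝ (Set.range fun t : Fin J => z t)

theorem direction_spanOf (j : ℕ) (z : ℕ → E) : (spanOf (j + 1) z).direction =
    Submodule.span ℝ ((fun t => z t - z 0) '' Set.Iio (j + 1)) := by
  rw [spanOf, direction_affineSpan, vectorSpan_range_eq_span_range_vsub_right ℝ _ (0 : Fin (j + 1))]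
  congr 1
  ext v
  constructor
  · rintro ⟨t, rfl⟩
    exact ⟨t, t.2, rfl⟩
  · rintro ⟨t, ht, rfl⟩
    exact ⟨⟨t, ht⟩, rfl⟩

theorem direction_spanOf_gsVec (j : ℕ) (z : ℕ → ℕ → E) (l : ℕ) :
    (spanOf (j + 1) (z l)).direction = Submodule.span ℝ (gsVec z l '' Set.Iio (j + 1)) := by
  rw [direction_spanOf]
  exact (InnerProductSpace.span_gramSchmidt_Iio ℝ (fun t => z l t - z l 0) (j + 1)).symm

theorem mem_spanOf {J t : ℕ} (z : ℕ → E) (ht : t < J) : z t ∈ spanOf J z :=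
  mem_affineSpan ℝ ⟨⟨t, ht⟩, rfl⟩

/-- What the projections subtract lies in the direction of the flat, and the remainder is orthogonal
to all Gram-Schmidt vectors, which span that direction. Vanishing ones are harmless, so no
assumption on the dimension is needed. -/
theorem norm_projSeq_gsVec (j : ℕ) (z : ℕ → ℕ → E) (l : ℕ) (x : E) :
    ‖projSeq (gsVec z l) (j + 1) (x - z l 0)‖ =
      Metric.infDist x (spanOf (j + 1) (z l) : Set E) := by
  set b := gsVec z l with hb
  have ho : ∀ s t, s ≠ t → inner ℝ (b s) (b t) = 0 := fun s t hst =>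
    InnerProductSpace.gramSchmidt_orthogonal ℝ _ hst
  rw [projSeq_of_orthogonal ho]
  set u := ∑ s ∈ Finset.range (j + 1), (inner ℝ (x - z l 0) (b s) / inner ℝ (b s) (b s)) • b s
    with hu
  have h1 : u ∈ (spanOf (j + 1) (z l)).direction := by
    rw [direction_spanOf_gsVec]
    refine Submodule.sum_mem _ fun s hs => Submodule.smul_mem _ _ (Submodule.subset_span ⟨s, ?_, rfl⟩)
    simpa using hs
  have h2 : u +ᵥ z l 0 ∈ spanOf (j + 1) (z l) :=
    AffineSubspace.vadd_mem_of_mem_direction h1 (mem_spanOf _ (by omega))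
  have h3 : x - z l 0 - u = x - (u +ᵥ z l 0) := by
    rw [vadd_eq_add]
    abel
  rw [h3, infDist_affineSubspace h2]
  intro v hv
  rw [direction_spanOf_gsVec] at hv
  refine Submodule.span_induction (p := fun v _ => inner ℝ (x - (u +ᵥ z l 0)) v = 0) ?_ (by simp)
    (fun v w _ _ hv hw => by rw [inner_add_right, hv, hw, add_zero])
    (fun a v _ hv => by rw [inner_smul_right, hv, mul_zero]) hv
  rintro _ ⟨t, ht, rfl⟩
  change inner ℝ (x - (u +ᵥ z l 0)) (b t) = 0
  rw [← h3, inner_sub_left, hu, sum_inner, Finset.sum_eq_single t]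
  · rw [inner_smul_left]
    by_cases h0 : inner ℝ (b t) (b t) = 0
    · rw [inner_self_eq_zero.1 h0]
      simp
    · rw [conj_trivial, div_mul_cancel₀ _ h0, sub_self]
  · intro s _ hs
    rw [inner_smul_left, ho s t hs, mul_zero]
  · intro h
    simp at h
    exact absurd ht (by simp; omega)

-- The nonzero Gram-Schmidt vectors are orthogonal, hence a basis of the direction; the dimension is
-- their number.
open scoped Classical in
theorem finrank_direction_spanOf (j : ℕ) (z : ℕ → ℕ → E) (l : ℕ) :
    Module.finrank ℝ (spanOf (j + 1) (z l)).direction +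
      ∑ t ∈ Finset.range (j + 1), (if gsVec z l t = 0 then 1 else 0) = j + 1 := by
  rw [direction_spanOf_gsVec]
  set b := gsVec z l with hb
  let T := (Finset.range (j + 1)).filter fun t => b t ≠ 0
  have ho : ∀ s t, s ≠ t → inner ℝ (b s) (b t) = 0 := fun s t hst =>
    InnerProductSpace.gramSchmidt_orthogonal ℝ _ hst
  have hli : LinearIndependent ℝ fun t : T => b t :=
    linearIndependent_of_ne_zero_of_inner_eq_zero
      (fun t => (Finset.mem_filter.1 t.2).2) fun s t hst => ho s t fun h => hst (Subtype.ext h)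
  have h1 : Submodule.span ℝ (b '' Set.Iio (j + 1)) = Submodule.span ℝ (Set.range fun t : T => b t) := by
    refine le_antisymm (Submodule.span_le.2 ?_) (Submodule.span_mono ?_)
    · rintro _ ⟨t, ht, rfl⟩
      by_cases h : b t = 0
      · rw [h]
        exact Submodule.zero_mem _
      · exact Submodule.subset_span ⟨⟨t, Finset.mem_filter.2 ⟨Finset.mem_range.2 ht, h⟩⟩, rfl⟩
    · rintro _ ⟨t, rfl⟩
      exact ⟨t, Finset.mem_range.1 (Finset.mem_filter.1 t.2).1, rfl⟩
  rw [h1, finrank_span_eq_card hli, Fintype.card_coe, ← Finset.card_filter, add_comm,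
    Finset.card_filter_add_card_filter_not, Finset.card_range]

-- The first difference z l 0 - z l 0 is 0, so each flat contributes at least one zero vector. A
-- total of at most k therefore means exactly one per flat, which is dimension j for each of them.
open scoped Classical in
theorem zeroCount_le_iff (k j : ℕ) (z : ℕ → ℕ → E) : zeroCount k (j + 1) z ≤ k ↔
    ∀ l < k, Module.finrank ℝ (spanOf (j + 1) (z l)).direction = j := by
  set c : ℕ → ℕ := fun l => ∑ t ∈ Finset.range (j + 1), (if gsVec z l t = 0 then 1 else 0) with hc
  have h0 : ∀ l, gsVec z l 0 = 0 := by
    intro l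
    rw [gsVec, InnerProductSpace.gramSchmidt_def]
    simp
  have h1 : ∀ l, 1 ≤ c l := by
    intro l
    simp only [hc]
    rw [Finset.sum_range_succ', h0 l]
    simp
  have h2 := fun l => finrank_direction_spanOf j z l
  have h3 : zeroCount k (j + 1) z = ∑ l ∈ Finset.range k, c l := by
    rw [zeroCount]
  have h4 : ∀ l, Module.finrank ℝ (spanOf (j + 1) (z l)).direction + c l = j + 1 := by
    exact h2
  have h5 : ∑ l ∈ Finset.range k, c l = k + ∑ l ∈ Finset.range k, (c l - 1) := by
    have : ∀ l ∈ Finset.range k, c l = 1 + (c l - 1) := fun l _ => by have := h1 l; omega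
    rw [Finset.sum_congr rfl this, Finset.sum_add_distrib]
    simp
  rw [h3, h5]
  constructor
  · intro h l hl
    have h6 : ∑ l ∈ Finset.range k, (c l - 1) = 0 := by omega
    have h7 := (Finset.sum_eq_zero_iff.1 h6) l (Finset.mem_range.2 hl)
    have := h1 l
    have := h4 l
    omega
  · intro h
    have h6 : ∑ l ∈ Finset.range k, (c l - 1) = 0 := Finset.sum_eq_zero fun l hl => by
      have := h4 l
      have := h l (Finset.mem_range.1 hl)
      omega
    omega

theorem distPow_eq (τ k j : ℕ) (z : ℕ → ℕ → E) (x : E) : distPow τ k (j + 1) z x =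
    ⨅ l : Fin k, Metric.infDist x (spanOf (j + 1) (z l) : Set E) ^ τ := by
  simp only [distPow, norm_projSeq_gsVec]

end Geometry

-- The subset of the points is the sublevel set of the threshold point; it is nonempty since it
-- contains that point.
open ProjectiveClustering in
theorem isApproxSolution_of_valid {τ n d k j : ℕ} {ε γ : ℝ} {P : Fin n → EuclideanSpace ℝ (Fin d)}
    {z : ℕ → ℕ → EuclideanSpace ℝ (Fin d)} {V : ℕ → EuclideanSpace ℝ (Fin d)} {i : ℕ}
    (hV : IsData j P V) (h : Valid τ n k j ((1 - γ) * n) z V i)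
    (h' : nearAvg τ n k (j + 1) z V i ≤ (1 + ε) * opt τ k j P)
    {F : Fin k → AffineSubspace ℝ (EuclideanSpace ℝ (Fin d))}
    (hF : ∀ l, F l = spanOf (j + 1) (z l)) : IsApproxSolution τ j ε γ P F := by
  classical
  obtain ⟨h1, h2, h3⟩ := h
  rw [zeroCount_le_iff] at h3
  refine ⟨fun l => ?_, ?_⟩
  · rw [hF]
    exact ⟨⟨_, mem_spanOf (z l) (Nat.succ_pos j)⟩, h3 l l.2⟩
  let S : Finset (Fin n) := Finset.univ.filter fun i' : Fin n => (i' : ℕ) ∈ near τ n k (j + 1) z V i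
  have hS : S.map Fin.valEmbedding = near τ n k (j + 1) z V i := by
    ext v
    simp only [S, Finset.mem_map, Finset.mem_filter, Finset.mem_univ, true_and,
      Fin.valEmbedding_apply]
    constructor
    · rintro ⟨v, hv, rfl⟩
      exact hv
    · intro hv
      have : v < n := by
        rw [near, Finset.mem_filter, Finset.mem_range] at hv
        exact hv.1
      exact ⟨⟨v, this⟩, hv, rfl⟩
  have hcard : S.card = (near τ n k (j + 1) z V i).card := by rw [← hS, Finset.card_map]
  refine ⟨S, ⟨⟨i, h1⟩, ?_⟩, by rw [hcard]; exact h2, ?_⟩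
  · simp [S, near]
  · refine le_trans (le_of_eq ?_) h'
    rw [cost, nearAvg, ← hS, Finset.sum_map, Finset.card_map, one_div, inv_mul_eq_div]
    congr 1
    refine Finset.sum_congr rfl fun i' _ => ?_
    rw [Fin.valEmbedding_apply, hV.1 i', distPow_eq]
    simp only [hF]

/-- Since k and j are at most m, every term is a constant, at most linear in τ, times a monomial
dominated by m³nd. -/
theorem trialTime_le {τ n d k j m : ℕ} (hn : 1 ≤ n) (hd : 1 ≤ d) (hk : 1 ≤ k)
    (hkm : k ≤ m) (hjm : j ≤ m) : trialTime τ n d k j m ≤ 3000 * (τ + 1) * (m ^ 3 * (n * d)) := by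
  have hm : 1 ≤ m := hk.trans hkm
  have hJ : j + 1 ≤ 2 * m := by omega
  have hmj : m + j ≤ 2 * m := by omega
  have h0 : 1 ≤ n * d := Nat.mul_pos hn hd
  have hdn : d ≤ n * d := Nat.le_mul_of_pos_left d hn
  have e1 : m ≤ m ^ 3 := Nat.le_self_pow (by norm_num) m
  have e2 : m ^ 2 ≤ m ^ 3 := Nat.pow_le_pow_right hm (by norm_num)
  have e0 : 1 ≤ m ^ 3 := hm.trans e1
  have a : ∀ {c y : ℕ}, c ≤ m ^ 3 → y ≤ n * d → c * y ≤ m ^ 3 * (n * d) := fun h h' =>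
    Nat.mul_le_mul h h'
  have b1 := a e0 h0
  have b2 := a e1 hdn
  have b3 := a e2 hdn
  have b4 := a le_rfl hdn
  have b5 := a e1 h0
  have b6 := a e2 (le_refl (n * d))
  have b7 := a e1 (le_refl (n * d))
  have b8 := a e0 (le_refl (n * d))
  have b9 := a e1 (show n ≤ n * d from Nat.le_mul_of_pos_right n hd)
  have b10 := a e0 (show n ≤ n * d from Nat.le_mul_of_pos_right n hd)
  unfold trialTime
  calc _ ≤ (m * (2 * m * (2 * m * (70 * d) + 75 * d) + 10) + 5) +
      ((m * (2 * m * (2 * m * (205 * d) + 130 * d) + 10) + 7) +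
      ((n + n) * (m * (2 * m * (205 * d) + 100 * d + 5 * τ + 40) + 20) +
      m * (2 * m) * (60 * d) + 20)) := by gcongr
    _ = (280 * (m ^ 3 * d) + 150 * (m ^ 2 * d) + 10 * (m * 1)) + 32 * (1 * 1) +
      (820 * (m ^ 3 * d) + 260 * (m ^ 2 * d) + 10 * (m * 1)) +
      (820 * (m ^ 2 * (n * d)) + 200 * (m * (n * d)) + 80 * (m * n) + 40 * (1 * n)) +
      10 * τ * (m * n) + 120 * (m ^ 2 * d) := by ring
    _ ≤ 3000 * (m ^ 3 * (n * d)) + 10 * τ * (m ^ 3 * (n * d)) := by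
      have := Nat.mul_le_mul_left (10 * τ) b9
      omega
    _ ≤ 3000 * (m ^ 3 * (n * d)) + 3000 * τ * (m ^ 3 * (n * d)) := by gcongr; norm_num
    _ = _ := by ring

theorem mainTime_le {τ n d k j m : ℕ} (hn : 1 ≤ n) (hd : 1 ≤ d) (hk : 1 ≤ k)
    (hkm : k ≤ m) (hjm : j ≤ m) :
    mainTime τ n d k j m ≤ 5000 * (τ + 1) * (2 ^ m ^ 5 * (m ^ 5 * (n * d))) := by
  have hm : 1 ≤ m := hk.trans hkm
  have hJ : j + 1 ≤ 2 * m := by omega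
  have hmj : m + j ≤ 2 * m := by omega
  have h0 : 1 ≤ n * d := Nat.mul_pos hn hd
  have hdn : d ≤ n * d := Nat.le_mul_of_pos_left d hn
  have T := trialTime_le (τ := τ) hn hd hk hkm hjm
  have e0 : 1 ≤ m ^ 5 := Nat.one_le_pow _ _ hm
  have e1 : m ≤ m ^ 5 := Nat.le_self_pow (by norm_num) m
  have e2 : m ^ 2 ≤ m ^ 5 := Nat.pow_le_pow_right hm (by norm_num)
  have e3 : m ^ 3 ≤ m ^ 5 := Nat.pow_le_pow_right hm (by norm_num)
  have N1 : 1 ≤ 2 ^ m ^ 5 := Nat.one_le_two_pow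
  unfold mainTime
  generalize 2 ^ m ^ 5 = N at *
  have a : ∀ {c y : ℕ}, c ≤ m ^ 5 → y ≤ n * d → N * (c * y) ≤ N * (m ^ 5 * (n * d)) := fun h h' =>
    Nat.mul_le_mul_left _ (Nat.mul_le_mul h h')
  have a' : ∀ {c y : ℕ}, c ≤ m ^ 5 → y ≤ n * d → c * y ≤ N * (m ^ 5 * (n * d)) := fun h h' =>
    (Nat.le_mul_of_pos_left _ N1).trans (a h h')
  have b1 := a e0 h0
  have b2 := a e3 h0
  have b3 := a e3 (le_refl (n * d))
  have b4 := a e2 h0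
  have c1 := a' e0 h0
  have c2 := a' le_rfl h0
  have c3 := a' e2 h0
  have c4 := a' e1 h0
  have c5 := a' e0 hdn
  have c6 := a' e2 hdn
  calc _ ≤ 100 * (m ^ 5 + m ^ 2 + m + m + m + d + 1) + ((N *
      (1 + ((1 + m * m) * 9 + 2 + (m * (2 * m) * (2 * m) * 9 + 2 + 3000 * (τ + 1) *
        (m ^ 3 * (n * d)))) + 4) + 2) + (2 + (m * (2 * m) * (60 * d) + 2))) := by gcongr
    _ = 100 * (m ^ 5 * 1 + m ^ 2 * 1 + m * 1 + m * 1 + m * 1 + 1 * d + 1 * 1) + 18 * (N * (1 * 1)) +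
        9 * (N * (m ^ 2 * 1)) + 36 * (N * (m ^ 3 * 1)) + 3000 * (N * (m ^ 3 * (n * d))) +
        3000 * τ * (N * (m ^ 3 * (n * d))) + 6 * (1 * 1) + 120 * (m ^ 2 * d) := by ring
    _ ≤ 5000 * (N * (m ^ 5 * (n * d))) + 3000 * τ * (N * (m ^ 5 * (n * d))) := by
      have := Nat.mul_le_mul_left (3000 * τ) b3
      omega
    _ ≤ 5000 * (N * (m ^ 5 * (n * d))) + 5000 * τ * (N * (m ^ 5 * (n * d))) := by gcongr; norm_num
    _ = _ := by ring

theorem le_sampleSize {τ k j : ℕ} {ε γ : ℝ} (hτ : 1 ≤ τ) (hk : 1 ≤ k) (hj : 1 ≤ j) (hε : 0 < ε)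
    (hε' : ε ≤ 1) (hγ : 0 < γ) (hγ' : γ ≤ 1) :
    (k : ℝ) * j / (ε * γ) ≤ sampleSize τ k j ε γ ∧ 1 ≤ (k : ℝ) * j / (ε * γ) ∧
      (k : ℝ) ≤ (k : ℝ) * j / (ε * γ) ∧ (j : ℝ) ≤ (k : ℝ) * j / (ε * γ) := by
  have hk' : (1 : ℝ) ≤ k := by exact_mod_cast hk
  have hj' : (1 : ℝ) ≤ j := by exact_mod_cast hj
  have hτ' : (1 : ℝ) ≤ τ := by exact_mod_cast hτ
  have h0 : 0 < ε * γ := mul_pos hε hγ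
  have h1 : ε * γ ≤ 1 := mul_le_one₀ hε' hγ.le hγ'
  have h2 : (k : ℝ) ≤ (k : ℝ) * j / (ε * γ) := by
    rw [le_div_iff₀ h0]
    exact mul_le_mul le_rfl (h1.trans hj') h0.le (by linarith)
  have h3 : (j : ℝ) ≤ (k : ℝ) * j / (ε * γ) := by
    rw [le_div_iff₀ h0, mul_comm (k : ℝ)]
    exact mul_le_mul le_rfl (h1.trans hk') h0.le (by linarith)
  refine ⟨?_, hk'.trans h2, h2, h3⟩
  refine le_trans ?_ (Nat.le_ceil _)
  have e : 128 * (τ : ℝ) * k * j / ε / γ = 128 * τ * ((k : ℝ) * j / (ε * γ)) := by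
    field_simp
  rw [e]
  have h4 : (k : ℝ) * j / (ε * γ) ≤ 128 * τ * ((k : ℝ) * j / (ε * γ)) := by
    refine le_mul_of_one_le_left (by positivity) ?_
    nlinarith
  exact h4.trans (le_self_pow₀ ((hk'.trans h2).trans h4) (by norm_num))

theorem sampleSize_le {τ k j : ℕ} {ε γ : ℝ} (hτ : 1 ≤ τ) (hk : 1 ≤ k) (hj : 1 ≤ j) (hε : 0 < ε)
    (hε' : ε ≤ 1) (hγ : 0 < γ) (hγ' : γ ≤ 1) :
    (sampleSize τ k j ε γ : ℝ) ≤ 2 * (128 * τ) ^ 8 * ((k : ℝ) * j / (ε * γ)) ^ 8 := by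
  obtain ⟨-, h1, -⟩ := le_sampleSize (τ := τ) hτ hk hj hε hε' hγ hγ'
  have hτ' : (1 : ℝ) ≤ τ := by exact_mod_cast hτ
  have e : 128 * (τ : ℝ) * k * j / ε / γ = 128 * τ * ((k : ℝ) * j / (ε * γ)) := by
    field_simp
  rw [sampleSize, e]
  have h2 : 1 ≤ (128 * (τ : ℝ) * ((k : ℝ) * j / (ε * γ))) ^ 8 :=
    one_le_pow₀ (by nlinarith)
  refine (Nat.ceil_lt_add_one (by linarith)).le.trans ?_
  calc _ ≤ 2 * (128 * (τ : ℝ) * ((k : ℝ) * j / (ε * γ))) ^ 8 := by linarith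
    _ = _ := by ring

end RealRAM

/-! ### Subfamilies of maximal volume and their sampling. -/

namespace ProjectiveClustering

open Function

section Spanner

variable {V : Type*} [NormedAddCommGroup V] [InnerProductSpace ℝ V]

/-- The Gram determinant, i.e. the squared volume of a parallelotope. -/
noncomputable def gramDet {r : ℕ} (v : Fin r → V) : ℝ := (Matrix.gram ℝ v).det

theorem gramDet_nonneg {r : ℕ} (v : Fin r → V) : 0 ≤ gramDet v :=
  (Matrix.posSemidef_gram ℝ v).det_nonneg

/-- The new family arises from the old one by the identity matrix with row t replaced by ψ, whose
determinant is ψ t. The Gram matrix becomes C G Cᵀ. -/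
theorem gramDet_update {r : ℕ} (b : Fin r → V) (ψ : Fin r → ℝ) (t : Fin r) :
    gramDet (update b t (∑ s, ψ s • b s)) = ψ t ^ 2 * gramDet b := by
  set C : Matrix (Fin r) (Fin r) ℝ := (1 : Matrix (Fin r) (Fin r) ℝ).updateRow t ψ with hC
  have h1 : C.det = ψ t := by
    rw [hC, ← Matrix.cramer_transpose_apply, Matrix.transpose_one, Matrix.cramer_one]
    rfl
  have h2 : ∀ i, update b t (∑ s, ψ s • b s) i = ∑ s, C i s • b s := by
    intro i
    by_cases hi : i = t
    · subst hi
      simp [hC]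
    · simp [hC, hi, Matrix.updateRow_ne, Matrix.one_apply, ite_smul]
  have h3 : Matrix.gram ℝ (update b t (∑ s, ψ s • b s)) = C * Matrix.gram ℝ b * C.transpose := by
    ext i i'
    rw [Matrix.gram_apply, h2, h2, sum_inner, Matrix.mul_assoc, Matrix.mul_apply]
    refine Finset.sum_congr rfl fun s _ => ?_
    rw [inner_smul_left, inner_sum, Matrix.mul_apply]
    congr 1
    refine Finset.sum_congr rfl fun s' _ => ?_
    rw [inner_smul_right, Matrix.gram_apply, Matrix.transpose_apply, mul_comm]
  rw [gramDet, h3, Matrix.det_mul, Matrix.det_mul, Matrix.det_transpose, h1, gramDet]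
  ring

/-- A subfamily of full rank whose parallelotope has maximal volume. -/
structure MaxVol {M r : ℕ} (Y : Fin M → V) (T : Fin r → Fin M) : Prop where
  card : r = Module.finrank ℝ (Submodule.span ℝ (Set.range Y))
  pos : 0 < gramDet (Y ∘ T)
  max : ∀ T' : Fin r → Fin M, gramDet (Y ∘ T') ≤ gramDet (Y ∘ T)

/-- There are finitely many index families, and one of them gives a basis of the span, so the
maximum is positive. -/
theorem exists_maxVol {M : ℕ} (Y : Fin M → V) : ∃ (r : ℕ) (T : Fin r → Fin M), MaxVol Y T := by
  have : FiniteDimensional ℝ (Submodule.span ℝ (Set.range Y)) :=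
    FiniteDimensional.span_of_finite ℝ (Set.finite_range Y)
  obtain ⟨f, hf, -, hli⟩ := Submodule.exists_fun_fin_finrank_span_eq ℝ (Set.range Y)
  choose T hT using hf
  have hpos : 0 < gramDet (Y ∘ T) := by
    have : Y ∘ T = f := funext hT
    rw [this]
    exact lt_of_le_of_ne (gramDet_nonneg f)
      (Ne.symm (Matrix.det_gram_ne_zero_iff_linearIndependent.2 hli))
  have : Nonempty (Fin (Module.finrank ℝ (Submodule.span ℝ (Set.range Y))) → Fin M) := ⟨T⟩
  obtain ⟨T', hT'⟩ := Finite.exists_max fun T : Fin (Module.finrank ℝ (Submodule.span ℝ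
    (Set.range Y))) → Fin M => gramDet (Y ∘ T)
  exact ⟨_, T', rfl, hpos.trans_le (hT' T), hT'⟩

theorem MaxVol.linearIndependent {M r : ℕ} {Y : Fin M → V} {T : Fin r → Fin M} (h : MaxVol Y T) :
    LinearIndependent ℝ (Y ∘ T) :=
  Matrix.linearIndependent_of_det_gram_ne_zero h.pos.ne'

theorem MaxVol.span_eq {M r : ℕ} {Y : Fin M → V} {T : Fin r → Fin M} (h : MaxVol Y T) :
    Submodule.span ℝ (Set.range (Y ∘ T)) = Submodule.span ℝ (Set.range Y) := by
  have : FiniteDimensional ℝ (Submodule.span ℝ (Set.range Y)) :=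
    FiniteDimensional.span_of_finite ℝ (Set.finite_range Y)
  refine Submodule.eq_of_le_of_finrank_eq (Submodule.span_mono (Set.range_comp_subset_range T Y)) ?_
  rw [finrank_span_eq_card h.linearIndependent, Fintype.card_fin]
  exact h.card

/-- All vectors are combinations of those of the subfamily, with coefficients of absolute value at
most one. -/
theorem MaxVol.exists_coeff {M r : ℕ} {Y : Fin M → V} {T : Fin r → Fin M} (h : MaxVol Y T)
    (i : Fin M) : ∃ ψ : Fin r → ℝ, Y i = ∑ t, ψ t • Y (T t) ∧ ∀ t, |ψ t| ≤ 1 := by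
  have h1 : Y i ∈ Submodule.span ℝ (Set.range (Y ∘ T)) := by
    rw [h.span_eq]
    exact Submodule.subset_span ⟨i, rfl⟩
  obtain ⟨ψ, hψ⟩ := (Submodule.mem_span_range_iff_exists_fun ℝ).1 h1
  refine ⟨ψ, hψ.symm, fun t => ?_⟩
  -- Exchanging the vector number t for Y i multiplies the squared volume by ψ t²; maximality forces
  -- ψ t² ≤ 1.
  have h2 := h.max (update T t i)
  rw [Function.comp_update, ← hψ, gramDet_update] at h2
  have h3 : ψ t ^ 2 ≤ 1 := by
    have := h.pos
    by_contra! h4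
    nlinarith
  exact (sq_le_one_iff_abs_le_one _).1 h3

/-- Removing an index that `T` does not use changes neither the span nor the maximal volume. Thus
every maximal subfamily of the remaining vectors, not only `T`, is maximal for the whole family.
This is needed because the subfamily chosen for the remaining vectors may differ from the one chosen
for all. -/
theorem MaxVol.of_succAbove {M r r' : ℕ} {X : Fin (M + 1) → V} {T : Fin r → Fin (M + 1)}
    (h : MaxVol X T) {i : Fin (M + 1)} (hi : ∀ t, T t ≠ i) {T' : Fin r' → Fin M}
    (h' : MaxVol (X ∘ i.succAbove) T') : MaxVol X (i.succAbove ∘ T') := by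
  have h1 : ∀ t, ∃ s, i.succAbove s = T t := fun t => Fin.exists_succAbove_eq (hi t)
  choose S hS using h1
  have hS' : (X ∘ i.succAbove) ∘ S = X ∘ T := by
    funext t
    simp [hS]
  have h2 : Submodule.span ℝ (Set.range (X ∘ i.succAbove)) = Submodule.span ℝ (Set.range X) := by
    refine le_antisymm (Submodule.span_mono (Set.range_comp_subset_range _ X)) ?_
    rw [← h.span_eq, ← hS']
    exact Submodule.span_mono (Set.range_comp_subset_range _ _)
  have h3 : r' = r := by rw [h'.card, h2, h.card]
  subst h3
  have h4 := h'.max S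
  rw [hS'] at h4
  exact ⟨h.card, h'.pos, fun T'' => (h.max T'').trans h4⟩

/-- The index set of the violators: vectors that are not short combinations of the chosen
subfamily of `Y`. -/
noncomputable def spannerRank {M : ℕ} (Y : Fin M → V) : ℕ := (exists_maxVol Y).choose

/-- A chosen subfamily of maximal volume. -/
noncomputable def spanner {M : ℕ} (Y : Fin M → V) : Fin (spannerRank Y) → Fin M :=
  (exists_maxVol Y).choose_spec.choose

theorem spanner_maxVol {M : ℕ} (Y : Fin M → V) : MaxVol Y (spanner Y) :=
  (exists_maxVol Y).choose_spec.choose_spec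

/-- `y` is a combination of the chosen subfamily with coefficients of absolute value at most one. -/
def Spanned {M : ℕ} (Y : Fin M → V) (y : V) : Prop :=
  ∃ ψ : Fin (spannerRank Y) → ℝ, y = ∑ t, ψ t • Y (spanner Y t) ∧ ∀ t, |ψ t| ≤ 1

theorem spanned_of_notMem {M : ℕ} (X : Fin (M + 1) → V) {i : Fin (M + 1)}
    (hi : ∀ t, spanner X t ≠ i) : Spanned (X ∘ i.succAbove) (X i) :=
  ((spanner_maxVol X).of_succAbove hi (spanner_maxVol (X ∘ i.succAbove))).exists_coeff i

open scoped Classical in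
/-- Few samples are not spanned by the others. -/
theorem card_not_spanned_le {M : ℕ} (X : Fin (M + 1) → V) :
    (Finset.univ.filter fun i => ¬ Spanned (X ∘ i.succAbove) (X i)).card ≤ spannerRank X := by
  have : (Finset.univ.filter fun i => ¬ Spanned (X ∘ i.succAbove) (X i)) ⊆
      Finset.univ.image (spanner X) := by
    intro i hi
    rw [Finset.mem_filter] at hi
    by_contra h
    refine hi.2 (spanned_of_notMem X fun t ht => h ?_)
    rw [← ht]
    exact Finset.mem_image_of_mem _ (Finset.mem_univ t)
  refine (Finset.card_le_card this).trans (Finset.card_image_le.trans ?_)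
  simp

open scoped Classical in
/-- Double counting: the average number of elements that are not spanned by `M` random ones. -/
theorem sum_card_not_spanned_le {ι : Type*} [Fintype ι] (h : ι → V) (M J : ℕ)
    (hJ : ∀ Y : Fin (M + 1) → ι, spannerRank (h ∘ Y) ≤ J) :
    (M + 1) * ∑ Y : Fin M → ι, (Finset.univ.filter fun x => ¬ Spanned (h ∘ Y) (h x)).card ≤
      J * Fintype.card ι ^ (M + 1) := by
  -- Symmetry of the samples: a position i of an (M+1)-tuple, tested against the other M,
  -- contributes the same total for every i.
  have h1 : ∀ i : Fin (M + 1), ∑ X : Fin (M + 1) → ι,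
      (if ¬ Spanned ((h ∘ X) ∘ i.succAbove) ((h ∘ X) i) then 1 else 0) =
      ∑ Y : Fin M → ι, (Finset.univ.filter fun x => ¬ Spanned (h ∘ Y) (h x)).card := by
    intro i
    rw [← (Fin.insertNthEquiv (fun _ => ι) i).sum_comp, Fintype.sum_prod_type, Finset.sum_comm]
    refine Finset.sum_congr rfl fun Y _ => ?_
    rw [Finset.card_filter]
    refine Finset.sum_congr rfl fun x _ => ?_
    have e1 : (h ∘ (Fin.insertNthEquiv (fun _ => ι) i) (x, Y)) ∘ i.succAbove = h ∘ Y := by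
      funext s
      simp [Fin.insertNthEquiv]
    have e2 : (h ∘ (Fin.insertNthEquiv (fun _ => ι) i) (x, Y)) i = h x := by
      simp [Fin.insertNthEquiv]
    rw [e1, e2]
  have h2 : (M + 1) * ∑ Y : Fin M → ι, (Finset.univ.filter fun x => ¬ Spanned (h ∘ Y) (h x)).card =
      ∑ i : Fin (M + 1), ∑ X : Fin (M + 1) → ι,
      (if ¬ Spanned ((h ∘ X) ∘ i.succAbove) ((h ∘ X) i) then 1 else 0) := by
    rw [Finset.sum_congr rfl fun i _ => h1 i]
    simp
  rw [h2, Finset.sum_comm]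
  calc _ ≤ ∑ _X : Fin (M + 1) → ι, J := by
        refine Finset.sum_le_sum fun X _ => ?_
        rw [← Finset.card_filter]
        exact (card_not_spanned_le (h ∘ X)).trans (hJ X)
    _ = _ := by simp [mul_comm]

open scoped Classical in
/-- At least half of all `M`-tuples span all but a small fraction of the elements. -/
theorem half_le_card_spanning {ι : Type*} [Fintype ι] (h : ι → V) (M J : ℕ) {b : ℝ}
    (hJ : ∀ Y : Fin (M + 1) → ι, spannerRank (h ∘ Y) ≤ J)
    (hb : 2 * J * (Fintype.card ι : ℝ) ≤ b * (M + 1)) (hι : 0 < Fintype.card ι) :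
    (Fintype.card ι : ℝ) ^ M / 2 ≤ (Finset.univ.filter fun Y : Fin M → ι =>
      ((Finset.univ.filter fun x => ¬ Spanned (h ∘ Y) (h x)).card : ℝ) ≤ b).card := by
  have h1 := sum_card_not_spanned_le h M J hJ
  set c : (Fin M → ι) → ℕ := fun Y => (Finset.univ.filter fun x => ¬ Spanned (h ∘ Y) (h x)).card
    with hc
  set A := Finset.univ.filter fun Y : Fin M → ι => (c Y : ℝ) ≤ b with hA
  set B := Finset.univ.filter fun Y : Fin M → ι => ¬ (c Y : ℝ) ≤ b with hB
  have h2 : (A.card : ℝ) + B.card = (Fintype.card ι : ℝ) ^ M := by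
    have := Finset.card_filter_add_card_filter_not (s := (Finset.univ : Finset (Fin M → ι)))
      (fun Y => (c Y : ℝ) ≤ b)
    rw [Finset.card_univ, Fintype.card_fun, Fintype.card_fin] at this
    exact_mod_cast this
  have h4 : ((M : ℝ) + 1) * ∑ Y : Fin M → ι, (c Y : ℝ) ≤ J * (Fintype.card ι : ℝ) ^ (M + 1) := by
    exact_mod_cast h1
  have hι' : (0 : ℝ) < Fintype.card ι := by exact_mod_cast hι
  -- Markov's inequality: if more than half of the tuples left more than b elements unspanned, the
  -- total would exceed the double counting bound.
  by_contra! hlt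
  have hBgt : (Fintype.card ι : ℝ) ^ M / 2 < B.card := by linarith
  have hpos : (0 : ℝ) < (Fintype.card ι : ℝ) ^ M := by positivity
  have hM : (0 : ℝ) < (M : ℝ) + 1 := by positivity
  have hBne : B.Nonempty := Finset.card_pos.1 (by
    have : (0 : ℝ) < B.card := by linarith
    exact_mod_cast this)
  have h3 : B.card * b < ∑ Y : Fin M → ι, (c Y : ℝ) := by
    calc B.card * b = ∑ Y ∈ B, b := by simp
      _ < ∑ Y ∈ B, (c Y : ℝ) := Finset.sum_lt_sum_of_nonempty hBne fun Y hY =>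
          not_le.1 (Finset.mem_filter.1 hY).2
      _ ≤ _ := Finset.sum_le_univ_sum_of_nonneg fun Y => by positivity
  have h0 : (0 : ℝ) ≤ J := by positivity
  have h5 : B.card * (2 * J * (Fintype.card ι : ℝ)) ≤ B.card * (b * (M + 1)) := by gcongr
  have h6 : (M + 1) * (B.card * b) < (M + 1) * ∑ Y : Fin M → ι, (c Y : ℝ) := by gcongr
  have h7 : J * (Fintype.card ι : ℝ) * ((Fintype.card ι : ℝ) ^ M / 2) ≤
      J * (Fintype.card ι : ℝ) * B.card := by gcongr
  rw [pow_succ] at h4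
  nlinarith

end Spanner

end ProjectiveClustering

/-! ### Gradient descent on the weights. -/

namespace ProjectiveClustering

open Function

section Descent

variable {E : Type*} [NormedAddCommGroup E] [InnerProductSpace ℝ E] {ι : Type*} [Fintype ι]
  {J : ℕ}

/-- `J` affine combinations of the points `p x`, `x ∈ Q ∩ S`, that have the values `b t`, with
coefficients bounded by `B`. -/
structure IsWeight (Q : Finset ι) (p : ι → E) (b : Fin J → E) (S : Set ι) (B : ℝ)
    (w : Fin J → ι → ℝ) : Prop where
  sum : ∀ t, ∑ x, w t x = 1
  comb : ∀ t, ∑ x, w t x • p x = b t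
  supp : ∀ t x, w t x ≠ 0 → x ∈ Q ∧ x ∈ S
  bound : ∀ t x, |w t x| ≤ B

/-- The combination of the errors `u x`. -/
noncomputable def errComb (u : ι → E) (w : Fin J → ι → ℝ) (t : Fin J) : E := ∑ x, w t x • u x

/-- The total squared error. -/
noncomputable def errSq (u : ι → E) (w : Fin J → ι → ℝ) : ℝ := ∑ t, ‖errComb u w t‖ ^ 2

/-- The error of the approximation of the point `x`. -/
noncomputable def errAt (u : ι → E) (ψ : ι → Fin J → ℝ) (w : Fin J → ι → ℝ) (x : ι) : E :=
  ∑ t, ψ x t • errComb u w t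

open scoped Classical in
/-- The elements that are approximated badly. -/
noncomputable def badSet (Q : Finset ι) (u : ι → E) (ψ : ι → Fin J → ℝ) (a ρ : ℝ)
    (w : Fin J → ι → ℝ) : Finset ι :=
  Q.filter fun x => (1 + a) * ‖u x‖ + a * ρ < ‖u x - errAt u ψ w x‖

open scoped Classical in
/-- A step of gradient descent. -/
noncomputable def descend (ψ : ι → Fin J → ℝ) (η : ℝ) (w : Fin J → ι → ℝ) (x : ι) (t : Fin J)
    (y : ι) : ℝ :=
  w t y - η * ψ x t * (∑ s, ψ x s * w s y - if y = x then 1 else 0)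

-- The step is linear in `f`; with values 1, p and u it shows the effect on the total weight, on the
-- represented point and on the error.
open scoped Classical in
theorem sum_descend_smul (f : ι → E) (ψ : ι → Fin J → ℝ) (η : ℝ) (w : Fin J → ι → ℝ) (x : ι)
    (t : Fin J) : ∑ y, descend ψ η w x t y • f y =
      ∑ y, w t y • f y - (η * ψ x t) • (∑ s, ψ x s • ∑ y, w s y • f y - f x) := by
  simp only [descend, sub_smul, Finset.sum_sub_distrib, mul_smul, ← Finset.smul_sum]
  congr 4
  · simp only [Finset.sum_smul, Finset.smul_sum, mul_smul]
    rw [Finset.sum_comm]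
  · simp [ite_smul]

/-- With h t = `errComb u w t` and g = ∑ ψ t • h t, the step moves along the gradient of ‖g - u‖²/2,
so the total changes by -2η⟨g, g-u⟩ + η²(∑ψ²)‖g-u‖². A bad point has ‖g-u‖ well above ‖u‖, which
makes ⟨g, g-u⟩ at least (a/2)‖g-u‖². With η = a/(2J) and ∑ψ² ≤ J the quadratic term costs at most
half of this gain. -/
theorem errSq_descend_le {u : ι → E} {ψ : ι → Fin J → ℝ} {a ρ : ℝ} {w : Fin J → ι → ℝ} {x : ι}
    (ha : 0 < a) (ha' : a ≤ 1) (hρ : 0 ≤ ρ) (hJ : 1 ≤ J) (hψ : ∀ t, |ψ x t| ≤ 1)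
    (hx : (1 + a) * ‖u x‖ + a * ρ < ‖u x - errAt u ψ w x‖) :
    errSq u (descend ψ (a / (2 * J)) w x) ≤ errSq u w - a ^ 4 / (4 * J) * ρ ^ 2 := by
  set η := a / (2 * J) with hη
  set g := errAt u ψ w x with hg
  have hJ' : (1 : ℝ) ≤ J := by exact_mod_cast hJ
  have hη0 : 0 < η := by positivity
  have h1 : ∀ t, errComb u (descend ψ η w x) t = errComb u w t - (η * ψ x t) • (g - u x) := by
    intro t
    rw [errComb, sum_descend_smul]
    rfl
  have h2 : errSq u (descend ψ η w x) = errSq u w - 2 * η * inner ℝ g (g - u x) +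
      η ^ 2 * (∑ t, ψ x t ^ 2) * ‖g - u x‖ ^ 2 := by
    have h3 : inner ℝ g (g - u x) = ∑ t, ψ x t * inner ℝ (errComb u w t) (g - u x) := by
      have h0 : ∀ v : E, inner ℝ g v = ∑ t, ψ x t * inner ℝ (errComb u w t) v := fun v => by
        rw [hg, errAt, sum_inner]
        refine Finset.sum_congr rfl fun t _ => ?_
        rw [inner_smul_left]
        rfl
      exact h0 _
    rw [h3, errSq, errSq, Finset.mul_sum, Finset.mul_sum, Finset.sum_mul, ← Finset.sum_sub_distrib,
      ← Finset.sum_add_distrib]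
    refine Finset.sum_congr rfl fun t _ => ?_
    rw [h1, norm_sub_sq_real, inner_smul_right, norm_smul, mul_pow, Real.norm_eq_abs, sq_abs]
    ring
  have h4 : ∑ t, ψ x t ^ 2 ≤ J := by
    calc ∑ t, ψ x t ^ 2 ≤ ∑ _t : Fin J, (1 : ℝ) :=
          Finset.sum_le_sum fun t _ => (sq_le_one_iff_abs_le_one _).2 (hψ t)
      _ = J := by simp
  have h5 : inner ℝ g (g - u x) = ‖g - u x‖ ^ 2 + inner ℝ (u x) (g - u x) := by
    rw [← real_inner_self_eq_norm_sq, ← inner_add_left]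
    congr 1
    abel
  have h6 : -(‖u x‖ * ‖g - u x‖) ≤ inner ℝ (u x) (g - u x) :=
    neg_le_of_abs_le (abs_real_inner_le_norm _ _)
  rw [norm_sub_rev] at hx
  set v := ‖g - u x‖ with hv
  have hu0 : 0 ≤ ‖u x‖ := norm_nonneg _
  have hv0 : 0 ≤ v := norm_nonneg _
  -- This uses (1 - a/2)(1 + a) ≥ 1 for 0 ≤ a ≤ 1.
  have h7 : a / 2 * v ≤ v - ‖u x‖ := by
    have : 0 ≤ a * ρ := by positivity
    nlinarith [mul_nonneg (mul_nonneg ha.le (sub_nonneg.2 ha')) hu0,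
      mul_nonneg (show 0 ≤ 1 - a / 2 by linarith) (show 0 ≤ v - (1 + a) * ‖u x‖ by linarith)]
  have h8 : a * ρ ≤ v := by nlinarith [mul_nonneg ha.le hu0]
  have h9 : a / 2 * v ^ 2 ≤ inner ℝ g (g - u x) := by
    rw [h5]
    nlinarith
  -- The gain is at least ηa·v², the loss at most ηa·v²/2. The difference is bounded below through v
  -- ≥ aρ.
  have h10 : η ^ 2 * (∑ t, ψ x t ^ 2) * v ^ 2 ≤ η ^ 2 * J * v ^ 2 := by gcongr
  have h11 : η ^ 2 * J = η * a / 2 := by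
    rw [hη]
    field_simp
  have h12 : η * a * v ^ 2 ≤ 2 * η * inner ℝ g (g - u x) := by nlinarith
  have h13 : a ^ 4 / (4 * J) * ρ ^ 2 ≤ η * a / 2 * v ^ 2 := by
    have e : a ^ 4 / (4 * J) * ρ ^ 2 = η * a / 2 * (a * ρ) ^ 2 := by
      rw [hη]
      field_simp
      ring
    rw [e]
    gcongr
  rw [h11] at h10
  rw [h2]
  linarith

-- The point mass at x and the combination ∑ ψ s · w s both have total 1 and represent p x. Moving
-- along their difference keeps the totals and the represented points b t. The bound on the weights
-- at most doubles, plus 1, since ηJ ≤ 1 and η ≤ 1.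
open scoped Classical in
theorem IsWeight.descend {Q : Finset ι} {p : ι → E} {b : Fin J → E} {S : Set ι} {B : ℝ}
    {w : Fin J → ι → ℝ} (h : IsWeight Q p b S B w) {ψ : ι → Fin J → ℝ} {x : ι} {η : ℝ}
    (hη : 0 ≤ η) (hη' : η * J ≤ 1) (hη2 : η ≤ 1) (hB : 0 ≤ B) (hx : x ∈ Q)
    (hψ : ∀ t, |ψ x t| ≤ 1) (hψ1 : ∑ t, ψ x t = 1) (hp : p x = ∑ t, ψ x t • b t) :
    IsWeight Q p b (S ∪ {x}) (2 * B + 1) (descend ψ η w x) := by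
  constructor
  · intro t
    have := sum_descend_smul (fun _ => (1 : ℝ)) ψ η w x t
    simp only [smul_eq_mul, mul_one, h.sum, hψ1, sub_self, mul_zero, sub_zero] at this
    exact this
  · intro t
    rw [sum_descend_smul]
    simp only [h.comb]
    rw [← hp, sub_self, smul_zero, sub_zero]
  · intro t y hy
    by_cases hyx : y = x
    · subst hyx
      exact ⟨hx, Or.inr rfl⟩
    · by_contra hn
      have h0 : ∀ s, w s y = 0 := by
        intro s
        by_contra h1
        exact hn ⟨(h.supp s y h1).1, Or.inl (h.supp s y h1).2⟩
      exact hy (by simp [ProjectiveClustering.descend, h0, hyx])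
  · intro t y
    have h1 : |∑ s, ψ x s * w s y| ≤ J * B := by
      refine (Finset.abs_sum_le_sum_abs _ _).trans ?_
      calc ∑ s, |ψ x s * w s y| ≤ ∑ _s : Fin J, B := by
            refine Finset.sum_le_sum fun s _ => ?_
            rw [abs_mul]
            exact (mul_le_mul (hψ s) (h.bound s y) (abs_nonneg _) zero_le_one).trans (by simp)
        _ = J * B := by simp
    have h2 : |∑ s, ψ x s * w s y - if y = x then 1 else 0| ≤ J * B + 1 := by
      refine (abs_sub _ _).trans (add_le_add h1 ?_)
      split_ifs <;> simp
    have h3 : |η * ψ x t * (∑ s, ψ x s * w s y - if y = x then 1 else 0)| ≤ B + 1 := by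
      rw [abs_mul, abs_mul, abs_of_nonneg hη]
      calc η * |ψ x t| * _ ≤ η * 1 * (J * B + 1) := by
            gcongr
            exact hψ t
        _ = η * J * B + η := by ring
        _ ≤ 1 * B + 1 := by gcongr
        _ = B + 1 := by ring
    refine (abs_sub _ _).trans ?_
    linarith [h.bound t y]

theorem IsWeight.mono {Q : Finset ι} {p : ι → E} {b : Fin J → E} {S S' : Set ι} {B B' : ℝ}
    {w : Fin J → ι → ℝ} (h : IsWeight Q p b S B w) (hS : S ⊆ S') (hB : B ≤ B') :
    IsWeight Q p b S' B' w :=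
  ⟨h.sum, h.comb, fun t x hx => ⟨(h.supp t x hx).1, hS (h.supp t x hx).2⟩,
    fun t x => (h.bound t x).trans hB⟩

theorem badSet_eq_empty {Q : Finset ι} {u : ι → E} {ψ : ι → Fin J → ℝ} {a ρ : ℝ}
    {w : Fin J → ι → ℝ} (ha : 0 < a) (hρ : 0 ≤ ρ) (h : errSq u w ≤ 0) :
    badSet Q u ψ a ρ w = ∅ := by
  have h0 : ∀ t, errComb u w t = 0 := by
    intro t
    have h2 := Finset.single_le_sum (f := fun t => ‖errComb u w t‖ ^ 2)
      (fun t _ => by positivity) (Finset.mem_univ t)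
    have h3 : ‖errComb u w t‖ ^ 2 ≤ 0 := h2.trans h
    exact norm_eq_zero.1 (pow_eq_zero_iff (two_ne_zero) |>.1 (le_antisymm h3 (by positivity)))
  refine Finset.filter_false_of_mem fun x _ => ?_
  rw [errAt]
  simp only [h0, smul_zero, Finset.sum_const_zero, sub_zero, not_lt]
  nlinarith [norm_nonneg (u x), mul_nonneg ha.le hρ, mul_nonneg ha.le (norm_nonneg (u x))]

open scoped Classical in
theorem card_filter_cons {N : ℕ} (p : (Fin (N + 1) → ι) → Prop) :
    (Finset.univ.filter p).card =
      ∑ x, (Finset.univ.filter fun Z : Fin N → ι => p (Fin.cons x Z)).card := by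
  simp only [Finset.card_filter]
  rw [← (Fin.consEquiv fun _ => ι).sum_comp, Fintype.sum_prod_type]
  rfl

open scoped Classical in
/-- Gradient descent with `N` random samples ends, with a lower bound for the number of successful
samples, in weights with few badly approximated elements. -/
theorem descent_count {Q : Finset ι} {p u : ι → E} {b : Fin J → E} {ψ : ι → Fin J → ℝ} {a ρ c : ℝ}
    (ha : 0 < a) (ha' : a ≤ 1) (hρ : 0 ≤ ρ) (hJ : 1 ≤ J) (hψ : ∀ x ∈ Q, ∀ t, |ψ x t| ≤ 1)
    (hψ1 : ∀ x ∈ Q, ∑ t, ψ x t = 1) (hp : ∀ x ∈ Q, p x = ∑ t, ψ x t • b t) (hc : 0 ≤ c)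
    (hc' : c ≤ Fintype.card ι) (N r e : ℕ) (hr : r ≤ N) (S : Set ι) (w : Fin J → ι → ℝ)
    (hw : IsWeight Q p b S (2 ^ e - 1) w) (hΦ : errSq u w ≤ r * (a ^ 4 / (4 * J) * ρ ^ 2)) :
    c ^ N ≤ (Finset.univ.filter fun X : Fin N → ι => ∃ w' : Fin J → ι → ℝ,
      IsWeight Q p b (S ∪ Set.range X) (2 ^ (e + N) - 1) w' ∧ errSq u w' ≤ errSq u w ∧
      ((badSet Q u ψ a ρ w').card : ℝ) ≤ c).card := by
  have hpow : ∀ N : ℕ, (2 : ℝ) ^ e - 1 ≤ 2 ^ (e + N) - 1 := fun N =>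
    sub_le_sub_right (pow_le_pow_right₀ (by norm_num) (by omega)) 1
  induction N generalizing r e S w with
  | zero =>
    obtain rfl : r = 0 := by omega
    have hbad : badSet Q u ψ a ρ w = ∅ := badSet_eq_empty ha hρ (by simpa using hΦ)
    rw [pow_zero, Nat.one_le_cast, Nat.one_le_iff_ne_zero, ← Nat.pos_iff_ne_zero, Finset.card_pos]
    refine ⟨fun i => i.elim0, Finset.mem_filter.2 ⟨Finset.mem_univ _, w,
      hw.mono Set.subset_union_left le_rfl, le_rfl, by rw [hbad]; simpa using hc⟩⟩
  | succ N ih =>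
    -- If few points are bad, all continuations are successful and c ≤ |ι| suffices. Otherwise more
    -- than c choices of the next sample permit a descent step. The number r counts the steps that
    -- the remaining energy can pay for.
    by_cases hbad : ((badSet Q u ψ a ρ w).card : ℝ) ≤ c
    · rw [Finset.filter_true_of_mem fun X _ => ⟨w, hw.mono Set.subset_union_left (hpow _), le_rfl,
        hbad⟩, Finset.card_univ, Fintype.card_fun, Fintype.card_fin]
      push_cast
      gcongr
    have hr0 : r ≠ 0 := by
      rintro rfl
      rw [badSet_eq_empty ha hρ (by simpa using hΦ)] at hbad
      exact hbad (by simpa using hc)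
    have hJ' : (1 : ℝ) ≤ J := by exact_mod_cast hJ
    rw [card_filter_cons]
    have key : ∀ x ∈ badSet Q u ψ a ρ w, c ^ N ≤ ((Finset.univ.filter fun Z : Fin N → ι =>
        ∃ w' : Fin J → ι → ℝ,
        IsWeight Q p b (S ∪ Set.range (Fin.cons x Z : Fin (N + 1) → ι)) (2 ^ (e + (N + 1)) - 1) w' ∧
        errSq u w' ≤ errSq u w ∧ ((badSet Q u ψ a ρ w').card : ℝ) ≤ c).card : ℝ) := by
      intro x hx
      rw [badSet, Finset.mem_filter] at hx
      obtain ⟨hxQ, hx⟩ := hx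
      have hd := errSq_descend_le ha ha' hρ hJ (hψ x hxQ) hx
      have hη : a / (2 * J) ≤ 1 / 2 := by
        rw [div_le_div_iff₀ (by positivity) (by norm_num)]
        nlinarith
      have hη2 : a / (2 * J) * J ≤ 1 := by
        rw [div_mul_eq_mul_div, div_le_one (by positivity)]
        nlinarith
      have hpos : 0 ≤ a ^ 4 / (4 * J) * ρ ^ 2 := by positivity
      have hw1 := hw.descend (ψ := ψ) (η := a / (2 * J)) (by positivity) hη2 (by linarith)
        (sub_nonneg.2 (one_le_pow₀ (by norm_num))) hxQ (hψ x hxQ) (hψ1 x hxQ) (hp x hxQ)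
      have hc1 : ((r - 1 : ℕ) : ℝ) = r - 1 := by
        rw [Nat.cast_sub (by omega), Nat.cast_one]
      -- The bound 2^e - 1 becomes 2(2^e - 1) + 1 = 2^(e+1) - 1.
      have := ih (r - 1) (e + 1) (by omega) (S ∪ {x}) _
        (hw1.mono le_rfl (by rw [pow_succ]; linarith)) (by rw [hc1]; linarith)
        fun N => sub_le_sub_right (pow_le_pow_right₀ (by norm_num) (by omega)) 1
      refine this.trans ?_
      refine Nat.cast_le.2 (Finset.card_le_card fun Z hZ => ?_)
      rw [Finset.mem_filter] at hZ ⊢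
      obtain ⟨-, w', k1, k2, k3⟩ := hZ
      refine ⟨Finset.mem_univ _, w', k1.mono ?_ (by rw [add_assoc, add_comm 1 N]), by linarith, k3⟩
      rw [Fin.range_cons, Set.union_assoc]
      rfl
    push_cast
    calc c ^ (N + 1) = c * c ^ N := by ring
      _ ≤ (badSet Q u ψ a ρ w).card * c ^ N := by
          gcongr
          exact (not_le.1 hbad).le
      _ = ∑ x ∈ badSet Q u ψ a ρ w, c ^ N := by simp
      _ ≤ _ := Finset.sum_le_sum key
      _ ≤ _ := Finset.sum_le_univ_sum_of_nonneg fun x => by positivity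

end Descent

end ProjectiveClustering

/-! ### Rounding the weights to a grid. -/

namespace ProjectiveClustering

open Function

section Rounding

/-- Round every Dω i down and add the integer deficit r, which lies between 0 and m, to a single
coordinate with nonzero weight. The sum is then exact and zero weights stay zero. Flooring and
correction each cost at most r in total. -/
theorem exists_int_round {m : ℕ} (ω : Fin m → ℝ) (D : ℕ) (h : ∑ i, ω i = 1) :
    ∃ W : Fin m → ℤ, ∑ i, W i = D ∧ (∀ i, ω i = 0 → W i = 0) ∧
      ∑ i, |(W i : ℝ) - D * ω i| ≤ 2 * m := by
  obtain ⟨i₀, hi₀⟩ : ∃ i, ω i ≠ 0 := by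
    by_contra! h0
    simp [h0] at h
  set r : ℤ := D - ∑ i, ⌊D * ω i⌋ with hr
  have hr' : (r : ℝ) = ∑ i, Int.fract (D * ω i) := by
    have : ∀ i, Int.fract (D * ω i) = D * ω i - ⌊D * ω i⌋ := fun i => rfl
    rw [Finset.sum_congr rfl fun i _ => this i, Finset.sum_sub_distrib, ← Finset.mul_sum, h, hr]
    push_cast
    ring
  have hr0 : (0 : ℝ) ≤ r := by
    rw [hr']
    exact Finset.sum_nonneg fun i _ => Int.fract_nonneg _
  have hrm : (r : ℝ) ≤ m := by
    rw [hr']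
    calc _ ≤ ∑ _i : Fin m, (1 : ℝ) := Finset.sum_le_sum fun i _ => (Int.fract_lt_one _).le
      _ = m := by simp
  refine ⟨fun i => ⌊D * ω i⌋ + if i = i₀ then r else 0, ?_, ?_, ?_⟩
  · rw [Finset.sum_add_distrib]
    simp [hr]
  · intro i hi
    have : i ≠ i₀ := by
      rintro rfl
      exact hi₀ hi
    simp [hi, this]
  · calc _ ≤ ∑ i, (Int.fract (D * ω i) + if i = i₀ then (r : ℝ) else 0) := by
          refine Finset.sum_le_sum fun i _ => ?_
          have h1 : ((⌊D * ω i⌋ + if i = i₀ then r else 0 : ℤ) : ℝ) - D * ω i =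
              (if i = i₀ then (r : ℝ) else 0) - Int.fract (D * ω i) := by
            rw [Int.fract]
            push_cast
            ring
          rw [h1]
          refine (abs_sub _ _).trans (le_of_eq ?_)
          rw [abs_of_nonneg (Int.fract_nonneg (D * ω i)), abs_of_nonneg, add_comm]
          split_ifs
          · exact hr0
          · exact le_rfl
      _ = r + r := by
          rw [Finset.sum_add_distrib, ← hr']
          simp
      _ ≤ 2 * m := by linarith

/-- A perturbation of the identity matrix can be solved for. -/
theorem exists_solve_perturbed {J : ℕ} (e : Fin J → Fin J → ℝ) {κ : ℝ} (hκ : J * κ ≤ 1 / 2)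
    (he : ∀ t s, |e t s| ≤ κ) (ψ : Fin J → ℝ) (hψ : ∀ t, |ψ t| ≤ 1) :
    ∃ l : Fin J → ℝ, (∀ s, l s + ∑ t, l t * e t s = ψ s) ∧ (∀ s, |l s| ≤ 2) ∧
      ∀ s, |l s - ψ s| ≤ 2 * (J * κ) := by
  let L : (Fin J → ℝ) →ₗ[ℝ] (Fin J → ℝ) :=
    { toFun := fun l s => l s + ∑ t, l t * e t s
      map_add' := fun l l' => by
        funext s
        simp only [Pi.add_apply, add_mul, Finset.sum_add_distrib]
        ring
      map_smul' := fun c l => by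
        funext s
        simp only [Pi.smul_apply, smul_eq_mul, RingHom.id_apply, mul_add, Finset.mul_sum, mul_assoc] }
  have hbd : ∀ (l : Fin J → ℝ) (s : Fin J), |∑ t, l t * e t s| ≤ J * κ * ‖l‖ := by
    intro l s
    refine (Finset.abs_sum_le_sum_abs _ _).trans ?_
    calc ∑ t, |l t * e t s| ≤ ∑ _t : Fin J, ‖l‖ * κ := by
          refine Finset.sum_le_sum fun t _ => ?_
          rw [abs_mul]
          exact mul_le_mul (norm_le_pi_norm l t) (he t s) (abs_nonneg _) (norm_nonneg _)
      _ = J * κ * ‖l‖ := by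
          simp
          ring
  -- In the sup norm the perturbation has norm at most Jκ ≤ 1/2. Hence the map is injective, and by
  -- finite dimension surjective.
  have hn : ∀ l : Fin J → ℝ, ‖l‖ ≤ ‖L l‖ + 1 / 2 * ‖l‖ := by
    intro l
    refine (pi_norm_le_iff_of_nonneg (by positivity)).2 fun s => ?_
    have h1 : l s = L l s - ∑ t, l t * e t s := by
      simp [L]
    rw [h1]
    refine (norm_sub_le _ _).trans (add_le_add (norm_le_pi_norm _ _) ?_)
    exact (hbd l s).trans (by gcongr)
  have hinj : Injective L := by
    rw [← LinearMap.ker_eq_bot, LinearMap.ker_eq_bot']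
    intro l hl
    have := hn l
    rw [hl, norm_zero] at this
    exact norm_le_zero_iff.1 (by linarith)
  obtain ⟨l, hl⟩ := LinearMap.injective_iff_surjective.1 hinj ψ
  have h1 : ‖l‖ ≤ 2 := by
    have h2 := hn l
    have h3 : ‖L l‖ ≤ 1 := by
      rw [hl]
      exact (pi_norm_le_iff_of_nonneg zero_le_one).2 hψ
    linarith
  refine ⟨l, fun s => congrFun hl s, fun s => (norm_le_pi_norm l s).trans h1, fun s => ?_⟩
  have h2 : l s - ψ s = - ∑ t, l t * e t s := by
    rw [← congrFun hl s]
    simp [L]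
  rw [h2, abs_neg]
  refine (hbd l s).trans ?_
  rcases Nat.eq_zero_or_pos J with rfl | hJ
  · exact s.elim0
  have hκ0 : 0 ≤ κ := (abs_nonneg _).trans (he s s)
  have : 0 ≤ J * κ := by positivity
  nlinarith

variable {ι : Type*} [Fintype ι]

open scoped Classical in
/-- Transfer of weights from elements to samples: the weight goes to the first occurrence. -/
noncomputable def pullWeight {m : ℕ} (X : Fin m → ι) (f : ι → ℝ) (i : Fin m) : ℝ :=
  if ∀ i', i' < i → X i' ≠ X i then f (X i) else 0

/-- The first occurrences are in bijection with the distinct sampled elements, so an element sampled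
repeatedly carries its weight once. -/
theorem sum_pullWeight {F : Type*} [AddCommGroup F] [Module ℝ F] {m : ℕ} (X : Fin m → ι)
    {w : ι → ℝ} (hw : ∀ v, w v ≠ 0 → v ∈ Set.range X) (f : ι → F) :
    ∑ i, pullWeight X w i • f (X i) = ∑ v, w v • f v := by
  classical
  set I := Finset.univ.filter fun i => ∀ i', i' < i → X i' ≠ X i with hI
  have h1 : ∑ i, pullWeight X w i • f (X i) = ∑ i ∈ I, w (X i) • f (X i) := by
    rw [hI, Finset.sum_filter]
    refine Finset.sum_congr rfl fun i _ => ?_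
    rw [pullWeight, ite_smul, zero_smul]
  have h2 : Set.InjOn X I := by
    intro i hi i' hi' h
    simp only [hI, Finset.coe_filter, Finset.mem_univ, true_and, Set.mem_ofPred_eq] at hi hi'
    rcases lt_trichotomy i i' with h3 | h3 | h3
    · exact absurd h (hi' i h3)
    · exact h3
    · exact absurd h.symm (hi i' h3)
  rw [h1, ← Finset.sum_image (f := fun v => w v • f v) h2]
  refine Finset.sum_subset (Finset.subset_univ _) fun v _ hv => ?_
  by_cases h0 : w v = 0
  · rw [h0, zero_smul]
  exfalso
  obtain ⟨i, hi⟩ := hw v h0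
  have hne : (Finset.univ.filter fun i => X i = v).Nonempty := ⟨i, by simp [hi]⟩
  refine hv (Finset.mem_image.2 ⟨_, ?_, (Finset.mem_filter.1 (Finset.min'_mem _ hne)).2⟩)
  refine Finset.mem_filter.2 ⟨Finset.mem_univ _, fun i' hi' h => ?_⟩
  have h3 := (Finset.mem_filter.1 (Finset.min'_mem _ hne)).2
  exact absurd (Finset.min'_le _ i' (Finset.mem_filter.2 ⟨Finset.mem_univ _, h.trans h3⟩))
    (not_le.2 hi')

variable {E : Type*} [NormedAddCommGroup E] [InnerProductSpace ℝ E] {J : ℕ}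

/-- The weights can be rounded to a grid. -/
theorem IsWeight.round {Q : Finset ι} {p u : ι → E} {b : Fin J → E} {ψ : ι → Fin J → ℝ} {ρ B : ℝ}
    {m D : ℕ} {X : Fin m → ι} {w : Fin J → ι → ℝ} (hw : IsWeight Q p b (Set.range X) B w)
    (hB : 0 ≤ B) (hρ : 0 ≤ ρ) (hJ : 1 ≤ J) (hψ : ∀ x ∈ Q, ∀ t, |ψ x t| ≤ 1)
    (hψ1 : ∀ x ∈ Q, ∑ t, ψ x t = 1) (hp : ∀ x ∈ Q, p x = ∑ t, ψ x t • b t)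
    (hu : ∀ x ∈ Q, ‖u x‖ ≤ ρ) (hΦ : errSq u w ≤ J * ρ ^ 2) (hD : 0 < D)
    (hDm : J * (2 * m / D : ℝ) ≤ 1 / 2) :
    ∃ W : Fin J → Fin m → ℤ, (∀ t, ∑ i, W t i = D) ∧ (∀ t i, |(W t i : ℝ)| ≤ D * B + 2 * m) ∧
      ∀ x ∈ Q, ∃ l : Fin J → ℝ, ∑ t, l t = 1 ∧
        ‖p x + u x - ∑ t, l t • ∑ i, ((W t i : ℝ) / D) • (p (X i) + u (X i))‖ ≤
          ‖u x - errAt u ψ w x‖ + 4 * J ^ 3 * (2 * m / D) * ρ := by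
  have hD' : (0 : ℝ) < D := by exact_mod_cast hD
  have hJ' : (1 : ℝ) ≤ J := by exact_mod_cast hJ
  set κ : ℝ := 2 * m / D with hκ
  have hκ0 : 0 ≤ κ := by positivity
  set ω : Fin J → Fin m → ℝ := fun t => pullWeight X (w t) with hω
  have hωs : ∀ t, ∑ i, ω t i = 1 := by
    intro t
    have := sum_pullWeight X (w := w t) (fun v hv => (hw.supp t v hv).2) fun _ => (1 : ℝ)
    simpa [hw.sum t] using this
  have hωQ : ∀ t i, ω t i ≠ 0 → X i ∈ Q := by
    intro t i hi
    refine (hw.supp t (X i) fun h => hi ?_).1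
    simp only [hω, pullWeight, h, ite_self]
  have hωB : ∀ t i, |ω t i| ≤ B := by
    intro t i
    simp only [hω, pullWeight]
    split_ifs
    · exact hw.bound t _
    · simpa using hB
  choose W hW1 hW2 hW3 using fun t => exists_int_round (ω t) D (hωs t)
  set e : Fin J → Fin m → ℝ := fun t i => (W t i : ℝ) / D - ω t i with he
  have heQ : ∀ t i, X i ∉ Q → e t i = 0 := by
    intro t i hi
    have h0 : ω t i = 0 := by
      by_contra h
      exact hi (hωQ t i h)
    simp [he, h0, hW2 t i h0]
  have heabs : ∀ t, ∑ i, |e t i| ≤ κ := by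
    intro t
    have : ∀ i, |e t i| = |(W t i : ℝ) - D * ω t i| / D := by
      intro i
      rw [← abs_of_pos hD', ← abs_div, abs_of_pos hD']
      congr 1
      simp only [he]
      field_simp
    rw [Finset.sum_congr rfl fun i _ => this i, ← Finset.sum_div, hκ]
    gcongr
    exact hW3 t
  have hesum : ∀ t, ∑ i, e t i = 0 := by
    intro t
    simp only [he, Finset.sum_sub_distrib, hωs, ← Finset.sum_div]
    rw [← Int.cast_sum, hW1 t]
    simp [hD'.ne']
  refine ⟨W, hW1, ?_, ?_⟩
  · intro t i
    have h1 : |(W t i : ℝ) - D * ω t i| ≤ 2 * m :=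
      (Finset.single_le_sum (f := fun i => |(W t i : ℝ) - D * ω t i|) (fun _ _ => abs_nonneg _)
        (Finset.mem_univ i)).trans (hW3 t)
    have h2 : |D * ω t i| ≤ D * B := by
      rw [abs_mul, abs_of_pos hD']
      exact mul_le_mul_of_nonneg_left (hωB t i) hD'.le
    have h3 : (W t i : ℝ) = D * ω t i + (W t i - D * ω t i) := by ring
    rw [h3]
    exact (abs_add_le _ _).trans (add_le_add h2 h1)
  intro x hx
  -- Rounding moves the represented point b t to b t + ∑ M t s • b s.
  set M : Fin J → Fin J → ℝ := fun t s => ∑ i, e t i * ψ (X i) s with hM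
  have hMabs : ∀ t s, |M t s| ≤ κ := by
    intro t s
    refine (Finset.abs_sum_le_sum_abs _ _).trans (le_trans ?_ (heabs t))
    refine Finset.sum_le_sum fun i _ => ?_
    by_cases hi : X i ∈ Q
    · rw [abs_mul]
      exact mul_le_of_le_one_right (abs_nonneg _) (hψ _ hi s)
    · simp [heQ t i hi]
  -- New coefficients l, close to ψ x, represent p x exactly in terms of the moved points. Since the
  -- rows of `M` sum to 0, they still have total 1.
  obtain ⟨l, hl1, hl2, hl3⟩ := exists_solve_perturbed M hDm hMabs (ψ x) (hψ x hx)
  have hMsum : ∀ t, ∑ s, M t s = 0 := by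
    intro t
    simp only [hM]
    rw [Finset.sum_comm, ← hesum t]
    refine Finset.sum_congr rfl fun i _ => ?_
    rw [← Finset.mul_sum]
    by_cases hi : X i ∈ Q
    · rw [hψ1 _ hi, mul_one]
    · rw [heQ t i hi, zero_mul]
  have hep : ∀ t, ∑ i, e t i • p (X i) = ∑ s, M t s • b s := by
    intro t
    simp only [hM, Finset.sum_smul]
    rw [Finset.sum_comm]
    refine Finset.sum_congr rfl fun i _ => ?_
    by_cases hi : X i ∈ Q
    · rw [hp _ hi, Finset.smul_sum]
      simp only [mul_smul]
    · simp [heQ t i hi]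
  have hW : ∀ t (f : ι → E), ∑ i, ((W t i : ℝ) / D) • f (X i) =
      ∑ v, w t v • f v + ∑ i, e t i • f (X i) := by
    intro t f
    rw [← sum_pullWeight X (fun v hv => (hw.supp t v hv).2) f, ← Finset.sum_add_distrib]
    refine Finset.sum_congr rfl fun i _ => ?_
    rw [← add_smul]
    congr 1
    simp [he, hω]
  have hl4 : ∑ t, l t • ∑ i, ((W t i : ℝ) / D) • p (X i) = p x := by
    rw [hp x hx]
    simp only [hW, hep, hw.comb, smul_add, Finset.sum_add_distrib, Finset.smul_sum, ← hl1, add_smul,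
      Finset.sum_smul, mul_smul]
    rw [Finset.sum_comm (γ := Fin J)]
  refine ⟨l, ?_, ?_⟩
  · rw [← hψ1 x hx]
    simp only [← hl1, Finset.sum_add_distrib]
    rw [Finset.sum_comm]
    simp only [← Finset.mul_sum, hMsum, mul_zero, Finset.sum_const_zero, add_zero]
  set ε : Fin J → E := fun t => ∑ i, e t i • u (X i) with hε
  have hεn : ∀ t, ‖ε t‖ ≤ κ * ρ := by
    intro t
    calc ‖ε t‖ ≤ ∑ i, |e t i| * ρ := by
          refine norm_sum_le_of_le _ fun i _ => ?_
          rw [norm_smul, Real.norm_eq_abs]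
          by_cases hi : X i ∈ Q
          · exact mul_le_mul_of_nonneg_left (hu _ hi) (abs_nonneg _)
          · simp [heQ t i hi]
      _ = (∑ i, |e t i|) * ρ := by rw [Finset.sum_mul]
      _ ≤ κ * ρ := mul_le_mul_of_nonneg_right (heabs t) hρ
  have hhn : ∀ t, ‖errComb u w t‖ ≤ J * ρ := by
    intro t
    have h1 : ‖errComb u w t‖ ^ 2 ≤ J * ρ ^ 2 :=
      (Finset.single_le_sum (f := fun t => ‖errComb u w t‖ ^ 2) (fun _ _ => by positivity)
        (Finset.mem_univ t)).trans hΦ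
    refine le_of_sq_le_sq (h1.trans ?_) (by positivity)
    rw [mul_pow]
    have : (J : ℝ) ≤ J ^ 2 := by nlinarith
    gcongr
  -- The p-parts cancel by `hl4`. What remains is the error before rounding, the effect of l ≠ ψ on
  -- the combined errors, and the rounding errors applied to u.
  have e1 : p x + u x - ∑ t, l t • ∑ i, ((W t i : ℝ) / D) • (p (X i) + u (X i)) =
      (u x - errAt u ψ w x) - (∑ t, (l t - ψ x t) • errComb u w t + ∑ t, l t • ε t) := by
    have h1 : ∑ t, l t • ∑ i, ((W t i : ℝ) / D) • (p (X i) + u (X i)) =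
        p x + (∑ t, l t • errComb u w t + ∑ t, l t • ε t) := by
      conv_rhs => rw [← hl4]
      rw [← Finset.sum_add_distrib, ← Finset.sum_add_distrib]
      refine Finset.sum_congr rfl fun t _ => ?_
      rw [← smul_add, ← smul_add]
      congr 1
      simp only [smul_add, Finset.sum_add_distrib]
      rw [hW t u]
      rfl
    rw [h1, errAt]
    simp only [sub_smul, Finset.sum_sub_distrib]
    abel
  rw [e1]
  refine (norm_sub_le _ _).trans (add_le_add le_rfl ?_)
  refine (norm_add_le _ _).trans ?_
  have h1 : ‖∑ t, (l t - ψ x t) • errComb u w t‖ ≤ J * (2 * (J * κ) * (J * ρ)) := by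
    calc _ ≤ ∑ _t : Fin J, 2 * (J * κ) * (J * ρ) := by
          refine norm_sum_le_of_le _ fun t _ => ?_
          rw [norm_smul]
          exact mul_le_mul (hl3 t) (hhn t) (norm_nonneg _) (by positivity)
      _ = _ := by simp
  have h2 : ‖∑ t, l t • ε t‖ ≤ J * (2 * (κ * ρ)) := by
    calc _ ≤ ∑ _t : Fin J, 2 * (κ * ρ) := by
          refine norm_sum_le_of_le _ fun t _ => ?_
          rw [norm_smul]
          exact mul_le_mul (hl2 t) (hεn t) (norm_nonneg _) (by positivity)
      _ = _ := by simp
  have h3 : (J : ℝ) * (2 * (κ * ρ)) ≤ 2 * J ^ 3 * κ * ρ := by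
    have h4 : (J : ℝ) ≤ J ^ 3 := le_self_pow₀ hJ' (by norm_num)
    have h5 : 0 ≤ κ * ρ := by positivity
    nlinarith
  calc _ ≤ J * (2 * (J * κ) * (J * ρ)) + J * (2 * (κ * ρ)) := add_le_add h1 h2
    _ ≤ J * (2 * (J * κ) * (J * ρ)) + 2 * J ^ 3 * κ * ρ := by gcongr
    _ = _ := by ring

end Rounding

end ProjectiveClustering

/-! ### Samples that determine a good approximation of one flat. -/

namespace ProjectiveClustering

open Function

section OneFlat

variable {E : Type*} [NormedAddCommGroup E] [InnerProductSpace ℝ E]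

/-- The lift of a point to homogeneous coordinates. -/
noncomputable def hat (p : E) : WithLp 2 (E × ℝ) := WithLp.toLp 2 (p, 1)

/-- The lifts lie in the image of F.direction × ℝ under (v, s) ↦ (v + s·p₀, s). -/
theorem finrank_span_hat_le [FiniteDimensional ℝ E] {j M : ℕ} {F : AffineSubspace ℝ E}
    (hF : Module.finrank ℝ F.direction = j) (p : Fin M → E) (hp : ∀ i, p i ∈ F) :
    Module.finrank ℝ (Submodule.span ℝ (Set.range fun i => hat (p i))) ≤ j + 1 := by
  rcases Nat.eq_zero_or_pos M with rfl | hM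
  · rw [Set.range_eq_empty, Submodule.span_empty, finrank_bot]
    omega
  set p₀ := p ⟨0, hM⟩ with hp₀
  let Φ : F.direction × ℝ →ₗ[ℝ] WithLp 2 (E × ℝ) :=
    (WithLp.linearEquiv 2 ℝ (E × ℝ)).symm.toLinearMap ∘ₗ
      ((F.direction.subtype.coprod (LinearMap.toSpanSingleton ℝ E p₀)).prod
        (LinearMap.snd ℝ F.direction ℝ))
  have h1 : Submodule.span ℝ (Set.range fun i => hat (p i)) ≤ LinearMap.range Φ := by
    refine Submodule.span_le.2 ?_
    rintro _ ⟨i, rfl⟩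
    refine ⟨(⟨p i - p₀, AffineSubspace.vsub_mem_direction (hp i) (hp _)⟩, 1), ?_⟩
    simp [Φ, hat]
  refine (Submodule.finrank_mono h1).trans ((LinearMap.finrank_range_le Φ).trans ?_)
  rw [Module.finrank_prod, hF, Module.finrank_self]

/-- The last coordinate turns a linear combination of lifts into an affine combination of points;
this is the purpose of the lift. -/
theorem sum_smul_hat {r : ℕ} {p : E} {q : Fin r → E} {ψ : Fin r → ℝ}
    (h : hat p = ∑ t, ψ t • hat (q t)) : p = ∑ t, ψ t • q t ∧ ∑ t, ψ t = 1 := by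
  have h1 := congrArg (fun v => (WithLp.ofLp v).1) h
  have h2 := congrArg (fun v => (WithLp.ofLp v).2) h
  simp only [hat, WithLp.ofLp_sum, WithLp.ofLp_smul, Prod.fst_sum, Prod.snd_sum, Prod.smul_mk,
    smul_eq_mul, mul_one] at h1 h2
  exact ⟨h1, h2.symm⟩

open scoped Classical in
theorem card_filter_append {ι : Type*} [Fintype ι] {M N : ℕ} (P : (Fin (M + N) → ι) → Prop) :
    (Finset.univ.filter P).card =
      ∑ Y : Fin M → ι, (Finset.univ.filter fun Z : Fin N → ι => P (Fin.append Y Z)).card := by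
  simp only [Finset.card_filter]
  rw [← (Fin.appendEquiv M N).sum_comp, Fintype.sum_prod_type]
  rfl

variable {n j : ℕ}

/-- The candidate points of a flat for integer weights `W` and samples `X`. -/
noncomputable def rows {m : ℕ} (D : ℕ) (x : Fin n → E) (X : Fin m → Fin n)
    (W : Fin (j + 1) → Fin m → ℤ) (t : Fin (j + 1)) : E := ∑ i, ((W t i : ℝ) / D) • x (X i)

open scoped Classical in
/-- There are weights such that the flat of the candidate points is close to most points of `Q`. -/
def GoodSample {m : ℕ} (j : ℕ) (x u : Fin n → E) (Q : Finset (Fin n)) (a ρ c : ℝ)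
    (X : Fin m → Fin n) : Prop :=
  ∃ W : Fin (j + 1) → Fin m → ℤ, (∀ t, ∑ i, W t i = 2 ^ m) ∧ (∀ t i, |W t i| ≤ 4 ^ m) ∧
    ∃ B : Finset (Fin n), (B.card : ℝ) ≤ 2 * c ∧ ∀ i ∈ Q, i ∉ B →
      Metric.infDist (x i) (affineSpan ℝ (Set.range (rows (2 ^ m) x X W)) : Set E) ≤
        (1 + a) * ‖u i‖ + 2 * a * ρ

theorem infDist_affineSpan_le {J : ℕ} {x : E} {z : Fin J → E} {l : Fin J → ℝ} {b : ℝ}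
    (hl : ∑ t, l t = 1) (h : ‖x - ∑ t, l t • z t‖ ≤ b) :
    Metric.infDist x (affineSpan ℝ (Set.range z) : Set E) ≤ b := by
  have h1 : ∑ t, l t • z t ∈ affineSpan ℝ (Set.range z) := by
    rw [← Finset.affineCombination_eq_linear_combination _ _ _ hl]
    exact affineCombination_mem_affineSpan hl z
  refine (Metric.infDist_le_dist_of_mem h1).trans ?_
  rwa [dist_eq_norm]

open scoped Classical in
/-- Completion of a good spanning sample by gradient descent. -/
theorem card_goodSample_append {p u x : Fin n → E} {Q : Finset (Fin n)} {a ρ c : ℝ} {M N : ℕ}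
    (hx : ∀ i, x i = p i + u i) (hu : ∀ i ∈ Q, ‖u i‖ ≤ ρ) (ha : 0 < a) (ha' : a ≤ 1)
    (hρ : 0 ≤ ρ) (hc : 0 ≤ c) (hc' : c ≤ n) (hM : 1 ≤ M)
    (hN : 4 * ((j + 1 : ℕ) : ℝ) ^ 2 ≤ N * a ^ 4)
    (hD : 8 * ((j + 1 : ℕ) : ℝ) ^ 3 * (M + N : ℕ) ≤ a * 2 ^ (M + N))
    (Y : Fin M → Q) (hr : spannerRank ((fun i : Q => hat (p i)) ∘ Y) ≤ j + 1)
    (hY : ((Finset.univ.filter fun i : Q => ¬ Spanned ((fun i : Q => hat (p i)) ∘ Y)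
      (hat (p i))).card : ℝ) ≤ c) :
    c ^ N ≤ (Finset.univ.filter fun Z : Fin N → Fin n =>
      GoodSample j x u Q a ρ c (Fin.append (fun i => (Y i : Fin n)) Z)).card := by
  set h : Q → WithLp 2 (E × ℝ) := fun i => hat (p i) with hh
  set r := spannerRank (h ∘ Y) with hrdef
  have hmv := spanner_maxVol (h ∘ Y)
  -- The points of Q that are spanned boundedly by the first M samples; by `hY` at most c points of
  -- Q are missing.
  let Q' : Finset (Fin n) := Q.filter fun i => ∃ ψ : Fin r → ℝ,
    hat (p i) = ∑ t, ψ t • hat (p (Y (spanner (h ∘ Y) t))) ∧ ∀ t, |ψ t| ≤ 1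
  have hQ' : ∀ i, i ∈ Q' → i ∈ Q := fun i hi => (Finset.mem_filter.1 hi).1
  have hYQ' : ∀ i, (Y i : Fin n) ∈ Q' := fun i =>
    Finset.mem_filter.2 ⟨(Y i).2, hmv.exists_coeff i⟩
  -- The r ≤ j + 1 spanning samples are padded to exactly j + 1 by an arbitrary sample, which gets
  -- coefficient 0 in every ψ.
  let base : Fin (j + 1) → Fin n := fun t =>
    if ht : (t : ℕ) < r then Y (spanner (h ∘ Y) ⟨t, ht⟩) else Y ⟨0, hM⟩
  have hbase : ∀ t, base t ∈ Q' ∧ base t ∈ Set.range fun i => (Y i : Fin n) := by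
    intro t
    simp only [base]
    split_ifs
    · exact ⟨hYQ' _, _, rfl⟩
    · exact ⟨hYQ' _, _, rfl⟩
  have hψex : ∀ i : Fin n, ∃ ψ : Fin r → ℝ, i ∈ Q' →
      hat (p i) = ∑ t, ψ t • hat (p (Y (spanner (h ∘ Y) t))) ∧ ∀ t, |ψ t| ≤ 1 := by
    intro i
    by_cases hi : i ∈ Q'
    · obtain ⟨ψ, hψ⟩ := (Finset.mem_filter.1 hi).2
      exact ⟨ψ, fun _ => hψ⟩
    · exact ⟨0, fun h => absurd h hi⟩
  choose ψ₀ hψ₀ using hψex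
  let ψ : Fin n → Fin (j + 1) → ℝ := fun i t => if ht : (t : ℕ) < r then ψ₀ i ⟨t, ht⟩ else 0
  have hψlt : ∀ (t : Fin r) i, ψ i (Fin.castLE hr t) = ψ₀ i t := fun t i => dif_pos t.2
  have hbaselt : ∀ t : Fin r, base (Fin.castLE hr t) = Y (spanner (h ∘ Y) t) := fun t => dif_pos t.2
  have hψge : ∀ (t : Fin (j + 1)) i, t ∉ Set.range (Fin.castLE hr) → ψ i t = 0 := fun t i ht =>
    dif_neg fun h' => ht ⟨⟨t, h'⟩, rfl⟩
  have hp : ∀ i ∈ Q', p i = ∑ t, ψ i t • p (base t) := by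
    intro i hi
    rw [(sum_smul_hat (hψ₀ i hi).1).1]
    refine Fintype.sum_of_injective (Fin.castLE hr) (Fin.castLE_injective hr) _ _ ?_ ?_
    · intro t ht
      rw [hψge t i ht, zero_smul]
    · intro t
      rw [hψlt, hbaselt]
  have hψ1 : ∀ i ∈ Q', ∑ t, ψ i t = 1 := by
    intro i hi
    rw [← (sum_smul_hat (hψ₀ i hi).1).2]
    exact (Fintype.sum_of_injective (Fin.castLE hr) (Fin.castLE_injective hr) _ _
      (fun t ht => hψge t i ht) fun t => (hψlt t i).symm).symm
  have hψ : ∀ i ∈ Q', ∀ t, |ψ i t| ≤ 1 := by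
    intro i hi t
    simp only [ψ]
    split_ifs
    · exact (hψ₀ i hi).2 _
    · simp
  -- Descent starts from the sampled base points themselves. The weights are at most 1 = 2^1 - 1,
  -- which explains e = 1.
  let w₀ : Fin (j + 1) → Fin n → ℝ := fun t y => if y = base t then 1 else 0
  have hw₀ : IsWeight Q' p (fun t => p (base t)) (Set.range fun i => (Y i : Fin n)) (2 ^ 1 - 1) w₀ := by
    constructor
    · intro t
      simp [w₀]
    · intro t
      simp [w₀, ite_smul]
    · intro t y hy
      have : y = base t := by
        by_contra h'
        exact hy (if_neg h')
      rw [this]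
      exact hbase t
    · intro t y
      simp only [w₀]
      split_ifs <;> norm_num
  have hJ0 : (1 : ℝ) ≤ ((j + 1 : ℕ) : ℝ) := by
    push_cast
    linarith [(Nat.cast_nonneg j : (0 : ℝ) ≤ j)]
  have hΦ₀ : errSq u w₀ ≤ ((j + 1 : ℕ) : ℝ) * ρ ^ 2 := by
    calc errSq u w₀ ≤ ∑ _t : Fin (j + 1), ρ ^ 2 := by
          refine Finset.sum_le_sum fun t _ => ?_
          have : errComb u w₀ t = u (base t) := by simp [errComb, w₀, ite_smul]
          rw [this]
          have := hu _ (hQ' _ (hbase t).1)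
          gcongr
      _ = _ := by simp
  -- The initial energy is at most (j+1)ρ², so N descent steps are enough to exhaust it.
  have hΦN : errSq u w₀ ≤ N * (a ^ 4 / (4 * (j + 1 : ℕ)) * ρ ^ 2) := by
    refine hΦ₀.trans ?_
    rw [← mul_assoc]
    refine mul_le_mul_of_nonneg_right ?_ (sq_nonneg ρ)
    rw [mul_div_assoc', le_div_iff₀ (by positivity)]
    linarith
  have hcount := descent_count ha ha' hρ (Nat.succ_pos j) hψ hψ1 hp hc (by simpa using hc') N N 1
    le_rfl _ w₀ hw₀ hΦN
  refine hcount.trans (Nat.cast_le.2 (Finset.card_le_card fun Z hZ => ?_))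
  rw [Finset.mem_filter] at hZ ⊢
  obtain ⟨-, w', hw', hΦ', hbad⟩ := hZ
  refine ⟨Finset.mem_univ _, ?_⟩
  set X := Fin.append (fun i => (Y i : Fin n)) Z with hX
  have hXr : (Set.range fun i => (Y i : Fin n)) ∪ Set.range Z ⊆ Set.range X := by
    rintro v (⟨i, rfl⟩ | ⟨i, rfl⟩)
    · exact ⟨Fin.castAdd N i, by simp [hX]⟩
    · exact ⟨Fin.natAdd M i, by simp [hX]⟩
  have hDpos : (0 : ℝ) < 2 ^ (M + N) := by positivity
  have hDm : 8 * ((j + 1 : ℕ) : ℝ) ^ 3 * (M + N : ℕ) ≤ 2 ^ (M + N) :=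
    hD.trans (mul_le_of_le_one_left hDpos.le ha')
  have hmD : 8 * ((M + N : ℕ) : ℝ) ≤ 2 ^ (M + N) := by
    refine le_trans ?_ hDm
    have : (1 : ℝ) ≤ ((j + 1 : ℕ) : ℝ) ^ 3 := one_le_pow₀ hJ0
    have h0 : (0 : ℝ) ≤ ((M + N : ℕ) : ℝ) := by positivity
    nlinarith
  obtain ⟨W, hW1, hW2, hW3⟩ := (hw'.mono hXr le_rfl).round (D := 2 ^ (M + N)) (u := u) (ρ := ρ)
    (sub_nonneg.2 (one_le_pow₀ (by norm_num))) hρ (Nat.succ_pos j) hψ hψ1 hp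
    (fun i hi => hu i (hQ' i hi)) (hΦ'.trans hΦ₀) (by positivity) (by
      push_cast
      rw [mul_div_assoc', div_le_iff₀ hDpos]
      have h1 : ((j + 1 : ℕ) : ℝ) ≤ ((j + 1 : ℕ) : ℝ) ^ 3 := le_self_pow₀ hJ0 (by norm_num)
      have h0 : (0 : ℝ) ≤ ((M + N : ℕ) : ℝ) := by positivity
      push_cast at h1 h0 hDm
      nlinarith)
  -- The 2c exceptions are c points not spanned by the first samples and c points left bad by the
  -- descent.
  refine ⟨W, fun t => by rw [hW1 t]; push_cast; rfl, ?_, (Q \ Q') ∪ badSet Q' u ψ a ρ w', ?_, ?_⟩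
  · intro t i
    have h1 := hW2 t i
    have h2 : (2 : ℝ) ^ (1 + N) ≤ 2 ^ (M + N) := pow_le_pow_right₀ (by norm_num) (by omega)
    have h3 : (4 : ℝ) ^ (M + N) = 2 ^ (M + N) * 2 ^ (M + N) := by
      rw [← mul_pow]
      norm_num
    have h4 : |(W t i : ℝ)| ≤ 4 ^ (M + N) := by
      rw [h3]
      push_cast at h1 hmD
      nlinarith
    exact_mod_cast h4
  · have h1 : ((Q \ Q').card : ℝ) ≤ c := by
      refine le_trans (Nat.cast_le.2 ?_) hY
      rw [← Finset.card_map (Embedding.subtype fun i => i ∈ Q)]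
      refine Finset.card_le_card fun i hi => ?_
      rw [Finset.mem_sdiff] at hi
      refine Finset.mem_map.2 ⟨⟨i, hi.1⟩, Finset.mem_filter.2 ⟨Finset.mem_univ _, fun hs => ?_⟩, rfl⟩
      exact hi.2 (Finset.mem_filter.2 ⟨hi.1, hs⟩)
    have h2 := Finset.card_union_le (Q \ Q') (badSet Q' u ψ a ρ w')
    have h3 : (((Q \ Q') ∪ badSet Q' u ψ a ρ w').card : ℝ) ≤
        (Q \ Q').card + (badSet Q' u ψ a ρ w').card := by exact_mod_cast h2
    linarith
  · intro i hi hiB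
    rw [Finset.mem_union, not_or, Finset.mem_sdiff, not_and, not_not] at hiB
    have hi' := hiB.1 hi
    obtain ⟨l, hl1, hl2⟩ := hW3 i hi'
    have hgood : ‖u i - errAt u ψ w' i‖ ≤ (1 + a) * ‖u i‖ + a * ρ := by
      by_contra! h'
      exact hiB.2 (Finset.mem_filter.2 ⟨hi', h'⟩)
    refine infDist_affineSpan_le hl1 ?_
    have e : ∑ t, l t • rows (2 ^ (M + N)) x X W t =
        ∑ t, l t • ∑ i, ((W t i : ℝ) / (2 ^ (M + N) : ℕ)) • (p (X i) + u (X i)) := by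
      refine Finset.sum_congr rfl fun t _ => ?_
      simp only [rows, hx]
    rw [e, hx i]
    refine hl2.trans ?_
    -- The rounding loss is at most aρ; together with the aρ allowed to points that are not bad this
    -- gives 2aρ.
    have h5 : 4 * ((j + 1 : ℕ) : ℝ) ^ 3 * (2 * (M + N : ℕ) / (2 ^ (M + N) : ℕ)) ≤ a := by
      push_cast
      rw [mul_div_assoc', div_le_iff₀ hDpos]
      push_cast at hD
      linarith
    have h6 := mul_le_mul_of_nonneg_right h5 hρ
    linarith

/-- All of Q may be declared exceptional, so any admissible weights do. Small clusters need no care.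
-/
theorem goodSample_of_card_le {m : ℕ} {x u : Fin n → E} {Q : Finset (Fin n)} {a ρ c : ℝ}
    (hm : 1 ≤ m) (hQ : (Q.card : ℝ) ≤ 2 * c) (X : Fin m → Fin n) : GoodSample j x u Q a ρ c X := by
  refine ⟨fun _ i => if i = ⟨0, hm⟩ then 2 ^ m else 0, fun t => by simp, fun t i => ?_, Q, hQ,
    fun i hi hi' => absurd hi hi'⟩
  beta_reduce
  split_ifs
  · rw [abs_of_nonneg (by positivity)]
    exact pow_le_pow_left₀ (by norm_num) (by norm_num) m
  · simp

open scoped Classical in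
/-- A lower bound for the number of good samples for a single flat. -/
theorem le_card_goodSample [FiniteDimensional ℝ E] {p u x : Fin n → E} {Q : Finset (Fin n)}
    {a ρ c : ℝ} {M N : ℕ} {F : AffineSubspace ℝ E} (hF : Module.finrank ℝ F.direction = j)
    (hp : ∀ i, p i ∈ F) (hx : ∀ i, x i = p i + u i) (hu : ∀ i ∈ Q, ‖u i‖ ≤ ρ) (ha : 0 < a)
    (ha' : a ≤ 1) (hρ : 0 ≤ ρ) (hc : 0 ≤ c) (hc' : c ≤ n) (hM : 1 ≤ M)
    (hM' : 2 * ((j + 1 : ℕ) : ℝ) * n ≤ c * (M + 1))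
    (hN : 4 * ((j + 1 : ℕ) : ℝ) ^ 2 ≤ N * a ^ 4)
    (hD : 8 * ((j + 1 : ℕ) : ℝ) ^ 3 * (M + N : ℕ) ≤ a * 2 ^ (M + N)) :
    c ^ (M + N) ≤ (Finset.univ.filter fun X : Fin (M + N) → Fin n =>
      GoodSample j x u Q a ρ c X).card := by
  by_cases hQ : (Q.card : ℝ) ≤ 2 * c
  · rw [Finset.filter_true_of_mem fun X _ => goodSample_of_card_le (by omega) hQ X,
      Finset.card_univ, Fintype.card_fun, Fintype.card_fin, Fintype.card_fin]
    push_cast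
    gcongr
  rw [not_le] at hQ
  set h : Q → WithLp 2 (E × ℝ) := fun i => hat (p i) with hh
  have hrank : ∀ {M : ℕ} (Y : Fin M → Q), spannerRank (h ∘ Y) ≤ j + 1 := by
    intro M Y
    rw [(spanner_maxVol (h ∘ Y)).card]
    exact finrank_span_hat_le hF (fun i => p (Y i)) fun i => hp _
  have hQn : (Q.card : ℝ) ≤ n := by
    have := Finset.card_le_univ Q
    rw [Fintype.card_fin] at this
    exact_mod_cast this
  have hQ0 : 0 < Q.card := by
    have : (0 : ℝ) < Q.card := by linarith
    exact_mod_cast this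
  set G := Finset.univ.filter fun Y : Fin M → Q =>
    ((Finset.univ.filter fun i : Q => ¬ Spanned (h ∘ Y) (h i)).card : ℝ) ≤ c with hG
  have hhalf : (Q.card : ℝ) ^ M / 2 ≤ G.card := by
    have := half_le_card_spanning h M (j + 1) (b := c) (fun Y => hrank Y) (by
      rw [Fintype.card_coe]
      refine le_trans ?_ hM'
      gcongr) (by rwa [Fintype.card_coe])
    rwa [Fintype.card_coe] at this
  have hinj : Injective fun (Y : Fin M → Q) (i : Fin M) => (Y i : Fin n) := fun Y Y' hYY' =>
    funext fun i => Subtype.ext (congrFun hYY' i)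
  rw [card_filter_append]
  push_cast
  calc c ^ (M + N) ≤ (Q.card : ℝ) ^ M / 2 * c ^ N := by
        rw [pow_add]
        refine mul_le_mul_of_nonneg_right ?_ (by positivity)
        -- Here |Q| > 2c: the spanning tuples number at least |Q|^M/2 ≥ (2c)^M/2 ≥ c^M, so the loss
        -- of one half is absorbed.
        have h1 : (2 * c) ^ M ≤ (Q.card : ℝ) ^ M := by gcongr
        have h2 : 2 * c ^ M ≤ (2 * c) ^ M := by
          rw [mul_pow]
          have : (2 : ℝ) ≤ 2 ^ M := le_self_pow₀ (by norm_num) (by omega)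
          gcongr
        linarith
    _ ≤ G.card * c ^ N := by gcongr
    _ = ∑ Y ∈ G, c ^ N := by simp
    _ ≤ ∑ Y ∈ G, ((Finset.univ.filter fun Z : Fin N → Fin n =>
          GoodSample j x u Q a ρ c (Fin.append (fun i => (Y i : Fin n)) Z)).card : ℝ) :=
        Finset.sum_le_sum fun Y hY => card_goodSample_append hx hu ha ha' hρ hc hc' hM hN hD Y
          (hrank Y) (Finset.mem_filter.1 hY).2
    _ = ∑ Y ∈ G.map ⟨_, hinj⟩, ((Finset.univ.filter fun Z : Fin N → Fin n =>
          GoodSample j x u Q a ρ c (Fin.append Y Z)).card : ℝ) := by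
        rw [Finset.sum_map]
        rfl
    _ ≤ _ := Finset.sum_le_univ_sum_of_nonneg fun Y => by positivity

end OneFlat

end ProjectiveClustering

/-! ### Enlarging a flat to dimension j. -/

namespace ProjectiveClustering

open Function

section Completion

variable {E : Type*} [NormedAddCommGroup E] [InnerProductSpace ℝ E]

/-- Some members of a family of vectors can be replaced by members of an independent family, such
that the span grows and the family becomes independent. -/
theorem exists_independent_replace {j : ℕ} {e : Fin j → E} (he : LinearIndependent ℝ e) (N : ℕ)
    (f : Fin j → E) (hN : j ≤ Module.finrank ℝ (Submodule.span ℝ (Set.range f)) + N) :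
    ∃ f' : Fin j → E, (∀ t, f' t = f t ∨ ∃ i, f' t = e i) ∧
      Submodule.span ℝ (Set.range f) ≤ Submodule.span ℝ (Set.range f') ∧
      LinearIndependent ℝ f' := by
  induction N generalizing f with
  | zero =>
    refine ⟨f, fun t => Or.inl rfl, le_rfl, ?_⟩
    rw [linearIndependent_iff_card_le_finrank_span, Fintype.card_fin]
    exact hN
  | succ N ih =>
    by_cases hf : LinearIndependent ℝ f
    · exact ⟨f, fun t => Or.inl rfl, le_rfl, hf⟩
    have hlt : Module.finrank ℝ (Submodule.span ℝ (Set.range f)) < j := by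
      rw [linearIndependent_iff_card_le_finrank_span, Fintype.card_fin, not_le] at hf
      exact hf
    -- A redundant vector is exchanged for a member of `e` outside the span. The rank rises by at
    -- least one; N bounds the missing rank.
    obtain ⟨t, ht⟩ : ∃ t, f t ∈ Submodule.span ℝ (f '' (Set.univ \ {t})) := by
      rw [linearIndependent_iff_notMem_span] at hf
      push Not at hf
      exact hf
    have hfin : FiniteDimensional ℝ (Submodule.span ℝ (Set.range f)) :=
      FiniteDimensional.span_of_finite ℝ (Set.finite_range f)
    obtain ⟨i, hi⟩ : ∃ i, e i ∉ Submodule.span ℝ (Set.range f) := by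
      by_contra! h
      have h1 : Submodule.span ℝ (Set.range e) ≤ Submodule.span ℝ (Set.range f) :=
        Submodule.span_le.2 (by rintro _ ⟨i, rfl⟩; exact h i)
      have h2 := Submodule.finrank_mono h1
      rw [finrank_span_eq_card he, Fintype.card_fin] at h2
      omega
    set f₁ := update f t (e i) with hf₁
    have h1 : Submodule.span ℝ (f '' (Set.univ \ {t})) ≤ Submodule.span ℝ (Set.range f₁) := by
      refine Submodule.span_mono ?_
      rintro _ ⟨s, hs, rfl⟩
      refine ⟨s, update_of_ne ?_ _ _⟩
      simpa using hs
    have h2 : Submodule.span ℝ (Set.range f) ≤ Submodule.span ℝ (Set.range f₁) := by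
      refine Submodule.span_le.2 ?_
      rintro _ ⟨s, rfl⟩
      by_cases hs : s = t
      · rw [hs]
        exact h1 ht
      · exact h1 (Submodule.subset_span ⟨s, by simpa using hs, rfl⟩)
    have h3 : Submodule.span ℝ (Set.range f) < Submodule.span ℝ (Set.range f₁) := by
      refine lt_of_le_of_ne h2 fun h => hi ?_
      rw [h]
      exact Submodule.subset_span ⟨t, update_self ..⟩
    have hfin' : FiniteDimensional ℝ (Submodule.span ℝ (Set.range f₁)) :=
      FiniteDimensional.span_of_finite ℝ (Set.finite_range f₁)
    have h4 := Submodule.finrank_lt_finrank_of_lt h3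
    obtain ⟨f', k1, k2, k3⟩ := ih f₁ (by omega)
    refine ⟨f', fun s => ?_, h2.trans k2, k3⟩
    rcases k1 s with h | h
    · by_cases hs : s = t
      · right
        exact ⟨i, by rw [h, hs]; exact update_self ..⟩
      · left
        rw [h]
        exact update_of_ne hs _ _
    · exact Or.inr h

theorem vectorSpan_range_fin (j : ℕ) (z : Fin (j + 1) → E) :
    vectorSpan ℝ (Set.range z) = Submodule.span ℝ (Set.range fun t : Fin j => z t.succ - z 0) := by
  rw [vectorSpan_range_eq_span_range_vsub_right ℝ z 0]
  refine le_antisymm (Submodule.span_le.2 ?_) (Submodule.span_mono ?_)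
  · rintro _ ⟨t, rfl⟩
    refine Fin.cases ?_ (fun t => ?_) t
    · simp
    · exact Submodule.subset_span ⟨t, rfl⟩
  · rintro _ ⟨t, rfl⟩
    exact ⟨t.succ, rfl⟩

/-- The points of a candidate flat of too small dimension can be replaced such that the flat grows
and gets the dimension `j`. -/
theorem exists_completion {j : ℕ} {e : Fin j → E} (he : LinearIndependent ℝ e)
    (z : Fin (j + 1) → E) : ∃ z' : Fin (j + 1) → E, (∀ t, z' t = z t ∨ ∃ i, z' t = z 0 + e i) ∧
      affineSpan ℝ (Set.range z) ≤ affineSpan ℝ (Set.range z') ∧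
      Module.finrank ℝ (affineSpan ℝ (Set.range z')).direction = j := by
  obtain ⟨f', k1, k2, k3⟩ := exists_independent_replace he j (fun t : Fin j => z t.succ - z 0)
    (by omega)
  -- The base point stays, so only directions are exchanged and every new point has the form z 0 + e
  -- i.
  set z' : Fin (j + 1) → E := Fin.cons (z 0) fun t => z 0 + f' t with hz'
  have h1 : vectorSpan ℝ (Set.range z') = Submodule.span ℝ (Set.range f') := by
    rw [vectorSpan_range_fin]
    congr 2
    funext t
    simp [hz']
  refine ⟨z', fun t => ?_, ?_, ?_⟩
  · refine Fin.cases ?_ (fun t => ?_) t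
    · simp [hz']
    · rcases k1 t with h | ⟨i, h⟩
      · left
        simp [hz', h]
      · right
        exact ⟨i, by simp [hz', h]⟩
  · refine affineSpan_le.2 ?_
    rintro _ ⟨t, rfl⟩
    have h0 : z 0 ∈ affineSpan ℝ (Set.range z') := mem_affineSpan ℝ ⟨0, by simp [hz']⟩
    have h2 : z t - z 0 ∈ (affineSpan ℝ (Set.range z')).direction := by
      rw [direction_affineSpan, h1]
      refine k2 ?_
      rw [← vectorSpan_range_fin]
      exact vsub_mem_vectorSpan ℝ ⟨t, rfl⟩ ⟨0, rfl⟩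
    have := AffineSubspace.vadd_mem_of_mem_direction h2 h0
    simpa using this
  · rw [direction_affineSpan, h1, finrank_span_eq_card k3, Fintype.card_fin]

end Completion

/-! ### Random thresholds and the choice of parameters. -/

section Threshold

open scoped Classical in
/-- The elements with at most the value of `i`. -/
noncomputable def sublevel {ι : Type*} [Fintype ι] (f : ι → ℝ) (i : ι) : Finset ι :=
  Finset.univ.filter fun i' => f i' ≤ f i

-- Among all sets of elements the sublevel set minimizes the sum of f x - f i, since it collects all
-- nonpositive terms.
open scoped Classical in
theorem sum_sublevel_le {ι : Type*} [Fintype ι] (f : ι → ℝ) (i : ι) (G : Finset ι) :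
    ∑ x ∈ sublevel f i, f x ≤ ∑ x ∈ G, f x + f i * ((sublevel f i).card - G.card) := by
  have h1 : ∑ x ∈ sublevel f i, (f x - f i) ≤ ∑ x ∈ G, (f x - f i) := by
    have h2 : ∑ x ∈ sublevel f i, (f x - f i) ≤ ∑ x ∈ sublevel f i ∩ G, (f x - f i) := by
      rw [← Finset.sum_inter_add_sum_sdiff (sublevel f i) G]
      have : ∑ x ∈ sublevel f i \ G, (f x - f i) ≤ 0 := Finset.sum_nonpos fun x hx => by
        have := (Finset.mem_filter.1 (Finset.mem_sdiff.1 hx).1).2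
        linarith
      linarith
    refine h2.trans ?_
    refine Finset.sum_le_sum_of_subset_of_nonneg Finset.inter_subset_right fun x hx hx' => ?_
    have : ¬ f x ≤ f i := fun h => hx' (Finset.mem_inter.2
      ⟨Finset.mem_filter.2 ⟨Finset.mem_univ _, h⟩, hx⟩)
    linarith
  simp only [Finset.sum_sub_distrib, Finset.sum_const, nsmul_eq_mul] at h1
  linarith

open scoped Classical in
/-- Many elements are good thresholds. -/
theorem card_threshold {n : ℕ} (hn : 1 ≤ n) (f : Fin n → ℝ) (hf : ∀ i, 0 ≤ f i)
    (G : Finset (Fin n)) {θ γ : ℝ} (hθ : 0 ≤ θ) (hθγ : θ ≤ γ / 4) (hγ : 0 < γ) (hγ' : γ ≤ 1)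
    (hG : (1 - θ) * n ≤ G.card) :
    γ / 2 * n ≤ (Finset.univ.filter fun i => (1 - γ) * n ≤ (sublevel f i).card ∧
      (∑ x ∈ sublevel f i, f x) / (sublevel f i).card ≤
        (1 + 4 * θ / γ) / (1 - θ) * ((∑ x ∈ G, f x) / n)).card := by
  have hn' : (1 : ℝ) ≤ n := by exact_mod_cast hn
  set A := ∑ x ∈ G, f x with hA
  have hA0 : 0 ≤ A := Finset.sum_nonneg fun x _ => hf x
  -- Two kinds of elements are unsuitable: those with too small a sublevel set, and those among the
  -- largest values of G. In each family an extremal member bounds the size of the whole family.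
  set B₁ := G.filter fun i => ¬ (1 - γ) * n ≤ (sublevel f i).card with hB₁
  set B₂ := G.filter fun i => ¬ γ / 4 * n ≤ (G.filter fun x => f i ≤ f x).card with hB₂
  have h1 : (B₁.card : ℝ) ≤ (1 - γ) * n := by
    rcases B₁.eq_empty_or_nonempty with h | h
    · rw [h]
      have : 0 ≤ (1 - γ) * n := mul_nonneg (by linarith) (by linarith)
      simpa using this
    · obtain ⟨i, hi, hmax⟩ := Finset.exists_max_image B₁ f h
      have h2 : B₁ ⊆ sublevel f i := fun x hx => Finset.mem_filter.2 ⟨Finset.mem_univ _, hmax x hx⟩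
      have h3 := not_le.1 (Finset.mem_filter.1 hi).2
      exact (Nat.cast_le.2 (Finset.card_le_card h2)).trans h3.le
  have h2 : (B₂.card : ℝ) ≤ γ / 4 * n := by
    rcases B₂.eq_empty_or_nonempty with h | h
    · rw [h]
      have : 0 ≤ γ / 4 * n := by positivity
      simpa using this
    · obtain ⟨i, hi, hmin⟩ := Finset.exists_min_image B₂ f h
      have h2 : B₂ ⊆ G.filter fun x => f i ≤ f x := fun x hx =>
        Finset.mem_filter.2 ⟨(Finset.mem_filter.1 hx).1, hmin x hx⟩
      have h3 := not_le.1 (Finset.mem_filter.1 hi).2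
      exact (Nat.cast_le.2 (Finset.card_le_card h2)).trans h3.le
  have h3 : (G.card : ℝ) ≤ (G \ (B₁ ∪ B₂)).card + (B₁.card + B₂.card) := by
    have e1 := Finset.card_le_card_sdiff_add_card (s := G) (t := B₁ ∪ B₂)
    have e2 := Finset.card_union_le B₁ B₂
    have e3 : G.card ≤ (G \ (B₁ ∪ B₂)).card + (B₁.card + B₂.card) := by omega
    exact_mod_cast e3
  -- At least (1-θ) - (1-γ) - γ/4 = 3γ/4 - θ ≥ γ/2 of the points remain.
  have h4 : γ / 2 * n ≤ ((G \ (B₁ ∪ B₂)).card : ℝ) := by nlinarith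
  refine h4.trans (Nat.cast_le.2 (Finset.card_le_card fun i hi => ?_))
  rw [Finset.mem_sdiff, Finset.mem_union, not_or] at hi
  obtain ⟨hiG, hi1, hi2⟩ := hi
  have k1 : (1 - γ) * n ≤ (sublevel f i).card := by
    by_contra h
    exact hi1 (Finset.mem_filter.2 ⟨hiG, h⟩)
  have k2 : γ / 4 * n ≤ (G.filter fun x => f i ≤ f x).card := by
    by_contra h
    exact hi2 (Finset.mem_filter.2 ⟨hiG, h⟩)
  refine Finset.mem_filter.2 ⟨Finset.mem_univ _, k1, ?_⟩
  -- At least γn/4 elements of G have values at least f i; hence f i ≤ 4A/(γn).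
  have k3 : f i * (γ / 4 * n) ≤ A := by
    calc f i * (γ / 4 * n) ≤ f i * (G.filter fun x => f i ≤ f x).card :=
          mul_le_mul_of_nonneg_left k2 (hf i)
      _ = ∑ x ∈ G.filter fun x => f i ≤ f x, f i := by simp [mul_comm]
      _ ≤ ∑ x ∈ G.filter fun x => f i ≤ f x, f x :=
          Finset.sum_le_sum fun x hx => (Finset.mem_filter.1 hx).2
      _ ≤ A := Finset.sum_le_sum_of_subset_of_nonneg (Finset.filter_subset _ _) fun x _ _ => hf x
  set S := sublevel f i with hS
  have k4 := sum_sublevel_le f i G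
  rw [← hS, ← hA] at k4
  have hSpos : (0 : ℝ) < S.card := by
    have : 0 < S.card := Finset.card_pos.2 ⟨i, Finset.mem_filter.2 ⟨Finset.mem_univ _, le_rfl⟩⟩
    exact_mod_cast this
  have hθ1 : 0 < 1 - θ := by linarith
  have hGpos : (0 : ℝ) < G.card := lt_of_lt_of_le (by positivity) hG
  have hSn : (S.card : ℝ) ≤ n := by
    have := Finset.card_le_univ S
    rw [Fintype.card_fin] at this
    exact_mod_cast this
  have goal : (1 + 4 * θ / γ) / (1 - θ) * (A / n) = A * (1 + 4 * θ / γ) / ((1 - θ) * n) := by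
    field_simp
  rw [goal]
  have hq : 0 ≤ 4 * θ / γ := by positivity
  -- If the sublevel set is larger than G, at most θn extra elements are paid for at f i each. If it
  -- is smaller, its average is at most that of G.
  rcases le_total (G.card : ℝ) S.card with hc | hc
  · have e1 : f i * (S.card - G.card) ≤ f i * (θ * n) :=
      mul_le_mul_of_nonneg_left (by linarith) (hf i)
    have e2 : f i * (θ * n) ≤ A * (4 * θ / γ) := by
      have : f i * (θ * n) = f i * (γ / 4 * n) * (4 * θ / γ) := by field_simp
      rw [this]
      exact mul_le_mul_of_nonneg_right k3 hq
    have e3 : ∑ x ∈ S, f x ≤ A * (1 + 4 * θ / γ) := by linarith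
    exact div_le_div₀ (by positivity) e3 (by positivity) (hG.trans hc)
  · have e1 : ∑ x ∈ S, f x ≤ f i * S.card := by
      calc _ ≤ ∑ x ∈ S, f i := Finset.sum_le_sum fun x hx => (Finset.mem_filter.1 hx).2
        _ = _ := by simp [mul_comm]
    have e2 : (∑ x ∈ S, f x) / S.card ≤ A / G.card := by
      rw [div_le_div_iff₀ hSpos hGpos]
      have e3 := mul_le_mul_of_nonneg_right e1 (sub_nonneg.2 hc)
      have e4 := mul_le_mul_of_nonneg_right k4 hSpos.le
      nlinarith
    refine e2.trans (div_le_div₀ (by positivity) ?_ (by positivity) hG)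
    nlinarith

/-- Convexity of the τ-th power with weights (1+α)/(1+2α) and α/(1+2α). As R is at most the power
mean of the r i, replacing R^τ by their average loses nothing. -/
theorem sum_pow_combination_le {ι : Type*} (s : Finset ι) (r : ι → ℝ) (hr : ∀ i ∈ s, 0 ≤ r i)
    {α R : ℝ} (hα : 0 ≤ α) (hR : 0 ≤ R) (τ : ℕ) (h : (s.card : ℝ) * R ^ τ ≤ ∑ i ∈ s, r i ^ τ) :
    ∑ i ∈ s, ((1 + α) * r i + α * R) ^ τ ≤ (1 + 2 * α) ^ τ * ∑ i ∈ s, r i ^ τ := by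
  have hpos : 0 < 1 + 2 * α := by linarith
  have h1 : ∀ i ∈ s, ((1 + α) * r i + α * R) ^ τ ≤
      (1 + 2 * α) ^ τ * ((1 + α) / (1 + 2 * α) * r i ^ τ + α / (1 + 2 * α) * R ^ τ) := by
    intro i hi
    have hcv : ConvexOn ℝ (Set.Ici 0) fun x : ℝ => x ^ τ := convexOn_pow τ
    have h2 := And.right hcv (hr i hi : r i ∈ Set.Ici 0) (hR : R ∈ Set.Ici 0)
      (show 0 ≤ (1 + α) / (1 + 2 * α) by positivity) (show 0 ≤ α / (1 + 2 * α) by positivity)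
      (by field_simp; ring)
    simp only [smul_eq_mul] at h2
    have h3 : ((1 + α) * r i + α * R) =
        (1 + 2 * α) * ((1 + α) / (1 + 2 * α) * r i + α / (1 + 2 * α) * R) := by field_simp
    rw [h3, mul_pow]
    exact mul_le_mul_of_nonneg_left h2 (by positivity)
  refine (Finset.sum_le_sum h1).trans ?_
  rw [← Finset.mul_sum, Finset.sum_add_distrib, ← Finset.mul_sum, Finset.sum_const, nsmul_eq_mul]
  refine mul_le_mul_of_nonneg_left ?_ (by positivity)
  have h4 : (s.card : ℝ) * (α / (1 + 2 * α) * R ^ τ) ≤ α / (1 + 2 * α) * ∑ i ∈ s, r i ^ τ := by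
    rw [mul_left_comm]
    exact mul_le_mul_of_nonneg_left h (by positivity)
  refine (add_le_add le_rfl h4).trans (le_of_eq ?_)
  field_simp
  ring

/-- The choice of the parameters. -/
theorem parameter_bound {τ : ℕ} {ε γ : ℝ} (hτ : 1 ≤ τ) (hε : 0 < ε) (hε' : ε ≤ 1) (hγ : 0 < γ)
    (hγ' : γ ≤ 1) : (1 + 4 * (ε * γ / 32) / γ) / (1 - ε * γ / 32) * (1 + 2 * (ε / (16 * τ))) ^ τ ≤
      1 + ε := by
  have hτ' : (1 : ℝ) ≤ τ := by exact_mod_cast hτ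
  -- The power is at most exp(ε/8) ≤ 1 + 2·ε/8.
  have h1 : (1 + 2 * (ε / (16 * τ))) ^ τ ≤ 1 + ε / 4 := by
    have e1 : (1 + 2 * (ε / (16 * τ))) ^ τ ≤ Real.exp (ε / 8) := by
      have e2 : ε / 8 = τ * (2 * (ε / (16 * τ))) := by
        field_simp
        norm_num
      rw [e2, Real.exp_nat_mul]
      gcongr
      rw [add_comm]
      exact Real.add_one_le_exp _
    have e3 := Real.abs_exp_sub_one_le (x := ε / 8) (by rw [abs_of_pos (by positivity)]; linarith)
    rw [abs_of_pos (show 0 < ε / 8 by positivity)] at e3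
    have e4 := le_abs_self (Real.exp (ε / 8) - 1)
    linarith
  have h2 : 4 * (ε * γ / 32) / γ = ε / 8 := by
    field_simp
    norm_num
  have h3 : ε * γ ≤ ε := mul_le_of_le_one_right hε.le hγ'
  rw [h2]
  calc _ ≤ (1 + ε / 8) / (1 - ε / 32) * (1 + ε / 4) := by
        refine mul_le_mul ?_ h1 (by positivity) (div_nonneg (by linarith) (by linarith))
        exact div_le_div_of_nonneg_left (by linarith) (by linarith) (by linarith)
    _ ≤ 1 + ε := by
        rw [div_mul_eq_mul_div, div_le_iff₀ (by linarith)]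
        nlinarith [mul_pos hε hε, mul_nonneg hε.le (sub_nonneg.2 hε')]

end Threshold

end ProjectiveClustering

/-! ### From good samples to good thresholds for k flats. -/

namespace ProjectiveClustering

open Function RealRAM

section Trial

theorem linearIndependent_unitVec {d j : ℕ} (h : j ≤ d) :
    LinearIndependent ℝ fun i : Fin j => unitVec d i := by
  have h1 : (fun i : Fin j => unitVec d i) =
      (fun i : Fin d => EuclideanSpace.single i (1 : ℝ)) ∘ Fin.castLE h := by
    funext i
    ext q
    simp [unitVec, Fin.ext_iff]
  rw [h1]
  exact ((EuclideanSpace.orthonormal_single (𝕜 := ℝ) (ι := Fin d)).linearIndependent).comp _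
    (Fin.castLE_injective h)

variable {n d : ℕ}

/-- The combination of samples and unit vectors with given weights. -/
noncomputable def combine {m j : ℕ} (D : ℕ) (x : Fin n → EuclideanSpace ℝ (Fin d))
    (X : Fin m → Fin n) (W : Fin m → ℤ) (W' : Fin j → ℤ) : EuclideanSpace ℝ (Fin d) :=
  ∑ i, ((W i : ℝ) / D) • x (X i) + ∑ i, ((W' i : ℝ) / D) • unitVec d i

-- The completed flat contains the old one, so the distances do not grow. The exchanged points are
-- again grid combinations once unit vectors are admitted as summands.
open scoped Classical in
theorem GoodSample.complete {j m : ℕ} {x u : Fin n → EuclideanSpace ℝ (Fin d)} {Q : Finset (Fin n)}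
    {a ρ c : ℝ} {X : Fin m → Fin n} (hjd : j ≤ d) (h : GoodSample j x u Q a ρ c X) :
    ∃ (W : Fin (j + 1) → Fin m → ℤ) (W' : Fin (j + 1) → Fin j → ℤ),
      (∀ t i, |W t i| ≤ 4 ^ m) ∧ (∀ t i, |W' t i| ≤ 4 ^ m) ∧
      Module.finrank ℝ (affineSpan ℝ (Set.range fun t => combine (2 ^ m) x X (W t) (W' t))).direction
        = j ∧
      ∃ B : Finset (Fin n), (B.card : ℝ) ≤ 2 * c ∧ ∀ i ∈ Q, i ∉ B → Metric.infDist (x i)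
        (affineSpan ℝ (Set.range fun t => combine (2 ^ m) x X (W t) (W' t)) :
          Set (EuclideanSpace ℝ (Fin d))) ≤ (1 + a) * ‖u i‖ + 2 * a * ρ := by
  obtain ⟨W, -, hW, B, hB, hd⟩ := h
  obtain ⟨z', k1, k2, k3⟩ := exists_completion (linearIndependent_unitVec hjd)
    (rows (2 ^ m) x X W)
  have hD : ((2 ^ m : ℕ) : ℝ) ≠ 0 := by positivity
  have h24 : (2 : ℤ) ^ m ≤ 4 ^ m := pow_le_pow_left₀ (by norm_num) (by norm_num) m
  have h5 : ∀ t, ∃ (V : Fin m → ℤ) (V' : Fin j → ℤ), (∀ i, |V i| ≤ 4 ^ m) ∧ (∀ i, |V' i| ≤ 4 ^ m) ∧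
      z' t = combine (2 ^ m) x X V V' := by
    intro t
    rcases k1 t with h | ⟨i, h⟩
    · exact ⟨W t, fun _ => 0, hW t, fun _ => by simp, by simp [h, rows, combine]⟩
    -- The point z 0 + e i has the weights of row 0 and the numerator 2^m, that is coefficient 1, at
    -- e i.
    · refine ⟨W 0, fun i' => if i' = i then 2 ^ m else 0, hW 0, fun i' => ?_, ?_⟩
      · beta_reduce
        split_ifs
        · rw [abs_of_nonneg (by positivity)]
          exact h24
        · simp
      · rw [h, rows, combine]
        congr 1
        rw [Finset.sum_eq_single i]
        · simp
        · intro i' _ hi'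
          simp [hi']
        · simp
  choose V V' hV hV' hz using h5
  obtain rfl : z' = fun t => combine (2 ^ m) x X (V t) (V' t) := funext hz
  refine ⟨V, V', hV, hV', k3, B, hB, fun i hi hiB => le_trans ?_ (hd i hi hiB)⟩
  exact Metric.infDist_le_infDist_of_subset k2 ⟨_, mem_affineSpan ℝ ⟨0, rfl⟩⟩

variable {E : Type*} [NormedAddCommGroup E] [InnerProductSpace ℝ E]

open scoped Classical in
/-- If most points of each cluster are close to the candidate flats, then many thresholds give a
good subset of the points. -/
theorem card_good_threshold {k τ : ℕ} {x : Fin n → E} {F G : Fin k → AffineSubspace ℝ E}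
    {ε γ R c : ℝ} {lab : Fin n → Fin k} (hn : 1 ≤ n) (hτ : 1 ≤ τ) (hε : 0 < ε) (hε' : ε ≤ 1)
    (hγ : 0 < γ) (hγ' : γ ≤ 1) (hR : 0 ≤ R)
    (hlab : ∑ i, Metric.infDist (x i) (F (lab i) : Set E) ^ τ = n * R ^ τ)
    (hc : k * (2 * c) ≤ ε * γ / 64 * n)
    (hG : ∀ l, ∃ B : Finset (Fin n), (B.card : ℝ) ≤ 2 * c ∧ ∀ i, lab i = l →
      Metric.infDist (x i) (F l : Set E) ≤ 2 * R / (ε * γ / 32) → i ∉ B →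
      Metric.infDist (x i) (G l : Set E) ≤
        (1 + ε / (16 * τ) * (ε * γ / 32) / 4) * Metric.infDist (x i) (F l : Set E) +
        2 * (ε / (16 * τ) * (ε * γ / 32) / 4) * (2 * R / (ε * γ / 32))) :
    γ / 2 * n ≤ (Finset.univ.filter fun i₀ =>
      (1 - γ) * n ≤ (sublevel (fun i => ⨅ l, Metric.infDist (x i) (G l : Set E) ^ τ) i₀).card ∧
      (∑ i ∈ sublevel (fun i => ⨅ l, Metric.infDist (x i) (G l : Set E) ^ τ) i₀,
        ⨅ l, Metric.infDist (x i) (G l : Set E) ^ τ) /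
        (sublevel (fun i => ⨅ l, Metric.infDist (x i) (G l : Set E) ^ τ) i₀).card ≤
        (1 + ε) * R ^ τ).card := by
  have hn' : (1 : ℝ) ≤ n := by exact_mod_cast hn
  have hτ' : (1 : ℝ) ≤ τ := by exact_mod_cast hτ
  set f : Fin n → ℝ := fun i => ⨅ l, Metric.infDist (x i) (G l : Set E) ^ τ with hf
  set r : Fin n → ℝ := fun i => Metric.infDist (x i) (F (lab i) : Set E) with hr
  have hr0 : ∀ i, 0 ≤ r i := fun i => Metric.infDist_nonneg
  have hf0 : ∀ i, 0 ≤ f i := fun i => Real.iInf_nonneg fun l => pow_nonneg Metric.infDist_nonneg τ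
  set θ := ε * γ / 32 with hθ
  have hεγ : ε * γ ≤ γ := mul_le_of_le_one_left hγ.le hε'
  have hθ0 : 0 < θ := by positivity
  have hθγ : θ ≤ γ / 32 := by rw [hθ]; linarith
  set α := ε / (16 * τ) with hα
  have hα0 : 0 < α := by positivity
  set ρ := 2 * R / θ with hρ
  have hρ0 : 0 ≤ ρ := by positivity
  choose B hB1 hB2 using hG
  set H := Finset.univ.filter fun i => ρ < r i with hH
  have hHcard : (H.card : ℝ) ≤ θ / 2 * n := by
    have h1 : H.card * ρ ^ τ ≤ ∑ i ∈ H, r i ^ τ := by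
      calc H.card * ρ ^ τ = ∑ i ∈ H, ρ ^ τ := by simp
        _ ≤ _ := Finset.sum_le_sum fun i hi =>
            pow_le_pow_left₀ hρ0 (Finset.mem_filter.1 hi).2.le τ
    have h2 : ∑ i ∈ H, r i ^ τ ≤ n * R ^ τ := by
      rw [← hlab]
      exact Finset.sum_le_univ_sum_of_nonneg fun i => pow_nonneg (hr0 i) τ
    -- Markov's inequality for the τ-th powers. For R = 0 all distances vanish and no point is far.
    rcases hR.eq_or_lt with h0 | hRpos
    · have : H = ∅ := by
        refine Finset.filter_false_of_mem fun i _ => ?_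
        have h3 : r i ^ τ ≤ 0 := by
          have := Finset.single_le_sum (f := fun i => r i ^ τ) (fun i _ => pow_nonneg (hr0 i) τ)
            (Finset.mem_univ i)
          have h4 : ∑ i, r i ^ τ = 0 := by
            rw [hlab, ← h0, zero_pow (by omega), mul_zero]
          linarith
        have h5 : r i = 0 := pow_eq_zero_iff (by omega) |>.1 (le_antisymm h3 (pow_nonneg (hr0 i) τ))
        rw [h5]
        exact not_lt.2 hρ0
      rw [this]
      simp only [Finset.card_empty, Nat.cast_zero]
      positivity
    · have hRτ : 0 < R ^ τ := by positivity
      -- Because 2/θ ≥ 1, its first power already suffices, and the bound on far points is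
      -- independent of τ.
      have h3 : 2 / θ * R ^ τ ≤ ρ ^ τ := by
        have e : ρ ^ τ = (2 / θ) ^ τ * R ^ τ := by
          rw [← mul_pow, hρ]
          congr 1
          ring
        rw [e]
        refine mul_le_mul_of_nonneg_right (le_self_pow₀ ?_ (by omega)) hRτ.le
        rw [le_div_iff₀ hθ0]
        linarith
      have h4 : H.card * (2 / θ * R ^ τ) ≤ n * R ^ τ :=
        ((mul_le_mul_of_nonneg_left h3 (by positivity)).trans h1).trans h2
      have h5 : H.card * (2 / θ) ≤ n := by
        rw [← mul_assoc] at h4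
        exact le_of_mul_le_mul_right h4 hRτ
      rw [mul_div_assoc', div_le_iff₀ hθ0] at h5
      linarith
  -- Half of the budget θn is used by far points, the other half by the exceptions of the k flats.
  set Bad := H ∪ Finset.univ.biUnion B with hBad
  have hBadcard : (Bad.card : ℝ) ≤ θ * n := by
    have e1 : Bad.card ≤ H.card + ∑ l, (B l).card :=
      (Finset.card_union_le _ _).trans (add_le_add le_rfl Finset.card_biUnion_le)
    have e2 : ((∑ l, (B l).card : ℕ) : ℝ) ≤ k * (2 * c) := by
      push_cast
      calc _ ≤ ∑ _l : Fin k, 2 * c := Finset.sum_le_sum fun l _ => hB1 l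
        _ = _ := by simp
    have e3 : (Bad.card : ℝ) ≤ H.card + ((∑ l, (B l).card : ℕ) : ℝ) := by exact_mod_cast e1
    have e4 : ε * γ / 64 * n = θ / 2 * n := by
      rw [hθ]
      ring
    linarith
  set Gd := Badᶜ with hGd
  have hGdcard : (1 - θ) * n ≤ Gd.card := by
    have e1 := Finset.card_add_card_compl Bad
    rw [Fintype.card_fin] at e1
    have e2 : (Bad.card : ℝ) + Gd.card = n := by exact_mod_cast e1
    linarith
  have hsum : ∑ i ∈ Gd, f i ≤ (1 + 2 * α) ^ τ * (n * R ^ τ) := by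
    rw [← hlab]
    refine le_trans ?_ (sum_pow_combination_le Finset.univ r (fun i _ => hr0 i) hα0.le hR τ
      (by rw [Finset.card_univ, Fintype.card_fin, hlab]))
    refine le_trans (Finset.sum_le_sum fun i hi => ?_)
      (Finset.sum_le_univ_sum_of_nonneg fun i => pow_nonneg (add_nonneg
        (mul_nonneg (by linarith) (hr0 i)) (mul_nonneg hα0.le hR)) τ)
    rw [hGd, Finset.mem_compl, hBad, Finset.mem_union, not_or] at hi
    have h1 : r i ≤ ρ := by
      by_contra h
      exact hi.1 (Finset.mem_filter.2 ⟨Finset.mem_univ _, not_le.1 h⟩)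
    have h2 : i ∉ B (lab i) := fun h =>
      hi.2 (Finset.mem_biUnion.2 ⟨lab i, Finset.mem_univ _, h⟩)
    have h3 := hB2 (lab i) i rfl h1 h2
    have h4 : f i ≤ Metric.infDist (x i) (G (lab i) : Set E) ^ τ :=
      ciInf_le (Set.finite_range _).bddBelow (lab i)
    refine h4.trans (pow_le_pow_left₀ Metric.infDist_nonneg (h3.trans ?_) τ)
    have h5 : α * θ / 4 ≤ α := by
      have : θ ≤ 1 := by linarith
      nlinarith
    -- The reason for a = αθ/4: the additive error becomes αR, as `sum_pow_combination_le` expects.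
    have h6 : 2 * (α * θ / 4) * ρ = α * R := by
      rw [hρ]
      field_simp
      ring
    rw [h6]
    have := mul_le_mul_of_nonneg_right h5 (hr0 i)
    change (1 + α * θ / 4) * r i + α * R ≤ _
    linarith
  have hcard := card_threshold hn f hf0 Gd hθ0.le (by linarith) hγ hγ' hGdcard
  refine hcard.trans (Nat.cast_le.2 (Finset.card_le_card fun i hi => ?_))
  rw [Finset.mem_filter] at hi ⊢
  refine ⟨hi.1, hi.2.1, hi.2.2.trans ?_⟩
  have hp := parameter_bound hτ hε hε' hγ hγ'
  rw [← hθ, ← hα] at hp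
  have hRτ : 0 ≤ R ^ τ := by positivity
  calc (1 + 4 * θ / γ) / (1 - θ) * ((∑ x ∈ Gd, f x) / n)
      ≤ (1 + 4 * θ / γ) / (1 - θ) * ((1 + 2 * α) ^ τ * R ^ τ) := by
        refine mul_le_mul_of_nonneg_left ?_ (div_nonneg (by positivity) (by linarith))
        rw [div_le_iff₀ (by positivity)]
        linarith
    _ = (1 + 4 * θ / γ) / (1 - θ) * (1 + 2 * α) ^ τ * R ^ τ := by ring
    _ ≤ _ := mul_le_mul_of_nonneg_right hp hRτ

end Trial

end ProjectiveClustering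

/-! ### Counting random outcomes. -/

namespace RealRAM

open Function
open scoped ENNReal

/-- The index memory with `R` cells, from cell `q` on, overwritten. -/
def fillM {b R : ℕ} (ω : Fin R → Fin (b + 1)) (q : ℕ) (M : ℕ → ℕ) (p : ℕ) : ℕ :=
  if h : q ≤ p ∧ p < q + R then ω ⟨p - q, by omega⟩ else M p

theorem fillM_add {b R q : ℕ} (ω : Fin R → Fin (b + 1)) (M : ℕ → ℕ) (i : Fin R) :
    fillM ω q M (q + i) = ω i := by
  rw [fillM, dif_pos ⟨by omega, by omega⟩]
  congr 2
  ext
  simp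

theorem fillM_of_lt {b R q p : ℕ} (ω : Fin R → Fin (b + 1)) (M : ℕ → ℕ) (h : p < q) :
    fillM ω q M p = M p := by
  rw [fillM, dif_neg (by omega)]

theorem fillM_cons {b R q : ℕ} (v : Fin (b + 1)) (ω : Fin R → Fin (b + 1)) (M : ℕ → ℕ) :
    fillM (Fin.cons v ω : Fin (R + 1) → Fin (b + 1)) q M = fillM ω (q + 1) (update M q v) := by
  funext p
  rcases lt_trichotomy p q with h | rfl | h
  · rw [fillM_of_lt _ _ h, fillM_of_lt _ _ (by omega), update_of_ne h.ne]
  · rw [fillM_of_lt (q := p + 1) _ _ (by omega), update_self]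
    exact fillM_add (q := p) (Fin.cons v ω : Fin (R + 1) → Fin (b + 1)) M 0
  · obtain ⟨t, rfl⟩ : ∃ t, p = q + 1 + t := ⟨p - (q + 1), by omega⟩
    by_cases ht : t < R
    · have e := fillM_add (q := q) (Fin.cons v ω : Fin (R + 1) → Fin (b + 1)) M (Fin.succ ⟨t, ht⟩)
      have e' := fillM_add (q := q + 1) ω (update M q v) ⟨t, ht⟩
      rw [Fin.cons_succ, Fin.val_succ] at e
      rw [e', ← e]
      congr 1
      simp
      ring
    · rw [fillM, fillM, dif_neg (by omega), dif_neg (by omega), update_of_ne (by omega)]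

theorem avgM_eq (b : ℕ) (f : (ℕ → ℕ) → ℝ≥0∞) (R q : ℕ) (M : ℕ → ℕ) :
    avgM b R q f M = (((b : ℝ≥0∞) + 1) ^ R)⁻¹ * ∑ ω : Fin R → Fin (b + 1), f (fillM ω q M) := by
  induction R generalizing q M with
  | zero =>
    rw [avgM, pow_zero, inv_one, one_mul, Fintype.sum_unique]
    congr 1
    funext p
    rw [fillM, dif_neg (by omega)]
  | succ R ih =>
    rw [avgM, pow_succ', ENNReal.mul_inv (by simp) (by simp), mul_assoc]
    simp_rw [ih]
    rw [← Finset.mul_sum]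
    congr 2
    rw [← (Fin.consEquiv fun _ => Fin (b + 1)).sum_comp, Fintype.sum_prod_type]
    refine Finset.sum_congr rfl fun v _ => Finset.sum_congr rfl fun ω _ => ?_
    rw [← fillM_cons]
    rfl

/-- For each good tuple of samples a single tuple of weights is enough; guessing it costs the factor
(U+1)^(-k(j+1)(m+j)). -/
theorem le_drawAvg {n k j m U : ℕ} {A : (ℕ → ℕ) → Prop} [DecidablePred A] {M : ℕ → ℕ} {c : ℝ}
    (S : Finset (Fin (1 + k * m) → Fin (n + 1)))
    (hS : c * ((n : ℝ) + 1) ^ (1 + k * m) * ((U : ℝ) + 1) ^ (k * (j + 1) * (m + j)) ≤ S.card)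
    (hA : ∀ ω ∈ S, ∃ ω' : Fin (k * (j + 1) * (m + j)) → Fin (U + 1),
      A (fillM ω' (1 + k * m) (fillM ω 0 M))) :
    ENNReal.ofReal c ≤ drawAvg (n + 1) k j m U (fun M => if A M then 1 else 0) M := by
  set R := k * (j + 1) * (m + j) with hR
  have h1 : ∀ ω ∈ S, (((U : ℝ≥0∞) + 1) ^ R)⁻¹ ≤
      avgM U R (1 + k * m) (fun M => if A M then 1 else 0) (fillM ω 0 M) := by
    intro ω hω
    obtain ⟨ω', h⟩ := hA ω hω
    rw [avgM_eq]
    refine le_mul_of_one_le_right' ?_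
    refine le_trans ?_ (Finset.single_le_sum (f := fun ω' : Fin R → Fin (U + 1) =>
      if A (fillM ω' (1 + k * m) (fillM ω 0 M)) then (1 : ℝ≥0∞) else 0)
      (fun _ _ => zero_le) (Finset.mem_univ ω'))
    rw [if_pos h]
  rw [drawAvg, Nat.add_sub_cancel, avgM_eq]
  have h2 : (S.card : ℝ≥0∞) * (((U : ℝ≥0∞) + 1) ^ R)⁻¹ ≤ ∑ ω : Fin (1 + k * m) → Fin (n + 1),
      avgM U R (1 + k * m) (fun M => if A M then 1 else 0) (fillM ω 0 M) := by
    calc _ = ∑ ω ∈ S, (((U : ℝ≥0∞) + 1) ^ R)⁻¹ := by simp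
      _ ≤ ∑ ω ∈ S, avgM U R (1 + k * m) (fun M => if A M then 1 else 0) (fillM ω 0 M) :=
        Finset.sum_le_sum h1
      _ ≤ _ := Finset.sum_le_univ_sum_of_nonneg fun _ => zero_le
  refine le_trans ?_ (mul_le_mul_right h2 _)
  have e : (((n : ℝ≥0∞) + 1) ^ (1 + k * m))⁻¹ * (S.card * (((U : ℝ≥0∞) + 1) ^ R)⁻¹) =
      ENNReal.ofReal ((((n : ℝ) + 1) ^ (1 + k * m))⁻¹ * (S.card * (((U : ℝ) + 1) ^ R)⁻¹)) := by
    rw [ENNReal.ofReal_mul (by positivity), ENNReal.ofReal_mul (by positivity),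
      ENNReal.ofReal_inv_of_pos (by positivity), ENNReal.ofReal_inv_of_pos (by positivity),
      ENNReal.ofReal_pow (by positivity), ENNReal.ofReal_pow (by positivity),
      ENNReal.ofReal_add (by positivity) (by positivity),
      ENNReal.ofReal_add (by positivity) (by positivity)]
    simp
  rw [e]
  refine ENNReal.ofReal_le_ofReal ?_
  rw [inv_mul_eq_div, le_div_iff₀ (by positivity), ← div_eq_mul_inv, le_div_iff₀ (by positivity)]
  exact hS

/-- Finitely many values are bounded away from the numbers that they exceed. -/
theorem exists_gap {ι : Type*} [Finite ι] (v : ι → ℝ) (o : ℝ) :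
    ∃ δ > 0, ∀ w, v w ≤ o + δ → v w ≤ o := by
  have h : ∀ᶠ δ in nhdsWithin (0 : ℝ) (Set.Ioi 0), ∀ w, v w ≤ o + δ → v w ≤ o := by
    refine Filter.eventually_all.2 fun w => ?_
    by_cases hw : v w ≤ o
    · exact Filter.Eventually.of_forall fun _ _ => hw
    · rw [not_le] at hw
      filter_upwards [nhdsWithin_le_nhds (Iio_mem_nhds (sub_pos.2 hw))] with δ hδ h
      rw [Set.mem_Iio] at hδ
      linarith
  obtain ⟨δ, h1, h2⟩ := (h.and self_mem_nhdsWithin).exists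
  exact ⟨δ, h2, h1⟩

end RealRAM

/-! ### Numerical estimates for the sample size and the success probability. -/

namespace ProjectiveClustering

open Function RealRAM

theorem eight_mul_sq_le_two_pow {m : ℕ} (hm : 11 ≤ m) : 8 * m ^ 2 ≤ 2 ^ m := by
  induction m, hm using Nat.le_induction with
  | base => norm_num
  | succ m hm ih =>
    rw [pow_succ 2 m]
    nlinarith

/-- The sample size suffices for both phases of the sampling. -/
theorem exists_sampleSize_split {τ k j n : ℕ} {ε γ a c : ℝ} (hτ : 1 ≤ τ) (hk : 1 ≤ k)
    (hj : 1 ≤ j) (hε : 0 < ε) (hε' : ε ≤ 1) (hγ : 0 < γ) (hγ' : γ ≤ 1)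
    (ha : a = ε / (16 * τ) * (ε * γ / 32) / 4) (hc : c = ε * γ / (128 * k) * n) :
    ∃ M N, M + N = sampleSize τ k j ε γ ∧ 1 ≤ M ∧ 2 * ((j + 1 : ℕ) : ℝ) * n ≤ c * (M + 1) ∧
      4 * ((j + 1 : ℕ) : ℝ) ^ 2 ≤ N * a ^ 4 ∧
      8 * ((j + 1 : ℕ) : ℝ) ^ 3 * (M + N : ℕ) ≤ a * 2 ^ (M + N) := by
  have hk' : (1 : ℝ) ≤ k := by exact_mod_cast hk
  have hj' : (1 : ℝ) ≤ j := by exact_mod_cast hj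
  have hτ' : (1 : ℝ) ≤ τ := by exact_mod_cast hτ
  have h0 : 0 < ε * γ := mul_pos hε hγ
  have h1 : ε * γ ≤ 1 := mul_le_one₀ hε' hγ.le hγ'
  set y := 128 * (τ : ℝ) * k * j / ε / γ with hy
  set m := sampleSize τ k j ε γ with hm
  have hye : y = 128 * τ * (k * j / (ε * γ)) := by rw [hy]; field_simp
  obtain ⟨-, h2, h3, h4⟩ := le_sampleSize (τ := τ) hτ hk hj hε hε' hγ hγ'
  set x := (k : ℝ) * j / (ε * γ) with hx
  have hxy : 128 * x ≤ y := by
    rw [hye]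
    have : (128 : ℝ) * 1 ≤ 128 * τ := by linarith
    nlinarith
  have hy1 : 128 ≤ y := by linarith
  have hym : y ^ 8 ≤ m := Nat.le_ceil _
  have hy8 : y ^ 3 ≤ y ^ 8 := pow_le_pow_right₀ (by linarith) (by norm_num)
  have hyy : y ≤ y ^ 3 := le_self_pow₀ (by linarith) (by norm_num)
  -- Thus 1/a is of order y² at most. Descent needs about j²/a⁴ samples, which explains the exponent
  -- 8 in the sample size.
  have hya : 8 * (j : ℝ) ^ 2 ≤ y ^ 2 * a := by
    have e : y ^ 2 * a = 8 * j ^ 2 * (τ * k ^ 2 / γ) := by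
      rw [hy, ha]
      field_simp
      norm_num
    rw [e]
    refine le_mul_of_one_le_right (by positivity) ?_
    rw [le_div_iff₀ hγ]
    have := one_le_pow₀ (n := 2) hk'
    nlinarith
  have ha0 : 0 < a := by rw [ha]; positivity
  -- Chosen to make c·M at least 2(j+1)n; it is linear in y and leaves at least y^8/2 samples for
  -- the descent.
  set M := ⌈256 * k * (j + 1) / (ε * γ)⌉₊ with hM
  have hM1 : 256 * k * (j + 1) / (ε * γ) ≤ M := Nat.le_ceil _
  have hM2 : (M : ℝ) ≤ 4 * y + 1 := by
    refine (Nat.ceil_lt_add_one (by positivity)).le.trans ?_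
    have : 256 * k * (j + 1) / (ε * γ) ≤ 512 * x := by
      rw [hx, mul_div_assoc', div_le_div_iff_of_pos_right h0]
      nlinarith
    linarith
  have hy5 : 128 ^ 2 * y ≤ y ^ 8 := by
    calc 128 ^ 2 * y ≤ y ^ 2 * y := by gcongr
      _ = y ^ 3 := by ring
      _ ≤ _ := hy8
  have hMm : M ≤ m := by
    have : (M : ℝ) ≤ m := by linarith
    exact_mod_cast this
  have hMN : M + (m - M) = m := by omega
  refine ⟨M, m - M, hMN, Nat.ceil_pos.2 (by positivity), ?_, ?_, ?_⟩
  · have e : c * (256 * k * (j + 1) / (ε * γ)) = 2 * ((j + 1 : ℕ) : ℝ) * n := by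
      rw [hc]
      push_cast
      field_simp
      ring
    rw [← e]
    have hc0 : 0 ≤ c := by rw [hc]; positivity
    exact mul_le_mul_of_nonneg_left (by linarith) hc0
  · rw [Nat.cast_sub hMm]
    have hN : y ^ 8 / 2 ≤ (m : ℝ) - M := by linarith
    have e1 : (8 * (j : ℝ) ^ 2) ^ 4 ≤ (y ^ 2 * a) ^ 4 := pow_le_pow_left₀ (by positivity) hya 4
    have e2 : (j : ℝ) ^ 2 ≤ j ^ 8 := pow_le_pow_right₀ hj' (by norm_num)
    push_cast
    calc 4 * ((j : ℝ) + 1) ^ 2 ≤ 4 * ((j : ℝ) + j) ^ 2 := by gcongr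
      _ = 16 * (j : ℝ) ^ 2 := by ring
      _ ≤ (8 * (j : ℝ) ^ 2) ^ 4 / 2 := by nlinarith
      _ ≤ (y ^ 2 * a) ^ 4 / 2 := by linarith
      _ = y ^ 8 / 2 * a ^ 4 := by ring
      _ ≤ _ := by gcongr
  · rw [hMN]
    have hm11 : 11 ≤ m := by
      have : (11 : ℝ) ≤ m := by linarith
      exact_mod_cast this
    have e1 : 8 * (m : ℝ) ^ 2 ≤ 2 ^ m := by exact_mod_cast eight_mul_sq_le_two_pow hm11
    have hy0 : 0 < y := by linarith
    have hm0 : (0 : ℝ) ≤ m := by positivity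
    have hjy : (j : ℝ) ≤ y := by linarith
    have e2 : 8 * (j : ℝ) * m * y ^ 2 ≤ 2 ^ m := by
      calc 8 * (j : ℝ) * m * y ^ 2 ≤ 8 * y * m * y ^ 2 := by gcongr
        _ = 8 * m * y ^ 3 := by ring
        _ ≤ 8 * m * m := by gcongr; linarith
        _ = 8 * (m : ℝ) ^ 2 := by ring
        _ ≤ _ := e1
    -- After multiplication by y² the factor y²a is at least 8j², and y³ ≤ m reduces the rest to 8m²
    -- ≤ 2^m.
    refine le_of_mul_le_mul_left ?_ (pow_pos hy0 2)
    push_cast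
    calc y ^ 2 * (8 * ((j : ℝ) + 1) ^ 3 * m) ≤ y ^ 2 * (8 * ((j : ℝ) + j) ^ 3 * m) := by gcongr
      _ = 8 * j ^ 2 * (8 * j * m * y ^ 2) := by ring
      _ ≤ y ^ 2 * a * 2 ^ m := by gcongr
      _ = _ := by ring

/-- The weights and the samples determine the success probability. -/
theorem trial_success_le {τ k j n m : ℕ} {ε γ c : ℝ} (hτ : 1 ≤ τ) (hk : 1 ≤ k) (hj : 1 ≤ j)
    (hε : 0 < ε) (hε' : ε ≤ 1) (hγ : 0 < γ) (hγ' : γ ≤ 1) (hm : m = sampleSize τ k j ε γ)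
    (hc : c = ε * γ / (128 * k) * (n + 1)) :
    ((2 : ℝ) ^ m ^ 5)⁻¹ * ((n : ℝ) + 1) ^ (1 + k * m) *
      (((2 * 4 ^ m : ℕ) : ℝ) + 1) ^ (k * (j + 1) * (m + j)) ≤
      (c ^ m) ^ k * (γ / 2 * (n + 1)) := by
  have hk' : (1 : ℝ) ≤ k := by exact_mod_cast hk
  have hj' : (1 : ℝ) ≤ j := by exact_mod_cast hj
  have hτ' : (1 : ℝ) ≤ τ := by exact_mod_cast hτ
  have h0 : 0 < ε * γ := mul_pos hε hγ
  have h1 : ε * γ ≤ 1 := mul_le_one₀ hε' hγ.le hγ'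
  obtain ⟨-, h2, h3, h4⟩ := le_sampleSize (τ := τ) hτ hk hj hε hε' hγ hγ'
  set x := (k : ℝ) * j / (ε * γ) with hx
  have hxm : 128 * x ≤ m := by
    have e : 128 * (τ : ℝ) * k * j / ε / γ = 128 * τ * x := by rw [hx]; field_simp
    have h5 : 128 * x ≤ 128 * τ * x := by nlinarith
    rw [hm]
    refine le_trans ?_ (Nat.le_ceil _)
    rw [e]
    exact h5.trans (le_self_pow₀ (by linarith) (by norm_num))
  have hm2 : (m : ℝ) ≤ 2 ^ m := by exact_mod_cast Nat.lt_two_pow_self.le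
  -- Each of the km samples and the threshold cost a factor of at least 2^(-m), each weight at least
  -- 2^(-2m-2). The total exponent is at most m^5 by `hexp`.
  have hβ : ((2 : ℝ) ^ m)⁻¹ ≤ ε * γ / (128 * k) := by
    rw [inv_le_comm₀ (by positivity) (by positivity), inv_div]
    have : 128 * k / (ε * γ) ≤ 128 * x := by
      rw [hx, mul_div_assoc', div_le_div_iff_of_pos_right h0]
      nlinarith
    linarith
  have hγ2 : ((2 : ℝ) ^ m)⁻¹ ≤ γ / 2 := by
    refine hβ.trans ?_
    rw [div_le_div_iff₀ (by positivity) (by norm_num)]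
    nlinarith
  have hkj : k * j ≤ m ∧ 128 ≤ m ∧ k ≤ m ∧ j ≤ m ∧ k * (j + 1) * 64 ≤ m := by
    have hkx : (k : ℝ) * j ≤ x := by
      rw [hx, le_div_iff₀ h0]
      exact mul_le_of_le_one_right (by positivity) h1
    refine ⟨?_, ?_, ?_, ?_, ?_⟩
    · have : (k : ℝ) * j ≤ m := by linarith
      exact_mod_cast this
    · have : (128 : ℝ) ≤ m := by linarith
      exact_mod_cast this
    · have : (k : ℝ) ≤ m := by linarith
      exact_mod_cast this
    · have : (j : ℝ) ≤ m := by linarith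
      exact_mod_cast this
    · have : (k : ℝ) * (j + 1) * 64 ≤ m := by nlinarith
      exact_mod_cast this
  obtain ⟨-, hm128, hkm, hjm, hkjm⟩ := hkj
  have hU : (((2 * 4 ^ m : ℕ) : ℝ) + 1) ≤ 2 ^ (2 * m + 2) := by
    have e : (2 : ℝ) ^ (2 * m + 2) = 4 * 4 ^ m := by
      rw [pow_add, pow_mul]
      norm_num
      ring
    have : (1 : ℝ) ≤ 4 ^ m := one_le_pow₀ (by norm_num)
    rw [e]
    push_cast
    linarith
  have hexp : m + m * m * k + (2 * m + 2) * (k * (j + 1) * (m + j)) ≤ m ^ 5 := by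
    have e1 : k * (j + 1) * (m + j) ≤ m * (2 * m) := Nat.mul_le_mul (by omega) (by omega)
    calc _ ≤ m + m * m * m + (3 * m) * (m * (2 * m)) := by gcongr; omega
      _ = m * 1 + m ^ 3 * 7 := by ring
      _ ≤ m * m ^ 3 + m ^ 3 * (m * 7) := by
        gcongr
        · exact Nat.one_le_pow _ _ (by omega)
        · omega
      _ = m ^ 4 * 8 := by ring
      _ ≤ m ^ 4 * m := by gcongr; omega
      _ = m ^ 5 := by ring
  have hn0 : (0 : ℝ) < n + 1 := by positivity
  have e3 : ((2 : ℝ) ^ m ^ 5)⁻¹ * (((2 * 4 ^ m : ℕ) : ℝ) + 1) ^ (k * (j + 1) * (m + j)) ≤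
      (((2 : ℝ) ^ m)⁻¹ ^ m) ^ k * ((2 : ℝ) ^ m)⁻¹ := by
    rw [inv_mul_le_iff₀ (by positivity), inv_pow, inv_pow, ← mul_inv, ← pow_mul, ← pow_mul,
      ← pow_add, le_mul_inv_iff₀ (by positivity)]
    refine (mul_le_mul_of_nonneg_right (pow_le_pow_left₀ (by positivity) hU _)
      (by positivity)).trans ?_
    rw [← pow_mul, ← pow_add]
    exact pow_le_pow_right₀ one_le_two ((le_of_eq (by ring)).trans hexp)
  have e5 : (((2 : ℝ) ^ m)⁻¹ ^ m) ^ k * ((2 : ℝ) ^ m)⁻¹ ≤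
      ((ε * γ / (128 * k)) ^ m) ^ k * (γ / 2) := by gcongr
  calc _ = ((2 : ℝ) ^ m ^ 5)⁻¹ * (((2 * 4 ^ m : ℕ) : ℝ) + 1) ^ (k * (j + 1) * (m + j)) *
        ((n : ℝ) + 1) ^ (1 + k * m) := by ring
    _ ≤ ((ε * γ / (128 * k)) ^ m) ^ k * (γ / 2) * ((n : ℝ) + 1) ^ (1 + k * m) := by
      exact mul_le_mul_of_nonneg_right (e3.trans e5) (by positivity)
    _ = _ := by
      rw [hc, mul_pow, mul_pow, pow_add, pow_one, ← pow_mul ((n : ℝ) + 1), mul_comm m k]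
      ring

end ProjectiveClustering

/-! ### Encoding samples, thresholds and weights in the random memory. -/

namespace ProjectiveClustering

open Function RealRAM

/-- The cells of the sampled numbers: a threshold, and `m` samples for each of `k` flats. -/
def sampleCell (k m : ℕ) : Fin 1 ⊕ Fin k × Fin m ≃ Fin (1 + k * m) :=
  ((Equiv.refl _).sumCongr finProdFinEquiv).trans finSumFinEquiv

/-- The cells of the weights. -/
def weightCell (k J m j : ℕ) : (Fin k × Fin J) × (Fin m ⊕ Fin j) ≃ Fin (k * J * (m + j)) :=
  (finProdFinEquiv.prodCongr finSumFinEquiv).trans finProdFinEquiv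

/-- The random numbers that stand for given samples and a given threshold. -/
def encodeSample {k m n : ℕ} (X : Fin k → Fin m → Fin n) (i₀ : Fin n) (p : Fin (1 + k * m)) :
    Fin n :=
  Sum.elim (fun _ => i₀) (fun q => X q.1 q.2) ((sampleCell k m).symm p)

theorem encodeSample_threshold {k m n : ℕ} (X : Fin k → Fin m → Fin n) (i₀ : Fin n) :
    encodeSample X i₀ (sampleCell k m (Sum.inl 0)) = i₀ := by
  simp [encodeSample]

theorem encodeSample_sample {k m n : ℕ} (X : Fin k → Fin m → Fin n) (i₀ : Fin n) (l : Fin k)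
    (i : Fin m) : encodeSample X i₀ (sampleCell k m (Sum.inr (l, i))) = X l i := by
  simp [encodeSample]

-- The samples of different flats are independent, so their counts multiply. The set of good
-- thresholds may depend on the samples, hence a sigma type; injectivity of the encoding preserves
-- the count.
open scoped Classical in
theorem exists_encodeSample {k m n : ℕ} {b c : ℝ} (T : Fin k → Finset (Fin m → Fin n))
    (hc : 0 ≤ c) (hT : ∀ l, c ≤ (T l).card) (hb : 0 ≤ b)
    (g : (Fin k → Fin m → Fin n) → Finset (Fin n))
    (hg : ∀ X, (∀ l, X l ∈ T l) → b ≤ (g X).card) :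
    ∃ S : Finset (Fin (1 + k * m) → Fin n), c ^ k * b ≤ S.card ∧
      ∀ ω ∈ S, ∃ X i₀, ω = encodeSample X i₀ ∧ (∀ l, X l ∈ T l) ∧ i₀ ∈ g X := by
  refine ⟨((Fintype.piFinset T).sigma g).image fun q => encodeSample q.1 q.2, ?_, ?_⟩
  · rw [Finset.card_image_of_injective, Finset.card_sigma]
    · push_cast
      calc c ^ k * b ≤ (Fintype.piFinset T).card * b := by
            refine mul_le_mul_of_nonneg_right ?_ hb
            rw [Fintype.card_piFinset]
            push_cast
            calc c ^ k = ∏ _l : Fin k, c := by simp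
              _ ≤ _ := Finset.prod_le_prod (fun _ _ => hc) fun l _ => hT l
        _ = ∑ _X ∈ Fintype.piFinset T, b := by simp
        _ ≤ _ := Finset.sum_le_sum fun X hX => hg X (Fintype.mem_piFinset.1 hX)
    · rintro ⟨X, i⟩ ⟨X', i'⟩ h
      have h1 : i = i' := by
        rw [← encodeSample_threshold X i, ← encodeSample_threshold X' i']
        exact congrFun h _
      have h2 : X = X' := by
        funext l t
        rw [← encodeSample_sample X i, ← encodeSample_sample X' i']
        exact congrFun h _
      rw [h1, h2]
  · intro ω hω
    obtain ⟨⟨X, i₀⟩, hq, rfl⟩ := Finset.mem_image.1 hω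
    rw [Finset.mem_sigma] at hq
    exact ⟨X, i₀, rfl, Fintype.mem_piFinset.1 hq.1, hq.2⟩

/-- The random numbers that stand for given weights. -/
def encodeWeight {k J m j : ℕ} (U : ℕ) (W : Fin k → Fin J → Fin m ⊕ Fin j → ℤ)
    (hW : ∀ l t i, |W l t i| ≤ U) (p : Fin (k * J * (m + j))) : Fin (2 * U + 1) :=
  ⟨(W ((weightCell k J m j).symm p).1.1 ((weightCell k J m j).symm p).1.2
    ((weightCell k J m j).symm p).2 + U).toNat, by
    have := hW ((weightCell k J m j).symm p).1.1 ((weightCell k J m j).symm p).1.2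
      ((weightCell k J m j).symm p).2
    rw [abs_le] at this
    omega⟩

/-- Integer weights are stored with offset `U`, so that they become natural numbers at most 2U. -/
theorem encodeWeight_cell {k J m j U : ℕ} {W : Fin k → Fin J → Fin m ⊕ Fin j → ℤ}
    (hW : ∀ l t i, |W l t i| ≤ U) (l : Fin k) (t : Fin J) (i : Fin m ⊕ Fin j) :
    ((encodeWeight U W hW (weightCell k J m j ((l, t), i)) : ℕ) : ℝ) - U = W l t i := by
  have h := hW l t i
  rw [abs_le] at h
  have e : (((encodeWeight U W hW (weightCell k J m j ((l, t), i)) : ℕ) : ℤ)) = W l t i + U := by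
    rw [encodeWeight]
    simp only [Equiv.symm_apply_apply]
    exact Int.toNat_of_nonneg (by omega)
  have e' : ((encodeWeight U W hW (weightCell k J m j ((l, t), i)) : ℕ) : ℝ) =
      (W l t i : ℝ) + U := by exact_mod_cast e
  rw [e']
  ring

/-- The candidates of a trial whose random numbers stand for given samples and weights. -/
theorem cand_encode {n d k j m U D : ℕ} {P : Fin (n + 1) → EuclideanSpace ℝ (Fin d)}
    {V : ℕ → EuclideanSpace ℝ (Fin d)} (hV : IsData j P V) (M : ℕ → ℕ)
    (X : Fin k → Fin m → Fin (n + 1)) (i₀ : Fin (n + 1))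
    {W : Fin k → Fin (j + 1) → Fin m ⊕ Fin j → ℤ} (hW : ∀ l t i, |W l t i| ≤ U)
    (l : Fin k) (t : Fin (j + 1)) :
    cand (n + 1) k j m D U V (fillM (encodeWeight U W hW) (1 + k * m)
      (fillM (encodeSample X i₀) 0 M)) l t =
      combine D P (X l) (fun i => W l t (Sum.inl i)) (fun i => W l t (Sum.inr i)) := by
  set M' := fillM (encodeWeight U W hW) (1 + k * m) (fillM (encodeSample X i₀) 0 M) with hM'
  have hs : ∀ i : Fin m, M' (1 + l * m + i) = X l i := by
    intro i
    have e : (1 + (l : ℕ) * m + i) = (sampleCell k m (Sum.inr (l, i)) : ℕ) := by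
      simp [sampleCell]
      ring
    have := fillM_add (q := 0) (encodeSample X i₀) M (sampleCell k m (Sum.inr (l, i)))
    rw [zero_add, encodeSample_sample] at this
    rw [e, hM', fillM_of_lt _ _ (Fin.is_lt _), this]
  have hw : ∀ i : Fin m ⊕ Fin j, M' (1 + k * m + ((l : ℕ) * (j + 1) + t) * (m + j) +
      (finSumFinEquiv i : ℕ)) = encodeWeight U W hW (weightCell k (j + 1) m j ((l, t), i)) := by
    intro i
    have e : (1 + k * m + ((l : ℕ) * (j + 1) + t) * (m + j) + (finSumFinEquiv i : ℕ)) =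
        1 + k * m + (weightCell k (j + 1) m j ((l, t), i) : ℕ) := by
      simp [weightCell]
      ring
    rw [e, hM', fillM_add]
  rw [cand, rowVal, combine, Finset.sum_range, Finset.sum_range]
  congr 1
  · refine Finset.sum_congr rfl fun i _ => ?_
    have h1 := hw (Sum.inl i)
    rw [finSumFinEquiv_apply_left, Fin.val_castAdd] at h1
    rw [h1, encodeWeight_cell, hs, hV.1]
  · refine Finset.sum_congr rfl fun i _ => ?_
    have h1 := hw (Sum.inr i)
    rw [finSumFinEquiv_apply_right, Fin.val_natAdd, ← add_assoc] at h1
    rw [h1, encodeWeight_cell, hV.2 i i.2]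

open scoped Classical in
/-- The selection of a threshold, in terms of the flats. -/
theorem valid_iff_sublevel {τ n d k j : ℕ} {g o : ℝ} {P : Fin n → EuclideanSpace ℝ (Fin d)}
    {V : ℕ → EuclideanSpace ℝ (Fin d)} (hV : IsData j P V) {z : ℕ → ℕ → EuclideanSpace ℝ (Fin d)}
    (i₀ : Fin n) {G : Fin k → AffineSubspace ℝ (EuclideanSpace ℝ (Fin d))}
    (hG : ∀ l : Fin k, spanOf (j + 1) (z l) = G l)
    (hfin : ∀ l, Module.finrank ℝ (G l).direction = j)
    (h1 : g ≤ (sublevel (fun i => ⨅ l, Metric.infDist (P i) (G l : Set _) ^ τ) i₀).card)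
    (h2 : (∑ i ∈ sublevel (fun i => ⨅ l, Metric.infDist (P i) (G l : Set _) ^ τ) i₀,
        ⨅ l, Metric.infDist (P i) (G l : Set _) ^ τ) /
        (sublevel (fun i => ⨅ l, Metric.infDist (P i) (G l : Set _) ^ τ) i₀).card ≤ o) :
    Valid τ n k j g z V i₀ ∧ nearAvg τ n k (j + 1) z V i₀ ≤ o := by
  set f : Fin n → ℝ := fun i => ⨅ l, Metric.infDist (P i) (G l : Set _) ^ τ with hf
  have hd : ∀ i : Fin n, distPow τ k (j + 1) z (V i) = f i := by
    intro i
    rw [hV.1 i, distPow_eq]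
    simp only [hG, hf]
  have hS : near τ n k (j + 1) z V i₀ = (sublevel f i₀).map Fin.valEmbedding := by
    ext v
    simp only [near, sublevel, Finset.mem_map, Finset.mem_filter, Finset.mem_univ, true_and,
      Fin.valEmbedding_apply, Finset.mem_range]
    constructor
    · rintro ⟨hv, h⟩
      refine ⟨⟨v, hv⟩, ?_, rfl⟩
      rw [← hd, ← hd]
      exact h
    · rintro ⟨v, hv, rfl⟩
      rw [hd, hd]
      exact ⟨v.2, hv⟩
  refine ⟨⟨i₀.2, ?_, ?_⟩, ?_⟩
  · rw [hS, Finset.card_map]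
    exact h1
  · rw [zeroCount_le_iff]
    intro l hl
    rw [hG ⟨l, hl⟩]
    exact hfin _
  · rw [nearAvg, hS, Finset.card_map, Finset.sum_map]
    simp only [Fin.valEmbedding_apply, hd]
    exact h2

end ProjectiveClustering

/-! ### Success probability of a trial. -/

namespace ProjectiveClustering

open Function RealRAM

/-- The assignment of the points to nearest flats, and the radius that has the cost as a power. -/
theorem exists_labels {n d k τ : ℕ} (hn : 1 ≤ n) (hk : 1 ≤ k) (hτ : 1 ≤ τ)
    (P : Fin n → EuclideanSpace ℝ (Fin d))
    (F : Fin k → AffineSubspace ℝ (EuclideanSpace ℝ (Fin d))) :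
    ∃ (lab : Fin n → Fin k) (R : ℝ), 0 ≤ R ∧
      ∑ i, Metric.infDist (P i) (F (lab i) : Set _) ^ τ = n * R ^ τ ∧
      R ^ τ = cost τ P Finset.univ F := by
  have hne : Nonempty (Fin k) := ⟨⟨0, hk⟩⟩
  have hn' : (0 : ℝ) < n := by exact_mod_cast hn
  have h1 : ∀ i, ∃ l, Metric.infDist (P i) (F l : Set _) ^ τ =
      ⨅ l, Metric.infDist (P i) (F l : Set _) ^ τ := fun i => exists_eq_ciInf_of_finite
  choose lab hlab using h1
  have h0 : 0 ≤ cost τ P Finset.univ F := mul_nonneg (by positivity)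
    (Finset.sum_nonneg fun i _ => Real.iInf_nonneg fun l => pow_nonneg Metric.infDist_nonneg τ)
  have hR : (cost τ P Finset.univ F ^ ((τ : ℝ)⁻¹)) ^ τ = cost τ P Finset.univ F :=
    Real.rpow_inv_natCast_pow h0 (by omega)
  refine ⟨lab, cost τ P Finset.univ F ^ ((τ : ℝ)⁻¹), Real.rpow_nonneg h0 _, ?_, hR⟩
  rw [hR, Finset.sum_congr rfl fun i _ => hlab i, cost, Finset.card_univ, Fintype.card_fin,
    ← mul_assoc, mul_one_div_cancel hn'.ne', one_mul]

open scoped Classical in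
/-- Many samples can be completed to candidates that are nearly as good as given flats. -/
theorem exists_successful {τ n d k j m : ℕ} {ε γ c : ℝ}
    {P : Fin (n + 1) → EuclideanSpace ℝ (Fin d)}
    {V : ℕ → EuclideanSpace ℝ (Fin d)} (hτ : 1 ≤ τ) (hk : 1 ≤ k) (hj : 1 ≤ j)
    (hjd : j ≤ d) (hε : 0 < ε) (hε' : ε ≤ 1) (hγ : 0 < γ) (hγ' : γ ≤ 1)
    (hm : m = sampleSize τ k j ε γ) (hc : c = ε * γ / (128 * k) * (n + 1))
    (hV : IsData j P V) (M : ℕ → ℕ)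
    (F : Fin k → AffineSubspace ℝ (EuclideanSpace ℝ (Fin d))) (hF : ∀ l, IsFlat j (F l)) :
    ∃ S : Finset (Fin (1 + k * m) → Fin (n + 1)), (c ^ m) ^ k * (γ / 2 * (n + 1)) ≤ S.card ∧
      ∀ ω ∈ S, ∃ (ω' : Fin (k * (j + 1) * (m + j)) → Fin (2 * 4 ^ m + 1)) (i₀ : Fin (n + 1)),
        fillM ω' (1 + k * m) (fillM ω 0 M) 0 = i₀ ∧
        Valid τ (n + 1) k j ((1 - γ) * (n + 1 : ℕ))
          (cand (n + 1) k j m (2 ^ m) (4 ^ m) V (fillM ω' (1 + k * m) (fillM ω 0 M))) V i₀ ∧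
        nearAvg τ (n + 1) k (j + 1)
          (cand (n + 1) k j m (2 ^ m) (4 ^ m) V (fillM ω' (1 + k * m) (fillM ω 0 M))) V i₀ ≤
          (1 + ε) * cost τ P Finset.univ F := by
  have hk' : (1 : ℝ) ≤ k := by exact_mod_cast hk
  have hτ' : (1 : ℝ) ≤ τ := by exact_mod_cast hτ
  have h0 : 0 < ε * γ := mul_pos hε hγ
  have h1 : ε * γ ≤ 1 := mul_le_one₀ hε' hγ.le hγ'
  obtain ⟨lab, R, hR, hlab, hRc⟩ := exists_labels (Nat.succ_pos n) hk hτ P F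
  set a := ε / (16 * τ) * (ε * γ / 32) / 4 with ha
  set ρ := 2 * R / (ε * γ / 32) with hρ
  have ha0 : 0 < a := by positivity
  have ha1 : a ≤ 1 := by
    have h2 : ε / (16 * τ) ≤ 1 := by
      rw [div_le_one (by positivity)]
      linarith
    have h3 : ε / (16 * τ) * (ε * γ / 32) ≤ 1 :=
      mul_le_one₀ h2 (by positivity) (by linarith)
    linarith
  have hρ0 : 0 ≤ ρ := by positivity
  -- The constant 128k makes the 2c exceptions of each of the k flats add up to half of θ times the
  -- number of points.
  have hc' : c = ε * γ / (128 * k) * (n + 1 : ℕ) := by rw [hc]; push_cast; ring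
  have hc0 : 0 ≤ c := by rw [hc]; positivity
  have hcn : c ≤ (n + 1 : ℕ) := by
    rw [hc']
    refine mul_le_of_le_one_left (by positivity) ?_
    rw [div_le_one (by positivity)]
    linarith
  have hF1 : ∀ l, ∃ p : Fin (n + 1) → EuclideanSpace ℝ (Fin d), (∀ i, p i ∈ F l) ∧
      ∀ i, ‖P i - p i‖ = Metric.infDist (P i) (F l : Set _) := by
    intro l
    have hne : Nonempty (F l) := (hF l).1.to_subtype
    refine ⟨fun i => EuclideanGeometry.orthogonalProjection (F l) (P i), fun i => Subtype.mem _,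
      fun i => ?_⟩
    rw [← EuclideanGeometry.dist_orthogonalProjection_eq_infDist, dist_eq_norm]
  choose p hp hpd using hF1
  let Q : Fin k → Finset (Fin (n + 1)) := fun l => Finset.univ.filter fun i =>
    lab i = l ∧ Metric.infDist (P i) (F l : Set _) ≤ ρ
  let T : Fin k → Finset (Fin m → Fin (n + 1)) := fun l => Finset.univ.filter fun X =>
    GoodSample j P (fun i => P i - p l i) (Q l) a ρ c X
  have hT : ∀ l, c ^ m ≤ (T l).card := by
    intro l
    obtain ⟨M₁, M₂, e1, e2, e3, e4, e5⟩ :=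
      exists_sampleSize_split (n := n + 1) hτ hk hj hε hε' hγ hγ' ha hc'
    rw [← hm] at e1
    subst e1
    exact le_card_goodSample (hF l).2 (hp l) (fun i => by abel) (fun i hi => by
      rw [hpd]
      exact (Finset.mem_filter.1 hi).2.2) ha0 ha1 hρ0 hc0 hcn e2 e3 e4 e5
  have hcomp : ∀ (l : Fin k) (X : Fin m → Fin (n + 1)), ∃ W : Fin (j + 1) → Fin m ⊕ Fin j → ℤ,
      (∀ t i, |W t i| ≤ (4 ^ m : ℕ)) ∧ (X ∈ T l →
        Module.finrank ℝ (affineSpan ℝ (Set.range fun t => combine (2 ^ m) P X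
          (fun i => W t (Sum.inl i)) (fun i => W t (Sum.inr i)))).direction = j ∧
        ∃ B : Finset (Fin (n + 1)), (B.card : ℝ) ≤ 2 * c ∧ ∀ i ∈ Q l, i ∉ B →
          Metric.infDist (P i) (affineSpan ℝ (Set.range fun t => combine (2 ^ m) P X
            (fun i => W t (Sum.inl i)) (fun i => W t (Sum.inr i))) : Set _) ≤
            (1 + a) * ‖P i - p l i‖ + 2 * a * ρ) := by
    intro l X
    by_cases hX : X ∈ T l
    · obtain ⟨W, W', w1, w2, w3, w4⟩ := (Finset.mem_filter.1 hX).2.complete hjd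
      refine ⟨fun t => Sum.elim (W t) (W' t), fun t i => ?_, fun _ => ⟨w3, w4⟩⟩
      push_cast
      rcases i with i | i
      · exact w1 t i
      · exact w2 t i
    · exact ⟨0, fun _ _ => by simp, fun h => absurd h hX⟩
  choose W hW hWT using hcomp
  let G : (Fin k → Fin m → Fin (n + 1)) → Fin k → AffineSubspace ℝ (EuclideanSpace ℝ (Fin d)) :=
    fun X l => affineSpan ℝ (Set.range fun t => combine (2 ^ m) P (X l)
      (fun i => W l (X l) t (Sum.inl i)) (fun i => W l (X l) t (Sum.inr i)))
  obtain ⟨S, hS, hS'⟩ := exists_encodeSample (b := γ / 2 * (n + 1 : ℕ)) T (by positivity) hT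
    (by positivity) (fun X => Finset.univ.filter fun i₀ => (1 - γ) * (n + 1 : ℕ) ≤
      (sublevel (fun i => ⨅ l, Metric.infDist (P i) (G X l : Set _) ^ τ) i₀).card ∧
      (∑ i ∈ sublevel (fun i => ⨅ l, Metric.infDist (P i) (G X l : Set _) ^ τ) i₀,
        ⨅ l, Metric.infDist (P i) (G X l : Set _) ^ τ) /
        (sublevel (fun i => ⨅ l, Metric.infDist (P i) (G X l : Set _) ^ τ) i₀).card ≤
        (1 + ε) * R ^ τ) fun X hX => by
      refine card_good_threshold (c := c) (Nat.succ_pos n) hτ hε hε' hγ hγ' hR hlab ?_ fun l => ?_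
      · rw [hc']
        refine le_of_eq ?_
        field_simp
        ring
      · obtain ⟨B, hB, hB'⟩ := (hWT l (X l) (hX l)).2
        refine ⟨B, hB, fun i h2 h3 h4 => ?_⟩
        rw [← hpd]
        exact hB' i (Finset.mem_filter.2 ⟨Finset.mem_univ _, h2, h3⟩) h4
  refine ⟨S, by exact_mod_cast hS, fun ω hω => ?_⟩
  obtain ⟨X, i₀, rfl, hX, hi⟩ := hS' ω hω
  rw [Finset.mem_filter] at hi
  have hWX : ∀ l t i, |W l (X l) t i| ≤ (4 ^ m : ℕ) := fun l t i => hW l (X l) t i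
  refine ⟨encodeWeight (4 ^ m) (fun l => W l (X l)) hWX, i₀, ?_, ?_⟩
  · rw [fillM_of_lt _ _ (by omega)]
    have := fillM_add (q := 0) (encodeSample X i₀) M (sampleCell k m (Sum.inl 0))
    rw [encodeSample_threshold] at this
    simpa [sampleCell] using this
  · rw [← hRc]
    have hcand := cand_encode (D := 2 ^ m) hV M X i₀ hWX
    push_cast at hcand
    refine valid_iff_sublevel hV i₀ (G := G X) (fun l => ?_) (fun l => (hWT l (X l) (hX l)).1)
      hi.2.1 hi.2.2
    rw [spanOf]
    congr 2
    funext t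
    exact hcand l t

/-- Ensures that the infimum in `opt` runs over a nonempty family. -/
theorem exists_isFlat {d j : ℕ} (h : j ≤ d) :
    ∃ F : AffineSubspace ℝ (EuclideanSpace ℝ (Fin d)), IsFlat j F := by
  refine ⟨AffineSubspace.mk' 0 (Submodule.span ℝ (Set.range fun i : Fin j => unitVec d i)),
    ⟨0, AffineSubspace.self_mem_mk' _ _⟩, ?_⟩
  rw [AffineSubspace.direction_mk', finrank_span_eq_card (linearIndependent_unitVec h),
    Fintype.card_fin]

end ProjectiveClustering

namespace RealRAM

open ProjectiveClustering in
open scoped Classical in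
/-- The success probability of a trial. -/
theorem trial_prob {τ n d k j m : ℕ} {ε γ : ℝ} {P : Fin n → EuclideanSpace ℝ (Fin d)}
    {V : ℕ → EuclideanSpace ℝ (Fin d)} (hτ : 1 ≤ τ) (hn : 1 ≤ n) (hk : 1 ≤ k) (hj : 1 ≤ j)
    (hjd : j ≤ d) (hε : 0 < ε) (hε' : ε ≤ 1) (hγ : 0 < γ) (hγ' : γ ≤ 1)
    (hm : m = sampleSize τ k j ε γ) (hV : IsData j P V) (M : ℕ → ℕ) :
    ENNReal.ofReal ((2 : ℝ) ^ m ^ 5)⁻¹ ≤ drawAvg n k j m (2 * 4 ^ m) (fun M =>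
      if Valid τ n k j ((1 - γ) * n) (cand n k j m (2 ^ m) (4 ^ m) V M) V (M 0) ∧
        nearAvg τ n k (j + 1) (cand n k j m (2 ^ m) (4 ^ m) V M) V (M 0) ≤ (1 + ε) * opt τ k j P
      then 1 else 0) M := by
  obtain ⟨n, rfl⟩ : ∃ n', n = n' + 1 := ⟨n - 1, by omega⟩
  let M' : (Fin (1 + k * m) → Fin (n + 1)) × (Fin (k * (j + 1) * (m + j)) → Fin (2 * 4 ^ m + 1)) →
    ℕ → ℕ := fun w => fillM w.2 (1 + k * m) (fillM w.1 0 M)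
  -- That the infimum is attained is not needed: a trial has finitely many outcomes, so an average
  -- at most (1+ε)·opt + δ is already at most (1+ε)·opt, and flats within δ/(1+ε) of the optimum can
  -- be used.
  obtain ⟨δ, hδ, hgap⟩ := exists_gap (fun w => nearAvg τ (n + 1) k (j + 1)
    (cand (n + 1) k j m (2 ^ m) (4 ^ m) V (M' w)) V (M' w 0)) ((1 + ε) * opt τ k j P)
  obtain ⟨F₀, hF₀⟩ := exists_isFlat hjd
  have hne : Nonempty (Fin k → {F : AffineSubspace ℝ (EuclideanSpace ℝ (Fin d)) // IsFlat j F}) :=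
    ⟨fun _ => ⟨F₀, hF₀⟩⟩
  obtain ⟨F, hF⟩ := exists_lt_of_ciInf_lt (show opt τ k j P < opt τ k j P + δ / (1 + ε) from
    lt_add_of_pos_right _ (by positivity))
  have hF' : (1 + ε) * cost τ P Finset.univ (fun l => (F l).1) ≤ (1 + ε) * opt τ k j P + δ := by
    have h1 := mul_le_mul_of_nonneg_left hF.le (by linarith : (0 : ℝ) ≤ 1 + ε)
    rwa [mul_add, mul_div_cancel₀ _ (by linarith : (1 + ε) ≠ 0)] at h1
  obtain ⟨S, hS, hS'⟩ := exists_successful hτ hk hj hjd hε hε' hγ hγ' hm rfl hV M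
    (fun l => (F l).1) fun l => (F l).2
  refine le_drawAvg S ((trial_success_le hτ hk hj hε hε' hγ hγ' hm rfl).trans hS) fun ω hω => ?_
  obtain ⟨ω', i₀, h1, h2, h3⟩ := hS' ω hω
  refine ⟨ω', ?_⟩
  have h4 := hgap (ω, ω')
  simp only [M', h1] at h4
  rw [h1]
  exact ⟨h2, h4 (h3.trans hF')⟩

end RealRAM

/-! ### Assembly of the result. -/

namespace RealRAM

open scoped ENNReal

/-- Bernoulli gives (1+1/N)^N ≥ 2, while (1-1/N)(1+1/N) ≤ 1; hence (1-1/N)^N ≤ 1/2. -/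
theorem half_le_retry (N : ℕ) (hN : 1 ≤ N) : (1 : ℝ) / 2 ≤ 1 - (1 - (N : ℝ)⁻¹) ^ N := by
  have hN' : (1 : ℝ) ≤ N := by exact_mod_cast hN
  have h0 : (N : ℝ)⁻¹ ≤ 1 := inv_le_one_of_one_le₀ hN'
  have h1 : 0 ≤ (N : ℝ)⁻¹ := by positivity
  have h2 : (2 : ℝ) ≤ (1 + (N : ℝ)⁻¹) ^ N := by
    have := one_add_mul_le_pow (a := (N : ℝ)⁻¹) (by linarith) N
    rw [mul_inv_cancel₀ (by linarith)] at this
    linarith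
  have h3 : (1 - (N : ℝ)⁻¹) ^ N * (1 + (N : ℝ)⁻¹) ^ N ≤ 1 := by
    rw [← mul_pow]
    exact pow_le_one₀ (by nlinarith) (by nlinarith)
  have h4 : 0 ≤ (1 - (N : ℝ)⁻¹) ^ N := pow_nonneg (by linarith) N
  nlinarith

/-- The exponent of the running time. -/
theorem mainTime_exp_le {τ n d k j m : ℕ} {ε γ : ℝ} (hτ : 1 ≤ τ) (hn : 1 ≤ n) (hd : 1 ≤ d)
    (hk : 1 ≤ k) (hj : 1 ≤ j) (hε : 0 < ε) (hε' : ε ≤ 1) (hγ : 0 < γ) (hγ' : γ ≤ 1)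
    (hm : m = sampleSize τ k j ε γ) : (mainTime τ n d k j m : ℝ) ≤
      5000 * (τ + 1) * (2 : ℝ) ^ ((2 * (2 * (128 * (τ : ℝ)) ^ 8) ^ 5) ^ 2) *
        (2 : ℝ) ^ (((k : ℝ) * j / (ε * γ)) ^ 80) * n * d := by
  obtain ⟨h1, h2, h3, h4⟩ := le_sampleSize (τ := τ) hτ hk hj hε hε' hγ hγ'
  have h5 := sampleSize_le (τ := τ) hτ hk hj hε hε' hγ hγ'
  rw [← hm] at h1 h5
  set x := (k : ℝ) * j / (ε * γ) with hx
  have hkm : k ≤ m := by exact_mod_cast h3.trans h1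
  have hjm : j ≤ m := by exact_mod_cast h4.trans h1
  have T := mainTime_le (τ := τ) hn hd hk hkm hjm
  have h6 : m ^ 5 ≤ 2 ^ m ^ 5 := Nat.lt_two_pow_self.le
  -- The factor m^5 is absorbed into a second power 2^(m^5).
  have T' : mainTime τ n d k j m ≤ 5000 * (τ + 1) * (2 ^ (2 * m ^ 5) * (n * d)) := by
    refine T.trans ?_
    rw [two_mul, pow_add, mul_assoc (2 ^ m ^ 5)]
    gcongr
  have T2 : (mainTime τ n d k j m : ℝ) ≤ 5000 * (τ + 1) * ((2 : ℝ) ^ (2 * m ^ 5) * (n * d)) := by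
    exact_mod_cast T'
  refine T2.trans ?_
  set A := 2 * (2 * (128 * (τ : ℝ)) ^ 8) ^ 5 with hA
  -- The product A·x^40 is bounded by A² + x^80. This separates τ, which may enter the constant,
  -- from x = kj/(εγ), and yields a polynomial that does not depend on τ.
  have h7 : (2 : ℝ) ^ (2 * m ^ 5) ≤ (2 : ℝ) ^ (A ^ 2) * (2 : ℝ) ^ (x ^ 80) := by
    rw [← Real.rpow_add (by norm_num), ← Real.rpow_natCast]
    refine Real.rpow_le_rpow_of_exponent_le (by norm_num) ?_
    push_cast
    have h8 : 2 * (m : ℝ) ^ 5 ≤ A * x ^ 40 := by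
      calc 2 * (m : ℝ) ^ 5 ≤ 2 * (2 * (128 * (τ : ℝ)) ^ 8 * x ^ 8) ^ 5 := by gcongr
        _ = A * x ^ 40 := by rw [hA]; ring
    have h9 : x ^ 80 = (x ^ 40) ^ 2 := by ring
    rw [h9]
    nlinarith [sq_nonneg (A - x ^ 40), sq_nonneg A, sq_nonneg (x ^ 40)]
  calc 5000 * ((τ : ℝ) + 1) * ((2 : ℝ) ^ (2 * m ^ 5) * (n * d))
      ≤ 5000 * ((τ : ℝ) + 1) * (((2 : ℝ) ^ (A ^ 2) * (2 : ℝ) ^ (x ^ 80)) * (n * d)) := by gcongr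
    _ = _ := by ring

open ProjectiveClustering in
/-- The algorithm, on one instance. -/
theorem mainCmd_correct {τ n d k j : ℕ} {ε γ : ℝ} (P : Fin n → EuclideanSpace ℝ (Fin d))
    (hτ : 1 ≤ τ) (hn : 1 ≤ n) (hk : 1 ≤ k) (hj : 1 ≤ j) (hjd : j ≤ d) (hε : 0 < ε) (hε' : ε ≤ 1)
    (hγ : 0 < γ) (hγ' : γ ≤ 1) :
    ∃ T : ℕ, (T : ℝ) ≤ 5000 * (τ + 1) * (2 : ℝ) ^ ((2 * (2 * (128 * (τ : ℝ)) ^ 8) ^ 5) ^ 2) *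
        (2 : ℝ) ^ (((k : ℝ) * j / (ε * γ)) ^ 80) * n * d ∧
      (∀ c ∈ (run ((mainCmd τ).comp 0) T (input k j ε γ P)).support,
        Halted ((mainCmd τ).comp 0) c) ∧
      ENNReal.ofReal (1 / 2) ≤ (run ((mainCmd τ).comp 0) T (input k j ε γ P)).toOuterMeasure
        {c | IsApproxSolution τ j ε γ P (output d k j c)} := by
  classical
  have hd : 1 ≤ d := hj.trans hjd
  set m := sampleSize τ k j ε γ with hm
  have T := mainTime_exp_le (k := k) hτ hn hd hk hj hε hε' hγ hγ' hm
  have hN : (1 : ℝ) ≤ (2 : ℝ) ^ m ^ 5 := one_le_pow₀ (by norm_num)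
  let s : St := ⟨(input k j ε γ P).I, (input k j ε γ P).M, (input k j ε γ P).X,
    (input k j ε γ P).A⟩
  have S := mainCmd_spec τ (k := k) (ρ := ((2 : ℝ) ^ m ^ 5)⁻¹) (o := (1 + ε) * opt τ k j P) (P := P)
    hn hk hd hjd hm (by positivity) (inv_le_one_of_one_le₀ hN)
    (fun V M hV => trial_prob hτ hn hk hj hjd hε hε' hγ hγ' hm hV M) s rfl
  have hL : ((mainCmd τ).comp 0).length = (mainCmd τ).len := Cmd.length_comp ..
  -- The whole program is the compiled command, so the continuation is empty: at its end the machine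
  -- has halted.
  have E := S ((mainCmd τ).comp 0) 0 {c | IsApproxSolution τ j ε γ P (output d k j c)} 0
    (fun i _ => by rw [zero_add]) fun s' _ => by
      refine Ens.halted ?_ ?_
      · simp [Halted, hL, St.at]
      · beta_reduce
        by_cases h : ∃ z V i, IsData j P V ∧ Valid τ n k j ((1 - γ) * n) z V i ∧
          nearAvg τ n k (j + 1) z V i ≤ (1 + ε) * opt τ k j P ∧
          ∀ l t, l < k → t < j + 1 → vecs d s'.A (l * (j + 1) + t) = z l t
        · obtain ⟨z, V, i, h1, h2, h3, h4⟩ := h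
          rw [if_pos ⟨z, V, i, h1, h2, h3, h4⟩, PMF.toOuterMeasure_pure_apply, if_pos]
          refine isApproxSolution_of_valid h1 h2 h3 fun l => ?_
          rw [output, spanOf]
          congr 2
          funext t
          exact h4 l t l.2 t.2
        · rw [if_neg h]
          exact zero_le
  obtain ⟨h1, h2⟩ := E (mainTime τ n d k j m) (by omega)
  refine ⟨mainTime τ n d k j m, T, h1, le_trans ?_ h2⟩
  refine ENNReal.ofReal_le_ofReal ?_
  have := half_le_retry (2 ^ m ^ 5) Nat.one_le_two_pow
  push_cast at this
  exact this

end RealRAM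

theorem theorem8 :
    ∃ p : ENNReal, 0 < p ∧ ∃ q : Polynomial ℝ, ∀ τ : ℕ, 1 ≤ τ →
      ∃ (prog : RealRAM.Program) (C : ℝ),
        ∀ (n d k j : ℕ) (ε γ : ℝ) (P : Fin n → EuclideanSpace ℝ (Fin d)),
          1 ≤ n → 1 ≤ k → 1 ≤ j → j ≤ d → 0 < ε → ε ≤ 1 → 0 < γ → γ ≤ 1 →
          ∃ T : ℕ,
            (T : ℝ) ≤ C * (2 : ℝ) ^ q.eval ((k : ℝ) * (j : ℝ) / (ε * γ)) * (n : ℝ) * (d : ℝ) ∧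
            (∀ c ∈ (RealRAM.run prog T (ProjectiveClustering.input k j ε γ P)).support,
              RealRAM.Halted prog c) ∧
            p ≤ (RealRAM.run prog T (ProjectiveClustering.input k j ε γ P)).toOuterMeasure
              {c | ProjectiveClustering.IsApproxSolution τ j ε γ P
                (ProjectiveClustering.output d k j c)} := by
  refine ⟨ENNReal.ofReal (1 / 2), by simp, Polynomial.X ^ 80, fun τ hτ =>
    ⟨(RealRAM.mainCmd τ).comp 0,
      5000 * (τ + 1) * (2 : ℝ) ^ ((2 * (2 * (128 * (τ : ℝ)) ^ 8) ^ 5) ^ 2), ?_⟩⟩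
  intro n d k j ε γ P hn hk hj hjd hε hε' hγ hγ'
  rw [Polynomial.eval_pow, Polynomial.eval_X]
  exact RealRAM.mainCmd_correct P hτ hn hk hj hjd hε hε' hγ hγ'
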